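/- Let $X$ be a smooth (Hausdorff) manifold with boundary, $\dim X=d+2\ge 2$, and let $\theta$ be a smooth 1-form on $X$ whose pullback to $\partial X$ vanishes nowhere (for instance an extension of a contact form on $\partial X$). Let $\rho$ denote a local boundary defining coordinate, and let $X^\circ$ be the interior of $X$. *The bundle ${}^{\Theta}T^*X$.* The $\Theta$-vector fields are the smooth vector fields $v\in\rho\, C^\infty(X;TX)$ with $\theta(v)\in\rho^2C^\infty(X)$. They are the sections of a vector bundle ${}^{\Theta}TX$, and ${}^{\Theta}T^*X$ is its dual. It equals $T^*X$ over $X^\circ$. In local coordinates $(\rho,w,z)$ with $\theta(\partial_z)\ne0$ its elements are written $\mu\frac{d\rho}{\rho}+\sum_i u_i\frac{dw_i}{\rho}+t\frac{\theta}{\rho^2}$, with $(\rho,w,z;\mu,u,t)$ smooth coordinates up to the boundary. The canonical 1-form ${}^{\Theta}\alpha$, defined over $X^\circ$, is given by this same expression. *The stretched product.* $M=X\times_\Theta X$, with blow-down map $\beta:M\to X\times X$, is the manifold with corners obtained by parabolic blow-up of the boundary diagonal $\partial X_{\rm diag}\subset X\times X$ in the direction of $\pi_L^*\theta-\pi_R^*\theta$: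 the functions $\rho,\rho',w_i-w_i'$ have weight one and a function vanishing on $\partial X_{\rm diag}$ with differential $\pi_L^*\theta-\pi_R^*\theta$ there has weight two. Its front face is $F=\beta^{-1}(\partial X_{\rm diag})$. Its left and right faces are the closures of $\beta^{-1}((X\times\partial X)\setminus\partial X_{\rm diag})$ and $\beta^{-1}((\partial X\times X)\setminus\partial X_{\rm diag})$. *Liftable transformations.* Let $\Gamma={}^{\Theta}T^*X$ or $\Gamma={}^{\Theta}T^*X\setminus 0$, and correspondingly $\Omega=T^*M$ or $\Omega=T^*M\setminus 0$. Let $\chi:\Gamma\to\Gamma$ be a liftable canonical transformation, that is, a diffeomorphism which commutes with the positive fibre dilations, satisfies $\chi^*({}^{\Theta}\alpha)={}^{\Theta}\alpha$ over $X^\circ$, and covers the identity over $\partial X$: $\pi(\chi(\zeta))=\pi(\zeta)$ whenever $\pi(\zeta)\in\partial X$, where $\pi:{}^{\Theta}T^*X\to X$ is the projection. Then the following hold. 1. Over $X^\circ\times X^\circ$, the identification ${}^{\Theta}T^*X\times{}^{\Theta}T^*X= T^*X\times T^*X\simeq T^*(X\times X)$, $((p,\xi),(p',\xi'))\mapsto((p,p'),(\xi,-\xi'))$,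 followed by the dual of the differential of $\beta$, is a diffeomorphism $\varphi_\Theta$ onto the part of $T^*M$ over $X^\circ\times X^\circ$. It pulls back the canonical 1-form of $T^*M$ to $\pi_1^*({}^{\Theta}\alpha)-\pi_2^*({}^{\Theta}\alpha)$. 2. The map $\zeta\mapsto\varphi_\Theta(\zeta,\chi(\zeta))$, defined for $\zeta\in\Gamma$ over $X^\circ$, extends continuously to $\Phi:\Gamma\to T^*M$. The map $\Phi$ is a smooth embedding of $\Gamma$ (a manifold with boundary), and its image $\Lambda_\chi=\Phi(\Gamma)$ is a conic Lagrangian submanifold of $T^*M$ which is contained in $\Omega$ and closed in $\Omega$. 3. $\Lambda_\chi$ meets the boundary of $T^*M$ only over $F$; more precisely, it is disjoint from the restrictions of $T^*M$ to the left and right faces. It is transverse to $T^*_FM=T^*M|_F$, that is, $\Lambda_\chi$ is extendible across $F$. 4. $\Phi(\zeta)\in T^*_FM$ if and only if $\zeta$ lies over $\partial X$. The restriction of covectors $T^*_FM\to T^*F$ maps the intersection $\Lambda_\chi\cap T^*_FM$ injectively onto an embedded Lagrangian submanifold of $T^*F$; more precisely, its composition with $\Phi|_{\partial\Gamma}$ is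 a smooth embedding $\partial\Gamma\to T^*F$ with Lagrangian image, where $\partial\Gamma$ is the part of $\Gamma$ over $\partial X$. -/

import Mathlib

open Set Filter Topology Manifold
open scoped ContDiff

noncomputable section

namespace ThetaCalc

/-! ### Spaces presented by charts that complete an open interior

A manifold with corners `P` is recovered from its interior `S` and its charts: a point of `P` is
determined by the trace on `S` of its neighbourhood filter, and the topology of `P` is the
subspace topology of Mathlib's topology on `Filter S` (generated by the sets `{l | s ∈ l}`).
This is used for the rescaled cotangent bundle (interior `T*X°`) and for the cotangent bundle
of the stretched product (interior `T*X° × T*X°`). -/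

/-- A coordinate chart of a manifold with corners with interior contained in `S`: `dom` is the
coordinate domain, `inner` its part lying over the interior, and `toFun` the parametrization
of interior points by coordinates in `inner`. -/
structure BChart (E S : Type*) where
  dom : Set E
  inner : Set E
  toFun : E → S

/-- The point with coordinates `a`, as the trace on the interior of its neighbourhood filter. -/
def BChart.germ {E S : Type*} [TopologicalSpace E] (φ : BChart E S) (a : E) : Filter S :=
  Filter.map φ.toFun (𝓝[φ.inner] a)

/-- The space covered by a family of charts. Points of different charts are identified when they
have the same trace on the interior. -/
abbrev BSpace {ι E S : Type*} [TopologicalSpace E] (A : ι → BChart E S) : Type _ :=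
  {l : Filter S // ∃ i, ∃ a ∈ (A i).dom, l = (A i).germ a}

section Smooth

variable {ι κ E E' S S' : Type*} [NormedAddCommGroup E] [NormedSpace ℝ E]
  [NormedAddCommGroup E'] [NormedSpace ℝ E']

/-- `G` is a smooth coordinate expression of `f` near the point with coordinates `a` in the
chart `A i` of the source and the chart `B j` of the target. -/
structure IsLocalRep (A : ι → BChart E S) (B : κ → BChart E' S') (f : BSpace A → BSpace B)
    (i : ι) (j : κ) (a : E) (G : E → E') : Prop where
  mem : a ∈ (A i).dom
  smooth : ContDiffWithinAt ℝ ∞ G (A i).dom a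
  rep : ∀ᶠ b in 𝓝[(A i).dom] a, G b ∈ (B j).dom ∧
    ∀ p : BSpace A, p.1 = (A i).germ b → (f p).1 = (B j).germ (G b)

/-- Smoothness of a map at a point: smooth in some charts at the point and at its image. -/
def SmoothAt (A : ι → BChart E S) (B : κ → BChart E' S') (f : BSpace A → BSpace B)
    (p : BSpace A) : Prop :=
  ∃ i j a G, p.1 = (A i).germ a ∧ IsLocalRep A B f i j a G

end Smooth

/-- The canonical symplectic form of the coordinate cotangent bundle `E × E*`
(up to the usual overall sign convention). -/
def symp {E : Type*} [NormedAddCommGroup E] [NormedSpace ℝ E] (u v : E × (E →L[ℝ] ℝ)) : ℝ :=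
  u.2 v.1 - v.2 u.1

/-! ### The manifold with boundary, its `Θ`-structure, and the rescaled cotangent bundle -/

/-- Coordinates on `X`. The coordinate `0` is the boundary defining coordinate `ρ`, the last
coordinate is `z`, and the others are `w`. -/
abbrev V (d : ℕ) : Type := EuclideanSpace ℝ (Fin (d + 2))

/-- The coordinate vector `∂_z`. -/
def ez (d : ℕ) : V d := EuclideanSpace.single (Fin.last (d + 1)) 1

section Base

variable {d : ℕ} {X : Type*} [TopologicalSpace X] [ChartedSpace (EuclideanHalfSpace (d + 2)) X]

variable (d X) in
/-- The total space of `T*X`. -/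
abbrev Cot : Type _ :=
  Bundle.TotalSpace (V d →L[ℝ] ℝ) (fun p : X => TangentSpace (𝓡∂ (d + 2)) p →L[ℝ] ℝ)

/-- Multiplication by a scalar in the fibres of `T*X`. -/
def dil (c : ℝ) (q : Cot d X) : Cot d X := ⟨q.proj, c • q.snd⟩

variable (d X) in
/-- Smoothness of a 1-form on `X`. -/
def IsSmoothForm (θ : ∀ p : X, TangentSpace (𝓡∂ (d + 2)) p →L[ℝ] ℝ)
    [IsManifold (𝓡∂ (d + 2)) ∞ X] : Prop :=
  ContMDiff (𝓡∂ (d + 2)) ((𝓡∂ (d + 2)).prod 𝓘(ℝ, V d →L[ℝ] ℝ)) ∞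
    (fun p : X => (⟨p, θ p⟩ : Bundle.TotalSpace (V d →L[ℝ] ℝ)
      (fun p : X => TangentSpace (𝓡∂ (d + 2)) p →L[ℝ] Bundle.Trivial X ℝ p)))

/-- The pullback of `θ` to `∂X` vanishes nowhere. -/
def NonvanishingOnBoundary (θ : ∀ p : X, TangentSpace (𝓡∂ (d + 2)) p →L[ℝ] ℝ) : Prop :=
  ∀ p ∈ (𝓡∂ (d + 2)).boundary X, ∃ v : V d, v 0 = 0 ∧ (show V d →L[ℝ] ℝ from θ p) v ≠ 0

/-- A chart `e` of `X` together with (the coordinate expression of) a smooth 1-form `form`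
on its domain which extends `θ` from `∂X` and satisfies `form (∂_z) ≠ 0`. Then
`dρ/ρ, dw_i/ρ, form/ρ²` is the coframe dual to a local frame of the vector fields `v` with
`v ∈ ρ C^∞(X; TX)` and `form v ∈ ρ² C^∞(X)`. -/
structure ThetaChart (θ : ∀ p : X, TangentSpace (𝓡∂ (d + 2)) p →L[ℝ] ℝ) where
  e : OpenPartialHomeomorph X (EuclideanHalfSpace (d + 2))
  mem_atlas : e ∈ IsManifold.maximalAtlas (𝓡∂ (d + 2)) ∞ X
  form : V d → V d →L[ℝ] ℝ
  smooth : ContDiffOn ℝ ∞ form (e.extend (𝓡∂ (d + 2))).target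
  form_ez : ∀ x ∈ (e.extend (𝓡∂ (d + 2))).target, form x (ez d) ≠ 0
  agree : ∀ p ∈ e.source, p ∈ (𝓡∂ (d + 2)).boundary X →
    ∀ v : TangentSpace (𝓡∂ (d + 2)) p,
      form (e.extend (𝓡∂ (d + 2)) p)
        (mfderiv (𝓡∂ (d + 2)) 𝓘(ℝ, V d) (e.extend (𝓡∂ (d + 2))) p v) = θ p v

namespace ThetaChart

variable {θ : ∀ p : X, TangentSpace (𝓡∂ (d + 2)) p →L[ℝ] ℝ} (c : ThetaChart θ)

/-- The coordinate range of the chart, a relatively open subset of the half space. -/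
def target : Set (V d) := (c.e.extend (𝓡∂ (d + 2))).target

/-- The point of `X` with coordinates `x`. -/
def pt (x : V d) : X := (c.e.extend (𝓡∂ (d + 2))).symm x

/-- The point of `T*X` over `pt x` with components `ξ` in the coordinates of the chart. -/
def cov (x : V d) (ξ : V d →L[ℝ] ℝ) : Cot d X :=
  ⟨c.pt x, ξ.comp (show V d →L[ℝ] V d from
    mfderiv (𝓡∂ (d + 2)) 𝓘(ℝ, V d) (c.e.extend (𝓡∂ (d + 2))) (c.pt x))⟩

/-- The covector `μ dρ/ρ + ∑ u_i dw_i/ρ + t form/ρ²` at `x`, where `v = (μ, u, t)`. -/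
def coform (x v : V d) : V d →L[ℝ] ℝ :=
  (∑ j : Fin (d + 1), (v j.castSucc / x 0) • EuclideanSpace.proj (𝕜 := ℝ) j.castSucc) +
    (v (Fin.last (d + 1)) / (x 0) ^ 2) • c.form x

/-- The chart `(ρ, w, z; μ, u, t)` of `ᶿT*X`. -/
def cotChart : BChart (V d × V d) (Cot d X) where
  dom := {a | a.1 ∈ c.target}
  inner := {a | a.1 ∈ c.target ∧ 0 < a.1 0}
  toFun a := c.cov a.1 (c.coform a.1 a.2)

end ThetaChart

section ThetaCot

variable (θ : ∀ p : X, TangentSpace (𝓡∂ (d + 2)) p →L[ℝ] ℝ)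

/-- The charts of `ᶿT*X`. -/
def thetaAtlas (c : ThetaChart θ) : BChart (V d × V d) (Cot d X) := c.cotChart

/-- The rescaled cotangent bundle `ᶿT*X`, equal to `T*X` over the interior. -/
abbrev ThetaCot : Type _ := BSpace (thetaAtlas θ)

end ThetaCot

variable {θ : ∀ p : X, TangentSpace (𝓡∂ (d + 2)) p →L[ℝ] ℝ}

namespace ThetaCot

/-- `ζ ∈ ᶿT*X` has base point `p`. -/
def IsOver (ζ : ThetaCot θ) (p : X) : Prop :=
  Tendsto (fun q : Cot d X => q.proj) ζ.1 (𝓝 p)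

def OverInterior (ζ : ThetaCot θ) : Prop := ∃ p ∈ (𝓡∂ (d + 2)).interior X, IsOver ζ p

def OverBoundary (ζ : ThetaCot θ) : Prop := ∃ p ∈ (𝓡∂ (d + 2)).boundary X, IsOver ζ p

def IsZero (ζ : ThetaCot θ) : Prop :=
  ∃ c : ThetaChart θ, ∃ x ∈ c.target, ζ.1 = (thetaAtlas θ c).germ (x, 0)

variable (θ) in
/-- `ᶿT*X` with its zero section (`z = true`), or without it (`z = false`). -/
def domain (z : Bool) : Set (ThetaCot θ) := {ζ | z = true ∨ ¬ IsZero ζ}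

end ThetaCot

/-- Liftable canonical transformations of `ᶿT*X` (`z = true`) or of `ᶿT*X ∖ 0` (`z = false`). -/
structure IsLiftable (z : Bool) (χ : ThetaCot θ → ThetaCot θ) : Prop where
  /-- `χ` is a diffeomorphism. -/
  mapsTo : MapsTo χ (ThetaCot.domain θ z) (ThetaCot.domain θ z)
  smooth : ∀ ζ ∈ ThetaCot.domain θ z, SmoothAt (thetaAtlas θ) (thetaAtlas θ) χ ζ
  inverse : ∃ ψ : ThetaCot θ → ThetaCot θ,
    MapsTo ψ (ThetaCot.domain θ z) (ThetaCot.domain θ z) ∧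
    InvOn ψ χ (ThetaCot.domain θ z) (ThetaCot.domain θ z) ∧
    ∀ ζ ∈ ThetaCot.domain θ z, SmoothAt (thetaAtlas θ) (thetaAtlas θ) ψ ζ
  /-- `χ` preserves the canonical 1-form `μ dρ/ρ + ∑ u_i dw_i/ρ + t θ/ρ²`, which is defined
  over the interior. -/
  canonical : ∀ ζ ∈ ThetaCot.domain θ z, ζ.OverInterior →
    (χ ζ).OverInterior ∧
    ∃ c c' a G, ζ.1 = (thetaAtlas θ c).germ a ∧
      IsLocalRep (thetaAtlas θ) (thetaAtlas θ) χ c c' a G ∧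
      ∀ h : V d × V d, c'.coform (G a).1 (G a).2
          (fderivWithin ℝ G (thetaAtlas θ c).dom a h).1 = c.coform a.1 a.2 h.1
  /-- `χ` commutes with the positive dilations of the fibres. -/
  homogeneous : ∀ δ : ℝ, 0 < δ → ∀ ζ ∈ ThetaCot.domain θ z, ∀ ζ' : ThetaCot θ,
    ζ'.1 = Filter.map (dil δ) ζ.1 → (χ ζ').1 = Filter.map (dil δ) (χ ζ).1
  /-- The projection of `χ` to the base is the identity over `∂X`. -/
  boundary : ∀ ζ ∈ ThetaCot.domain θ z, ∀ p ∈ (𝓡∂ (d + 2)).boundary X,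
    ζ.IsOver p → (χ ζ).IsOver p

/-! ### The stretched product and its cotangent bundle -/

variable (θ) in
/-- Charts of the stretched product `M = X ×_Θ X`.
* `prod c c'`: product coordinates on `X × X` away from the boundary diagonal.
* `front c k pos`: projective coordinates for the parabolic blow-up of the boundary diagonal.
  The weight-one functions are `ρ`, `ρ'`, `w_i - w'_i`; the function of weight two is
  `form_{x'} (x - x')`, whose differential along the boundary diagonal is `π_L^* θ - π_R^* θ`.
  The function labelled by `k` (`none` for `ρ'`, `some 0` for `ρ`, `some (last)` for the
  one of weight two) dominates, and has the sign given by `pos`. -/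
inductive MChart where
  | prod (c c' : ThetaChart θ)
  | front (c : ThetaChart θ) (k : Option (Fin (d + 2))) (pos : Bool)

/-- The coordinate `s` that defines the front face in `MChart.front c k pos`. -/
def slot (k : Option (Fin (d + 2))) (a : V d × V d) : ℝ :=
  match k with
  | none => a.2 0
  | some j => a.1 j

def sgn (pos : Bool) : ℝ := if pos then 1 else -1

/-- The rescaled value of `ρ'`. -/
def omegaR (k : Option (Fin (d + 2))) (pos : Bool) (a : V d × V d) : ℝ :=
  match k with
  | none => sgn pos
  | some _ => a.2 0

/-- The rescaled values of `ρ`, `w - w'` and `form_{x'} (x - x')`. -/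
def omega (k : Option (Fin (d + 2))) (pos : Bool) (a : V d × V d) (i : Fin (d + 2)) : ℝ :=
  if k = some i then sgn pos else a.1 i

/-- The right point `x' = (s ω_R, y')`, where the coordinates `y' = (w', z')` are stored in `a.2`. -/
def frontRight (k : Option (Fin (d + 2))) (pos : Bool) (a : V d × V d) : V d :=
  WithLp.toLp 2 (fun i => if i = 0 then slot k a * omegaR k pos a else a.2 i)

/-- The weight-one part of the difference `x - x'`: its `ρ` component is `s ω_0 - s ω_R`, its
`w_i` component is `s ω_i`, and its `z` component is set to `0`. -/
def frontDiff (k : Option (Fin (d + 2))) (pos : Bool) (a : V d × V d) : V d :=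
  WithLp.toLp 2 (fun i => if i = 0 then slot k a * (omega k pos a 0 - omegaR k pos a)
    else if i = Fin.last (d + 1) then 0 else slot k a * omega k pos a i)

/-- The left point `x`, determined by the weight-one part of `x - x'` and by the equation
`form_{x'} (x - x') = s² ω_last`. -/
def frontLeft (c : ThetaChart θ) (k : Option (Fin (d + 2))) (pos : Bool) (a : V d × V d) : V d :=
  frontRight k pos a + frontDiff k pos a +
    (((slot k a) ^ 2 * omega k pos a (Fin.last (d + 1)) -
        c.form (frontRight k pos a) (frontDiff k pos a)) /
      c.form (frontRight k pos a) (ez d)) • ez d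

namespace MChart

/-- The charts of `X` used for the left and the right factor. -/
def left : MChart θ → ThetaChart θ
  | prod c _ => c
  | front c _ _ => c

def right : MChart θ → ThetaChart θ
  | prod _ c' => c'
  | front c _ _ => c

/-- The blow-down map `β` in coordinates. -/
def blowdown : MChart θ → V d × V d → V d × V d
  | prod _ _ => fun a => a
  | front c k pos => fun a => (frontLeft c k pos a, frontRight k pos a)

/-- The coordinate range of a chart of `M`. -/
def dom : MChart θ → Set (V d × V d)
  | prod c c' => {a | a.1 ∈ c.target ∧ a.2 ∈ c'.target ∧
      ¬ (c.pt a.1 = c'.pt a.2 ∧ c.pt a.1 ∈ (𝓡∂ (d + 2)).boundary X)}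
  | front c k pos => {a | 0 ≤ slot k a ∧ 0 ≤ omega k pos a 0 ∧ 0 ≤ omegaR k pos a ∧
      frontLeft c k pos a ∈ c.target ∧ frontRight k pos a ∈ c.target}

/-- The induced chart of `T*M`. Over the interior, `T*M` is identified with `T*X × T*X` by the
dual of the differential of the blow-down map. -/
def cotChart (c : MChart θ) :
    BChart ((V d × V d) × ((V d × V d) →L[ℝ] ℝ)) (Cot d X × Cot d X) where
  dom := {b | b.1 ∈ c.dom}
  inner := {b | b.1 ∈ c.dom ∧ 0 < (c.blowdown b.1).1 0 ∧ 0 < (c.blowdown b.1).2 0}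
  toFun b :=
    (c.left.cov (c.blowdown b.1).1
      ((b.2.comp (fderiv ℝ c.blowdown b.1).inverse).comp (ContinuousLinearMap.inl ℝ (V d) (V d))),
     c.right.cov (c.blowdown b.1).2
      ((b.2.comp (fderiv ℝ c.blowdown b.1).inverse).comp (ContinuousLinearMap.inr ℝ (V d) (V d))))

end MChart

section CotM

variable (θ)

/-- The charts of `T*(X ×_Θ X)`. -/
def mAtlas (c : MChart θ) :
    BChart ((V d × V d) × ((V d × V d) →L[ℝ] ℝ)) (Cot d X × Cot d X) := c.cotChart

/-- The cotangent bundle `T*M` of the stretched product `M = X ×_Θ X`. -/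
abbrev CotM : Type _ := BSpace (mAtlas θ)

end CotM

namespace CotM

/-- The base point of `τ ∈ T*M` is mapped to `q ∈ X × X` by the blow-down map. -/
def IsOver (τ : CotM θ) (q : X × X) : Prop :=
  Tendsto (fun r : Cot d X × Cot d X => (r.1.proj, r.2.proj)) τ.1 (𝓝 q)

def OverInterior (τ : CotM θ) : Prop :=
  ∃ p ∈ (𝓡∂ (d + 2)).interior X, ∃ p' ∈ (𝓡∂ (d + 2)).interior X, IsOver τ (p, p')

/-- The base point lies on the front face, the preimage of the boundary diagonal. -/
def OverFront (τ : CotM θ) : Prop := ∃ p ∈ (𝓡∂ (d + 2)).boundary X, IsOver τ (p, p)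

variable (θ) in
/-- The restriction of `T*M` to the union of the left and right faces: the closure of the
part over the boundary of `X × X` with the boundary diagonal removed. -/
def sideFaces : Set (CotM θ) :=
  closure {τ | ∃ p p' : X, (p ∈ (𝓡∂ (d + 2)).boundary X ∨ p' ∈ (𝓡∂ (d + 2)).boundary X) ∧
    p ≠ p' ∧ IsOver τ (p, p')}

def IsZero (τ : CotM θ) : Prop :=
  ∃ c : MChart θ, ∃ a ∈ c.dom, τ.1 = (mAtlas θ c).germ (a, 0)

variable (θ) in
/-- `T*M` with its zero section (`z = true`), or without it (`z = false`). -/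
def domain (z : Bool) : Set (CotM θ) := {τ | z = true ∨ ¬ IsZero τ}

/-- `Λ` is invariant under the positive dilations of the fibres of `T*M`. -/
def IsConic (Λ : Set (CotM θ)) : Prop :=
  ∀ δ : ℝ, 0 < δ → ∀ τ ∈ Λ, ∀ τ' : CotM θ,
    τ'.1 = Filter.map (Prod.map (dil δ) (dil δ)) τ.1 → τ' ∈ Λ

end CotM

variable (θ) in
/-- The restriction `T*_F M` of `T*M` to the front face `F`. -/
abbrev CotMFront : Type _ := {τ : CotM θ // τ.OverFront}

/-- Two elements of `T*_F M` over the same point of `F` have the same restriction to `TF`.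
In a chart `front c k pos`, `F = {s = 0}` and `TF = {b | slot k b = 0}`. -/
def SameRestriction (τ τ' : CotMFront θ) : Prop :=
  ∃ c k pos a η η', a ∈ (MChart.front c k pos).dom ∧ slot k a = 0 ∧
    τ.1.1 = (mAtlas θ (MChart.front c k pos)).germ (a, η) ∧
    τ'.1.1 = (mAtlas θ (MChart.front c k pos)).germ (a, η') ∧
    ∀ b, slot k b = 0 → η b = η' b

variable (θ) in
/-- The cotangent bundle `T*F` of the front face, as the quotient of `T*_F M` by the conormal
bundle of `F`, with the quotient topology. -/
abbrev CotF : Type _ := Quot (SameRestriction (θ := θ))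

/-- The restriction of covectors, `T*_F M → T*F`. -/
def restrictToF (τ : CotMFront θ) : CotF θ := Quot.mk _ τ

/-! ### The identification over the interior and the properties of the lifted graph -/

/-- `φ` is, over `X° × X°`, the identification
`ᶿT*X × ᶿT*X ≃ T*X × T*X → T*(X × X) → T*(X ×_Θ X)`, `((p, ξ), (p', ξ')) ↦ ((p, p'), (ξ, -ξ'))`. -/
def IsIdentification (φ : ThetaCot θ × ThetaCot θ → CotM θ) : Prop :=
  ∀ ζ ζ', ThetaCot.OverInterior ζ → ThetaCot.OverInterior ζ' →
    (φ (ζ, ζ')).1 = ζ.1 ×ˢ Filter.map (dil (-1)) ζ'.1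

/-- Over `X° × X°`, `φ` is a diffeomorphism which pulls back the canonical 1-form of `T*M`
to the difference `π_1^* α - π_2^* α` of the canonical 1-forms. -/
def IsCanonicalDiffeoOverInterior (φ : ThetaCot θ × ThetaCot θ → CotM θ) : Prop :=
  BijOn φ {q | q.1.OverInterior ∧ q.2.OverInterior} {τ | τ.OverInterior} ∧
  ∀ ζ ζ' : ThetaCot θ, ζ.OverInterior → ζ'.OverInterior →
    ∃ (c c' : ThetaChart θ) (m : MChart θ) (a : V d × V d) (a' : V d × V d)
      (G : (V d × V d) × (V d × V d) → (V d × V d) × ((V d × V d) →L[ℝ] ℝ)),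
      a ∈ (thetaAtlas θ c).dom ∧ a' ∈ (thetaAtlas θ c').dom ∧
      ζ.1 = (thetaAtlas θ c).germ a ∧ ζ'.1 = (thetaAtlas θ c').germ a' ∧
      ContDiffAt ℝ ∞ G (a, a') ∧
      (∀ᶠ b in 𝓝 (a, a'), G b ∈ (mAtlas θ m).dom ∧
        ∀ q q' : ThetaCot θ, q.1 = (thetaAtlas θ c).germ b.1 → q'.1 = (thetaAtlas θ c').germ b.2 →
          (φ (q, q')).1 = (mAtlas θ m).germ (G b)) ∧
      Function.Bijective (fderiv ℝ G (a, a')) ∧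
      ∀ h, (G (a, a')).2 (fderiv ℝ G (a, a') h).1 =
        c.coform a.1 a.2 h.1.1 - c'.coform a'.1 a'.2 h.2.1

/-- `Φ` is a smooth embedding of the domain `D` (a manifold with boundary of dimension
`2 dim X = dim M`) onto a Lagrangian submanifold of `T*M` (of dimension `2 dim M`). -/
def IsLagrangianEmbedding (D : Set (ThetaCot θ)) (Φ : ThetaCot θ → CotM θ) : Prop :=
  IsEmbedding (D.domRestrict Φ) ∧
  ∀ ζ ∈ D, ∃ c m a G, ζ.1 = (thetaAtlas θ c).germ a ∧
    IsLocalRep (thetaAtlas θ) (mAtlas θ) Φ c m a G ∧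
    Function.Injective (fderivWithin ℝ G (thetaAtlas θ c).dom a) ∧
    ∀ h k, symp (fderivWithin ℝ G (thetaAtlas θ c).dom a h)
      (fderivWithin ℝ G (thetaAtlas θ c).dom a k) = 0

/-- The image of the embedding `Φ` of `D` is transverse to `T*_F M`: where it meets `T*_F M`, its
tangent space and the tangent space of `T*_F M` span the tangent space of `T*M`. -/
def IsTransverseToFront (D : Set (ThetaCot θ)) (Φ : ThetaCot θ → CotM θ) : Prop :=
  ∀ ζ ∈ D, (Φ ζ).OverFront → ∃ c cM k pos a G, ζ.1 = (thetaAtlas θ c).germ a ∧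
    IsLocalRep (thetaAtlas θ) (mAtlas θ) Φ c (MChart.front cM k pos) a G ∧
    slot k (G a).1 = 0 ∧
    ∀ u : (V d × V d) × ((V d × V d) →L[ℝ] ℝ), ∃ h, ∃ v : (V d × V d) × ((V d × V d) →L[ℝ] ℝ),
      slot k v.1 = 0 ∧ fderivWithin ℝ G (thetaAtlas θ c).dom a h + v = u

/-- `Φ` maps exactly the boundary of `D` into `T*_F M`, and, composed with the restriction
`T*_F M → T*F`, it is a smooth embedding of `∂D` (of dimension `dim M - 1 = dim F`) onto a
Lagrangian submanifold of `T*F`. -/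
def IsFrontLagrangianEmbedding (D : Set (ThetaCot θ)) (Φ : ThetaCot θ → CotM θ) : Prop :=
  (∀ ζ ∈ D, (Φ ζ).OverFront ↔ ζ.OverBoundary) ∧
  IsEmbedding (fun ζ : {ζ : ThetaCot θ // ζ ∈ D ∧ (Φ ζ).OverFront} =>
    restrictToF ⟨Φ ζ.1, ζ.2.2⟩) ∧
  ∀ ζ ∈ D, (Φ ζ).OverFront → ∃ c cM k pos a G, ζ.1 = (thetaAtlas θ c).germ a ∧
    IsLocalRep (thetaAtlas θ) (mAtlas θ) Φ c (MChart.front cM k pos) a G ∧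
    a.1 0 = 0 ∧ slot k (G a).1 = 0 ∧
    (∀ h, h.1 0 = 0 → slot k (fderivWithin ℝ G (thetaAtlas θ c).dom a h).1 = 0) ∧
    (∀ h, h.1 0 = 0 → (fderivWithin ℝ G (thetaAtlas θ c).dom a h).1 = 0 →
      (∀ b, slot k b = 0 → (fderivWithin ℝ G (thetaAtlas θ c).dom a h).2 b = 0) → h = 0) ∧
    ∀ h l, h.1 0 = 0 → l.1 0 = 0 →
      symp (fderivWithin ℝ G (thetaAtlas θ c).dom a h)
        (fderivWithin ℝ G (thetaAtlas θ c).dom a l) = 0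

end Base

end ThetaCalc

end

open ThetaCalc

noncomputable section
namespace ThetaCalc

/-! ### Parametric integrals and division of smooth functions -/

section Analysis

/-! Over the interior a covector of M is a pair (ξ, -ξ') read through the differential of the
blow-down map, and the graph of `χ` is a family of such pairs. The main point is that this family
stays smooth up to the boundary. Near a boundary point use one chart on both sides, let `G` be the
coordinate expression of `χ`, and write x' for its base component. As `χ` covers the identity over
∂X, division by ρ gives x' = x + ρ Y with Y smooth, and smoothness of the inverse of `χ` forces 1 +
Y_0 > 0, so that ρ and ρ' are comparable. Invariance of the canonical form, multiplied by ρ'² and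
restricted to ρ = 0, gives t θ(Y) = 0. Since t ≠ 0 is dense in the fibres, θ(Y) = 0 on the boundary
(`BoundaryRep.form_quotient_eq_zero`). Hence θ(x - x') = O(ρ²), which is exactly the weight two
condition of the parabolic blow-up: (x, x') lifts to a smooth map into the projective chart where ρ'
dominates.

The covector on this lifted graph is determined by two kinds of directions. On those that fix the
right point it is the left form on rescaled vector fields, and all negative powers of ρ' cancel. On
those tangent to the lifted graph it vanishes, because `χ` preserves the canonical form. The right
base component of the graph covers all directions, so the two kinds span, and the covector extends
smoothly (`BoundaryRep.exists_lift`).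

The canonical 1-form therefore pulls back to zero over the interior; differentiating and passing to
the limit gives isotropy at the boundary too (`symp_fderivWithin_eq_zero`), and the dimension is
half. The rescaled frame of the left factor lifts to vector fields on M that are smooth up to the
boundary and tangent to F (`MChart.exists_lift`). Pairing covectors with these fields defines a
continuous map `CotM.left` from T*M to ᶿT*X which inverts the lift from the left, so the lift is a
topological embedding; differentiating the same pairing shows that it is an immersion. By tangency
to F this map factors through T*F, which gives the second embedding. Transversality holds because
dρ' = (1 + Y_0) dρ on the lifted graph at the boundary.

For closedness, let covectors of the lifted graph converge. If the left component of the limit lies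
in Γ, continuity identifies the limit. Otherwise that component is a zero vector; normalizing the
fibre coordinates to the unit sphere and using homogeneity shows that the limit is a zero covector,
which Ω excludes.

Points of the spaces are filters on the interior, so separation has to be proved. For ᶿT*X it holds
throughout (`ThetaCot.eq_of_inf_neBot`). For T*M it is enough that points over the interior, or over
the part of the front face where ρ' dominates and ρ/ρ' > 0, are separated from all others
(`CotM.IsRegular`). The changes of charts of the stretched product serve that purpose. -/

theorem _root_.IntervalIntegrable.clm_apply_const {P F : Type} [NormedAddCommGroup P]
    [NormedSpace ℝ P] [NormedAddCommGroup F] [NormedSpace ℝ F] {K : ℝ → P →L[ℝ] F} {a b : ℝ}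
    (h : IntervalIntegrable K MeasureTheory.volume a b) (v : P) :
    IntervalIntegrable (fun t => K t v) MeasureTheory.volume a b :=
  ⟨h.1.apply_continuousLinearMap v, h.2.apply_continuousLinearMap v⟩

/-- Compactness of the interval makes `K'` continuous in the parameter uniformly in `t`. The mean
value inequality on a small convex piece of `C` then bounds the remainder by `ε * ‖q - p‖` for all
`t` at once. `C` need not be open, so boundary points of half spaces are allowed. -/
theorem hasFDerivWithinAt_integral_of_continuousOn {P F : Type} [NormedAddCommGroup P]
    [NormedSpace ℝ P] [NormedAddCommGroup F] [NormedSpace ℝ F] [CompleteSpace F]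
    {C : Set P} (hC : Convex ℝ C) {K : ℝ → P → F} {K' : ℝ → P → P →L[ℝ] F}
    (hK : ContinuousOn (fun q : ℝ × P => K q.1 q.2) (Icc (0 : ℝ) 1 ×ˢ C))
    (hK' : ContinuousOn (fun q : ℝ × P => K' q.1 q.2) (Icc (0 : ℝ) 1 ×ˢ C))
    (hd : ∀ t ∈ Icc (0 : ℝ) 1, ∀ p ∈ C, HasFDerivWithinAt (K t) (K' t p) C p)
    {p : P} (hp : p ∈ C) :
    HasFDerivWithinAt (fun p => ∫ t in (0 : ℝ)..1, K t p) (∫ t in (0 : ℝ)..1, K' t p) C p := by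
  have hI : ∀ q ∈ C, IntervalIntegrable (fun t => K t q) MeasureTheory.volume 0 1 := fun q hq => by
    apply ContinuousOn.intervalIntegrable
    rw [uIcc_of_le zero_le_one]
    exact hK.comp (f := fun t => (t, q)) (by fun_prop) fun t ht => ⟨ht, hq⟩
  have hI' : ∀ q ∈ C, IntervalIntegrable (fun t => K' t q) MeasureTheory.volume 0 1 :=
    fun q hq => by
      apply ContinuousOn.intervalIntegrable
      rw [uIcc_of_le zero_le_one]
      exact hK'.comp (f := fun t => (t, q)) (by fun_prop) fun t ht => ⟨ht, hq⟩
  rw [hasFDerivWithinAt_iff_isLittleO, Asymptotics.isLittleO_iff]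
  intro ε hε
  have hcont : ContinuousOn (Function.uncurry fun p t => K' t p) (C ×ˢ Icc (0 : ℝ) 1) :=
    hK'.comp continuous_swap.continuousOn fun q hq => ⟨hq.2, hq.1⟩
  obtain ⟨v, hv, hvu⟩ := isCompact_Icc.mem_uniformity_of_prod hcont hp (Metric.dist_mem_uniformity hε)
  obtain ⟨r, hr, hrv⟩ := Metric.mem_nhdsWithin_iff.1 hv
  filter_upwards [inter_mem_nhdsWithin C (Metric.ball_mem_nhds p hr)] with q hq
  have hs : Convex ℝ (C ∩ Metric.ball p r) := hC.inter (convex_ball p r)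
  have key : ∀ t ∈ Icc (0 : ℝ) 1, ‖K t q - K t p - K' t p (q - p)‖ ≤ ε * ‖q - p‖ := by
    intro t ht
    refine hs.norm_image_sub_le_of_norm_hasFDerivWithin_le'
      (fun x hx => (hd t ht x hx.1).mono inter_subset_left) (fun x hx => ?_)
      ⟨hp, Metric.mem_ball_self hr⟩ hq
    have h : dist (K' t x) (K' t p) < ε := hvu x (hrv ⟨hx.2, hx.1⟩) t ht
    exact (dist_eq_norm (K' t x) (K' t p) ▸ h).le
  have e1 : (∫ t in (0 : ℝ)..1, K' t p) (q - p) = ∫ t in (0 : ℝ)..1, K' t p (q - p) :=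
    ContinuousLinearMap.intervalIntegral_apply (hI' p hp) (q - p)
  have i3 : IntervalIntegrable (fun t => K' t p (q - p)) MeasureTheory.volume 0 1 :=
    (hI' p hp).clm_apply_const (q - p)
  rw [e1, ← intervalIntegral.integral_sub (hI q hq.1) (hI p hp),
    ← intervalIntegral.integral_sub ((hI q hq.1).sub (hI p hp)) i3]
  have := intervalIntegral.norm_integral_le_of_norm_le_const (a := (0 : ℝ)) (b := 1)
    (f := fun t => K t q - K t p - K' t p (q - p)) (C := ε * ‖q - p‖) (fun t ht => by
      rw [uIoc_of_le zero_le_one] at ht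
      exact key t ⟨ht.1.le, ht.2⟩)
  simpa using this

/-- Induction on the order. `F` is quantified after `n`, since the induction hypothesis is applied
to the derivative, whose values lie in `P →L[ℝ] F`. Order zero is uniform continuity over the
compact interval. -/
theorem contDiffOn_integral {P : Type} [NormedAddCommGroup P] [NormedSpace ℝ P] {C : Set P}
    (hC : Convex ℝ C) (hu : UniqueDiffOn ℝ C) (n : ℕ) :
    ∀ {F : Type} [NormedAddCommGroup F] [NormedSpace ℝ F] [CompleteSpace F] {K : ℝ × P → F},
      ContDiffOn ℝ n K (Icc (0 : ℝ) 1 ×ˢ C) →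
      ContDiffOn ℝ n (fun p => ∫ t in (0 : ℝ)..1, K (t, p)) C := by
  have hu2 : UniqueDiffOn ℝ (Icc (0 : ℝ) 1 ×ˢ C) := (uniqueDiffOn_Icc zero_lt_one).prod hu
  induction n with
  | zero =>
    intro F _ _ _ K hK
    have hK := hK.continuousOn
    refine contDiffOn_zero.2 fun p hp => ?_
    have hcont : ContinuousOn (Function.uncurry fun p t => K (t, p)) (C ×ˢ Icc (0 : ℝ) 1) :=
      hK.comp continuous_swap.continuousOn fun q hq => ⟨hq.2, hq.1⟩
    have hI : ∀ q ∈ C, IntervalIntegrable (fun t => K (t, q)) MeasureTheory.volume 0 1 :=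
      fun q hq => by
        apply ContinuousOn.intervalIntegrable
        rw [uIcc_of_le zero_le_one]
        exact hK.comp (f := fun t => (t, q)) (by fun_prop) fun t ht => ⟨ht, hq⟩
    rw [ContinuousWithinAt, Metric.tendsto_nhds]
    intro ε hε
    obtain ⟨v, hv, hvu⟩ :=
      isCompact_Icc.mem_uniformity_of_prod hcont hp (Metric.dist_mem_uniformity (half_pos hε))
    filter_upwards [hv, self_mem_nhdsWithin] with q hq hqC
    rw [dist_eq_norm, ← intervalIntegral.integral_sub (hI q hqC) (hI p hp)]
    have := intervalIntegral.norm_integral_le_of_norm_le_const (a := (0 : ℝ)) (b := 1)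
      (f := fun t => K (t, q) - K (t, p)) (C := ε / 2) (fun t ht => by
        rw [uIoc_of_le zero_le_one] at ht
        have h : dist (K (t, q)) (K (t, p)) < ε / 2 := hvu q hq t ⟨ht.1.le, ht.2⟩
        exact (dist_eq_norm (K (t, q)) (K (t, p)) ▸ h).le)
    simp only [sub_zero, abs_one, mul_one] at this
    linarith
  | succ n ih =>
    intro F _ _ _ K hK
    push_cast at hK ⊢
    have h1 := (contDiffOn_succ_iff_fderivWithin hu2).1 hK
    let K' : ℝ × P → P →L[ℝ] F := fun q =>
      (fderivWithin ℝ K (Icc (0 : ℝ) 1 ×ˢ C) q).comp (ContinuousLinearMap.inr ℝ ℝ P)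
    have hK' : ContDiffOn ℝ n K' (Icc (0 : ℝ) 1 ×ˢ C) := h1.2.2.clm_comp contDiffOn_const
    have hd : ∀ p ∈ C, HasFDerivWithinAt (fun p => ∫ t in (0 : ℝ)..1, K (t, p))
        (∫ t in (0 : ℝ)..1, K' (t, p)) C p := fun p hp => by
      refine hasFDerivWithinAt_integral_of_continuousOn (K := fun t p => K (t, p))
        (K' := fun t p => K' (t, p)) hC hK.continuousOn hK'.continuousOn ?_ hp
      intro t ht p hp
      have hA : HasFDerivWithinAt (fun p : P => (t, p)) (ContinuousLinearMap.inr ℝ ℝ P) C p :=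
        (hasFDerivAt_prodMk_right t p).hasFDerivWithinAt
      exact (h1.1 (t, p) ⟨ht, hp⟩).hasFDerivWithinAt.comp p hA fun q hq => ⟨ht, hq⟩
    refine (contDiffOn_succ_iff_hasFDerivWithinAt_of_uniqueDiffOn hu).2
      ⟨by simp, fun p => ∫ t in (0 : ℝ)..1, K' (t, p), ih hK', hd⟩

variable {E F : Type} [NormedAddCommGroup E] [NormedSpace ℝ E] [NormedAddCommGroup F]
  [NormedSpace ℝ F]

/-- The averaged derivative of `f` along the segment from `p.2` to `p.1`. -/
def avgDeriv (f : E → F) (S : Set E) (p : E × E) : E →L[ℝ] F :=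
  ∫ t in (0 : ℝ)..1, fderivWithin ℝ f S (p.2 + t • (p.1 - p.2))

theorem avgDeriv_self [CompleteSpace F] (f : E → F) (S : Set E) (x : E) :
    avgDeriv f S (x, x) = fderivWithin ℝ f S x := by
  simp [avgDeriv]

theorem eventually_contDiffOn_ball {S : Set E} {f : E → F} {a : E} {n : ℕ} (ha : a ∈ S)
    (hf : ContDiffWithinAt ℝ n f S a) : ∃ r > 0, ContDiffOn ℝ n f (S ∩ Metric.ball a r) := by
  obtain ⟨u, hu, -, h⟩ := hf.contDiffOn le_rfl (by simp)
  rw [insert_eq_of_mem ha] at hu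
  obtain ⟨r, hr, hru⟩ := Metric.mem_nhdsWithin_iff.1 hu
  exact ⟨r, hr, h.mono fun x hx => hru ⟨hx.2, hx.1⟩⟩

theorem segment_param_mem {S : Set E} (hS : Convex ℝ S) {p : E × E} (hp : p ∈ S ×ˢ S) {t : ℝ}
    (ht : t ∈ Icc (0 : ℝ) 1) : p.2 + t • (p.1 - p.2) ∈ S :=
  hS.add_smul_sub_mem hp.2 hp.1 ht

theorem contDiffOn_avgDeriv [CompleteSpace F] {S : Set E} (hS : Convex ℝ S) (hu : UniqueDiffOn ℝ S) {f : E → F}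
    {n : ℕ} (hf : ContDiffOn ℝ (n + 1) f S) : ContDiffOn ℝ n (avgDeriv f S) (S ×ˢ S) := by
  refine contDiffOn_integral (hS.prod hS) (hu.prod hu) n
    (K := fun q : ℝ × E × E => fderivWithin ℝ f S (q.2.2 + q.1 • (q.2.1 - q.2.2))) ?_
  have h1 := ((contDiffOn_succ_iff_fderivWithin hu).1 hf).2.2
  refine h1.comp (ContDiff.contDiffOn (by fun_prop)) ?_
  intro q hq
  exact segment_param_mem hS hq.2 hq.1

theorem sub_eq_avgDeriv [CompleteSpace F] {S : Set E} (hS : Convex ℝ S) (hu : UniqueDiffOn ℝ S) {f : E → F}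
    (hf : ContDiffOn ℝ 1 f S) {p : E × E} (hp : p ∈ S ×ˢ S) :
    f p.1 - f p.2 = avgDeriv f S p (p.1 - p.2) := by
  have h1 := (contDiffOn_succ_iff_fderivWithin (n := 0) hu).1 (by simpa using hf)
  set γ : ℝ → E := fun t => p.2 + t • (p.1 - p.2)
  have hγ : MapsTo γ (Icc 0 1) S := fun t ht => segment_param_mem hS hp ht
  have hγc : Continuous γ := by fun_prop
  have hγd : ∀ t, HasDerivAt γ (p.1 - p.2) t := fun t => by
    have := ((hasDerivAt_id t).smul_const (p.1 - p.2)).const_add p.2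
    rwa [one_smul] at this
  have hc : ContinuousOn (fun t => fderivWithin ℝ f S (γ t)) (Icc 0 1) :=
    h1.2.2.continuousOn.comp hγc.continuousOn hγ
  have hi : IntervalIntegrable (fun t => fderivWithin ℝ f S (γ t)) MeasureTheory.volume 0 1 := by
    apply ContinuousOn.intervalIntegrable
    rwa [uIcc_of_le zero_le_one]
  have := intervalIntegral.integral_eq_sub_of_hasDerivAt_of_le (a := (0 : ℝ)) (b := 1)
    (f := fun t => f (γ t)) (f' := fun t => fderivWithin ℝ f S (γ t) (p.1 - p.2)) zero_le_one
    (hf.continuousOn.comp hγc.continuousOn hγ) (fun t ht => by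
      have h2 := (h1.1 (γ t) (hγ (Ioo_subset_Icc_self ht))).hasFDerivWithinAt
      exact ((h2.comp_hasDerivWithinAt t (hγd t).hasDerivWithinAt hγ).hasDerivAt
        (Icc_mem_nhds ht.1 ht.2)))
    (hi.clm_apply_const (p.1 - p.2))
  rw [avgDeriv, ContinuousLinearMap.intervalIntegral_apply hi, this]
  simp [γ]

/-- Segments stay in the convex ball, and `fderivWithin` is local. The neighbourhood on which `f` is
of class `n` may shrink with `n`; this lets the single function `avgDeriv f S` serve every order. -/
theorem avgDeriv_inter_ball {S : Set E} (hS : Convex ℝ S) (f : E → F) (a : E) (r : ℝ)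
    {p : E × E} (hp : p ∈ (S ∩ Metric.ball a r) ×ˢ (S ∩ Metric.ball a r)) :
    avgDeriv f (S ∩ Metric.ball a r) p = avgDeriv f S p := by
  refine intervalIntegral.integral_congr fun t ht => ?_
  rw [uIcc_of_le zero_le_one] at ht
  have := segment_param_mem (hS.inter (convex_ball a r)) hp ht
  exact fderivWithin_inter (Metric.isOpen_ball.mem_nhds this.2)

/-- Difference quotients of smooth functions on convex sets are smooth. -/
theorem exists_avgDeriv [CompleteSpace F] {S : Set E} (hS : Convex ℝ S) (hu : UniqueDiffOn ℝ S) {f : E → F} {a : E}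
    (ha : a ∈ S) (hf : ContDiffWithinAt ℝ ∞ f S a) :
    ContDiffWithinAt ℝ ∞ (avgDeriv f S) (S ×ˢ S) (a, a) ∧
      ∀ᶠ p in 𝓝[S ×ˢ S] (a, a), f p.1 - f p.2 = avgDeriv f S p (p.1 - p.2) := by
  have hev : ∀ r > 0, (S ∩ Metric.ball a r) ×ˢ (S ∩ Metric.ball a r) ∈ 𝓝[S ×ˢ S] (a, a) := by
    intro r hr
    rw [nhdsWithin_prod_eq]
    exact prod_mem_prod (inter_mem self_mem_nhdsWithin
      (mem_nhdsWithin_of_mem_nhds (Metric.ball_mem_nhds a hr))) (inter_mem self_mem_nhdsWithin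
      (mem_nhdsWithin_of_mem_nhds (Metric.ball_mem_nhds a hr)))
  constructor
  · refine contDiffWithinAt_infty.2 fun n => ?_
    obtain ⟨r, hr, h⟩ := eventually_contDiffOn_ball (n := n + 1) ha
      (hf.of_le (by exact_mod_cast le_top))
    have h2 := contDiffOn_avgDeriv (hS.inter (convex_ball a r)) (hu.inter Metric.isOpen_ball)
      (n := n) (by exact_mod_cast h)
    have h3 : ContDiffOn ℝ n (avgDeriv f S) ((S ∩ Metric.ball a r) ×ˢ (S ∩ Metric.ball a r)) :=
      h2.congr fun p hp => (avgDeriv_inter_ball hS f a r hp).symm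
    exact (h3 (a, a) ⟨⟨ha, Metric.mem_ball_self hr⟩, ha, Metric.mem_ball_self hr⟩
      ).mono_of_mem_nhdsWithin (hev r hr)
  · obtain ⟨r, hr, h⟩ := eventually_contDiffOn_ball (n := 1) ha
      (hf.of_le (by exact_mod_cast le_top))
    filter_upwards [hev r hr] with p hp
    rw [sub_eq_avgDeriv (hS.inter (convex_ball a r)) (hu.inter Metric.isOpen_ball)
      (by exact_mod_cast h) hp, avgDeriv_inter_ball hS f a r hp]

theorem convex_halfspace_ge (ρ : E →L[ℝ] ℝ) : Convex ℝ {b | 0 ≤ ρ b} :=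
  convex_halfSpace_ge ρ.toLinearMap.isLinear 0

theorem uniqueDiffOn_halfspace_ge {ρ : E →L[ℝ] ℝ} {e : E} (he : ρ e = 1) :
    UniqueDiffOn ℝ {b | 0 ≤ ρ b} := by
  refine uniqueDiffOn_convex (convex_halfspace_ge ρ) ⟨e, ?_⟩
  refine mem_interior_iff_mem_nhds.2 ?_
  have : {b | 0 < ρ b} ∈ 𝓝 e := (isOpen_lt continuous_const ρ.continuous).mem_nhds (by simp [he])
  exact mem_of_superset this fun b (hb : 0 < ρ b) => hb.le

/-- A smooth function on a half space which vanishes on its boundary is divisible by the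
boundary defining function. -/
theorem exists_smooth_quotient [CompleteSpace F] {ρ : E →L[ℝ] ℝ} {e : E} (he : ρ e = 1) {f : E → F} {a : E}
    (ha : 0 ≤ ρ a) (hf : ContDiffWithinAt ℝ ∞ f {b | 0 ≤ ρ b} a)
    (h0 : ∀ᶠ b in 𝓝[{b | 0 ≤ ρ b}] a, ρ b = 0 → f b = 0) :
    ∃ g : E → F, ContDiffWithinAt ℝ ∞ g {b | 0 ≤ ρ b} a ∧
      ∀ᶠ b in 𝓝[{b | 0 ≤ ρ b}] a, f b = ρ b • g b := by
  rcases ha.eq_or_lt with ha | ha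
  swap
  · refine ⟨fun b => (ρ b)⁻¹ • f b, ?_, ?_⟩
    · exact (ContDiffWithinAt.inv ρ.contDiff.contDiffWithinAt ha.ne').smul hf
    · have : {b | 0 < ρ b} ∈ 𝓝 a := (isOpen_lt continuous_const ρ.continuous).mem_nhds ha
      filter_upwards [mem_nhdsWithin_of_mem_nhds this] with b hb
      rw [smul_inv_smul₀ (ne_of_gt hb)]
  replace ha := ha.symm
  have haS : a ∈ {b | 0 ≤ ρ b} := ha.ge
  obtain ⟨h1, h2⟩ := exists_avgDeriv (convex_halfspace_ge ρ) (uniqueDiffOn_halfspace_ge he) haS hf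
  -- Compare `b` with its projection along `e` to the hyperplane `ρ = 0`, where `f` vanishes; the
  -- two points differ by `ρ b • e`.
  let π : E → E × E := fun b => (b, b - ρ b • e)
  have hπ : ContDiff ℝ ∞ π := by fun_prop
  have hπa : π a = (a, a) := by simp [π, ha]
  have hπm : MapsTo π {b | 0 ≤ ρ b} ({b | 0 ≤ ρ b} ×ˢ {b | 0 ≤ ρ b}) := fun b hb =>
    ⟨hb, by simp [π, he]⟩
  have hπt : Tendsto π (𝓝[{b | 0 ≤ ρ b}] a) (𝓝[{b | 0 ≤ ρ b} ×ˢ {b | 0 ≤ ρ b}] (a, a)) := by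
    rw [← hπa]
    exact hπ.continuous.continuousWithinAt.tendsto_nhdsWithin hπm
  have hπ2 : Tendsto (fun b => b - ρ b • e) (𝓝[{b | 0 ≤ ρ b}] a) (𝓝[{b | 0 ≤ ρ b}] a) := by
    have : ContinuousWithinAt (fun b => b - ρ b • e) {b | 0 ≤ ρ b} a := by fun_prop
    have := this.tendsto_nhdsWithin (t := {b | 0 ≤ ρ b}) fun b hb => by simp [he]
    simpa [ha] using this
  refine ⟨fun b => avgDeriv f {b | 0 ≤ ρ b} (π b) e, ?_, ?_⟩
  · have h3 : ContDiffWithinAt ℝ ∞ (fun b => avgDeriv f {b | 0 ≤ ρ b} (π b)) {b | 0 ≤ ρ b} a :=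
      ContDiffWithinAt.comp (g := avgDeriv f {b | 0 ≤ ρ b}) a (by rwa [hπa]) hπ.contDiffWithinAt hπm
    exact h3.clm_apply contDiffWithinAt_const
  · filter_upwards [hπt.eventually h2, hπ2.eventually h0] with b hb hb0
    have : f (b - ρ b • e) = 0 := hb0 (by simp [he])
    simpa [π, this] using hb

end Analysis

/-! ### Filters -/

theorem _root_.Filter.map_eq_of_rightInverse {α β : Type*} {f : α → β} {g : β → α} {l : Filter α}
    {l' : Filter β} (hf : Tendsto f l l') (hg : Tendsto g l' l) (h : ∀ᶠ x in l', f (g x) = x) :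
    map f l = l' := by
  refine le_antisymm hf ?_
  calc l' = map (f ∘ g) l' := by
        conv_lhs => rw [← map_id (f := l')]
        exact map_congr (h.mono fun x hx => hx.symm)
    _ = map f (map g l') := (map_map).symm
    _ ≤ map f l := map_mono hg

theorem neBot_inf_of_map_injOn {α β : Type*} {f : α → β} {l l' : Filter α} {s : Set α}
    (hl : s ∈ l) (hl' : s ∈ l') (hf : InjOn f s) (h : (map f l ⊓ map f l').NeBot) :
    (l ⊓ l').NeBot := by
  rw [← map_inf' hl hl' hf] at h
  exact map_neBot_iff f |>.1 h

end ThetaCalc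

end

noncomputable section
namespace ThetaCalc
set_option linter.unusedSectionVars false

/-! ### Charts of the base -/

/-! ### Germs in a single chart -/

section BChartGen

variable {E S : Type*} [TopologicalSpace E]

theorem BChart.germ_neBot {φ : BChart E S} {a : E} (h : a ∈ closure φ.inner) :
    (φ.germ a).NeBot := by
  have := mem_closure_iff_nhdsWithin_neBot.1 h
  exact this.map _

/-- The parametrization is injective on `inner`, so filters that meet after it already meet before
it, and `E` is Hausdorff. -/
theorem BChart.eq_of_germ_inf_neBot [T2Space E] {φ : BChart E S} (hi : InjOn φ.toFun φ.inner)
    {a b : E} (h : (φ.germ a ⊓ φ.germ b).NeBot) : a = b := by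
  have := neBot_inf_of_map_injOn self_mem_nhdsWithin self_mem_nhdsWithin hi h
  have h2 : (𝓝 a ⊓ 𝓝 b).NeBot :=
    this.mono (inf_le_inf nhdsWithin_le_nhds nhdsWithin_le_nhds)
  exact eq_of_nhds_neBot h2

/-- A mere inclusion of germs forces equal coordinates. This later upgrades one-sided comparisons
between two charts to equalities. -/
theorem BChart.eq_of_germ_le [T2Space E] {φ : BChart E S} (hi : InjOn φ.toFun φ.inner)
    {a b : E} (ha : a ∈ closure φ.inner) (h : φ.germ a ≤ φ.germ b) : a = b := by
  have := BChart.germ_neBot ha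
  exact BChart.eq_of_germ_inf_neBot hi (by rwa [inf_eq_left.2 h])

theorem BChart.eventually_mem_germ {φ : BChart E S} {a : E} {s : Set S} (h : s ∈ φ.germ a) :
    ∀ᶠ b in 𝓝 a, s ∈ φ.germ b := by
  have h1 : ∀ᶠ y in 𝓝[φ.inner] a, φ.toFun y ∈ s := h
  exact (eventually_eventually_nhdsWithin' h1)
where
  eventually_eventually_nhdsWithin' {p : E → Prop} {s : Set E} {a : E}
      (h : ∀ᶠ y in 𝓝[s] a, p y) : ∀ᶠ b in 𝓝 a, ∀ᶠ y in 𝓝[s] b, p y := by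
    rw [eventually_nhdsWithin_iff] at h
    filter_upwards [eventually_eventually_nhds.2 h] with b hb
    exact eventually_nhdsWithin_iff.2 hb

end BChartGen

variable {d : ℕ}

/-- The coordinate half space. -/
def HS (d : ℕ) : Set (V d) := {x | 0 ≤ x 0}

/-- The boundary defining coordinate, as a linear functional. -/
def rho (d : ℕ) : V d →L[ℝ] ℝ := EuclideanSpace.proj 0

@[simp] theorem rho_apply (x : V d) : rho d x = x 0 := rfl

/-- The coordinate vector `∂_j`. -/
def ei (j : Fin (d + 2)) : V d := EuclideanSpace.single j 1

theorem ei_apply (j k : Fin (d + 2)) : (ei j : V d) k = if k = j then 1 else 0 := by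
  simp [ei]

theorem ez_eq : ez d = ei (Fin.last (d + 1)) := rfl

@[simp] theorem last_ne_zero' : Fin.last (d + 1) ≠ 0 := Fin.last_pos.ne'

@[simp] theorem zero_ne_last' : (0 : Fin (d + 2)) ≠ Fin.last (d + 1) := Fin.last_pos.ne

@[simp] theorem ez_last : (ez d) (Fin.last (d + 1)) = 1 := by simp [ez_eq, ei_apply]

theorem ez_of_ne {j : Fin (d + 2)} (h : j ≠ Fin.last (d + 1)) : (ez d) j = 0 := by
  simp [ez_eq, ei_apply, h]

theorem rho_ei : rho d (ei 0) = 1 := by simp [ei_apply]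

theorem HS_eq_range : HS d = range (𝓡∂ (d + 2)) :=
  (range_modelWithCornersEuclideanHalfSpace (d + 2)).symm

theorem convex_HS : Convex ℝ (HS d) := convex_halfspace_ge (rho d)

theorem uniqueDiffOn_HS : UniqueDiffOn ℝ (HS d) := uniqueDiffOn_halfspace_ge rho_ei

theorem isClosed_HS : IsClosed (HS d) := isClosed_le continuous_const (rho d).continuous

theorem isOpen_pos : IsOpen {x : V d | 0 < x 0} := isOpen_lt continuous_const (rho d).continuous

theorem HS_mem_nhds {x : V d} (h : 0 < x 0) : HS d ∈ 𝓝 x :=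
  mem_of_superset (isOpen_pos.mem_nhds h) fun y (hy : 0 < y 0) => hy.le

theorem vec_eq_sum (v : V d) : v = ∑ j, v j • (ei j : V d) := by
  ext k
  simp [ei_apply]

theorem clm_ext_ei {F : Type*} [NormedAddCommGroup F] [NormedSpace ℝ F] {f g : V d →L[ℝ] F}
    (h : ∀ j, f (ei j) = g (ei j)) : f = g := by
  ext v
  rw [vec_eq_sum v]
  simp [map_sum, h]

/-! ### Coordinate changes of X and their behaviour at the boundary -/

section Base

variable {X : Type*} [TopologicalSpace X] [ChartedSpace (EuclideanHalfSpace (d + 2)) X]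
  {θ : ∀ p : X, TangentSpace (𝓡∂ (d + 2)) p →L[ℝ] ℝ}

namespace ThetaChart

variable (c c' : ThetaChart θ)

/-- The part of the coordinate range of `c` which lies in the domain of `c'`. -/
def overlap : Set (V d) := {x | x ∈ c.target ∧ c.pt x ∈ c'.e.source}

/-- The change of coordinates. -/
def change : V d → V d := (𝓡∂ (d + 2)).extendCoordChange c.e c'.e

variable {c c'}

theorem target_subset : c.target ⊆ HS d := by
  rw [HS_eq_range]; exact c.e.extend_target_subset_range

theorem nonneg {x : V d} (h : x ∈ c.target) : 0 ≤ x 0 := target_subset h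

theorem pt_mem_source {x : V d} (h : x ∈ c.target) : c.pt x ∈ c.e.source := by
  have := (c.e.extend (𝓡∂ (d + 2))).map_target h
  rwa [c.e.extend_source] at this

theorem extend_pt {x : V d} (h : x ∈ c.target) : c.e.extend (𝓡∂ (d + 2)) (c.pt x) = x :=
  (c.e.extend (𝓡∂ (d + 2))).right_inv h

theorem pt_extend {p : X} (h : p ∈ c.e.source) : c.pt (c.e.extend (𝓡∂ (d + 2)) p) = p :=
  c.e.extend_left_inv h

theorem extend_mem_target {p : X} (h : p ∈ c.e.source) :
    c.e.extend (𝓡∂ (d + 2)) p ∈ c.target :=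
  (c.e.extend (𝓡∂ (d + 2))).map_source (by rwa [c.e.extend_source])

theorem pt_injOn : InjOn c.pt c.target := (c.e.extend (𝓡∂ (d + 2))).symm.injOn

theorem continuousOn_pt : ContinuousOn c.pt c.target := c.e.continuousOn_extend_symm

theorem target_mem_nhdsWithin {x : V d} (h : x ∈ c.target) : c.target ∈ 𝓝[HS d] x := by
  have := c.e.extend_target_mem_nhdsWithin (I := 𝓡∂ (d + 2)) (pt_mem_source h)
  rwa [extend_pt h, ← HS_eq_range] at this

theorem nhdsWithin_target {x : V d} (h : x ∈ c.target) : 𝓝[c.target] x = 𝓝[HS d] x :=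
  le_antisymm (nhdsWithin_mono _ target_subset)
    (nhdsWithin_le_iff.2 (target_mem_nhdsWithin h))

theorem target_mem_nhds {x : V d} (h : x ∈ c.target) (h0 : 0 < x 0) : c.target ∈ 𝓝 x := by
  have := target_mem_nhdsWithin h
  rwa [nhdsWithin_eq_nhds.2 (HS_mem_nhds h0)] at this

theorem contDiffWithinAt_form {x : V d} (h : x ∈ c.target) :
    ContDiffWithinAt ℝ ∞ c.form (HS d) x :=
  (c.smooth x h).mono_of_mem_nhdsWithin (target_mem_nhdsWithin h)

theorem contDiffAt_form {x : V d} (h : x ∈ c.target) (h0 : 0 < x 0) :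
    ContDiffAt ℝ ∞ c.form x :=
  (contDiffWithinAt_form h).contDiffAt (HS_mem_nhds h0)

theorem mem_overlap_iff_source {x : V d} :
    x ∈ c.overlap c' ↔ x ∈ ((𝓡∂ (d + 2)).extendCoordChange c.e c'.e).source := by
  simp only [ModelWithCorners.extendCoordChange, PartialEquiv.trans_source,
    PartialEquiv.symm_source, c'.e.extend_source]
  rfl

theorem change_mem_target {x : V d} (h : x ∈ c.overlap c') : c.change c' x ∈ c'.target :=
  extend_mem_target h.2

theorem pt_change {x : V d} (h : x ∈ c.overlap c') : c'.pt (c.change c' x) = c.pt x :=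
  pt_extend h.2

theorem change_mem_overlap {x : V d} (h : x ∈ c.overlap c') :
    c.change c' x ∈ c'.overlap c :=
  ⟨change_mem_target h, by rw [pt_change h]; exact pt_mem_source h.1⟩

theorem change_eq_of_pt_eq {x y : V d} (hx : x ∈ c.target) (hy : y ∈ c'.target)
    (h : c.pt x = c'.pt y) : x ∈ c.overlap c' ∧ c.change c' x = y := by
  have h1 : x ∈ c.overlap c' := ⟨hx, h ▸ pt_mem_source hy⟩
  exact ⟨h1, pt_injOn (change_mem_target h1) hy ((pt_change h1).trans h)⟩

theorem change_change {x : V d} (h : x ∈ c.overlap c') : c'.change c (c.change c' x) = x :=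
  (change_eq_of_pt_eq (change_mem_target h) h.1 (pt_change h)).2

theorem overlap_mem_nhdsWithin {x : V d} (h : x ∈ c.overlap c') :
    c.overlap c' ∈ 𝓝[HS d] x := by
  have := (𝓡∂ (d + 2)).extendCoordChange_source_mem_nhdsWithin (mem_overlap_iff_source.1 h)
  rw [← HS_eq_range] at this
  exact mem_of_superset this fun y hy => mem_overlap_iff_source.2 hy

theorem mapsTo_change_HS : MapsTo (c.change c') (HS d) (HS d) := fun x _ => by
  rw [HS_eq_range]
  exact mem_range_self _

variable [IsManifold (𝓡∂ (d + 2)) ∞ X]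

theorem contDiffWithinAt_change {x : V d} (h : x ∈ c.overlap c') :
    ContDiffWithinAt ℝ ∞ (c.change c') (HS d) x := by
  have := (𝓡∂ (d + 2)).contDiffWithinAt_extendCoordChange c.mem_atlas c'.mem_atlas
    (mem_overlap_iff_source.1 h)
  rwa [← HS_eq_range] at this

/-- The differential of the change of coordinates. -/
def dchange (c c' : ThetaChart θ) (x : V d) : V d →L[ℝ] V d :=
  fderivWithin ℝ (c.change c') (HS d) x

theorem hasFDerivWithinAt_change {x : V d} (h : x ∈ c.overlap c') :
    HasFDerivWithinAt (c.change c') (dchange c c' x) (HS d) x :=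
  ((contDiffWithinAt_change h).differentiableWithinAt (by simp)).hasFDerivWithinAt

theorem contDiffWithinAt_dchange {x : V d} (h : x ∈ c.overlap c') :
    ContDiffWithinAt ℝ ∞ (dchange c c') (HS d) x :=
  (contDiffWithinAt_change h).fderivWithin_right uniqueDiffOn_HS (by simp)
    (target_subset h.1)

theorem dchange_dchange {x : V d} (h : x ∈ c.overlap c') :
    (dchange c' c (c.change c' x)).comp (dchange c c' x) = ContinuousLinearMap.id ℝ (V d) := by
  have h1 := (hasFDerivWithinAt_change (change_mem_overlap h)).comp x
    (hasFDerivWithinAt_change h) mapsTo_change_HS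
  have h2 : HasFDerivWithinAt (c'.change c ∘ c.change c') (ContinuousLinearMap.id ℝ (V d))
      (HS d) x := (hasFDerivWithinAt_id x _).congr_of_eventuallyEq
    (eventually_of_mem (overlap_mem_nhdsWithin h) fun y hy => change_change hy)
    (change_change h)
  exact (uniqueDiffOn_HS x (target_subset h.1)).eq h1 h2

theorem dchange_dchange_apply {x : V d} (h : x ∈ c.overlap c') (y : V d) :
    dchange c' c (c.change c' x) (dchange c c' x y) = y :=
  DFunLike.congr_fun (dchange_dchange h) y

theorem dchange_dchange_apply' {x : V d} (h : x ∈ c.overlap c') (y : V d) :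
    dchange c c' x (dchange c' c (c.change c' x) y) = y := by
  have := dchange_dchange_apply (change_mem_overlap h) y
  rwa [change_change h] at this

/-- The change of coordinates maps the half space to itself and has surjective differential at an
interior point; a boundary value would force the image of the differential into a half space. -/
theorem change_pos {x : V d} (h : x ∈ c.overlap c') (h0 : 0 < x 0) :
    0 < (c.change c' x) 0 := by
  have hn : HS d ∈ 𝓝 x := HS_mem_nhds h0
  have hd := (hasFDerivWithinAt_change h).hasFDerivAt hn
  have := hd.differentiableAt.mem_interior_convex_of_surjective_fderiv hn
    (convex_HS) isClosed_HS
    ⟨ei 0, mem_interior_iff_mem_nhds.2 (HS_mem_nhds (by simp [ei_apply]))⟩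
    mapsTo_change_HS (by
      rw [hd.fderiv]
      exact fun y => ⟨_, dchange_dchange_apply' h y⟩)
  rw [HS_eq_range, interior_range_modelWithCornersEuclideanHalfSpace] at this
  exact this

theorem change_pos_iff {x : V d} (h : x ∈ c.overlap c') :
    0 < (c.change c' x) 0 ↔ 0 < x 0 :=
  ⟨fun h0 => by simpa [change_change h] using change_pos (change_mem_overlap h) h0,
    change_pos h⟩

theorem change_eq_zero_iff {x : V d} (h : x ∈ c.overlap c') :
    (c.change c' x) 0 = 0 ↔ x 0 = 0 := by
  have h1 := change_pos_iff h
  have h2 := nonneg h.1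
  have h3 := nonneg (change_mem_target h)
  constructor
  · intro h4
    by_contra h5
    exact (h1.2 (lt_of_le_of_ne h2 (Ne.symm h5))).ne' h4
  · intro h4
    by_contra h5
    exact (h1.1 (lt_of_le_of_ne h3 (Ne.symm h5))).ne' h4

/-- The differential of the chart map. -/
def dext (c : ThetaChart θ) (p : X) : V d →L[ℝ] V d :=
  mfderiv (𝓡∂ (d + 2)) 𝓘(ℝ, V d) (c.e.extend (𝓡∂ (d + 2))) p

theorem mdifferentiableAt_extend {p : X} (h : p ∈ c.e.source) :
    MDifferentiableAt (𝓡∂ (d + 2)) 𝓘(ℝ, V d) (c.e.extend (𝓡∂ (d + 2))) p :=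
  (c.e.contMDiffAt_extend c.mem_atlas h).mdifferentiableAt (by simp)

theorem dext_change {x : V d} (h : x ∈ c.overlap c') :
    dext c' (c.pt x) = (dchange c c' x).comp (dext c (c.pt x)) := by
  have hp := pt_mem_source h.1
  have h1 := (mdifferentiableAt_extend hp).hasMFDerivAt
  have h2 : HasMFDerivWithinAt 𝓘(ℝ, V d) 𝓘(ℝ, V d) (c.change c') (HS d)
      (c.e.extend (𝓡∂ (d + 2)) (c.pt x)) (dchange c c' x) := by
    rw [extend_pt h.1]
    exact (hasFDerivWithinAt_change h).hasMFDerivWithinAt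
  have h3 := h2.comp (c.pt x) (hasMFDerivWithinAt_univ.2 h1) (fun q _ => by
    rw [mem_preimage, HS_eq_range]; exact mem_range_self _)
  have h4 : HasMFDerivAt (𝓡∂ (d + 2)) 𝓘(ℝ, V d) (c'.e.extend (𝓡∂ (d + 2))) (c.pt x)
      ((dchange c c' x).comp (dext c (c.pt x))) := by
    refine (hasMFDerivWithinAt_univ.1 h3).congr_of_eventuallyEq ?_
    filter_upwards [c.e.open_source.mem_nhds hp] with q hq
    change _ = (c'.e.extend (𝓡∂ (d + 2))) ((c.e.extend (𝓡∂ (d + 2))).symm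
      (c.e.extend (𝓡∂ (d + 2)) q))
    rw [c.e.extend_left_inv hq]
  exact h4.mfderiv

/-- The parametrization of the chart is a right inverse of the chart map, and derivatives on the
half space are unique, so the composite of the differentials is the identity. -/
theorem dext_surjective {x : V d} (h : x ∈ c.target) :
    Function.Surjective (dext c (c.pt x)) := by
  have hp := pt_mem_source h
  have h1 := (mdifferentiableAt_extend hp).hasMFDerivAt
  have h2 : MDifferentiableWithinAt 𝓘(ℝ, V d) (𝓡∂ (d + 2)) c.pt c.target x := by
    have := contMDiffOn_extend_symm (I := 𝓡∂ (d + 2)) c.mem_atlas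
    rw [← c.e.extend_target'] at this
    exact (this x h).mdifferentiableWithinAt (by simp)
  have h3 := h1.comp_hasMFDerivWithinAt x h2.hasMFDerivWithinAt
  have h4 : HasFDerivWithinAt (fun y : V d => c.e.extend (𝓡∂ (d + 2)) (c.pt y))
    ((dext c (c.pt x)).comp
      (show V d →L[ℝ] V d from mfderivWithin 𝓘(ℝ, V d) (𝓡∂ (d + 2)) c.pt c.target x))
      c.target x := h3.hasFDerivWithinAt
  have h5 : HasFDerivWithinAt (fun y : V d => c.e.extend (𝓡∂ (d + 2)) (c.pt y))
      (ContinuousLinearMap.id ℝ (V d)) c.target x :=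
    (hasFDerivWithinAt_id x _).congr (fun y hy => extend_pt hy) (extend_pt h)
  have hu : UniqueDiffWithinAt ℝ c.target x :=
    (uniqueDiffOn_HS x (target_subset h)).mono_nhds (by rw [nhdsWithin_target h])
  have h6 := hu.eq h4 h5
  exact fun y => ⟨_, DFunLike.congr_fun h6 y⟩

/-- Both local forms restrict to the same `θ` on all tangent vectors at a boundary point, although
they may differ away from ∂X. This is why ᶿT*X depends only on θ along the boundary. -/
theorem form_change {x : V d} (h : x ∈ c.overlap c') (hb : c.pt x ∈ (𝓡∂ (d + 2)).boundary X)
    (y : V d) : c'.form (c.change c' x) (dchange c c' x y) = c.form x y := by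
  obtain ⟨v, rfl⟩ := dext_surjective h.1 y
  have h1 := c.agree (c.pt x) (pt_mem_source h.1) hb v
  have h2 := c'.agree (c.pt x) h.2 hb v
  have h3 : dext c' (c.pt x) v = dchange c c' x (dext c (c.pt x) v) :=
    DFunLike.congr_fun (dext_change h) v
  rw [extend_pt h.1] at h1
  rw [← h3]
  exact h2.trans h1.symm

/-- The coordinate system `e` of a chart decides whether a point is in the interior. -/
theorem pt_mem_interior_iff {x : V d} (h : x ∈ c.target) :
    c.pt x ∈ (𝓡∂ (d + 2)).interior X ↔ 0 < x 0 := by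
  set e₀ := chartAt (EuclideanHalfSpace (d + 2)) (c.pt x)
  have he₀ : e₀ ∈ IsManifold.maximalAtlas (𝓡∂ (d + 2)) ∞ X :=
    IsManifold.chart_mem_maximalAtlas (c.pt x)
  -- The preferred chart at the point comes without a local form, so `change_pos` does not apply;
  -- the same argument is repeated for arbitrary charts of the maximal atlas.
  have key : ∀ e ∈ IsManifold.maximalAtlas (𝓡∂ (d + 2)) ∞ X,
      ∀ e' ∈ IsManifold.maximalAtlas (𝓡∂ (d + 2)) ∞ X, ∀ p : X, p ∈ e.source → p ∈ e'.source →
      0 < (e.extend (𝓡∂ (d + 2)) p) 0 → 0 < (e'.extend (𝓡∂ (d + 2)) p) 0 := by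
    intro e he e' he' p hp hp' h0
    have hn := HS_mem_nhds h0
    have hsrc : e.extend (𝓡∂ (d + 2)) p ∈ ((𝓡∂ (d + 2)).extendCoordChange e e').source := by
      rw [← OpenPartialHomeomorph.extend_image_source_inter]
      exact mem_image_of_mem _ ⟨hp, hp'⟩
    have hm : ((𝓡∂ (d + 2)).extendCoordChange e e').source ∈ 𝓝 (e.extend (𝓡∂ (d + 2)) p) := by
      have := (𝓡∂ (d + 2)).extendCoordChange_source_mem_nhdsWithin hsrc
      rwa [← HS_eq_range, nhdsWithin_eq_nhds.2 hn] at this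
    have hcd := (((𝓡∂ (d + 2)).contDiffOn_extendCoordChange he he') _ hsrc).contDiffAt hm
    have hinv := (𝓡∂ (d + 2)).isInvertible_fderivWithin_extendCoordChange (n := ∞) (by simp)
      he he' hsrc
    rw [fderivWithin_of_mem_nhds hm] at hinv
    have := (hcd.differentiableAt (by simp)).mem_interior_convex_of_surjective_fderiv hn
      convex_HS isClosed_HS
      ⟨ei 0, mem_interior_iff_mem_nhds.2 (HS_mem_nhds (by simp [ei_apply]))⟩
      (fun y _ => by rw [HS_eq_range]; exact mem_range_self _) hinv.surjective
    rw [HS_eq_range, interior_range_modelWithCornersEuclideanHalfSpace] at this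
    change 0 < (e'.extend (𝓡∂ (d + 2)) ((e.extend (𝓡∂ (d + 2))).symm
      (e.extend (𝓡∂ (d + 2)) p))) 0 at this
    rwa [e.extend_left_inv hp] at this
  have h1 : c.pt x ∈ (𝓡∂ (d + 2)).interior X ↔ 0 < (e₀.extend (𝓡∂ (d + 2)) (c.pt x)) 0 := by
    change extChartAt (𝓡∂ (d + 2)) (c.pt x) (c.pt x) ∈ interior (range (𝓡∂ (d + 2))) ↔ _
    rw [interior_range_modelWithCornersEuclideanHalfSpace]
    rfl
  rw [h1]
  constructor
  · intro h2
    have := key e₀ he₀ c.e c.mem_atlas (c.pt x) (mem_chart_source _ _) (pt_mem_source h) h2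
    rwa [extend_pt h] at this
  · intro h2
    exact key c.e c.mem_atlas e₀ he₀ (c.pt x) (pt_mem_source h) (mem_chart_source _ _)
      (by rwa [extend_pt h])

theorem pt_mem_boundary_iff {x : V d} (h : x ∈ c.target) :
    c.pt x ∈ (𝓡∂ (d + 2)).boundary X ↔ x 0 = 0 := by
  rw [← ModelWithCorners.compl_interior, mem_compl_iff, pt_mem_interior_iff h, not_lt]
  exact ⟨fun h1 => le_antisymm h1 (nonneg h), fun h1 => h1.le⟩

theorem cov_change {x : V d} (h : x ∈ c.overlap c') (ξ : V d →L[ℝ] ℝ) :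
    c'.cov (c.change c' x) ξ = c.cov x (ξ.comp (dchange c c' x)) := by
  have h1 : ∀ p, c'.pt (c.change c' x) = p → p = c.pt x →
      c'.cov (c.change c' x) ξ = (⟨p, ξ.comp (dext c' p)⟩ : Cot d X) := by
    rintro p rfl _; rfl
  rw [h1 (c.pt x) (pt_change h) rfl, dext_change h]
  rfl

theorem cov_injOn {x y : V d} {ξ η : V d →L[ℝ] ℝ} (hx : x ∈ c.target) (hy : y ∈ c.target)
    (h : c.cov x ξ = c.cov y η) : x = y ∧ ξ = η := by
  have h1 : c.pt x = c.pt y := congrArg (fun q => q.proj) h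
  obtain rfl := pt_injOn hx hy h1
  refine ⟨rfl, ?_⟩
  have h2 : ξ.comp (dext c (c.pt x)) = η.comp (dext c (c.pt x)) :=
    eq_of_heq (Bundle.TotalSpace.mk.inj h).2
  ext y
  obtain ⟨v, rfl⟩ := dext_surjective hx y
  exact DFunLike.congr_fun h2 v

end ThetaChart

end Base

end ThetaCalc

end

noncomputable section
namespace ThetaCalc
set_option linter.unusedSectionVars false

/-! ### The rescaled coframe and changes of charts of `ᶿT*X` -/

variable {d : ℕ}

/-- The part `∑ v_j dx_j` (without the last coordinate) of a covector. -/
def lin : V d →L[ℝ] V d →L[ℝ] ℝ :=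
  ∑ j : Fin (d + 1), ((EuclideanSpace.proj (𝕜 := ℝ) j.castSucc : V d →L[ℝ] ℝ)).smulRight
    (EuclideanSpace.proj (𝕜 := ℝ) j.castSucc : V d →L[ℝ] ℝ)

theorem lin_apply (v y : V d) : lin v y = ∑ j : Fin (d + 1), v j.castSucc * y j.castSucc := by
  simp [lin]

theorem lin_ei {j : Fin (d + 2)} (hj : j ≠ Fin.last (d + 1)) (v : V d) : lin v (ei j) = v j := by
  rw [lin_apply]
  obtain ⟨k, rfl⟩ := Fin.exists_castSucc_eq.2 hj
  simp [ei_apply]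

@[simp] theorem lin_ez (v : V d) : lin v (ez d) = 0 := by
  rw [lin_apply]
  refine Finset.sum_eq_zero fun j _ => ?_
  rw [ez_of_ne (Fin.castSucc_lt_last j).ne, mul_zero]

section Base

variable {X : Type*} [TopologicalSpace X] [ChartedSpace (EuclideanHalfSpace (d + 2)) X]
  {θ : ∀ p : X, TangentSpace (𝓡∂ (d + 2)) p →L[ℝ] ℝ}

namespace ThetaChart

variable (c c' : ThetaChart θ)

/-- The vector fields `frame j / ρ`, where `frame` is dual to the coframe of the chart. -/
def frame' (x : V d) (j : Fin (d + 2)) : V d :=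
  if j = Fin.last (d + 1) then (x 0 / c.form x (ez d)) • ez d
  else ei j - (c.form x (ei j) / c.form x (ez d)) • ez d

/-- The frame of `ᶿTX` dual to the coframe `dρ/ρ, dw_i/ρ, form/ρ²`. -/
def frame (x : V d) (j : Fin (d + 2)) : V d := x 0 • c.frame' x j

variable {c c'}

theorem coform_apply (x v y : V d) :
    c.coform x v y = (x 0)⁻¹ * lin v y + v (Fin.last (d + 1)) / (x 0) ^ 2 * c.form x y := by
  rw [coform, lin_apply, Finset.mul_sum]
  simp only [add_apply, sum_apply,
    smul_apply, smul_eq_mul]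
  congr 1
  refine Finset.sum_congr rfl fun j _ => ?_
  change _ * y j.castSucc = _
  ring

theorem form_frame' {x : V d} (h : x ∈ c.target) (j : Fin (d + 2)) :
    c.form x (c.frame' x j) = if j = Fin.last (d + 1) then x 0 else 0 := by
  have hz : c.form x (ez d) ≠ 0 := c.form_ez x h
  unfold frame'
  split_ifs with hj <;> simp [hz]

theorem lin_frame' (v x : V d) (j : Fin (d + 2)) :
    lin v (c.frame' x j) = if j = Fin.last (d + 1) then 0 else v j := by
  unfold frame'
  split_ifs with hj
  · simp
  · simp [lin_ei hj]

theorem coform_frame {x : V d} (h : x ∈ c.target) (h0 : 0 < x 0) (v : V d) (j : Fin (d + 2)) :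
    c.coform x v (c.frame x j) = v j := by
  rw [coform_apply, frame, map_smul, map_smul, lin_frame', form_frame' h]
  split_ifs with hj
  · subst hj; simp; field_simp
  · simp; field_simp

theorem coform_inj {x : V d} (h : x ∈ c.target) (h0 : 0 < x 0) {v w : V d}
    (hv : c.coform x v = c.coform x w) : v = w := by
  ext j
  rw [← coform_frame h h0 v j, hv, coform_frame h h0]

/-- The components of a covector in the rescaled coframe. -/
def comps (c : ThetaChart θ) (x : V d) (ξ : V d →L[ℝ] ℝ) : V d :=
  WithLp.toLp 2 fun j => ξ (c.frame x j)

@[simp] theorem comps_apply (x : V d) (ξ : V d →L[ℝ] ℝ) (j : Fin (d + 2)) :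
    c.comps x ξ j = ξ (c.frame x j) := rfl

theorem comps_coform {x : V d} (h : x ∈ c.target) (h0 : 0 < x 0) (v : V d) :
    c.comps x (c.coform x v) = v := by
  ext j
  rw [comps_apply, coform_frame h h0]

theorem coform_comps {x : V d} (h : x ∈ c.target) (h0 : 0 < x 0) (ξ : V d →L[ℝ] ℝ) :
    c.coform x (c.comps x ξ) = ξ := by
  have hz : c.form x (ez d) ≠ 0 := c.form_ez x h
  have hlast : c.coform x (c.comps x ξ) (ez d) = ξ (ez d) := by
    rw [coform_apply, lin_ez, comps_apply, frame, frame', if_pos rfl]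
    simp only [map_smul, smul_eq_mul]
    field_simp
    simp
  refine clm_ext_ei fun j => ?_
  by_cases hj : j = Fin.last (d + 1)
  · subst hj; exact hlast
  · have h1 := coform_frame h h0 (c.comps x ξ) j
    rw [comps_apply] at h1
    unfold frame frame' at h1
    rw [if_neg hj] at h1
    simp only [map_smul, map_sub, smul_eq_mul, hlast] at h1
    exact sub_left_injective (mul_left_cancel₀ h0.ne' h1)

theorem coform_smul (x : V d) (r : ℝ) (v : V d) : c.coform x (r • v) = r • c.coform x v := by
  ext y
  simp only [coform_apply, smul_apply, map_smul, smul_eq_mul, PiLp.smul_apply]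
  ring

theorem contDiffWithinAt_frame' {x : V d} (h : x ∈ c.target) (j : Fin (d + 2)) :
    ContDiffWithinAt ℝ ∞ (fun y => c.frame' y j) (HS d) x := by
  have hz : c.form x (ez d) ≠ 0 := c.form_ez x h
  have hf := contDiffWithinAt_form h
  have h0 : ContDiffWithinAt ℝ ∞ (fun y : V d => y 0) (HS d) x :=
    (rho d).contDiff.contDiffWithinAt
  have hfz := hf.clm_apply (contDiffWithinAt_const (c := ez d))
  have hfj := hf.clm_apply (contDiffWithinAt_const (c := (ei j : V d)))
  unfold frame'
  split_ifs with hj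
  · exact (h0.div hfz hz).smul contDiffWithinAt_const
  · exact contDiffWithinAt_const.sub ((hfj.div hfz hz).smul contDiffWithinAt_const)

theorem contDiffWithinAt_coform {x v : V d} (h : x ∈ c.target) (h0 : 0 < x 0) :
    ContDiffAt ℝ ∞ (fun b : V d × V d => c.coform b.1 b.2) (x, v) := by
  have hx : ∀ j, ContDiffAt ℝ ∞ (fun b : V d × V d => b.1 j) (x, v) := fun j =>
    ((EuclideanSpace.proj (𝕜 := ℝ) j : V d →L[ℝ] ℝ).contDiff.comp contDiff_fst).contDiffAt
  have hv : ∀ j, ContDiffAt ℝ ∞ (fun b : V d × V d => b.2 j) (x, v) := fun j =>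
    ((EuclideanSpace.proj (𝕜 := ℝ) j : V d →L[ℝ] ℝ).contDiff.comp contDiff_snd).contDiffAt
  have hf : ContDiffAt ℝ ∞ (fun b : V d × V d => c.form b.1) (x, v) :=
    (contDiffAt_form h h0).comp (x, v) contDiffAt_fst
  unfold coform
  refine ContDiffAt.add (ContDiffAt.sum fun j _ => ?_) ?_
  · exact ((hv _).div (hx 0) h0.ne').smul contDiffAt_const
  · exact ((hv _).div ((hx 0).pow 2) (pow_ne_zero 2 h0.ne')).smul hf

/-! #### The chart `cotChart` -/

theorem cotChart_dom : (thetaAtlas θ c).dom = {a | a.1 ∈ c.target} := rfl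

theorem cotChart_inner : (thetaAtlas θ c).inner = {a | a.1 ∈ c.target ∧ 0 < a.1 0} := rfl

variable [IsManifold (𝓡∂ (d + 2)) ∞ X]

theorem cot_injOn : InjOn (thetaAtlas θ c).toFun (thetaAtlas θ c).inner := by
  rintro ⟨x, v⟩ ⟨hx, hx0⟩ ⟨y, w⟩ ⟨hy, hy0⟩ h
  obtain ⟨rfl, h2⟩ := cov_injOn hx hy h
  obtain rfl := coform_inj hx hx0 h2
  rfl

theorem target_subset_closure : c.target ⊆ closure {x | x ∈ c.target ∧ 0 < x 0} := by
  intro x hx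
  rw [mem_closure_iff_nhdsWithin_neBot]
  have h1 : Tendsto (fun t : ℝ => x + t • (ei 0 : V d)) (𝓝[>] 0)
      (𝓝[{x | x ∈ c.target ∧ 0 < x 0}] x) := by
    have h2 : Tendsto (fun t : ℝ => x + t • (ei 0 : V d)) (𝓝[>] 0) (𝓝[HS d] x) := by
      refine tendsto_nhdsWithin_iff.2 ⟨?_, ?_⟩
      · have : Continuous fun t : ℝ => x + t • (ei 0 : V d) := by fun_prop
        have := this.tendsto 0
        simp only [zero_smul, add_zero] at this
        exact this.mono_left nhdsWithin_le_nhds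
      · filter_upwards [self_mem_nhdsWithin] with t ht
        have : 0 ≤ x 0 := nonneg hx
        have ht : 0 < t := ht
        simp [HS, ei_apply]
        linarith
    refine tendsto_nhdsWithin_iff.2 ⟨h2.mono_right nhdsWithin_le_nhds, ?_⟩
    filter_upwards [h2.eventually (target_mem_nhdsWithin hx), self_mem_nhdsWithin] with t h3 ht
    refine ⟨h3, ?_⟩
    have : 0 ≤ x 0 := nonneg hx
    have ht : 0 < t := ht
    simp [ei_apply]
    linarith
  exact h1.neBot

theorem dom_subset_closure : (thetaAtlas θ c).dom ⊆ closure (thetaAtlas θ c).inner := by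
  rintro ⟨x, v⟩ hx
  have h1 : (thetaAtlas θ c).inner = {x | x ∈ c.target ∧ 0 < x 0} ×ˢ univ := by
    ext; simp [cotChart_inner]
  rw [h1, closure_prod_eq]
  exact ⟨target_subset_closure hx, by simp⟩

theorem cot_germ_neBot {a : V d × V d} (ha : a ∈ (thetaAtlas θ c).dom) :
    ((thetaAtlas θ c).germ a).NeBot :=
  BChart.germ_neBot (dom_subset_closure ha)

theorem nhdsWithin_dom {a : V d × V d} (ha : a ∈ (thetaAtlas θ c).dom) :
    𝓝[(thetaAtlas θ c).dom] a = 𝓝[{b | 0 ≤ b.1 0}] a := by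
  have h1 : (thetaAtlas θ c).dom = c.target ×ˢ univ := by
    ext; simp [cotChart_dom]
  have h2 : {b : V d × V d | 0 ≤ b.1 0} = HS d ×ˢ univ := by
    ext; simp [HS]
  rw [h1, h2, nhdsWithin_prod_eq, nhdsWithin_prod_eq, nhdsWithin_target ha]

/-- The transition formula is assumed only at points with `0 < y 0`, which is all that germs see.
Continuity of the base change and of `M` at `x` carries the limit point along. The reverse inclusion
is obtained from the opposite change of charts. -/
theorem germ_change_le {x v : V d} (hx : x ∈ c.overlap c') {M : V d → V d →L[ℝ] V d}
    (hM : ContinuousWithinAt M (HS d) x)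
    (h : ∀ᶠ y in 𝓝[HS d] x, 0 < y 0 → ∀ w,
      (c'.coform (c.change c' y) (M y w)).comp (dchange c c' y) = c.coform y w) :
    (thetaAtlas θ c).germ (x, v) ≤ (thetaAtlas θ c').germ (c.change c' x, M x v) := by
  let K : V d × V d → V d × V d := fun b => (c.change c' b.1, M b.1 b.2)
  have hfst : Tendsto Prod.fst (𝓝[(thetaAtlas θ c).inner] (x, v)) (𝓝[HS d] x) := by
    refine tendsto_nhdsWithin_iff.2 ⟨continuous_fst.continuousWithinAt, ?_⟩
    filter_upwards [self_mem_nhdsWithin] with b hb using target_subset hb.1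
  have hK : Tendsto K (𝓝[(thetaAtlas θ c).inner] (x, v)) (𝓝 (c.change c' x, M x v)) := by
    have h1 : Tendsto (fun b : V d × V d => c.change c' b.1) (𝓝[(thetaAtlas θ c).inner] (x, v))
        (𝓝 (c.change c' x)) :=
      ((contDiffWithinAt_change hx).continuousWithinAt.tendsto).comp hfst
    have h2 : Tendsto (fun b : V d × V d => M b.1) (𝓝[(thetaAtlas θ c).inner] (x, v))
        (𝓝 (M x)) := hM.tendsto.comp hfst
    have h3 : Tendsto (fun b : V d × V d => b.2) (𝓝[(thetaAtlas θ c).inner] (x, v)) (𝓝 v) :=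
      continuous_snd.continuousWithinAt
    exact h1.prodMk_nhds ((isBoundedBilinearMap_apply.continuous.tendsto (M x, v)).comp (h2.prodMk_nhds h3))
  have hK2 : Tendsto K (𝓝[(thetaAtlas θ c).inner] (x, v))
      (𝓝[(thetaAtlas θ c').inner] (c.change c' x, M x v)) := by
    refine tendsto_nhdsWithin_iff.2 ⟨hK, ?_⟩
    filter_upwards [self_mem_nhdsWithin, hfst.eventually (overlap_mem_nhdsWithin hx)] with b hb hb2
    exact ⟨change_mem_target hb2, change_pos hb2 hb.2⟩
  have h4 : (thetaAtlas θ c).toFun =ᶠ[𝓝[(thetaAtlas θ c).inner] (x, v)]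
      (thetaAtlas θ c').toFun ∘ K := by
    filter_upwards [self_mem_nhdsWithin, hfst.eventually (overlap_mem_nhdsWithin hx),
      hfst.eventually h] with b hb hb2 hb3
    change c.cov b.1 (c.coform b.1 b.2) = c'.cov (c.change c' b.1) _
    rw [cov_change hb2, ← hb3 hb.2]
  unfold BChart.germ
  rw [map_congr h4, ← map_map]
  exact map_mono hK2

/-- The differential of the inverse change of coordinates, applied to the frame of `c'`. -/
theorem exists_change_matrix {x : V d} (hx : x ∈ c.overlap c') :
    ∃ M : V d → V d →L[ℝ] V d, ContDiffWithinAt ℝ ∞ M (HS d) x ∧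
      ∀ᶠ y in 𝓝[HS d] x, 0 < y 0 → ∀ w,
        (c'.coform (c.change c' y) (M y w)).comp (dchange c c' y) = c.coform y w := by
  have hxt := hx.1
  have hov := overlap_mem_nhdsWithin hx
  have hch := contDiffWithinAt_change hx
  have hxc := change_mem_overlap hx
  have hcomp : ∀ {F : Type} [NormedAddCommGroup F] [NormedSpace ℝ F] {f : V d → F},
      ContDiffWithinAt ℝ ∞ f (HS d) (c.change c' x) →
      ContDiffWithinAt ℝ ∞ (fun y => f (c.change c' y)) (HS d) x := fun hf =>
    hf.comp x hch mapsTo_change_HS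
  -- the quotient of the boundary defining functions
  obtain ⟨g, hg, hge⟩ := exists_smooth_quotient (ρ := rho d) rho_ei
    (f := fun y => rho d (c.change c' y)) (a := x) (nonneg hxt)
    ((rho d).contDiff.comp_contDiffWithinAt hch) (by
      filter_upwards [hov] with y hy h0
      exact (change_eq_zero_iff hy).2 h0)
  let q : Fin (d + 2) → V d → V d := fun j y =>
    dchange c' c (c.change c' y) (c'.frame' (c.change c' y) j)
  have hq : ∀ j, ContDiffWithinAt ℝ ∞ (q j) (HS d) x := fun j =>
    (hcomp (contDiffWithinAt_dchange hxc)).clm_apply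
      (hcomp (contDiffWithinAt_frame' hxc.1 j))
  -- The component along `form/ρ²` has one more negative power of ρ to absorb, so `form` of the
  -- transported frame must vanish at ρ = 0. There `form_change` turns it into the other form on its
  -- own frame, which is ρ' or 0.
  have hQ : ∀ j, ∃ Q : V d → ℝ, ContDiffWithinAt ℝ ∞ Q (HS d) x ∧
      ∀ᶠ y in 𝓝[HS d] x, c.form y (q j y) = rho d y • Q y := fun j => by
    refine exists_smooth_quotient (ρ := rho d) rho_ei (f := fun y => c.form y (q j y))
      (nonneg hxt) ((contDiffWithinAt_form hxt).clm_apply (hq j)) ?_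
    filter_upwards [hov] with y hy h0
    have hyb := (pt_mem_boundary_iff hy.1).2 h0
    have h1 := form_change hy hyb (q j y)
    rw [dchange_dchange_apply' hy, form_frame' (change_mem_target hy)] at h1
    rw [← h1]
    split_ifs
    · exact (change_eq_zero_iff hy).2 h0
    · rfl
  choose Q hQs hQe using hQ
  -- The coefficient is ρ' times the covector on `q j`, that is ρ' (lin/ρ + t form/ρ²). Substituting
  -- ρ' = ρ g and form (q j) = ρ Q j cancels every power of ρ.
  let L : Fin (d + 2) → V d → V d →L[ℝ] ℝ := fun j y =>
    g y • (lin.flip (q j y) + Q j y • (EuclideanSpace.proj (𝕜 := ℝ) (Fin.last (d + 1))))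
  have hL : ∀ j, ContDiffWithinAt ℝ ∞ (L j) (HS d) x := fun j =>
    hg.smul ((lin.flip.contDiff.comp_contDiffWithinAt (hq j)).add
      ((hQs j).smul contDiffWithinAt_const))
  refine ⟨fun y => ∑ j, (L j y).smulRight (ei j : V d), ?_, ?_⟩
  · refine ContDiffWithinAt.sum fun j _ => ?_
    exact ((ContinuousLinearMap.smulRightL ℝ (V d) (V d)).flip (ei j)).contDiff.comp_contDiffWithinAt
      (hL j)
  · filter_upwards [hov, hge, eventually_all.2 hQe] with y hy hgy hQy h0 w
    have hc0 := change_pos hy h0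
    have h1 : (∑ j, (L j y).smulRight (ei j : V d)) w =
        c'.comps (c.change c' y) ((c.coform y w).comp (dchange c' c (c.change c' y))) := by
      ext j
      rw [sum_apply]
      simp only [ContinuousLinearMap.smulRight_apply, WithLp.ofLp_sum, Finset.sum_apply,
        PiLp.smul_apply, ei_apply, smul_eq_mul, mul_ite, mul_one, mul_zero, Finset.sum_ite_eq,
        Finset.mem_univ, if_true, comps_apply, ContinuousLinearMap.comp_apply, frame, map_smul]
      change L j y w = (rho d (c.change c' y)) * c.coform y w (q j y)
      rw [hgy, coform_apply, hQy j]
      simp [L]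
      field_simp
    rw [h1, coform_comps (change_mem_target hy) hc0]
    ext z
    simp [dchange_dchange_apply hy]

/-- Two charts describe the same points of `ᶿT*X` over the overlap of their domains. -/
theorem germ_change {x v : V d} (hx : x ∈ c.overlap c') {M : V d → V d →L[ℝ] V d}
    (hM : ContinuousWithinAt M (HS d) x)
    (h : ∀ᶠ y in 𝓝[HS d] x, 0 < y 0 → ∀ w,
      (c'.coform (c.change c' y) (M y w)).comp (dchange c c' y) = c.coform y w) :
    (thetaAtlas θ c).germ (x, v) = (thetaAtlas θ c').germ (c.change c' x, M x v) := by
  obtain ⟨M', hM', h'⟩ := exists_change_matrix (change_mem_overlap hx)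
  have h1 := germ_change_le (v := v) hx hM h
  have h2 := germ_change_le (v := M x v) (change_mem_overlap hx) hM'.continuousWithinAt h'
  -- Going to the second chart and back gives an inclusion between germs of the first chart, hence
  -- equal coordinates, and the two inclusions become equalities.
  have h3 := BChart.eq_of_germ_le cot_injOn (dom_subset_closure hx.1) (h1.trans h2)
  exact le_antisymm h1 (h3 ▸ h2)

/-- Smooth changes of charts of `ᶿT*X`. -/
theorem exists_transition {x : V d} (hx : x ∈ c.overlap c') :
    ∃ M : V d → V d →L[ℝ] V d, ContDiffWithinAt ℝ ∞ M (HS d) x ∧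
      ∀ᶠ y in 𝓝[HS d] x, y ∈ c.overlap c' ∧
        (∀ w, (thetaAtlas θ c).germ (y, w) = (thetaAtlas θ c').germ (c.change c' y, M y w)) ∧
        (0 < y 0 → ∀ w,
          (c'.coform (c.change c' y) (M y w)).comp (dchange c c' y) = c.coform y w) := by
  obtain ⟨M, hM, h⟩ := exists_change_matrix hx
  refine ⟨M, hM, ?_⟩
  have h1 : ∀ᶠ y in 𝓝[HS d] x, ContinuousWithinAt M (HS d) y := by
    have := (hM.of_le (m := 1) (by simp)).eventually (by simp)
    rw [insert_eq_of_mem (target_subset hx.1)] at this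
    exact this.mono fun y hy => hy.continuousWithinAt
  filter_upwards [h1, overlap_mem_nhdsWithin hx, h, eventually_eventually_nhdsWithin.2 h]
    with y hy1 hy2 hy3 hy4
  exact ⟨hy2, fun w => germ_change hy2 hy1 hy4, hy3⟩

end ThetaChart

end Base

end ThetaCalc

end

noncomputable section
namespace ThetaCalc
set_option linter.unusedSectionVars false

/-! ### The topology of `ᶿT*X` and smooth maps in charts -/

theorem ContDiffWithinAt.comp_of_eventually {E F G : Type*} [NormedAddCommGroup E]
    [NormedSpace ℝ E] [NormedAddCommGroup F] [NormedSpace ℝ F] [NormedAddCommGroup G]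
    [NormedSpace ℝ G] {n : WithTop ℕ∞} {g : F → G} {f : E → F} {s : Set E} {t : Set F} {a : E}
    (hg : ContDiffWithinAt ℝ n g t (f a)) (hf : ContDiffWithinAt ℝ n f s a)
    (h : ∀ᶠ b in 𝓝[s] a, f b ∈ t) : ContDiffWithinAt ℝ n (fun b => g (f b)) s a := by
  have h1 : ContDiffWithinAt ℝ n (g ∘ f) (s ∩ f ⁻¹' t) a := hg.comp_inter a hf
  exact h1.mono_of_mem_nhdsWithin (inter_mem self_mem_nhdsWithin h)

/-! ### Convergence in a space of germs -/

section BSpaceGen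

variable {ι E S : Type*} [TopologicalSpace E] {A : ι → BChart E S}

/-- The point with coordinates `a` in the chart `i`. -/
def BSpace.mk (i : ι) (a : E) (h : a ∈ (A i).dom) : BSpace A := ⟨(A i).germ a, i, a, h, rfl⟩

theorem BSpace.tendsto_nhds_iff {α : Type*} {l : Filter α} {f : α → BSpace A} {τ : BSpace A} :
    Tendsto f l (𝓝 τ) ↔ ∀ s ∈ τ.1, ∀ᶠ y in l, s ∈ (f y).1 := by
  rw [nhds_subtype_eq_comap, tendsto_comap_iff, Filter.tendsto_nhds]
  rfl

theorem BSpace.eventually_mem {τ : BSpace A} {s : Set S} (h : s ∈ τ.1) :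
    ∀ᶠ τ' in 𝓝 τ, s ∈ τ'.1 :=
  BSpace.tendsto_nhds_iff.1 tendsto_id s h

theorem BSpace.tendsto_of_germ {α : Type*} {l : Filter α} {f : α → BSpace A} {τ : BSpace A}
    {i : ι} {a : E} (hτ : τ.1 = (A i).germ a) {g : α → E} (hg : Tendsto g l (𝓝 a))
    (hf : ∀ᶠ y in l, (f y).1 = (A i).germ (g y)) : Tendsto f l (𝓝 τ) := by
  rw [BSpace.tendsto_nhds_iff]
  intro s hs
  rw [hτ] at hs
  filter_upwards [hg.eventually (BChart.eventually_mem_germ hs), hf] with y h1 h2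
  rwa [h2]

end BSpaceGen

variable {d : ℕ} {X : Type*} [TopologicalSpace X] [ChartedSpace (EuclideanHalfSpace (d + 2)) X]
  {θ : ∀ p : X, TangentSpace (𝓡∂ (d + 2)) p →L[ℝ] ℝ}
  [IsManifold (𝓡∂ (d + 2)) ∞ X]

open ThetaChart

namespace ThetaCot

theorem neBot (ζ : ThetaCot θ) : ζ.1.NeBot := by
  obtain ⟨_, c, a, ha, rfl⟩ := ζ
  exact cot_germ_neBot ha

theorem exists_germ (ζ : ThetaCot θ) :
    ∃ c : ThetaChart θ, ∃ a ∈ (thetaAtlas θ c).dom, ζ.1 = (thetaAtlas θ c).germ a := ζ.2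

theorem tendsto_proj_germ {c : ThetaChart θ} {a : V d × V d} (ha : a ∈ (thetaAtlas θ c).dom) :
    Tendsto (fun q : Cot d X => q.proj) ((thetaAtlas θ c).germ a) (𝓝 (c.pt a.1)) := by
  have h1 : Tendsto (fun b : V d × V d => c.pt b.1) (𝓝[(thetaAtlas θ c).inner] a)
      (𝓝 (c.pt a.1)) := by
    have h2 := (continuousOn_pt (c := c)) a.1 ha
    refine h2.tendsto.comp (tendsto_nhdsWithin_iff.2 ⟨continuous_fst.continuousWithinAt, ?_⟩)
    filter_upwards [self_mem_nhdsWithin] with b hb using hb.1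
  exact tendsto_map'_iff.2 h1

theorem isOver_of_germ {ζ : ThetaCot θ} {c : ThetaChart θ} {a : V d × V d}
    (ha : a ∈ (thetaAtlas θ c).dom) (h : ζ.1 = (thetaAtlas θ c).germ a) :
    ζ.IsOver (c.pt a.1) := by
  unfold IsOver
  rw [h]
  exact tendsto_proj_germ ha

variable [T2Space X]

theorem isOver_unique {ζ : ThetaCot θ} {p q : X} (hp : ζ.IsOver p) (hq : ζ.IsOver q) : p = q :=
  have := ζ.neBot
  tendsto_nhds_unique hp hq

theorem overInterior_iff {ζ : ThetaCot θ} {c : ThetaChart θ} {a : V d × V d}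
    (ha : a ∈ (thetaAtlas θ c).dom) (h : ζ.1 = (thetaAtlas θ c).germ a) :
    ζ.OverInterior ↔ 0 < a.1 0 := by
  rw [← pt_mem_interior_iff (show a.1 ∈ c.target from ha)]
  constructor
  · rintro ⟨p, hp, hζ⟩
    rwa [isOver_unique (isOver_of_germ ha h) hζ]
  · intro hp
    exact ⟨_, hp, isOver_of_germ ha h⟩

theorem overBoundary_iff {ζ : ThetaCot θ} {c : ThetaChart θ} {a : V d × V d}
    (ha : a ∈ (thetaAtlas θ c).dom) (h : ζ.1 = (thetaAtlas θ c).germ a) :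
    ζ.OverBoundary ↔ a.1 0 = 0 := by
  rw [← pt_mem_boundary_iff (show a.1 ∈ c.target from ha)]
  constructor
  · rintro ⟨p, hp, hζ⟩
    rwa [isOver_unique (isOver_of_germ ha h) hζ]
  · intro hp
    exact ⟨_, hp, isOver_of_germ ha h⟩

theorem overInterior_or_overBoundary (ζ : ThetaCot θ) : ζ.OverInterior ∨ ζ.OverBoundary := by
  obtain ⟨c, a, ha, h⟩ := ζ.exists_germ
  rw [overInterior_iff ha h, overBoundary_iff ha h]
  exact (nonneg (show a.1 ∈ c.target from ha)).lt_or_eq.imp id Eq.symm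

theorem not_overBoundary_of_overInterior {ζ : ThetaCot θ} (h : ζ.OverInterior) :
    ¬ ζ.OverBoundary := by
  obtain ⟨c, a, ha, h1⟩ := ζ.exists_germ
  rw [overInterior_iff ha h1] at h
  rw [overBoundary_iff ha h1]
  exact h.ne'

theorem exists_germ_of_isOver {ζ : ThetaCot θ} {c : ThetaChart θ} {x : V d} (hx : x ∈ c.target)
    (h : ζ.IsOver (c.pt x)) : ∃ v, ζ.1 = (thetaAtlas θ c).germ (x, v) := by
  obtain ⟨c', a, ha, h1⟩ := ζ.exists_germ
  have h2 := isOver_unique (isOver_of_germ ha h1) h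
  obtain ⟨h3, h4⟩ := change_eq_of_pt_eq (show a.1 ∈ c'.target from ha) hx h2
  obtain ⟨M, -, hM⟩ := exists_transition h3
  have h5 := (hM.self_of_nhdsWithin (target_subset h3.1)).2.1 a.2
  rw [h4] at h5
  exact ⟨_, h1.trans h5⟩

/-- Neighbourhoods in a chart are closed under filters which meet a suitable set. -/
theorem exists_mem_germ_of_mesh {c : ThetaChart θ} {a : V d × V d}
    (ha : a ∈ (thetaAtlas θ c).dom) {W : Set (V d × V d)} (hW : W ∈ 𝓝[(thetaAtlas θ c).dom] a) :
    ∃ u ∈ (thetaAtlas θ c).germ a, ∀ ζ : ThetaCot θ, (𝓟 u ⊓ ζ.1).NeBot →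
      ∃ b ∈ W ∩ (thetaAtlas θ c).dom, ζ.1 = (thetaAtlas θ c).germ b := by
  have hW2 : W ∩ (thetaAtlas θ c).dom ∈ 𝓝[{b : V d × V d | 0 ≤ b.1 0}] a := by
    rw [← nhdsWithin_dom ha]
    exact inter_mem hW self_mem_nhdsWithin
  -- A compact half ball inside `W`: it is closed, and so is its image in the Hausdorff space X, so
  -- a point whose filter meets it can leave neither the chart nor `W`.
  obtain ⟨r, hr, hrW⟩ := (nhdsWithin_hasBasis Metric.nhds_basis_closedBall _).mem_iff.1 hW2
  set K := Metric.closedBall a r ∩ {b : V d × V d | 0 ≤ b.1 0}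
  have hcl : IsClosed {b : V d × V d | 0 ≤ b.1 0} :=
    isClosed_le continuous_const ((rho d).continuous.comp continuous_fst)
  have hK : IsCompact K := (isCompact_closedBall a r).inter_right hcl
  have hKi : (thetaAtlas θ c).inner ∩ K ∈ 𝓝[(thetaAtlas θ c).inner] a := by
    refine inter_mem self_mem_nhdsWithin ?_
    refine inter_mem (mem_nhdsWithin_of_mem_nhds (Metric.closedBall_mem_nhds a hr)) ?_
    filter_upwards [self_mem_nhdsWithin] with b hb using hb.2.le
  refine ⟨(thetaAtlas θ c).toFun '' ((thetaAtlas θ c).inner ∩ K), image_mem_map hKi, ?_⟩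
  intro ζ hζ
  obtain ⟨c', b', hb', h1⟩ := ζ.exists_germ
  have h2 := isOver_of_germ hb' h1
  have hKp : IsCompact ((fun b : V d × V d => c.pt b.1) '' K) := by
    refine hK.image_of_continuousOn ?_
    exact continuousOn_pt.comp continuous_fst.continuousOn fun b hb => (hrW hb).2
  have h3 : c'.pt b'.1 ∈ (fun b : V d × V d => c.pt b.1) '' K := by
    rw [← hKp.isClosed.closure_eq, mem_closure_iff_nhds_ne_bot]
    have h4 : Tendsto (fun q : Cot d X => q.proj)
        (𝓟 ((thetaAtlas θ c).toFun '' ((thetaAtlas θ c).inner ∩ K)) ⊓ ζ.1)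
        (𝓝 (c'.pt b'.1) ⊓ 𝓟 ((fun b : V d × V d => c.pt b.1) '' K)) := by
      refine tendsto_inf.2 ⟨h2.mono_left inf_le_right, Tendsto.mono_left ?_ inf_le_left⟩
      rw [tendsto_principal_principal]
      rintro _ ⟨b, hb, rfl⟩
      exact ⟨b, hb.2, rfl⟩
    exact h4.neBot.ne
  obtain ⟨k, hk, hkp⟩ := h3
  obtain ⟨v, hv⟩ := exists_germ_of_isOver (hrW hk).2 (by simpa only [hkp] using h2)
  have h5 : ((k.1, v) : V d × V d) ∈ (thetaAtlas θ c).dom := (hrW hk).2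
  rw [hv, ← map_principal] at hζ
  have h6 := neBot_inf_of_map_injOn (l := 𝓟 ((thetaAtlas θ c).inner ∩ K))
    (l' := 𝓝[(thetaAtlas θ c).inner] (k.1, v)) (mem_principal.2 inter_subset_left)
    self_mem_nhdsWithin cot_injOn hζ
  have h7 : ((k.1, v) : V d × V d) ∈ K := by
    rw [← hK.isClosed.closure_eq, mem_closure_iff_nhds_ne_bot, inf_comm]
    exact (h6.mono (inf_le_inf (principal_mono.2 inter_subset_right) nhdsWithin_le_nhds)).ne
  exact ⟨_, hrW h7, hv⟩

/-- Every neighbourhood of the coordinates `a` of the first point contains coordinates of the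
second. Those coordinates are a unique `b`; were `b` different from `a`, the neighbourhood `{b}ᶜ`
would contain none. -/
theorem eq_of_inf_neBot {ζ ζ' : ThetaCot θ} (h : (ζ.1 ⊓ ζ'.1).NeBot) : ζ = ζ' := by
  obtain ⟨c, a, ha, h1⟩ := ζ.exists_germ
  have key : ∀ W ∈ 𝓝[(thetaAtlas θ c).dom] a,
      ∃ b ∈ W ∩ (thetaAtlas θ c).dom, ζ'.1 = (thetaAtlas θ c).germ b := by
    intro W hW
    obtain ⟨u, hu, h2⟩ := exists_mem_germ_of_mesh ha hW
    exact h2 ζ' (h.mono (inf_le_inf_right _ (le_principal_iff.2 (h1 ▸ hu))))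
  obtain ⟨b, hb, h2⟩ := key univ univ_mem
  by_cases hab : a = b
  · exact Subtype.ext (by rw [h1, h2, hab])
  · obtain ⟨b', hb', h3⟩ := key {b}ᶜ
      (mem_nhdsWithin_of_mem_nhds (isOpen_compl_singleton.mem_nhds hab))
    exact (hb'.1 (BChart.eq_of_germ_le cot_injOn (dom_subset_closure hb'.2)
      (h3.symm.trans h2).le)).elim

theorem eq_of_germ_eq {c : ThetaChart θ} {a b : V d × V d} (ha : a ∈ (thetaAtlas θ c).dom)
    (h : (thetaAtlas θ c).germ a = (thetaAtlas θ c).germ b) : a = b :=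
  BChart.eq_of_germ_le cot_injOn (dom_subset_closure ha) h.le

theorem eventually_exists_germ {ζ : ThetaCot θ} {c : ThetaChart θ} {a : V d × V d}
    (ha : a ∈ (thetaAtlas θ c).dom) (h : ζ.1 = (thetaAtlas θ c).germ a)
    {W : Set (V d × V d)} (hW : W ∈ 𝓝[(thetaAtlas θ c).dom] a) :
    ∀ᶠ ζ' in 𝓝 ζ, ∃ b ∈ W ∩ (thetaAtlas θ c).dom, ζ'.1 = (thetaAtlas θ c).germ b := by
  obtain ⟨u, hu, h2⟩ := exists_mem_germ_of_mesh ha hW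
  filter_upwards [BSpace.eventually_mem (h ▸ hu : u ∈ ζ.1)] with ζ' hζ'
  have := ζ'.neBot
  exact h2 ζ' (by rwa [inf_eq_right.2 (le_principal_iff.2 hζ')])

/-- A form of regularity of the topology: meeting `u'` is enough to contain `u`. It yields
continuity of maps into ᶿT*X that are characterized only by an inclusion of filters. -/
theorem exists_mem_of_mesh {ζ : ThetaCot θ} {u : Set (Cot d X)} (hu : u ∈ ζ.1) :
    ∃ u' ∈ ζ.1, ∀ ζ' : ThetaCot θ, (𝓟 u' ⊓ ζ'.1).NeBot → u ∈ ζ'.1 := by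
  obtain ⟨c, a, ha, h1⟩ := ζ.exists_germ
  rw [h1] at hu ⊢
  obtain ⟨u', hu', h2⟩ := exists_mem_germ_of_mesh ha
    (mem_nhdsWithin_of_mem_nhds (BChart.eventually_mem_germ hu))
  refine ⟨u', hu', fun ζ' hζ' => ?_⟩
  obtain ⟨b, hb, h3⟩ := h2 ζ' hζ'
  rw [h3]
  exact hb.1

/-- The smooth change of coordinates near a point. -/
theorem exists_chart_change {c c' : ThetaChart θ} {a a' : V d × V d}
    (ha : a ∈ (thetaAtlas θ c).dom) (ha' : a' ∈ (thetaAtlas θ c').dom)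
    (h : (thetaAtlas θ c).germ a = (thetaAtlas θ c').germ a') :
    ∃ K : V d × V d → V d × V d, K a = a' ∧ ContDiffWithinAt ℝ ∞ K (thetaAtlas θ c).dom a ∧
      ∀ᶠ b in 𝓝[(thetaAtlas θ c).dom] a, b.1 ∈ c.overlap c' ∧ K b ∈ (thetaAtlas θ c').dom ∧
        (K b).1 = c.change c' b.1 ∧ (thetaAtlas θ c).germ b = (thetaAtlas θ c').germ (K b) ∧
        (b.2 = 0 → (K b).2 = 0) ∧
        (0 < b.1 0 →
          (c'.coform (K b).1 (K b).2).comp (dchange c c' b.1) = c.coform b.1 b.2) := by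
  have h1 : c.pt a.1 = c'.pt a'.1 := by
    have h2 := isOver_of_germ (ζ := BSpace.mk c a ha) ha rfl
    have h3 := isOver_of_germ (ζ := BSpace.mk c a ha) ha' h
    exact isOver_unique h2 h3
  obtain ⟨h2, h3⟩ := change_eq_of_pt_eq (show a.1 ∈ c.target from ha)
    (show a'.1 ∈ c'.target from ha') h1
  obtain ⟨M, hM, h4⟩ := exists_transition h2
  have hfst : MapsTo Prod.fst (thetaAtlas θ c).dom (HS d) := fun b hb => target_subset hb
  have hfst' : Tendsto Prod.fst (𝓝[(thetaAtlas θ c).dom] a) (𝓝[HS d] a.1) :=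
    continuous_fst.continuousWithinAt.tendsto_nhdsWithin hfst
  refine ⟨fun b => (c.change c' b.1, M b.1 b.2), ?_, ?_, ?_⟩
  · have h5 := (h4.self_of_nhdsWithin (target_subset h2.1)).2.1 a.2
    exact (eq_of_germ_eq ha' (h.symm.trans h5)).symm
  · have h5 : ContDiffWithinAt ℝ ∞ (fun b : V d × V d => c.change c' b.1)
        (thetaAtlas θ c).dom a :=
      (contDiffWithinAt_change h2).comp a contDiffWithinAt_fst hfst
    have h6 : ContDiffWithinAt ℝ ∞ (fun b : V d × V d => M b.1) (thetaAtlas θ c).dom a :=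
      hM.comp a contDiffWithinAt_fst hfst
    exact h5.prodMk (h6.clm_apply contDiffWithinAt_snd)
  · filter_upwards [hfst'.eventually h4] with b hb
    exact ⟨hb.1, change_mem_target hb.1, rfl, hb.2.1 b.2, fun h0 => by simp [h0],
      fun h0 => hb.2.2 h0 b.2⟩

theorem isZero_iff {ζ : ThetaCot θ} {c : ThetaChart θ} {a : V d × V d}
    (ha : a ∈ (thetaAtlas θ c).dom) (h : ζ.1 = (thetaAtlas θ c).germ a) :
    ζ.IsZero ↔ a.2 = 0 := by
  constructor
  · rintro ⟨c', x, hx, h1⟩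
    obtain ⟨K, hK, -, hK2⟩ := exists_chart_change (c := c') (a := (x, 0)) hx ha (h1.symm.trans h)
    have h2 := (hK2.self_of_nhdsWithin hx).2.2.2.2.1 rfl
    rwa [hK] at h2
  · intro h0
    exact ⟨c, a.1, ha, by rw [h, ← h0]⟩

theorem mem_domain_iff {ζ : ThetaCot θ} {c : ThetaChart θ} {a : V d × V d}
    (ha : a ∈ (thetaAtlas θ c).dom) (h : ζ.1 = (thetaAtlas θ c).germ a) (z : Bool) :
    ζ ∈ domain θ z ↔ z = true ∨ a.2 ≠ 0 := by
  rw [ne_eq, ← isZero_iff ha h]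
  rfl

theorem eventually_mem_domain {ζ : ThetaCot θ} {c : ThetaChart θ} {a : V d × V d}
    (ha : a ∈ (thetaAtlas θ c).dom) (h : ζ.1 = (thetaAtlas θ c).germ a) {z : Bool}
    (hζ : ζ ∈ domain θ z) : ∀ᶠ b in 𝓝[(thetaAtlas θ c).dom] a,
      b ∈ (thetaAtlas θ c).dom ∧
        ∀ ζ' : ThetaCot θ, ζ'.1 = (thetaAtlas θ c).germ b → ζ' ∈ domain θ z := by
  have h1 : ∀ᶠ b : V d × V d in 𝓝[(thetaAtlas θ c).dom] a, z = true ∨ b.2 ≠ 0 := by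
    rcases (mem_domain_iff ha h z).1 hζ with h2 | h2
    · exact Eventually.of_forall fun _ => Or.inl h2
    · have : ∀ᶠ b : V d × V d in 𝓝 a, b.2 ≠ 0 := continuous_snd.continuousAt.eventually_ne h2
      exact (this.filter_mono nhdsWithin_le_nhds).mono fun b hb => Or.inr hb
  filter_upwards [h1, self_mem_nhdsWithin] with b hb hbd
  exact ⟨hbd, fun ζ' hζ' => (mem_domain_iff hbd hζ' z).2 hb⟩

end ThetaCot

/-! ### Coordinate expressions of maps, and invariance of the canonical form in all charts -/

section LocalRep

variable [T2Space X] {κ E' S' : Type*} [NormedAddCommGroup E'] [NormedSpace ℝ E']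
  {B : κ → BChart E' S'}

theorem IsLocalRep.continuousAt {f : ThetaCot θ → BSpace B} {c : ThetaChart θ} {j : κ}
    {a : V d × V d} {G : V d × V d → E'} (h : IsLocalRep (thetaAtlas θ) B f c j a G)
    {ζ : ThetaCot θ} (hζ : ζ.1 = (thetaAtlas θ c).germ a) : ContinuousAt f ζ := by
  have ha := h.mem
  have h0 := (h.rep.self_of_nhdsWithin ha).2 ζ hζ
  rw [ContinuousAt, BSpace.tendsto_nhds_iff]
  intro s hs
  rw [h0] at hs
  have h1 : ∀ᶠ b in 𝓝[(thetaAtlas θ c).dom] a, s ∈ (B j).germ (G b) :=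
    h.smooth.continuousWithinAt.tendsto.eventually (BChart.eventually_mem_germ hs)
  filter_upwards [ThetaCot.eventually_exists_germ ha hζ (h1.and h.rep)] with ζ' hζ'
  obtain ⟨b, hb, h2⟩ := hζ'
  rw [hb.1.2.2 ζ' h2]
  exact hb.1.1

/-- Smooth maps have smooth coordinate expressions in all charts. -/
theorem SmoothAt.exists_isLocalRep {f : ThetaCot θ → ThetaCot θ} {ζ : ThetaCot θ}
    (h : SmoothAt (thetaAtlas θ) (thetaAtlas θ) f ζ) {c c' : ThetaChart θ} {a a' : V d × V d}
    (ha : a ∈ (thetaAtlas θ c).dom) (hζ : ζ.1 = (thetaAtlas θ c).germ a)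
    (ha' : a' ∈ (thetaAtlas θ c').dom) (hf : (f ζ).1 = (thetaAtlas θ c').germ a') :
    ∃ G, G a = a' ∧ IsLocalRep (thetaAtlas θ) (thetaAtlas θ) f c c' a G := by
  obtain ⟨i, j, a₀, G₀, h1, h2⟩ := h
  have h3 := h2.rep.self_of_nhdsWithin h2.mem
  obtain ⟨K, hKa, hKs, hK⟩ := ThetaCot.exists_chart_change ha h2.mem (hζ.symm.trans h1)
  obtain ⟨L, hLa, hLs, hL⟩ := ThetaCot.exists_chart_change h3.1 ha' ((h3.2 ζ h1).symm.trans hf)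
  have hKt : Tendsto K (𝓝[(thetaAtlas θ c).dom] a) (𝓝[(thetaAtlas θ i).dom] a₀) := by
    rw [← hKa]
    exact tendsto_nhdsWithin_iff.2 ⟨hKs.continuousWithinAt, hK.mono fun b hb => hb.2.1⟩
  have hGt : Tendsto G₀ (𝓝[(thetaAtlas θ i).dom] a₀) (𝓝[(thetaAtlas θ j).dom] (G₀ a₀)) :=
    tendsto_nhdsWithin_iff.2 ⟨h2.smooth.continuousWithinAt, h2.rep.mono fun b hb => hb.1⟩
  refine ⟨fun b => L (G₀ (K b)), by simp [hKa, hLa], ha, ?_, ?_⟩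
  · have h4 : ContDiffWithinAt ℝ ∞ (fun b => G₀ (K b)) (thetaAtlas θ c).dom a :=
      ContDiffWithinAt.comp_of_eventually (by rw [hKa]; exact h2.smooth) hKs
        (hK.mono fun b hb => hb.2.1)
    refine ContDiffWithinAt.comp_of_eventually (t := (thetaAtlas θ j).dom) ?_ h4 ?_
    · rw [hKa]; exact hLs
    · exact (hKt.eventually h2.rep).mono fun b hb => hb.1
  · filter_upwards [hK, hKt.eventually h2.rep, (hGt.comp hKt).eventually hL] with b hb1 hb2 hb3
    refine ⟨hb3.2.1, fun p hp => ?_⟩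
    rw [hb2.2 p (hp.trans hb1.2.2.2.1)]
    exact hb3.2.2.2.1

theorem dom_mem_nhds {c : ThetaChart θ} {a : V d × V d} (ha : a ∈ (thetaAtlas θ c).dom)
    (h0 : 0 < a.1 0) : (thetaAtlas θ c).dom ∈ 𝓝 a :=
  continuous_fst.continuousAt.preimage_mem_nhds (target_mem_nhds ha h0)

/-- Liftable canonical transformations preserve the canonical 1-form in all charts. -/
theorem IsLiftable.canonical_of_rep {z : Bool} {χ : ThetaCot θ → ThetaCot θ}
    (hχ : IsLiftable z χ) {ζ : ThetaCot θ} (hζ : ζ ∈ ThetaCot.domain θ z) {c c' : ThetaChart θ}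
    {a : V d × V d} (ha : a ∈ (thetaAtlas θ c).dom) (h0 : 0 < a.1 0)
    (hζa : ζ.1 = (thetaAtlas θ c).germ a) {G : V d × V d → V d × V d}
    (hG : ∀ᶠ b in 𝓝 a, G b ∈ (thetaAtlas θ c').dom ∧
      ∀ p : ThetaCot θ, p.1 = (thetaAtlas θ c).germ b → (χ p).1 = (thetaAtlas θ c').germ (G b))
    (h : V d × V d) :
    c'.coform (G a).1 (G a).2 (fderiv ℝ G a h).1 = c.coform a.1 a.2 h.1 := by
  have hint : ζ.OverInterior := (ThetaCot.overInterior_iff ha hζa).2 h0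
  obtain ⟨hχi, c₁, c₁', a₁, H, h1, h2, h3⟩ := hχ.canonical ζ hζ hint
  have h4 := h2.rep.self_of_nhdsWithin h2.mem
  have hGa := hG.self_of_nhds
  have e1 : (χ ζ).1 = (thetaAtlas θ c₁').germ (H a₁) := h4.2 ζ h1
  have e2 : (χ ζ).1 = (thetaAtlas θ c').germ (G a) := hGa.2 ζ hζa
  have p1 : 0 < a₁.1 0 := (ThetaCot.overInterior_iff h2.mem h1).1 hint
  have p2 : 0 < (H a₁).1 0 := (ThetaCot.overInterior_iff h4.1 e1).1 hχi
  obtain ⟨K, hKa, hKs, hK⟩ := ThetaCot.exists_chart_change ha h2.mem (hζa.symm.trans h1)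
  obtain ⟨L, hLa, hLs, hL⟩ := ThetaCot.exists_chart_change h4.1 hGa.1 (e1.symm.trans e2)
  have n0 := dom_mem_nhds ha h0
  have n1 := dom_mem_nhds h2.mem p1
  have n2 := dom_mem_nhds h4.1 p2
  rw [nhdsWithin_eq_nhds.2 n0] at hK
  rw [nhdsWithin_eq_nhds.2 n2] at hL
  have hrep := h2.rep
  rw [nhdsWithin_eq_nhds.2 n1] at hrep
  have hKd := (hKs.contDiffAt n0).differentiableAt (by simp)
  have hHd := (h2.smooth.contDiffAt n1).differentiableAt (by simp)
  have hLd := (hLs.contDiffAt n2).differentiableAt (by simp)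
  have hKt : Tendsto K (𝓝 a) (𝓝 a₁) := by
    have := hKd.continuousAt.tendsto
    rwa [hKa] at this
  have hHt : Tendsto H (𝓝 a₁) (𝓝 (H a₁)) := hHd.continuousAt
  -- the coordinate expressions agree
  have hGeq : G =ᶠ[𝓝 a] fun b => L (H (K b)) := by
    filter_upwards [hG, hK, hKt.eventually hrep, (hHt.comp hKt).eventually hL, n0]
      with b b1 b2 b3 b4 b0
    have e3 := b1.2 (BSpace.mk c b b0) rfl
    have e4 := b3.2 (BSpace.mk c b b0) b2.2.2.2.1
    exact ThetaCot.eq_of_germ_eq b1.1 (e3.symm.trans (e4.trans b4.2.2.2.1))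
  have hKd' : HasFDerivAt K (fderiv ℝ K a) a := hKd.hasFDerivAt
  have hHd' : HasFDerivAt H (fderiv ℝ H a₁) (K a) := by rw [hKa]; exact hHd.hasFDerivAt
  have hLd' : HasFDerivAt L (fderiv ℝ L (H a₁)) (H (K a)) := by rw [hKa]; exact hLd.hasFDerivAt
  have hcomp : fderiv ℝ G a =
      (fderiv ℝ L (H a₁)).comp ((fderiv ℝ H a₁).comp (fderiv ℝ K a)) := by
    rw [hGeq.fderiv_eq]
    exact (hLd'.comp a (hHd'.comp a hKd')).fderiv
  -- A chart change of ᶿT*X covers the change of base coordinates, so the base part of its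
  -- differential is the differential of the latter.
  have base : ∀ {i j : ThetaChart θ} {b : V d × V d} {T : V d × V d → V d × V d},
      b ∈ (thetaAtlas θ i).dom → 0 < b.1 0 → DifferentiableAt ℝ T b →
      (∀ᶠ y in 𝓝 b, y.1 ∈ i.overlap j ∧ (T y).1 = i.change j y.1) → ∀ k,
      (fderiv ℝ T b k).1 = dchange i j b.1 k.1 := by
    intro i j b T hb hb0 hT hTe k
    have hov := hTe.self_of_nhds.1
    have d1 : HasFDerivAt (fun y => (T y).1)
      ((ContinuousLinearMap.fst ℝ (V d) (V d)).comp (fderiv ℝ T b)) b := hT.hasFDerivAt.fst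
    have d2 : HasFDerivAt (fun y : V d × V d => i.change j y.1)
        ((dchange i j b.1).comp (ContinuousLinearMap.fst ℝ (V d) (V d))) b :=
      ((hasFDerivWithinAt_change hov).hasFDerivAt (HS_mem_nhds hb0)).comp b hasFDerivAt_fst
    have d3 := d2.congr_of_eventuallyEq (hTe.mono fun y hy => hy.2)
    exact DFunLike.congr_fun (d1.unique d3) k
  have hK1 := base ha h0 hKd (hK.mono fun y hy => ⟨hy.1, hy.2.2.1⟩) h
  have hL1 := base h4.1 p2 hLd (hL.mono fun y hy => ⟨hy.1, hy.2.2.1⟩)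
    (fderiv ℝ H a₁ (fderiv ℝ K a h))
  have hKc := hK.self_of_nhds.2.2.2.2.2 h0
  have hLc := hL.self_of_nhds.2.2.2.2.2 p2
  rw [hKa] at hKc
  rw [hLa] at hLc
  have h5 := h3 (fderiv ℝ K a h)
  rw [fderivWithin_of_mem_nhds n1] at h5
  rw [hcomp, ContinuousLinearMap.comp_apply, ContinuousLinearMap.comp_apply, hL1,
    ← ContinuousLinearMap.comp_apply (c'.coform (G a).1 (G a).2), hLc, h5, hK1,
    ← ContinuousLinearMap.comp_apply, hKc]

end LocalRep

end ThetaCalc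

end

noncomputable section
namespace ThetaCalc
set_option linter.unusedSectionVars false

/-! ### Projective coordinates of the parabolic blow-up -/

variable {d : ℕ}

theorem hasDerivAt_euclidean' {f : ℝ → V d} {f' : V d} {t : ℝ} :
    HasDerivAt f f' t ↔ ∀ i, HasDerivAt (fun s => f s i) (f' i) t := by
  rw [hasDerivAt_iff_hasFDerivAt, ← hasFDerivWithinAt_univ, hasFDerivWithinAt_euclidean]
  refine forall_congr' fun i => ?_
  rw [hasDerivAt_iff_hasFDerivAt, hasFDerivWithinAt_univ]
  have : (ContinuousLinearMap.toSpanSingleton ℝ (f' i)) =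
      (EuclideanSpace.proj i).comp (ContinuousLinearMap.toSpanSingleton ℝ f') := by
    ext
    simp
  rw [this]

theorem sgn_mul_self (pos : Bool) : sgn pos * sgn pos = 1 := by
  cases pos <;> simp [sgn]

/-- `slot` as a linear functional. -/
def slotL (k : Option (Fin (d + 2))) : V d × V d →L[ℝ] ℝ :=
  match k with
  | none => (EuclideanSpace.proj (𝕜 := ℝ) 0).comp (ContinuousLinearMap.snd ℝ (V d) (V d))
  | some j => (EuclideanSpace.proj (𝕜 := ℝ) j).comp (ContinuousLinearMap.fst ℝ (V d) (V d))

theorem slotL_apply (k : Option (Fin (d + 2))) (a : V d × V d) : slotL k a = slot k a := by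
  cases k <;> rfl

/-- The linear part of `omega`. -/
def omegaL (k : Option (Fin (d + 2))) (i : Fin (d + 2)) : V d × V d →L[ℝ] ℝ :=
  if k = some i then 0
  else (EuclideanSpace.proj (𝕜 := ℝ) i).comp (ContinuousLinearMap.fst ℝ (V d) (V d))

/-- The linear part of `omegaR`. -/
def omegaRL (k : Option (Fin (d + 2))) : V d × V d →L[ℝ] ℝ :=
  match k with
  | none => 0
  | some _ => (EuclideanSpace.proj (𝕜 := ℝ) 0).comp (ContinuousLinearMap.snd ℝ (V d) (V d))

theorem hasFDerivAt_slot (k : Option (Fin (d + 2))) (a : V d × V d) :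
    HasFDerivAt (slot k) (slotL k) a := by
  have : (slot k : V d × V d → ℝ) = slotL k := funext fun a => (slotL_apply k a).symm
  rw [this]
  exact (slotL k).hasFDerivAt

theorem hasFDerivAt_omega (k : Option (Fin (d + 2))) (pos : Bool) (i : Fin (d + 2))
    (a : V d × V d) : HasFDerivAt (fun a => omega k pos a i) (omegaL k i) a := by
  unfold omega omegaL
  split_ifs
  · exact hasFDerivAt_const _ _
  · exact ((EuclideanSpace.proj (𝕜 := ℝ) i).comp
      (ContinuousLinearMap.fst ℝ (V d) (V d))).hasFDerivAt

theorem hasFDerivAt_omegaR (k : Option (Fin (d + 2))) (pos : Bool) (a : V d × V d) :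
    HasFDerivAt (omegaR k pos) (omegaRL k) a := by
  cases k with
  | none => exact hasFDerivAt_const _ _
  | some j => exact ((EuclideanSpace.proj (𝕜 := ℝ) 0).comp
      (ContinuousLinearMap.snd ℝ (V d) (V d))).hasFDerivAt

theorem contDiff_slot (k : Option (Fin (d + 2))) : ContDiff ℝ ∞ (slot k : V d × V d → ℝ) := by
  have : (slot k : V d × V d → ℝ) = slotL k := funext fun a => (slotL_apply k a).symm
  rw [this]
  exact (slotL k).contDiff

theorem contDiff_omega (k : Option (Fin (d + 2))) (pos : Bool) (i : Fin (d + 2)) :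
    ContDiff ℝ ∞ (fun a : V d × V d => omega k pos a i) := by
  unfold omega
  split_ifs
  · exact contDiff_const
  · exact ((EuclideanSpace.proj (𝕜 := ℝ) i).comp
      (ContinuousLinearMap.fst ℝ (V d) (V d))).contDiff

theorem contDiff_omegaR (k : Option (Fin (d + 2))) (pos : Bool) :
    ContDiff ℝ ∞ (omegaR k pos : V d × V d → ℝ) := by
  cases k with
  | none => exact contDiff_const
  | some j => exact ((EuclideanSpace.proj (𝕜 := ℝ) 0).comp
      (ContinuousLinearMap.snd ℝ (V d) (V d))).contDiff

theorem contDiff_frontRight (k : Option (Fin (d + 2))) (pos : Bool) :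
    ContDiff ℝ ∞ (frontRight k pos : V d × V d → V d) := by
  refine contDiff_euclidean.2 fun i => ?_
  by_cases hi : i = 0
  · simp only [frontRight, hi, if_true]
    exact (contDiff_slot k).mul (contDiff_omegaR k pos)
  · simp only [frontRight, hi, if_false]
    exact ((EuclideanSpace.proj (𝕜 := ℝ) i).comp
      (ContinuousLinearMap.snd ℝ (V d) (V d))).contDiff

/-- The quotient of `frontDiff` by the front face defining function. -/
def frontDir (k : Option (Fin (d + 2))) (pos : Bool) (a : V d × V d) : V d :=
  WithLp.toLp 2 (fun i => if i = 0 then omega k pos a 0 - omegaR k pos a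
    else if i = Fin.last (d + 1) then 0 else omega k pos a i)

theorem frontDiff_eq (k : Option (Fin (d + 2))) (pos : Bool) (a : V d × V d) :
    frontDiff k pos a = slot k a • frontDir k pos a := by
  ext i
  simp only [frontDiff, frontDir, PiLp.smul_apply, smul_eq_mul]
  split_ifs <;> simp

theorem contDiff_frontDir (k : Option (Fin (d + 2))) (pos : Bool) :
    ContDiff ℝ ∞ (frontDir k pos : V d × V d → V d) := by
  refine contDiff_euclidean.2 fun i => ?_
  by_cases hi : i = 0
  · simp only [frontDir, hi, if_true]
    exact (contDiff_omega k pos 0).sub (contDiff_omegaR k pos)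
  · by_cases hl : i = Fin.last (d + 1)
    · simp only [frontDir, hl, if_false, if_true, last_ne_zero']
      exact contDiff_const
    · simp only [frontDir, hi, hl, if_false]
      exact contDiff_omega k pos i

section Base

variable {X : Type*} [TopologicalSpace X] [ChartedSpace (EuclideanHalfSpace (d + 2)) X]
  {θ : ∀ p : X, TangentSpace (𝓡∂ (d + 2)) p →L[ℝ] ℝ}

open ThetaChart

/-- As `form (∂_z) ≠ 0`, the components other than the last together with `form` are coordinates on
vectors. Last components of points of the blow-up are always compared through this. -/
theorem eq_of_form_eq {c : ThetaChart θ} {x u v : V d} (hx : x ∈ c.target)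
    (h : ∀ i, i ≠ Fin.last (d + 1) → u i = v i) (hf : c.form x u = c.form x v) : u = v := by
  have h1 : u - v = (u - v) (Fin.last (d + 1)) • ez d := by
    ext i
    by_cases hi : i = Fin.last (d + 1)
    · subst hi; simp
    · simp [h i hi, ez_of_ne hi]
  have h2 : c.form x (u - v) = 0 := by simp [hf]
  rw [h1, map_smul, smul_eq_mul, mul_eq_zero] at h2
  have h3 := h2.resolve_right (c.form_ez x hx)
  rw [h3, zero_smul] at h1
  exact sub_eq_zero.1 h1

variable {c : ThetaChart θ} {k : Option (Fin (d + 2))} {pos : Bool}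

theorem frontRight_zero (a : V d × V d) :
    (frontRight k pos a) 0 = slot k a * omegaR k pos a := by simp [frontRight]

theorem frontRight_of_ne (a : V d × V d) {i : Fin (d + 2)} (hi : i ≠ 0) :
    (frontRight k pos a) i = a.2 i := by simp [frontRight, hi]

/-- The quotient of `frontLeft - frontRight` by the front face defining function. -/
def frontStep (c : ThetaChart θ) (k : Option (Fin (d + 2))) (pos : Bool) (a : V d × V d) : V d :=
  frontDir k pos a + ((slot k a * omega k pos a (Fin.last (d + 1)) -
    c.form (frontRight k pos a) (frontDir k pos a)) /
      c.form (frontRight k pos a) (ez d)) • ez d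

theorem frontLeft_eq (a : V d × V d) :
    frontLeft c k pos a = frontRight k pos a + slot k a • frontStep c k pos a := by
  rw [frontLeft, frontStep, frontDiff_eq, smul_add, smul_smul, add_assoc]
  congr 3
  rw [map_smul, smul_eq_mul]
  ring

theorem frontStep_of_ne (a : V d × V d) {i : Fin (d + 2)} (hi : i ≠ Fin.last (d + 1)) :
    (frontStep c k pos a) i = omega k pos a i - (if i = 0 then omegaR k pos a else 0) := by
  simp only [frontStep, PiLp.add_apply, PiLp.smul_apply, ez_of_ne hi, smul_zero, add_zero]
  by_cases h0 : i = 0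
  · subst h0; simp [frontDir]
  · simp [frontDir, h0, hi]

theorem form_frontStep {a : V d × V d} (h : frontRight k pos a ∈ c.target) :
    c.form (frontRight k pos a) (frontStep c k pos a) =
      slot k a * omega k pos a (Fin.last (d + 1)) := by
  have := c.form_ez _ h
  simp [frontStep, this]

theorem frontLeft_zero (a : V d × V d) :
    (frontLeft c k pos a) 0 = slot k a * omega k pos a 0 := by
  rw [frontLeft_eq, PiLp.add_apply, PiLp.smul_apply, frontRight_zero,
    frontStep_of_ne a zero_ne_last']
  simp
  ring

theorem frontLeft_of_ne (a : V d × V d) {i : Fin (d + 2)} (h0 : i ≠ 0)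
    (hi : i ≠ Fin.last (d + 1)) :
    (frontLeft c k pos a) i = a.2 i + slot k a * omega k pos a i := by
  rw [frontLeft_eq, PiLp.add_apply, PiLp.smul_apply, frontRight_of_ne a h0, frontStep_of_ne a hi]
  simp [h0]

theorem form_frontLeft_sub {a : V d × V d} (h : frontRight k pos a ∈ c.target) :
    c.form (frontRight k pos a) (frontLeft c k pos a - frontRight k pos a) =
      slot k a ^ 2 * omega k pos a (Fin.last (d + 1)) := by
  rw [frontLeft_eq, add_sub_cancel_left, map_smul, form_frontStep h, smul_eq_mul]
  ring

theorem mem_front_dom {a : V d × V d} : a ∈ (MChart.front c k pos).dom ↔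
    0 ≤ slot k a ∧ 0 ≤ omega k pos a 0 ∧ 0 ≤ omegaR k pos a ∧
      frontLeft c k pos a ∈ c.target ∧ frontRight k pos a ∈ c.target := Iff.rfl

theorem contDiffWithinAt_frontStep {a : V d × V d} {D : Set (V d × V d)}
    (hD : ∀ b ∈ D, (0 : ℝ) ≤ slot k b * omegaR k pos b) (h : frontRight k pos a ∈ c.target) :
    ContDiffWithinAt ℝ ∞ (frontStep c k pos) D a := by
  have hm : MapsTo (frontRight k pos) D (HS d) := fun b hb => by
    change 0 ≤ (frontRight k pos b) 0
    rw [frontRight_zero]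
    exact hD b hb
  have h1 : ContDiffWithinAt ℝ ∞ (fun b => c.form (frontRight k pos b)) D a :=
    (contDiffWithinAt_form h).comp a (contDiff_frontRight k pos).contDiffWithinAt hm
  have h2 : ContDiffWithinAt ℝ ∞ (frontDir k pos : V d × V d → V d) D a :=
    (contDiff_frontDir k pos).contDiffWithinAt
  have h3 : ContDiffWithinAt ℝ ∞ (slot k : V d × V d → ℝ) D a :=
    (contDiff_slot k).contDiffWithinAt
  have h4 : ContDiffWithinAt ℝ ∞ (fun b : V d × V d => omega k pos b (Fin.last (d + 1))) D a :=
    (contDiff_omega k pos _).contDiffWithinAt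
  exact h2.add ((((h3.mul h4).sub (h1.clm_apply h2)).div (h1.clm_apply contDiffWithinAt_const)
    (c.form_ez _ h)).smul contDiffWithinAt_const)

theorem contDiffWithinAt_frontLeft {a : V d × V d} {D : Set (V d × V d)}
    (hD : ∀ b ∈ D, (0 : ℝ) ≤ slot k b * omegaR k pos b) (h : frontRight k pos a ∈ c.target) :
    ContDiffWithinAt ℝ ∞ (frontLeft c k pos) D a := by
  have : frontLeft c k pos = fun a => frontRight k pos a + slot k a • frontStep c k pos a :=
    funext fun a => frontLeft_eq a
  rw [this]
  exact (contDiff_frontRight k pos).contDiffWithinAt.add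
    ((contDiff_slot k).contDiffWithinAt.smul (contDiffWithinAt_frontStep hD h))

theorem slot_mul_omegaR_nonneg :
    ∀ b ∈ (MChart.front c k pos).dom, 0 ≤ slot k b * omegaR k pos b :=
  fun _ hb => mul_nonneg hb.1 hb.2.2.1

/-- The left and right points differ by s times the smooth vector `frontStep`, so the averaged
derivative of `form` divides the difference by s at s = 0; elsewhere the division is direct. The
quotient is needed because the coframe at the left point uses `form` there, whereas the weight two
function uses `form` at the right point. -/
theorem exists_form_quotient {a : V d × V d} (ha : a ∈ (MChart.front c k pos).dom) :
    ∃ Q : V d × V d → V d →L[ℝ] ℝ, ContDiffWithinAt ℝ ∞ Q (MChart.front c k pos).dom a ∧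
      ∀ᶠ b in 𝓝[(MChart.front c k pos).dom] a,
        c.form (frontLeft c k pos b) - c.form (frontRight k pos b) = slot k b • Q b := by
  obtain ⟨-, -, -, hl, hr⟩ := id ha
  set D := (MChart.front c k pos).dom
  have hL := contDiffWithinAt_frontLeft (slot_mul_omegaR_nonneg (c := c)) hr
  have hR : ContDiffWithinAt ℝ ∞ (frontRight k pos) D a :=
    (contDiff_frontRight k pos).contDiffWithinAt
  have hmL : MapsTo (frontLeft c k pos) D (HS d) := fun b hb => target_subset hb.2.2.2.1
  have hmR : MapsTo (frontRight k pos) D (HS d) := fun b hb => target_subset hb.2.2.2.2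
  by_cases hs : slot k a = 0
  · have he : frontLeft c k pos a = frontRight k pos a := by
      rw [frontLeft_eq, hs, zero_smul, add_zero]
    obtain ⟨h1, h2⟩ := exists_avgDeriv convex_HS uniqueDiffOn_HS (target_subset hr)
      (contDiffWithinAt_form hr)
    have hp : MapsTo (fun b => (frontLeft c k pos b, frontRight k pos b)) D (HS d ×ˢ HS d) :=
      fun b hb => ⟨hmL hb, hmR hb⟩
    have hpa : (frontLeft c k pos a, frontRight k pos a) =
      (frontRight k pos a, frontRight k pos a) := by rw [he]
    refine ⟨fun b => avgDeriv c.form (HS d) (frontLeft c k pos b, frontRight k pos b)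
      (frontStep c k pos b), ?_, ?_⟩
    · have h3 : ContDiffWithinAt ℝ ∞ (fun b => avgDeriv c.form (HS d)
          (frontLeft c k pos b, frontRight k pos b)) D a :=
        ContDiffWithinAt.comp (g := avgDeriv c.form (HS d)) a (by rwa [hpa]) (hL.prodMk hR) hp
      exact h3.clm_apply (contDiffWithinAt_frontStep (slot_mul_omegaR_nonneg (c := c)) hr)
    · have h3 : Tendsto (fun b => (frontLeft c k pos b, frontRight k pos b)) (𝓝[D] a)
          (𝓝[HS d ×ˢ HS d] (frontRight k pos a, frontRight k pos a)) := by
        rw [← hpa]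
        exact (hL.prodMk hR).continuousWithinAt.tendsto_nhdsWithin hp
      filter_upwards [h3.eventually h2] with b hb
      rw [hb]
      simp only [frontLeft_eq b, add_sub_cancel_left, map_smul]
  · refine ⟨fun b => (slot k b)⁻¹ •
      (c.form (frontLeft c k pos b) - c.form (frontRight k pos b)), ?_, ?_⟩
    · exact (ContDiffWithinAt.inv (contDiff_slot k).contDiffWithinAt hs).smul
        (((contDiffWithinAt_form hl).comp a hL hmL).sub
          ((contDiffWithinAt_form hr).comp a hR hmR))
    · have : ∀ᶠ b in 𝓝 a, slot k b ≠ 0 :=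
        (contDiff_slot k).continuous.continuousAt.eventually_ne hs
      filter_upwards [this.filter_mono nhdsWithin_le_nhds] with b hb
      rw [smul_inv_smul₀ hb]

/-- The vector `b` with `slot`, `omega` and `omegaR` components determined by the derivatives
`e` of the rescaled functions along a vector field. -/
def liftVec (k : Option (Fin (d + 2))) (pos : Bool) (a : V d × V d) (e : Fin (d + 2) → ℝ) :
    V d × V d :=
  -- `q` is to be the logarithmic derivative of s. The functions s ω_i, and s² ω_i for the last
  -- index, must have derivatives s e_i and s² e_i. For the dominating index ω_i = ±1 is constant,
  -- so its derivative goes into s; the factor 1/2 comes from s². With `none` one has s = ± ρ',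
  -- which is kept fixed, so `q = 0`.
  let q : ℝ := match k with
    | none => 0
    | some i => sgn pos * if i = Fin.last (d + 1) then e i / 2 else e i
  (WithLp.toLp 2 fun i => if k = some i then slot k a * q
      else if i = Fin.last (d + 1) then e i - 2 * q * omega k pos a i else e i - q * omega k pos a i,
    WithLp.toLp 2 fun i => if i = 0 then (if k = none then 0 else -(q * omegaR k pos a)) else 0)

/-- The logarithmic derivative of `slot` along `liftVec`. -/
def liftQ (k : Option (Fin (d + 2))) (pos : Bool) (e : Fin (d + 2) → ℝ) : ℝ :=
  match k with
    | none => 0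
    | some i => sgn pos * if i = Fin.last (d + 1) then e i / 2 else e i

theorem slotL_liftVec (a : V d × V d) (e : Fin (d + 2) → ℝ) :
    slotL k (liftVec k pos a e) = slot k a * liftQ k pos e := by
  cases k <;> simp [slotL_apply, slot, liftVec, liftQ]

theorem omegaL_liftVec (a : V d × V d) (e : Fin (d + 2) → ℝ) (i : Fin (d + 2)) :
    omegaL k i (liftVec k pos a e) = e i -
      (if i = Fin.last (d + 1) then 2 else 1) * liftQ k pos e * omega k pos a i := by
  have h1 := sgn_mul_self pos
  unfold omegaL
  by_cases h : k = some i
  · subst h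
    by_cases hi : i = Fin.last (d + 1) <;> simp [liftQ, omega, hi]
    · linear_combination (e (Fin.last (d + 1))) * h1
    · linear_combination (e i) * h1
  · rw [if_neg h]
    change (liftVec k pos a e).1 i = _
    cases k with
    | none => by_cases hi : i = Fin.last (d + 1) <;> simp [liftVec, liftQ, hi]
    | some j =>
      have hji : ¬ j = i := fun h2 => h (by rw [h2])
      by_cases hi : i = Fin.last (d + 1)
      · subst hi; simp [liftVec, liftQ, hji]
      · simp [liftVec, liftQ, hi, hji]

theorem omegaRL_liftVec (a : V d × V d) (e : Fin (d + 2) → ℝ) :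
    omegaRL k (liftVec k pos a e) = - (liftQ k pos e * omegaR k pos a) := by
  cases k <;> simp [omegaRL, liftVec, liftQ]

theorem liftVec_snd (a : V d × V d) (e : Fin (d + 2) → ℝ) {i : Fin (d + 2)} (hi : i ≠ 0) :
    (liftVec k pos a e).2 i = 0 := by simp [liftVec, hi]

theorem contDiffWithinAt_liftVec {D : Set (V d × V d)} {a : V d × V d}
    {e : V d × V d → Fin (d + 2) → ℝ} (he : ∀ i, ContDiffWithinAt ℝ ∞ (fun b => e b i) D a) :
    ContDiffWithinAt ℝ ∞ (fun b => liftVec k pos b (e b)) D a := by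
  have hq : ContDiffWithinAt ℝ ∞ (fun b => liftQ k pos (e b)) D a := by
    cases k with
    | none => exact contDiffWithinAt_const
    | some i =>
      unfold liftQ
      refine contDiffWithinAt_const.mul ?_
      split_ifs
      · exact (he i).div_const 2
      · exact he i
  refine ContDiffWithinAt.prodMk ?_ ?_
  · refine contDiffWithinAt_euclidean.2 fun i => ?_
    change ContDiffWithinAt ℝ ∞ (fun b => if k = some i then slot k b * liftQ k pos (e b)
      else if i = Fin.last (d + 1) then e b i - 2 * liftQ k pos (e b) * omega k pos b i
      else e b i - liftQ k pos (e b) * omega k pos b i) D a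
    have ho : ContDiffWithinAt ℝ ∞ (fun b : V d × V d => omega k pos b i) D a :=
      (contDiff_omega k pos i).contDiffWithinAt
    split_ifs
    · exact (contDiff_slot k).contDiffWithinAt.mul hq
    · exact (he i).sub ((contDiffWithinAt_const.mul hq).mul ho)
    · exact (he i).sub (hq.mul ho)
  · refine contDiffWithinAt_euclidean.2 fun i => ?_
    change ContDiffWithinAt ℝ ∞ (fun b => if i = 0 then (if k = none then 0 else
      -(liftQ k pos (e b) * omegaR k pos b)) else 0) D a
    split_ifs
    · exact contDiffWithinAt_const
    · exact (hq.mul (contDiff_omegaR k pos).contDiffWithinAt).neg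
    · exact contDiffWithinAt_const

/-- The derivative of the blow-down map along a lifted vector. -/
theorem hasDerivAt_frontRight (a : V d × V d) (e : Fin (d + 2) → ℝ) :
    HasDerivAt (fun t : ℝ => frontRight k pos (a + t • liftVec k pos a e)) 0 0 := by
  set u := liftVec k pos a e with hu
  have hγ : HasDerivAt (fun t : ℝ => a + t • u) u 0 := by
    have := ((hasDerivAt_id (0 : ℝ)).smul_const u).const_add a
    rwa [one_smul] at this
  have hγ0 : a + (0 : ℝ) • u = a := by simp
  have hs : HasDerivAt (fun t : ℝ => slot k (a + t • u)) (slot k a * liftQ k pos e) 0 := by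
    have := (hasFDerivAt_slot k (a + (0 : ℝ) • u)).comp_hasDerivAt 0 hγ
    rwa [hu, slotL_liftVec] at this
  have hR : HasDerivAt (fun t : ℝ => omegaR k pos (a + t • u)) (-(liftQ k pos e * omegaR k pos a))
      0 := by
    have := (hasFDerivAt_omegaR k pos (a + (0 : ℝ) • u)).comp_hasDerivAt 0 hγ
    rwa [hu, omegaRL_liftVec] at this
  refine hasDerivAt_euclidean'.2 fun i => ?_
  by_cases hi : i = 0
  · subst hi
    simp only [frontRight_zero]
    have := hs.fun_mul hR
    rw [hγ0] at this
    convert! this using 1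
    rw [PiLp.zero_apply]
    ring
  · simp only [frontRight_of_ne _ hi]
    have : (fun t : ℝ => (a + t • u).2 i) = fun _ => a.2 i := by
      funext t
      simp [hu, liftVec_snd a e hi]
    rw [this]
    exact hasDerivAt_const _ _

/-- Along the line through `a` in the lifted direction the right point is stationary to first order,
and so is `form` there. Only the weighted functions move, at the prescribed rates, and these rates
determine the displacement `y` of the left point by `eq_of_form_eq`. -/
theorem fderiv_blowdown_liftVec {a : V d × V d} (e : Fin (d + 2) → ℝ)
    (hr : frontRight k pos a ∈ c.target) (hr0 : 0 < (frontRight k pos a) 0)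
    (hd : DifferentiableAt ℝ (MChart.front c k pos).blowdown a) {y : V d}
    (hy : ∀ i, i ≠ Fin.last (d + 1) → y i = slot k a * e i)
    (hyl : c.form (frontRight k pos a) y = slot k a ^ 2 * e (Fin.last (d + 1))) :
    fderiv ℝ (MChart.front c k pos).blowdown a (liftVec k pos a e) = (y, 0) := by
  set u := liftVec k pos a e with hu
  have hγ : HasDerivAt (fun t : ℝ => a + t • u) u 0 := by
    have := ((hasDerivAt_id (0 : ℝ)).smul_const u).const_add a
    rwa [one_smul] at this
  have hγ0 : a + (0 : ℝ) • u = a := by simp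
  have hs : HasDerivAt (fun t : ℝ => slot k (a + t • u)) (slot k a * liftQ k pos e) 0 := by
    have := (hasFDerivAt_slot k (a + (0 : ℝ) • u)).comp_hasDerivAt 0 hγ
    rwa [hu, slotL_liftVec] at this
  have ho : ∀ i, HasDerivAt (fun t : ℝ => omega k pos (a + t • u) i) (e i -
      (if i = Fin.last (d + 1) then 2 else 1) * liftQ k pos e * omega k pos a i) 0 := fun i => by
    have := (hasFDerivAt_omega k pos i (a + (0 : ℝ) • u)).comp_hasDerivAt 0 hγ
    rwa [hu, omegaL_liftVec] at this
  have hR : HasDerivAt (fun t : ℝ => omegaR k pos (a + t • u)) (-(liftQ k pos e * omegaR k pos a))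
      0 := by
    have := (hasFDerivAt_omegaR k pos (a + (0 : ℝ) • u)).comp_hasDerivAt 0 hγ
    rwa [hu, omegaRL_liftVec] at this
  have hright := hasDerivAt_frontRight (k := k) (pos := pos) a e
  rw [← hu] at hright
  have hform : HasDerivAt (fun t : ℝ => c.form (frontRight k pos (a + t • u))) 0 0 := by
    have h1 : HasFDerivAt c.form (fderiv ℝ c.form (frontRight k pos a))
        (frontRight k pos (a + (0 : ℝ) • u)) := by
      rw [hγ0]
      exact ((contDiffAt_form hr hr0).differentiableAt (by simp)).hasFDerivAt
    have := h1.comp_hasDerivAt (0 : ℝ) hright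
    rwa [map_zero] at this
  let y' : V d := WithLp.toLp 2 fun i => if i = Fin.last (d + 1) then 0 else slot k a * e i
  have hdiff : HasDerivAt (fun t : ℝ => frontDiff k pos (a + t • u)) y' 0 := by
    refine hasDerivAt_euclidean'.2 fun i => ?_
    by_cases hi : i = 0
    · subst hi
      have := hs.fun_mul ((ho 0).fun_sub hR)
      rw [hγ0] at this
      simp only [frontDiff, if_true]
      convert! this using 1
      simp [y']
      ring
    · by_cases hl : i = Fin.last (d + 1)
      · subst hl
        simp only [frontDiff, last_ne_zero', if_false, if_true, y']
        exact hasDerivAt_const _ _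
      · have := hs.fun_mul (ho i)
        rw [hγ0] at this
        simp only [frontDiff, hi, hl, if_false]
        convert! this using 1
        simp [y', hl]
        ring
  have hquad : HasDerivAt (fun t : ℝ => slot k (a + t • u) ^ 2 *
      omega k pos (a + t • u) (Fin.last (d + 1))) (slot k a ^ 2 * e (Fin.last (d + 1))) 0 := by
    have := (hs.fun_pow 2).fun_mul (ho (Fin.last (d + 1)))
    rw [hγ0] at this
    convert! this using 1
    simp
    ring
  have hz : c.form (frontRight k pos (a + (0 : ℝ) • u)) (ez d) ≠ 0 := by
    rw [hγ0]; exact c.form_ez _ hr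
  have hleft := (hright.add hdiff).add (((hquad.sub (hform.clm_apply hdiff)).div
    (hform.clm_apply (hasDerivAt_const (0 : ℝ) (ez d))) hz).smul_const (ez d))
  have hbl := hleft.prodMk hright
  have h2 := (show HasFDerivAt (MChart.front c k pos).blowdown
    (fderiv ℝ (MChart.front c k pos).blowdown a) (a + (0 : ℝ) • u) by
      rw [hγ0]; exact hd.hasFDerivAt).comp_hasDerivAt (0 : ℝ) hγ
  have h3 := h2.unique hbl
  rw [h3]
  refine Prod.ext ?_ rfl
  simp only [hγ0] at hz ⊢
  refine eq_of_form_eq hr (fun i hi => ?_) ?_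
  · simp [hy i hi, y', hi, ez_of_ne hi]
  · simp only [zero_add, map_add, map_smul, smul_eq_mul, hyl]
    simp
    field_simp
    ring

end Base

end ThetaCalc

end

noncomputable section
namespace ThetaCalc
set_option linter.unusedSectionVars false

/-! ### Lifts of the rescaled frame to the stretched product -/

variable {d : ℕ} {X : Type*} [TopologicalSpace X] [ChartedSpace (EuclideanHalfSpace (d + 2)) X]
  [IsManifold (𝓡∂ (d + 2)) ∞ X]
  {θ : ∀ p : X, TangentSpace (𝓡∂ (d + 2)) p →L[ℝ] ℝ}

open ThetaChart

theorem ThetaChart.frame'_of_ne {c : ThetaChart θ} {x : V d} (j : Fin (d + 2)) {i : Fin (d + 2)}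
    (hi : i ≠ Fin.last (d + 1)) : c.frame' x j i = if i = j then 1 else 0 := by
  unfold frame'
  split_ifs with h1 h2 h2
  · exact (hi (h2.trans h1)).elim
  · simp [ez_of_ne hi]
  · subst h2
    simp [ez_of_ne hi, ei_apply]
  · simp [ez_of_ne hi, ei_apply, h2]

theorem ThetaChart.span_frame {c : ThetaChart θ} {x : V d} (hx : x ∈ c.target) (h0 : 0 < x 0)
    {P : Submodule ℝ (V d)} (h : ∀ j, c.frame x j ∈ P) (y : V d) : y ∈ P := by
  have hz := c.form_ez x hx
  have h1 : ∀ j, c.frame' x j ∈ P := fun j => by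
    have := P.smul_mem (x 0)⁻¹ (h j)
    rwa [frame, inv_smul_smul₀ h0.ne'] at this
  have h2 : ez d ∈ P := by
    have := P.smul_mem (x 0 / c.form x (ez d))⁻¹ (h1 (Fin.last (d + 1)))
    rwa [frame', if_pos rfl, inv_smul_smul₀ (div_ne_zero h0.ne' hz)] at this
  rw [vec_eq_sum y]
  refine P.sum_mem fun j _ => P.smul_mem _ ?_
  by_cases hj : j = Fin.last (d + 1)
  · rw [hj]; exact h2
  · have := P.add_mem (h1 j) (P.smul_mem (c.form x (ei j) / c.form x (ez d)) h2)
    rwa [frame', if_neg hj, sub_add_cancel] at this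

namespace MChart

theorem blowdown_mem {m : MChart θ} {a : V d × V d} (ha : a ∈ m.dom) :
    (m.blowdown a).1 ∈ m.left.target ∧ (m.blowdown a).2 ∈ m.right.target := by
  cases m with
  | prod c c' => exact ⟨ha.1, ha.2.1⟩
  | front c k pos => exact ⟨ha.2.2.2.1, ha.2.2.2.2⟩

/-- The part of the coordinate range over the interior. -/
def baseInner (m : MChart θ) : Set (V d × V d) :=
  {a | a ∈ m.dom ∧ 0 < (m.blowdown a).1 0 ∧ 0 < (m.blowdown a).2 0}

theorem contDiffWithinAt_blowdown {m : MChart θ} {a : V d × V d} (ha : a ∈ m.dom) :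
    ContDiffWithinAt ℝ ∞ m.blowdown m.dom a := by
  cases m with
  | prod c c' => exact contDiffWithinAt_id
  | front c k pos =>
    exact (contDiffWithinAt_frontLeft (slot_mul_omegaR_nonneg (c := c)) ha.2.2.2.2).prodMk
      (contDiff_frontRight k pos).contDiffWithinAt

theorem front_pos {c : ThetaChart θ} {k : Option (Fin (d + 2))} {pos : Bool} {a : V d × V d}
    (ha : a ∈ (front c k pos).baseInner) :
    0 < slot k a ∧ 0 < omega k pos a 0 ∧ 0 < omegaR k pos a := by
  obtain ⟨⟨h1, h2, h3, -, -⟩, h4, h5⟩ := ha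
  change 0 < (frontLeft c k pos a) 0 at h4
  change 0 < (frontRight k pos a) 0 at h5
  rw [frontLeft_zero] at h4
  rw [frontRight_zero] at h5
  exact ⟨(pos_iff_pos_of_mul_pos h4).2 (lt_of_le_of_ne h2 fun h => by simp [← h] at h4),
    lt_of_le_of_ne h2 fun h => by simp [← h] at h4,
    lt_of_le_of_ne h3 fun h => by simp [← h] at h5⟩

theorem baseInner_mem_nhds {m : MChart θ} {a : V d × V d} (ha : a ∈ m.baseInner) :
    m.baseInner ∈ 𝓝 a := by
  cases m with
  | prod c c' =>
    obtain ⟨⟨h1, h2, -⟩, h3, h4⟩ := ha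
    have e1 := continuous_fst.continuousAt.preimage_mem_nhds (target_mem_nhds h1 h3)
    have e2 := continuous_snd.continuousAt.preimage_mem_nhds (x := a) (target_mem_nhds h2 h4)
    have e3 := continuous_fst.continuousAt.preimage_mem_nhds (isOpen_pos.mem_nhds h3)
    have e4 := continuous_snd.continuousAt.preimage_mem_nhds (x := a) (isOpen_pos.mem_nhds h4)
    filter_upwards [e1, e2, e3, e4] with b b1 b2 b3 b4
    exact ⟨⟨b1, b2, fun h => b3.ne' ((pt_mem_boundary_iff b1).1 h.2)⟩, b3, b4⟩
  | front c k pos =>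
    obtain ⟨h1, h2, h3⟩ := front_pos ha
    have hl := ha.1.2.2.2.1
    have hr := ha.1.2.2.2.2
    have e1 : ∀ᶠ b in 𝓝 a, 0 < slot k b :=
      (contDiff_slot k).continuous.continuousAt.eventually_const_lt h1
    have e2 : ∀ᶠ b in 𝓝 a, 0 < omega k pos b 0 :=
      (contDiff_omega k pos 0).continuous.continuousAt.eventually_const_lt h2
    have e3 : ∀ᶠ b in 𝓝 a, 0 < omegaR k pos b :=
      (contDiff_omegaR k pos).continuous.continuousAt.eventually_const_lt h3
    have e4 : {b : V d × V d | 0 < slot k b ∧ 0 < omega k pos b 0 ∧ 0 < omegaR k pos b} ∈ 𝓝 a :=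
      (e1.and (e2.and e3))
    have cl : ContinuousAt (frontLeft c k pos) a :=
      ((contDiffWithinAt_frontLeft (D := {b | 0 < slot k b ∧ 0 < omega k pos b 0 ∧
        0 < omegaR k pos b}) (fun b hb => (mul_pos hb.1 hb.2.2).le) hr).contDiffAt e4).continuousAt
    have e5 := cl.preimage_mem_nhds (target_mem_nhds hl ha.2.1)
    have e6 := (contDiff_frontRight k pos).continuous.continuousAt.preimage_mem_nhds
      (target_mem_nhds hr ha.2.2)
    filter_upwards [e4, e5, e6] with b b1 b2 b3
    refine ⟨⟨b1.1.le, b1.2.1.le, b1.2.2.le, b2, b3⟩, ?_, ?_⟩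
    · change 0 < (frontLeft c k pos b) 0
      rw [frontLeft_zero]
      exact mul_pos b1.1 b1.2.1
    · change 0 < (frontRight k pos b) 0
      rw [frontRight_zero]
      exact mul_pos b1.1 b1.2.2

theorem contDiffAt_blowdown {m : MChart θ} {a : V d × V d} (ha : a ∈ m.baseInner) :
    ContDiffAt ℝ ∞ m.blowdown a :=
  (contDiffWithinAt_blowdown ha.1).contDiffAt
    (mem_of_superset (baseInner_mem_nhds ha) fun _ hb => hb.1)

/-- The left frame vectors are ρ times smooth fields, and ρ = s ω_0 in a projective chart. The extra
factor s makes the rates of the weight one functions smooth after division. For the weight two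
function the extra s is found in `form_frame'` and in the quotient of `form` by s. The derivative of
s along a lift is a multiple of s, so the lifts are tangent to the front face. -/
theorem exists_lift (m : MChart θ) {a : V d × V d} (ha : a ∈ m.dom) :
    ∃ T : Fin (d + 2) → V d × V d → V d × V d,
      (∀ j, ContDiffWithinAt ℝ ∞ (T j) m.dom a) ∧
      (∀ᶠ b in 𝓝[m.dom] a, b ∈ m.baseInner →
        ∀ j, fderiv ℝ m.blowdown b (T j b) = (m.left.frame (m.blowdown b).1 j, 0)) ∧
      ∀ c k pos, m = front c k pos → slot k a = 0 → ∀ j, slot k (T j a) = 0 := by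
  cases m with
  | prod c c' =>
    refine ⟨fun j b => (c.frame b.1 j, 0), fun j => ?_, Eventually.of_forall fun b _ j => ?_,
      by simp⟩
    · have hm : MapsTo Prod.fst (prod c c').dom (HS d) := fun b hb => target_subset hb.1
      have h1 : ContDiffWithinAt ℝ ∞ (fun x => c.frame x j) (HS d) a.1 :=
        (rho d).contDiff.contDiffWithinAt.smul (contDiffWithinAt_frame' ha.1 j)
      exact (h1.comp a contDiffWithinAt_fst hm).prodMk contDiffWithinAt_const
    · have : (prod c c').blowdown = id := rfl
      rw [this, fderiv_id]
      rfl
  | front c k pos =>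
    obtain ⟨Q, hQ, hQe⟩ := exists_form_quotient ha
    have hmL : MapsTo (frontLeft c k pos) (front c k pos).dom (HS d) :=
      fun b hb => target_subset hb.2.2.2.1
    have hF : ∀ j, ContDiffWithinAt ℝ ∞ (fun b => c.frame' (frontLeft c k pos b) j)
        (front c k pos).dom a := fun j =>
      (contDiffWithinAt_frame' ha.2.2.2.1 j).comp a
        (contDiffWithinAt_frontLeft (slot_mul_omegaR_nonneg (c := c)) ha.2.2.2.2) hmL
    have ho : ∀ i, ContDiffWithinAt ℝ ∞ (fun b : V d × V d => omega k pos b i)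
        (front c k pos).dom a := fun i => (contDiff_omega k pos i).contDiffWithinAt
    -- The rates of the left frame field s ω_0 `frame'`. At the right point `form` is its value at
    -- the left point minus s Q, so on the field it equals s² ω_0 (ω_0 - Q) for the last index and
    -- -s² ω_0 Q otherwise, with Q evaluated on `frame'`.
    let e : Fin (d + 2) → V d × V d → Fin (d + 2) → ℝ := fun j b i =>
      if i = Fin.last (d + 1) then omega k pos b 0 *
        ((if j = Fin.last (d + 1) then omega k pos b 0 else 0) -
          Q b (c.frame' (frontLeft c k pos b) j))
      else if i = j then omega k pos b 0 else 0
    refine ⟨fun j b => liftVec k pos b (e j b), fun j => ?_, ?_, ?_⟩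
    · refine contDiffWithinAt_liftVec fun i => ?_
      simp only [e]
      split_ifs
      · exact (ho 0).mul ((ho 0).sub (hQ.clm_apply (hF j)))
      · exact (ho 0).mul (contDiffWithinAt_const.sub (hQ.clm_apply (hF j)))
      · exact ho 0
      · exact contDiffWithinAt_const
    · filter_upwards [hQe] with b hb hbi j
      have hl := hbi.1.2.2.2.1
      have hr := hbi.1.2.2.2.2
      refine fderiv_blowdown_liftVec (e j b) hr hbi.2.2
        ((contDiffAt_blowdown hbi).differentiableAt (by simp)) ?_ ?_
      · intro i hi
        change (frontLeft c k pos b) 0 * c.frame' (frontLeft c k pos b) j i = _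
        rw [frontLeft_zero, frame'_of_ne j hi]
        simp only [e, hi, if_false]
        split_ifs <;> ring
      · change c.form (frontRight k pos b) ((frontLeft c k pos b) 0 •
          c.frame' (frontLeft c k pos b) j) = _
        have h1 : c.form (frontRight k pos b) = c.form (frontLeft c k pos b) - slot k b • Q b := by
          rw [← hb]; abel
        rw [h1, map_smul, sub_apply, form_frame' hl, frontLeft_zero]
        simp only [e, if_true, smul_apply, smul_eq_mul]
        split_ifs <;> ring
    · rintro c' k' pos' h hs j
      cases h
      rw [← slotL_apply, slotL_liftVec, hs, zero_mul]

/-- The lifted left frame already produces all vectors (y, 0), so it remains to check that the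
differential of the right point is onto; over the interior this is explicit because s > 0. Equality
of dimensions gives injectivity. -/
theorem bijective_fderiv_blowdown {m : MChart θ} {a : V d × V d} (ha : a ∈ m.baseInner) :
    Function.Bijective (fderiv ℝ m.blowdown a) := by
  suffices h : Function.Surjective (fderiv ℝ m.blowdown a) from
    ⟨(LinearMap.injective_iff_surjective (f := (fderiv ℝ m.blowdown a).toLinearMap)).2 h, h⟩
  obtain ⟨T, -, hT, -⟩ := exists_lift m ha.1
  have hT := (hT.self_of_nhdsWithin ha.1) ha
  have h1 : ∀ y : V d, ∃ u, fderiv ℝ m.blowdown a u = (y, 0) := fun y => by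
    have := span_frame (P := (LinearMap.range (fderiv ℝ m.blowdown a).toLinearMap).comap
      (LinearMap.inl ℝ (V d) (V d))) (blowdown_mem ha.1).1 ha.2.1 (fun j => ⟨T j a, hT j⟩) y
    exact this
  have h2 : ∀ y : V d, ∃ u, (fderiv ℝ m.blowdown a u).2 = y := fun y => by
    cases m with
    | prod c c' =>
      have : (prod c c').blowdown = id := rfl
      rw [this, fderiv_id]
      exact ⟨(0, y), rfl⟩
    | front c k pos =>
      have hs := (front_pos ha).1
      have e1 : ∀ u, (fderiv ℝ (front c k pos).blowdown a u).2 =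
          fderiv ℝ (frontRight k pos) a u := fun u => by
        have := ((contDiffAt_blowdown ha).differentiableAt (by simp)).hasFDerivAt.snd
        exact (DFunLike.congr_fun this.fderiv u).symm
      have e2 : ∀ u i, (fderiv ℝ (frontRight k pos) a u) i =
          if i = 0 then slotL k u * omegaR k pos a + slot k a * omegaRL k u else u.2 i := by
        intro u i
        have h0 : HasFDerivWithinAt (frontRight k pos) (fderiv ℝ (frontRight k pos) a) univ a :=
          ((contDiff_frontRight k pos (d := d)).contDiffAt.differentiableAt
          (x := a) (by simp)).hasFDerivAt.hasFDerivWithinAt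
        have h3 := hasFDerivWithinAt_euclidean.1 h0 i
        rw [hasFDerivWithinAt_univ] at h3
        by_cases hi : i = 0
        · subst hi
          simp only [frontRight_zero] at h3
          have h4 := (hasFDerivAt_slot k a).mul (hasFDerivAt_omegaR k pos a)
          have h5 := DFunLike.congr_fun (h3.unique h4) u
          simp only [if_true]
          refine h5.trans ?_
          simp
          ring
        · simp only [frontRight_of_ne _ hi] at h3
          have h4 := ((EuclideanSpace.proj (𝕜 := ℝ) i).comp
            (ContinuousLinearMap.snd ℝ (V d) (V d))).hasFDerivAt (x := a)
          have h5 := DFunLike.congr_fun (h3.unique h4) u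
          simp only [hi, if_false]
          exact h5
      cases k with
      | none =>
        have hp : sgn pos * sgn pos = 1 := sgn_mul_self pos
        refine ⟨(0, WithLp.toLp 2 fun i => if i = 0 then sgn pos * y 0 else y i), ?_⟩
        rw [e1]
        refine PiLp.ext fun i => ?_
        rw [e2]
        by_cases hi : i = 0
        · subst hi
          simp [slotL_apply, slot, omegaR, omegaRL]
          linear_combination y 0 * hp
        · simp [hi]
      | some j =>
        refine ⟨(0, WithLp.toLp 2 fun i => if i = 0 then y 0 / slot (some j) a else y i), ?_⟩
        rw [e1]
        refine PiLp.ext fun i => ?_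
        rw [e2]
        by_cases hi : i = 0
        · subst hi
          simp [slotL_apply, omegaRL]
          simp only [slot, PiLp.zero_apply, zero_mul, zero_add]
          change 0 < a.1 j at hs
          field_simp
        · simp [hi]
  intro y
  obtain ⟨u, hu⟩ := h2 y.2
  obtain ⟨u', hu'⟩ := h1 (y.1 - (fderiv ℝ m.blowdown a u).1)
  refine ⟨u' + u, ?_⟩
  rw [map_add, hu']
  ext1
  · simp
  · simp [hu]

/-- The differential of the blow-down map as a linear equivalence. -/
def blowdownEquiv {m : MChart θ} {a : V d × V d} (ha : a ∈ m.baseInner) :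
    (V d × V d) ≃L[ℝ] (V d × V d) :=
  (LinearEquiv.ofBijective (fderiv ℝ m.blowdown a).toLinearMap
    (bijective_fderiv_blowdown ha)).toContinuousLinearEquiv

theorem coe_blowdownEquiv {m : MChart θ} {a : V d × V d} (ha : a ∈ m.baseInner) :
    (blowdownEquiv ha : V d × V d →L[ℝ] V d × V d) = fderiv ℝ m.blowdown a := by
  exact ContinuousLinearMap.ext fun u => rfl

theorem inverse_fderiv_apply {m : MChart θ} {a : V d × V d} (ha : a ∈ m.baseInner)
    (u : V d × V d) :
    (fderiv ℝ m.blowdown a).inverse (fderiv ℝ m.blowdown a u) = u := by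
  rw [← coe_blowdownEquiv ha, ContinuousLinearMap.inverse_equiv]
  simp

theorem fderiv_inverse_apply {m : MChart θ} {a : V d × V d} (ha : a ∈ m.baseInner)
    (u : V d × V d) :
    fderiv ℝ m.blowdown a ((fderiv ℝ m.blowdown a).inverse u) = u := by
  rw [← coe_blowdownEquiv ha, ContinuousLinearMap.inverse_equiv]
  simp

theorem dom_subset_closure_baseInner {m : MChart θ} : m.dom ⊆ closure m.baseInner := by
  intro a ha
  rw [mem_closure_iff_nhdsWithin_neBot]
  cases m with
  | prod c c' =>
    have h1 := target_subset_closure ha.1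
    have h2 := target_subset_closure ha.2.1
    rw [mem_closure_iff_nhdsWithin_neBot] at h1 h2
    have h3 := h1.prod h2
    rw [← nhdsWithin_prod_eq] at h3
    refine h3.mono (nhdsWithin_mono _ ?_)
    rintro b ⟨⟨b1, b2⟩, b3, b4⟩
    exact ⟨⟨b1, b3, fun h => b2.ne' ((pt_mem_boundary_iff b1).1 h.2)⟩, b2, b4⟩
  | front c k pos =>
    -- A direction that increases s, ω_0 and ω_R together. Whichever of the last two is frozen at ±1
    -- is positive already, the value -1 being ruled out by the sign conditions of the domain.
    let u : V d × V d := (ei 0 + (match k with | none => 0 | some i => if i = 0 then 0 else ei i),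
      ei 0)
    have hcont : Continuous fun t : ℝ => a + t • u := by fun_prop
    have ht : Tendsto (fun t : ℝ => a + t • u) (𝓝[>] 0) (𝓝 a) := by
      have := hcont.tendsto 0
      simp only [zero_smul, add_zero] at this
      exact this.mono_left nhdsWithin_le_nhds
    have hs : ∀ t : ℝ, slot k (a + t • u) = slot k a + t := fun t => by
      cases k with
      | none => simp [slot, u, ei_apply]
      | some i => by_cases hi : i = 0 <;> simp [slot, u, ei_apply, hi]
    have ho : ∀ t : ℝ, 0 < t → 0 < omega k pos (a + t • u) 0 := fun t ht0 => by
      have h2 := ha.2.1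
      by_cases hk : k = some 0
      · subst hk
        cases pos
        · simp [omega, sgn] at h2
          linarith
        · simp [omega, sgn]
      · simp only [omega, hk, if_false] at h2 ⊢
        have : u.1 0 = 1 := by
          cases k with
          | none => simp [u, ei_apply]
          | some i =>
            have hi : i ≠ 0 := fun h => hk (by rw [h])
            simp [u, ei_apply, hi, hi.symm]
        simp [this]
        linarith
    have hr : ∀ t : ℝ, 0 < t → 0 < omegaR k pos (a + t • u) := fun t ht0 => by
      have h2 := ha.2.2.1
      cases k with
      | none =>
        cases pos
        · simp [omegaR, sgn] at h2
          linarith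
        · simp [omegaR, sgn]
      | some i =>
        simp only [omegaR] at h2 ⊢
        simp [u, ei_apply]
        linarith
    have hpos : ∀ t : ℝ, 0 < t → 0 < slot k (a + t • u) := fun t ht0 => by
      rw [hs]; linarith [ha.1]
    set D : Set (V d × V d) := {b | 0 ≤ slot k b ∧ 0 ≤ omega k pos b 0 ∧ 0 ≤ omegaR k pos b}
    have htD : Tendsto (fun t : ℝ => a + t • u) (𝓝[>] 0) (𝓝[D] a) := by
      refine tendsto_nhdsWithin_iff.2 ⟨ht, ?_⟩
      filter_upwards [self_mem_nhdsWithin] with t ht0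
      exact ⟨(hpos t ht0).le, (ho t ht0).le, (hr t ht0).le⟩
    have haD : a ∈ D := ⟨ha.1, ha.2.1, ha.2.2.1⟩
    have hL : Tendsto (fun t : ℝ => frontLeft c k pos (a + t • u)) (𝓝[>] 0)
        (𝓝[HS d] (frontLeft c k pos a)) := by
      have h1 := (contDiffWithinAt_frontLeft (D := D) (k := k) (pos := pos) (c := c)
        (fun b hb => mul_nonneg hb.1 hb.2.2) ha.2.2.2.2).continuousWithinAt.tendsto_nhdsWithin
        (t := HS d) fun b hb => by
          change 0 ≤ (frontLeft c k pos b) 0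
          rw [frontLeft_zero]
          exact mul_nonneg hb.1 hb.2.1
      exact h1.comp htD
    have hR : Tendsto (fun t : ℝ => frontRight k pos (a + t • u)) (𝓝[>] 0)
        (𝓝[HS d] (frontRight k pos a)) := by
      have h1 := (contDiff_frontRight k pos).continuous.continuousWithinAt.tendsto_nhdsWithin
        (s := D) (x := a) (t := HS d) fun b hb => by
          change 0 ≤ (frontRight k pos b) 0
          rw [frontRight_zero]
          exact mul_nonneg hb.1 hb.2.2
      exact h1.comp htD
    have hfin : Tendsto (fun t : ℝ => a + t • u) (𝓝[>] 0) (𝓝[(front c k pos).baseInner] a) := by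
      refine tendsto_nhdsWithin_iff.2 ⟨ht, ?_⟩
      filter_upwards [self_mem_nhdsWithin, hL.eventually (target_mem_nhdsWithin ha.2.2.2.1),
        hR.eventually (target_mem_nhdsWithin ha.2.2.2.2)] with t t0 t1 t2
      refine ⟨⟨(hpos t t0).le, (ho t t0).le, (hr t t0).le, t1, t2⟩, ?_, ?_⟩
      · change 0 < (frontLeft c k pos _) 0
        rw [frontLeft_zero]
        exact mul_pos (hpos t t0) (ho t t0)
      · change 0 < (frontRight k pos _) 0
        rw [frontRight_zero]
        exact mul_pos (hpos t t0) (hr t t0)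
    exact hfin.neBot

end MChart

end ThetaCalc

end

noncomputable section
namespace ThetaCalc
set_option linter.unusedSectionVars false

/-! ### The cotangent bundle of the stretched product -/

variable {d : ℕ} {X : Type*} [TopologicalSpace X] [ChartedSpace (EuclideanHalfSpace (d + 2)) X]
  [IsManifold (𝓡∂ (d + 2)) ∞ X]
  {θ : ∀ p : X, TangentSpace (𝓡∂ (d + 2)) p →L[ℝ] ℝ}

open ThetaChart

theorem ThetaChart.contDiffAt_frame {c : ThetaChart θ} {x : V d} (hx : x ∈ c.target)
    (h0 : 0 < x 0) (j : Fin (d + 2)) : ContDiffAt ℝ ∞ (fun y => c.frame y j) x :=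
  ((rho d).contDiff.contDiffWithinAt.smul (contDiffWithinAt_frame' hx j)).contDiffAt
    (HS_mem_nhds h0)

theorem ThetaChart.contDiffAt_comps {c : ThetaChart θ} {x : V d} (hx : x ∈ c.target)
    (h0 : 0 < x 0) (ξ : V d →L[ℝ] ℝ) :
    ContDiffAt ℝ ∞ (fun p : V d × (V d →L[ℝ] ℝ) => c.comps p.1 p.2) (x, ξ) := by
  refine contDiffAt_euclidean.2 fun j => ?_
  exact contDiffAt_snd.clm_apply (ContDiffAt.comp (g := fun y => c.frame y j) (x, ξ)
    (contDiffAt_frame hx h0 j) contDiffAt_fst)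

/-- Coordinates of a covector on the base of a chart of the stretched product. -/
abbrev CV (d : ℕ) : Type := (V d × V d) × ((V d × V d) →L[ℝ] ℝ)

namespace MChart

theorem cot_inner {m : MChart θ} : (mAtlas θ m).inner = {b | b.1 ∈ m.baseInner} := rfl

theorem cot_dom_subset_closure {m : MChart θ} :
    (mAtlas θ m).dom ⊆ closure (mAtlas θ m).inner := by
  intro b hb
  have : (mAtlas θ m).inner = m.baseInner ×ˢ univ := by
    ext; simp [cot_inner]
  rw [this, closure_prod_eq, closure_univ]
  exact ⟨dom_subset_closure_baseInner hb, trivial⟩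

theorem cot_germ_neBot {m : MChart θ} {b : CV d} (hb : b ∈ (mAtlas θ m).dom) :
    ((mAtlas θ m).germ b).NeBot := BChart.germ_neBot (cot_dom_subset_closure hb)

theorem tendsto_pt_blowdown {m : MChart θ} {a : V d × V d} (ha : a ∈ m.dom) :
    Tendsto (fun b => (m.left.pt (m.blowdown b).1, m.right.pt (m.blowdown b).2)) (𝓝[m.dom] a)
      (𝓝 (m.left.pt (m.blowdown a).1, m.right.pt (m.blowdown a).2)) := by
  have h1 := (contDiffWithinAt_blowdown ha).continuousWithinAt.tendsto
  have h2 := continuousOn_pt _ (blowdown_mem ha).1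
  have h3 := continuousOn_pt _ (blowdown_mem ha).2
  refine Tendsto.prodMk_nhds ?_ ?_
  · refine h2.tendsto.comp (tendsto_nhdsWithin_iff.2 ⟨(continuous_fst.tendsto _).comp h1, ?_⟩)
    filter_upwards [self_mem_nhdsWithin] with b hb using (blowdown_mem hb).1
  · refine h3.tendsto.comp (tendsto_nhdsWithin_iff.2 ⟨(continuous_snd.tendsto _).comp h1, ?_⟩)
    filter_upwards [self_mem_nhdsWithin] with b hb using (blowdown_mem hb).2

theorem tendsto_fst_inner {m : MChart θ} {b : CV d} :
    Tendsto Prod.fst (𝓝[(mAtlas θ m).inner] b) (𝓝[m.baseInner] b.1) :=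
  tendsto_nhdsWithin_iff.2 ⟨continuous_fst.continuousWithinAt,
    by filter_upwards [self_mem_nhdsWithin] with b hb using hb⟩

theorem tendsto_fst_inner_dom {m : MChart θ} {b : CV d} :
    Tendsto Prod.fst (𝓝[(mAtlas θ m).inner] b) (𝓝[m.dom] b.1) :=
  tendsto_fst_inner.mono_right (nhdsWithin_mono _ fun _ h => h.1)

end MChart

open MChart

namespace CotM

theorem neBot (τ : CotM θ) : τ.1.NeBot := by
  obtain ⟨_, m, b, hb, rfl⟩ := τ
  exact cot_germ_neBot hb

theorem exists_germ (τ : CotM θ) : ∃ m : MChart θ, ∃ b : CV d, b.1 ∈ m.dom ∧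
    τ.1 = (mAtlas θ m).germ b := τ.2

theorem tendsto_proj_germ {m : MChart θ} {b : CV d} (hb : b.1 ∈ m.dom) :
    Tendsto (fun r : Cot d X × Cot d X => (r.1.proj, r.2.proj)) ((mAtlas θ m).germ b)
      (𝓝 (m.left.pt (m.blowdown b.1).1, m.right.pt (m.blowdown b.1).2)) :=
  tendsto_map'_iff.2 ((tendsto_pt_blowdown hb).comp tendsto_fst_inner_dom)

theorem isOver_of_germ {τ : CotM θ} {m : MChart θ} {b : CV d} (hb : b.1 ∈ m.dom)
    (h : τ.1 = (mAtlas θ m).germ b) :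
    τ.IsOver (m.left.pt (m.blowdown b.1).1, m.right.pt (m.blowdown b.1).2) := by
  unfold IsOver
  rw [h]
  exact tendsto_proj_germ hb

variable [T2Space X]

theorem isOver_eq_of_inf_neBot {τ τ' : CotM θ} {q q' : X × X} (h : (τ.1 ⊓ τ'.1).NeBot)
    (hq : τ.IsOver q) (hq' : τ'.IsOver q') : q = q' :=
  tendsto_nhds_unique (hq.mono_left inf_le_left) (hq'.mono_left inf_le_right)

theorem isOver_unique {τ : CotM θ} {q q' : X × X} (hq : τ.IsOver q) (hq' : τ.IsOver q') :
    q = q' :=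
  isOver_eq_of_inf_neBot (by rw [inf_idem]; exact τ.neBot) hq hq'

theorem overInterior_iff {τ : CotM θ} {m : MChart θ} {b : CV d} (hb : b.1 ∈ m.dom)
    (h : τ.1 = (mAtlas θ m).germ b) : τ.OverInterior ↔ b.1 ∈ m.baseInner := by
  have h1 := isOver_of_germ hb h
  have h2 := blowdown_mem hb
  constructor
  · rintro ⟨p, hp, p', hp', h3⟩
    have h4 := isOver_unique h3 h1
    rw [Prod.mk.injEq] at h4
    rw [h4.1, pt_mem_interior_iff h2.1] at hp
    rw [h4.2, pt_mem_interior_iff h2.2] at hp'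
    exact ⟨hb, hp, hp'⟩
  · intro h3
    exact ⟨_, (pt_mem_interior_iff h2.1).2 h3.2.1, _, (pt_mem_interior_iff h2.2).2 h3.2.2, h1⟩

theorem overFront_iff {τ : CotM θ} {m : MChart θ} {b : CV d} (hb : b.1 ∈ m.dom)
    (h : τ.1 = (mAtlas θ m).germ b) : τ.OverFront ↔
      m.left.pt (m.blowdown b.1).1 = m.right.pt (m.blowdown b.1).2 ∧
      m.left.pt (m.blowdown b.1).1 ∈ (𝓡∂ (d + 2)).boundary X := by
  have h1 := isOver_of_germ hb h
  constructor
  · rintro ⟨p, hp, h3⟩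
    have h4 := isOver_unique h3 h1
    rw [Prod.mk.injEq] at h4
    rw [← h4.1, ← h4.2]
    exact ⟨rfl, hp⟩
  · rintro ⟨h3, h4⟩
    refine ⟨_, h4, ?_⟩
    nth_rw 2 [h3]
    exact h1

theorem overFront_of_slot_eq_zero {τ : CotM θ} {c : ThetaChart θ} {k pos} {b : CV d}
    (hb : b.1 ∈ (front c k pos).dom) (h : τ.1 = (mAtlas θ (front c k pos)).germ b)
    (h0 : slot k b.1 = 0) : τ.OverFront := by
  rw [overFront_iff hb h]
  have h1 : frontLeft c k pos b.1 = frontRight k pos b.1 := by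
    rw [frontLeft_eq, h0, zero_smul, add_zero]
  refine ⟨congrArg c.pt h1, (pt_mem_boundary_iff (blowdown_mem hb).1).2 ?_⟩
  change (frontLeft c k pos b.1) 0 = 0
  rw [frontLeft_zero, h0, zero_mul]

end CotM

/-! ### The left projection -/

/-- Over the interior a covector pulled back from X × X, paired with the lift of the j-th left frame
field, gives the j-th component of its left part. The lifts are smooth up to the boundary, so this
formula prolongs the left projection continuously. -/
theorem MChart.map_fst_germ_le {m : MChart θ} {b : CV d} (hb : b.1 ∈ m.dom)
    {T : Fin (d + 2) → V d × V d → V d × V d}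
    (hT : ∀ j, ContDiffWithinAt ℝ ∞ (T j) m.dom b.1)
    (hT' : ∀ᶠ b in 𝓝[m.dom] b.1, b ∈ m.baseInner →
        ∀ j, fderiv ℝ m.blowdown b (T j b) = (m.left.frame (m.blowdown b).1 j, 0)) :
    map Prod.fst ((mAtlas θ m).germ b) ≤
      (thetaAtlas θ m.left).germ ((m.blowdown b.1).1, WithLp.toLp 2 fun j => b.2 (T j b.1)) := by
  set H : CV d → V d × V d := fun b => ((m.blowdown b.1).1, WithLp.toLp 2 fun j => b.2 (T j b.1))
  have h1 : Tendsto H (𝓝[(mAtlas θ m).inner] b) (𝓝[(thetaAtlas θ m.left).inner] (H b)) := by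
    refine tendsto_nhdsWithin_iff.2 ⟨Tendsto.prodMk_nhds ?_ ?_, ?_⟩
    · exact ((continuous_fst.tendsto _).comp
        (contDiffWithinAt_blowdown hb).continuousWithinAt.tendsto).comp tendsto_fst_inner_dom
    · refine ((PiLp.continuous_toLp 2 _).tendsto _).comp (tendsto_pi_nhds.2 fun j => ?_)
      have e1 : Tendsto (fun b : CV d => b.2) (𝓝[(mAtlas θ m).inner] b) (𝓝 b.2) :=
        continuous_snd.continuousWithinAt
      have e2 := (hT j).continuousWithinAt.tendsto.comp (tendsto_fst_inner_dom (b := b))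
      exact (isBoundedBilinearMap_apply.continuous.tendsto (b.2, T j b.1)).comp
        (e1.prodMk_nhds e2)
    · filter_upwards [self_mem_nhdsWithin] with b' hb'
      exact ⟨(blowdown_mem hb'.1).1, hb'.2.1⟩
  unfold BChart.germ
  rw [Filter.map_map]
  refine le_trans (le_of_eq ?_) (Filter.map_mono h1)
  rw [Filter.map_map]
  refine Filter.map_congr ?_
  filter_upwards [self_mem_nhdsWithin, tendsto_fst_inner_dom.eventually hT'] with b' hb' h2
  have hb'' : b'.1 ∈ m.baseInner := hb'
  have h3 := h2 hb''
  have e : WithLp.toLp 2 (fun j => b'.2 (T j b'.1)) = m.left.comps (m.blowdown b'.1).1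
      ((b'.2.comp (fderiv ℝ m.blowdown b'.1).inverse).comp
        (ContinuousLinearMap.inl ℝ (V d) (V d))) := by
    refine PiLp.ext fun j => ?_
    rw [comps_apply]
    simp only [ContinuousLinearMap.comp_apply, ContinuousLinearMap.inl_apply]
    rw [← h3 j, inverse_fderiv_apply hb'']
  change m.left.cov _ _ = m.left.cov (m.blowdown b'.1).1
    (m.left.coform (m.blowdown b'.1).1 (H b').2)
  have e' : (H b').2 = _ := e
  rw [e', coform_comps (blowdown_mem hb''.1).1 hb''.2.1]

namespace CotM

theorem exists_left (τ : CotM θ) : ∃ ζ : ThetaCot θ, map Prod.fst τ.1 ≤ ζ.1 := by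
  obtain ⟨m, b, hb, hτ⟩ := τ.exists_germ
  obtain ⟨T, hT, hT', -⟩ := exists_lift m hb
  refine ⟨BSpace.mk m.left ((m.blowdown b.1).1, WithLp.toLp 2 fun j => b.2 (T j b.1))
    (blowdown_mem hb).1, ?_⟩
  rw [hτ]
  exact map_fst_germ_le hb hT hT'

/-- The component of a covector of the stretched product along the left factor, as an element of
the rescaled cotangent bundle. -/
def left (τ : CotM θ) : ThetaCot θ := (exists_left τ).choose

theorem map_fst_le_left (τ : CotM θ) : map Prod.fst τ.1 ≤ (left τ).1 := (exists_left τ).choose_spec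

variable [T2Space X]

theorem left_eq {τ : CotM θ} {ζ : ThetaCot θ} (h : map Prod.fst τ.1 ≤ ζ.1) : left τ = ζ := by
  have := τ.neBot
  exact ThetaCot.eq_of_inf_neBot
    ((inferInstance : (map Prod.fst τ.1).NeBot).mono (le_inf (map_fst_le_left τ) h))

theorem left_of_germ {τ : CotM θ} {m : MChart θ} {b : CV d} (hb : b.1 ∈ m.dom)
    (h : τ.1 = (mAtlas θ m).germ b) {T : Fin (d + 2) → V d × V d → V d × V d}
    (hT : ∀ j, ContDiffWithinAt ℝ ∞ (T j) m.dom b.1)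
    (hT' : ∀ᶠ b in 𝓝[m.dom] b.1, b ∈ m.baseInner →
        ∀ j, fderiv ℝ m.blowdown b (T j b) = (m.left.frame (m.blowdown b).1 j, 0)) :
    (left τ).1 = (thetaAtlas θ m.left).germ
      ((m.blowdown b.1).1, WithLp.toLp 2 fun j => b.2 (T j b.1)) := by
  rw [left_eq (ζ := BSpace.mk m.left ((m.blowdown b.1).1, WithLp.toLp 2 fun j => b.2 (T j b.1))
    (blowdown_mem hb).1)
    ((by rw [h]; exact map_fst_germ_le hb hT hT'))]
  rfl

/-- The left component is known only through an inclusion of filters: for nearby covectors its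
filter meets a given small set, and by `ThetaCot.exists_mem_of_mesh` that suffices. -/
theorem continuous_left : Continuous (left : CotM θ → ThetaCot θ) := by
  refine continuous_iff_continuousAt.2 fun τ => BSpace.tendsto_nhds_iff.2 fun u hu => ?_
  obtain ⟨u', hu', h⟩ := ThetaCot.exists_mem_of_mesh hu
  filter_upwards [BSpace.eventually_mem (map_fst_le_left τ hu')] with τ' hτ'
  refine h _ ?_
  have := τ'.neBot
  exact (inferInstance : (map Prod.fst τ'.1).NeBot).mono
    (le_inf (le_principal_iff.2 hτ') (map_fst_le_left τ'))

theorem left_isZero {τ : CotM θ} (h : τ.IsZero) : (left τ).IsZero := by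
  obtain ⟨m, a, ha, hτ⟩ := h
  obtain ⟨T, hT, hT', -⟩ := exists_lift m ha
  refine ⟨m.left, _, (blowdown_mem ha).1, ?_⟩
  rw [left_of_germ ha hτ hT hT']
  congr 2

theorem left_isOver {τ : CotM θ} {q : X × X} (h : τ.IsOver q) : (left τ).IsOver q.1 := by
  obtain ⟨m, b, hb, hτ⟩ := τ.exists_germ
  obtain ⟨T, hT, hT', -⟩ := exists_lift m hb
  have h1 := left_of_germ hb hτ hT hT'
  rw [isOver_unique h (isOver_of_germ hb hτ)]
  exact ThetaCot.isOver_of_germ (c := m.left)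
    (a := ((m.blowdown b.1).1, WithLp.toLp 2 fun j => b.2 (T j b.1))) (blowdown_mem hb).1 h1

/-- The lifts of the left frame are tangent to the front face, so the left component depends only on
the restriction of the covector to TF. -/
theorem left_eq_of_sameRestriction {τ τ' : CotMFront θ} (h : SameRestriction τ τ') :
    left τ.1 = left τ'.1 := by
  obtain ⟨c, k, pos, a, η, η', ha, h0, h1, h2, h3⟩ := h
  obtain ⟨T, hT, hT', hT0⟩ := exists_lift (front c k pos) ha
  refine Subtype.ext ?_
  rw [left_of_germ (b := (a, η)) ha h1 hT hT', left_of_germ (b := (a, η')) ha h2 hT hT']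
  congr 3
  funext j
  exact h3 _ (hT0 c k pos rfl h0 j)

end CotM

/-- The left component on the cotangent bundle of the front face. -/
def CotF.left [T2Space X] : CotF θ → ThetaCot θ :=
  Quot.lift (fun τ => CotM.left τ.1) fun _ _ h => CotM.left_eq_of_sameRestriction h

theorem CotF.continuous_left [T2Space X] : Continuous (CotF.left : CotF θ → ThetaCot θ) :=
  continuous_quot_lift _ (CotM.continuous_left.comp continuous_subtype_val)

/-! ### The identification over the interior -/

/-- The covector `((p, ξ), (p', -ξ'))` in the coordinates of a chart of the stretched product. -/
def MChart.pairing (m : MChart θ) (a : V d × V d) (v v' : V d) : (V d × V d) →L[ℝ] ℝ :=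
  ((m.left.coform (m.blowdown a).1 v).comp (ContinuousLinearMap.fst ℝ (V d) (V d)) -
    (m.right.coform (m.blowdown a).2 v').comp (ContinuousLinearMap.snd ℝ (V d) (V d))).comp
    (fderiv ℝ m.blowdown a)

attribute [local irreducible] MChart.blowdown ThetaChart.coform ThetaChart.comps

namespace MChart

/-- The components of a covector of the stretched product over the interior. -/
def split (m : MChart θ) (b : CV d) : (V d × V d) × (V d × V d) :=
  (((m.blowdown b.1).1, m.left.comps (m.blowdown b.1).1
      ((b.2.comp (fderiv ℝ m.blowdown b.1).inverse).comp (ContinuousLinearMap.inl ℝ (V d) (V d)))),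
   ((m.blowdown b.1).2, m.right.comps (m.blowdown b.1).2
      (-(b.2.comp (fderiv ℝ m.blowdown b.1).inverse).comp
        (ContinuousLinearMap.inr ℝ (V d) (V d)))))

theorem pairing_split {m : MChart θ} {b : CV d} (hb : b.1 ∈ m.baseInner) :
    m.pairing b.1 (m.split b).1.2 (m.split b).2.2 = b.2 := by
  refine ContinuousLinearMap.ext fun u => ?_
  simp only [pairing, split]
  rw [coform_comps (blowdown_mem hb.1).1 hb.2.1, coform_comps (blowdown_mem hb.1).2 hb.2.2]
  conv_rhs => rw [← inverse_fderiv_apply hb u]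
  simp only [ContinuousLinearMap.comp_apply, sub_apply, neg_apply, ContinuousLinearMap.inl_apply,
    ContinuousLinearMap.inr_apply, ContinuousLinearMap.coe_fst', ContinuousLinearMap.coe_snd',
    sub_neg_eq_add]
  rw [← map_add, ← map_add]
  simp

theorem split_pairing {m : MChart θ} {a : V d × V d} (ha : a ∈ m.baseInner) (v v' : V d) :
    m.split (a, m.pairing a v v') = (((m.blowdown a).1, v), ((m.blowdown a).2, v')) := by
  have h1 : ((m.pairing a v v').comp (fderiv ℝ m.blowdown a).inverse) =
      ((m.left.coform (m.blowdown a).1 v).comp (ContinuousLinearMap.fst ℝ (V d) (V d)) -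
    (m.right.coform (m.blowdown a).2 v').comp (ContinuousLinearMap.snd ℝ (V d) (V d))) := by
    refine ContinuousLinearMap.ext fun u => ?_
    simp only [pairing, ContinuousLinearMap.comp_apply]
    rw [fderiv_inverse_apply ha]
  unfold split
  simp only [h1]
  have h2 : ((m.left.coform (m.blowdown a).1 v).comp (ContinuousLinearMap.fst ℝ (V d) (V d)) -
      (m.right.coform (m.blowdown a).2 v').comp (ContinuousLinearMap.snd ℝ (V d) (V d))).comp
      (ContinuousLinearMap.inl ℝ (V d) (V d)) = m.left.coform (m.blowdown a).1 v :=
    ContinuousLinearMap.ext fun u => by simp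
  have h3 : -((m.left.coform (m.blowdown a).1 v).comp (ContinuousLinearMap.fst ℝ (V d) (V d)) -
      (m.right.coform (m.blowdown a).2 v').comp (ContinuousLinearMap.snd ℝ (V d) (V d))).comp
      (ContinuousLinearMap.inr ℝ (V d) (V d)) = m.right.coform (m.blowdown a).2 v' :=
    ContinuousLinearMap.ext fun u => by simp
  rw [h2, h3, comps_coform (blowdown_mem ha.1).1 ha.2.1,
    comps_coform (blowdown_mem ha.1).2 ha.2.2]

theorem contDiffAt_split {m : MChart θ} {b : CV d} (hb : b.1 ∈ m.baseInner) :
    ContDiffAt ℝ ∞ m.split b := by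
  have h1 : ContDiffAt ℝ ∞ (fun b : CV d => m.blowdown b.1) b :=
    ContDiffAt.comp b (contDiffAt_blowdown hb) contDiffAt_fst
  have h2 : ContDiffAt ℝ ∞ (fun a => (fderiv ℝ m.blowdown a).inverse) b.1 := by
    have e1 : ContDiffAt ℝ ∞ (fderiv ℝ m.blowdown) b.1 :=
      (contDiffAt_blowdown hb).fderiv_right (by simp)
    have e2 := contDiffAt_map_inverse (𝕜 := ℝ) (n := ∞) (blowdownEquiv hb)
    rw [coe_blowdownEquiv] at e2
    exact e2.comp b.1 e1
  have h3 : ContDiffAt ℝ ∞ (fun b : CV d => b.2.comp (fderiv ℝ m.blowdown b.1).inverse) b :=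
    contDiffAt_snd.clm_comp (ContDiffAt.comp b h2 contDiffAt_fst)
  refine ContDiffAt.prodMk (h1.fst.prodMk ?_) (h1.snd.prodMk ?_)
  · exact ContDiffAt.comp (g := fun p : V d × (V d →L[ℝ] ℝ) => m.left.comps p.1 p.2) b
      (contDiffAt_comps (blowdown_mem hb.1).1 hb.2.1 _)
      (h1.fst.prodMk (h3.clm_comp contDiffAt_const))
  · exact ContDiffAt.comp (g := fun p : V d × (V d →L[ℝ] ℝ) => m.right.comps p.1 p.2) b
      (contDiffAt_comps (blowdown_mem hb.1).2 hb.2.2 _)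
      (h1.snd.prodMk (h3.clm_comp contDiffAt_const).neg)

theorem contDiffAt_clm_pairing {E : Type*} [NormedAddCommGroup E] [NormedSpace ℝ E] {q : E}
    {f g : E → V d →L[ℝ] ℝ} {L : E → V d × V d →L[ℝ] V d × V d} (hf : ContDiffAt ℝ ∞ f q)
    (hg : ContDiffAt ℝ ∞ g q) (hL : ContDiffAt ℝ ∞ L q) :
    ContDiffAt ℝ ∞ (fun q => ((f q).comp (ContinuousLinearMap.fst ℝ (V d) (V d)) -
      (g q).comp (ContinuousLinearMap.snd ℝ (V d) (V d))).comp (L q)) q :=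
  ((hf.clm_comp contDiffAt_const).sub (hg.clm_comp contDiffAt_const)).clm_comp hL

theorem contDiffAt_pairing {m : MChart θ} {a : V d × V d} (ha : a ∈ m.baseInner) (v v' : V d) :
    ContDiffAt ℝ ∞ (fun q : (V d × V d) × (V d × V d) => m.pairing q.1 q.2.1 q.2.2)
      (a, (v, v')) := by
  have hm := blowdown_mem ha.1
  have f1 : ContDiffAt ℝ ∞ (fun q : (V d × V d) × (V d × V d) => m.blowdown q.1) (a, (v, v')) :=
    ContDiffAt.comp (g := m.blowdown) (a, (v, v')) (contDiffAt_blowdown ha) contDiffAt_fst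
  have f2 : ContDiffAt ℝ ∞ (fun q : (V d × V d) × (V d × V d) => fderiv ℝ m.blowdown q.1)
      (a, (v, v')) :=
    ContDiffAt.comp (g := fderiv ℝ m.blowdown) (a, (v, v'))
      ((contDiffAt_blowdown ha).fderiv_right (by simp)) contDiffAt_fst
  have f3 : ContDiffAt ℝ ∞ (fun q : (V d × V d) × (V d × V d) =>
      m.left.coform (m.blowdown q.1).1 q.2.1) (a, (v, v')) :=
    ContDiffAt.comp (g := fun b : V d × V d => m.left.coform b.1 b.2) (a, (v, v'))
      (contDiffWithinAt_coform hm.1 ha.2.1) (f1.fst.prodMk contDiffAt_snd.fst)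
  have f4 : ContDiffAt ℝ ∞ (fun q : (V d × V d) × (V d × V d) =>
      m.right.coform (m.blowdown q.1).2 q.2.2) (a, (v, v')) :=
    ContDiffAt.comp (g := fun b : V d × V d => m.right.coform b.1 b.2) (a, (v, v'))
      (contDiffWithinAt_coform hm.2 ha.2.2) (f1.snd.prodMk contDiffAt_snd.snd)
  exact contDiffAt_clm_pairing f3 f4 f2

theorem cot_germ_eq_map_nhds {m : MChart θ} {b : CV d} (hb : b.1 ∈ m.baseInner) :
    (mAtlas θ m).germ b = map (mAtlas θ m).toFun (𝓝 b) := by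
  unfold BChart.germ
  rw [nhdsWithin_eq_nhds.2]
  exact continuous_fst.continuousAt.preimage_mem_nhds (baseInner_mem_nhds hb)

end MChart

theorem ThetaChart.cot_germ_eq_map_nhds {c : ThetaChart θ} {a : V d × V d}
    (ha : a.1 ∈ c.target) (h0 : 0 < a.1 0) :
    (thetaAtlas θ c).germ a = map (thetaAtlas θ c).toFun (𝓝 a) := by
  unfold BChart.germ
  rw [nhdsWithin_eq_nhds.2]
  filter_upwards [continuous_fst.continuousAt.preimage_mem_nhds (target_mem_nhds ha h0),
    continuous_fst.continuousAt.preimage_mem_nhds (isOpen_pos.mem_nhds h0)] with b h1 h2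
  exact ⟨h1, h2⟩

theorem dil_cov {c : ThetaChart θ} (r : ℝ) (x : V d) (ξ : V d →L[ℝ] ℝ) :
    dil r (c.cov x ξ) = c.cov x (r • ξ) := by
  unfold dil ThetaChart.cov
  congr 1

/-- Over the interior `split` has a local right inverse, built from the local inverse of the
blow-down map and from `pairing`, so it carries neighbourhoods onto neighbourhoods of the split
point; these are products. The sign of the right component is the dilation by -1. -/
theorem MChart.germ_eq_prod {m : MChart θ} {b : CV d} (hb : b.1 ∈ m.baseInner) :
    (mAtlas θ m).germ b = (thetaAtlas θ m.left).germ (m.split b).1 ×ˢ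
      map (dil (-1)) ((thetaAtlas θ m.right).germ (m.split b).2) := by
  have hm := blowdown_mem hb.1
  have hr : (fderiv ℝ m.blowdown b.1).range = ⊤ :=
    LinearMap.range_eq_top.2 (bijective_fderiv_blowdown hb).2
  have hsd : HasStrictFDerivAt m.blowdown (fderiv ℝ m.blowdown b.1) b.1 :=
    (contDiffAt_blowdown hb).hasStrictFDerivAt (by simp)
  have hsd' : HasStrictFDerivAt m.blowdown (blowdownEquiv hb : V d × V d →L[ℝ] V d × V d) b.1 := by
    rwa [coe_blowdownEquiv]
  set L := hsd'.localInverse m.blowdown (blowdownEquiv hb) b.1 with hL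
  have hLc : ContinuousAt L (m.blowdown b.1) := hsd'.localInverse_continuousAt
  have hLr : ∀ᶠ y in 𝓝 (m.blowdown b.1), m.blowdown (L y) = y := hsd'.eventually_right_inverse
  have hLb : L (m.blowdown b.1) = b.1 := hsd'.localInverse_apply_image
  have hmap : map m.split (𝓝 b) = 𝓝 (m.split b) := by
    set S' : (V d × V d) × (V d × V d) → CV d := fun q =>
      (L (q.1.1, q.2.1), m.pairing (L (q.1.1, q.2.1)) q.1.2 q.2.2) with hS'
    have e0 : Tendsto (fun q : (V d × V d) × (V d × V d) => L (q.1.1, q.2.1)) (𝓝 (m.split b))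
        (𝓝 b.1) := by
      have : Tendsto (fun q : (V d × V d) × (V d × V d) => (q.1.1, q.2.1)) (𝓝 (m.split b))
        (𝓝 (m.blowdown b.1)) := by
        have h : Continuous fun q : (V d × V d) × (V d × V d) => (q.1.1, q.2.1) := by fun_prop
        exact h.tendsto (m.split b)
      have h2 := hLc.tendsto.comp this
      rwa [hLb] at h2
    refine map_eq_of_rightInverse (g := S') (contDiffAt_split hb).continuousAt.tendsto ?_ ?_
    · have f3 : Tendsto (fun q : (V d × V d) × (V d × V d) => (q.1.2, q.2.2)) (𝓝 (m.split b))
          (𝓝 ((m.split b).1.2, (m.split b).2.2)) :=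
        ((continuous_snd.comp continuous_fst).prodMk
          (continuous_snd.comp continuous_snd)).tendsto _
      have f4 := (contDiffAt_pairing hb (m.split b).1.2 (m.split b).2.2).continuousAt.tendsto
      simp only [pairing_split hb] at f4
      have f5 := e0.prodMk_nhds (f4.comp (e0.prodMk_nhds f3))
      exact f5
    · have e1 : Tendsto (fun q : (V d × V d) × (V d × V d) => (q.1.1, q.2.1)) (𝓝 (m.split b))
        (𝓝 (m.blowdown b.1)) := by
        have h : Continuous fun q : (V d × V d) × (V d × V d) => (q.1.1, q.2.1) := by fun_prop
        exact h.tendsto (m.split b)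
      filter_upwards [e1.eventually hLr, e0.eventually (baseInner_mem_nhds hb)] with q h1 h2
      rw [hS', split_pairing h2, h1]
  rw [cot_germ_eq_map_nhds hb, ThetaChart.cot_germ_eq_map_nhds (a := (m.split b).1) hm.1 hb.2.1,
    ThetaChart.cot_germ_eq_map_nhds (a := (m.split b).2) hm.2 hb.2.2, Filter.map_map,
    Filter.prod_map_map_eq, ← nhds_prod_eq, Prod.mk.eta, ← hmap, Filter.map_map]
  refine Filter.map_congr ?_
  filter_upwards [continuous_fst.continuousAt.preimage_mem_nhds (baseInner_mem_nhds hb)] with b' hb'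
  have hb'' : b'.1 ∈ m.baseInner := hb'
  refine Prod.ext ?_ ?_
  · change m.left.cov _ _ = m.left.cov _ (m.left.coform (m.blowdown b'.1).1 (m.split b').1.2)
    rw [split, coform_comps (blowdown_mem hb''.1).1 hb''.2.1]
  · change m.right.cov _ _ =
      dil (-1) (m.right.cov _ (m.right.coform (m.blowdown b'.1).2 (m.split b').2.2))
    rw [dil_cov, split, coform_comps (blowdown_mem hb''.1).2 hb''.2.2]
    exact congrArg _ (by simp)

theorem MChart.germ_pairing {m : MChart θ} {a : V d × V d} (ha : a ∈ m.baseInner) (v v' : V d) :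
    (mAtlas θ m).germ (a, m.pairing a v v') = (thetaAtlas θ m.left).germ ((m.blowdown a).1, v) ×ˢ
      map (dil (-1)) ((thetaAtlas θ m.right).germ ((m.blowdown a).2, v')) := by
  rw [germ_eq_prod (b := (a, _)) ha, split_pairing ha]

end ThetaCalc

end

noncomputable section
namespace ThetaCalc
set_option linter.unusedSectionVars false

/-! ### The canonical diffeomorphism over the interior -/

variable {d : ℕ} {X : Type*} [TopologicalSpace X] [ChartedSpace (EuclideanHalfSpace (d + 2)) X]
  [IsManifold (𝓡∂ (d + 2)) ∞ X]
  {θ : ∀ p : X, TangentSpace (𝓡∂ (d + 2)) p →L[ℝ] ℝ}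

open ThetaChart MChart

theorem prod_mem_baseInner {c c' : ThetaChart θ} {x x' : V d} (hx : x ∈ c.target)
    (hx' : x' ∈ c'.target) (h : 0 < x 0) (h' : 0 < x' 0) :
    (x, x') ∈ (MChart.prod c c').baseInner :=
  ⟨⟨hx, hx', fun hb => h.ne' ((pt_mem_boundary_iff hx).1 hb.2)⟩, h, h'⟩

theorem nonempty_cotM (ζ : ThetaCot θ) : Nonempty (CotM θ) := by
  obtain ⟨c, a, ha, -⟩ := ζ.exists_germ
  obtain ⟨x, hx, h0⟩ := closure_nonempty_iff.1 ⟨_, target_subset_closure ha⟩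
  exact ⟨BSpace.mk (MChart.prod c c) ((x, x), 0) (prod_mem_baseInner hx hx h0 h0).1⟩

theorem finrank_CV : Module.finrank ℝ ((V d × V d) × (V d × V d)) = Module.finrank ℝ (CV d) := by
  have h : Module.finrank ℝ ((V d × V d) →L[ℝ] ℝ) = Module.finrank ℝ (V d × V d) := by
    rw [← (LinearMap.toContinuousLinearMap (𝕜 := ℝ) (E := V d × V d) (F' := ℝ)).finrank_eq]
    exact Subspace.dual_finrank_eq
  rw [Module.finrank_prod (M := V d × V d), Module.finrank_prod (M := V d × V d) (M' := _ →L[ℝ] ℝ), h]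

attribute [local irreducible] MChart.pairing ThetaChart.coform ThetaChart.comps

section Ident

variable [T2Space X]

theorem CotM.overInterior_of_eq_prod {τ : CotM θ} {ζ ζ' : ThetaCot θ}
    (h : τ.1 = ζ.1 ×ˢ map (dil (-1)) ζ'.1) (hζ : ζ.OverInterior) (hζ' : ζ'.OverInterior) :
    τ.OverInterior := by
  obtain ⟨p, hp, h1⟩ := hζ
  obtain ⟨p', hp', h2⟩ := hζ'
  refine ⟨p, hp, p', hp', ?_⟩
  unfold CotM.IsOver
  rw [h]
  have h3 : Tendsto (fun q : Cot d X => q.proj) (map (dil (-1)) ζ'.1) (𝓝 p') :=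
    tendsto_map'_iff.2 h2
  exact (h1.comp tendsto_fst).prodMk_nhds (h3.comp tendsto_snd)

theorem CotM.exists_eq_prod {τ : CotM θ} (h : τ.OverInterior) :
    ∃ ζ ζ' : ThetaCot θ, ζ.OverInterior ∧ ζ'.OverInterior ∧
      τ.1 = ζ.1 ×ˢ map (dil (-1)) ζ'.1 := by
  obtain ⟨m, b, hb, hτ⟩ := τ.exists_germ
  have hbi := (CotM.overInterior_iff hb hτ).1 h
  have hm := blowdown_mem hb
  refine ⟨BSpace.mk m.left (m.split b).1 hm.1, BSpace.mk m.right (m.split b).2 hm.2, ?_, ?_, ?_⟩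
  · exact (ThetaCot.overInterior_iff (c := m.left) (a := (m.split b).1) hm.1 rfl).2 hbi.2.1
  · exact (ThetaCot.overInterior_iff (c := m.right) (a := (m.split b).2) hm.2 rfl).2 hbi.2.2
  · exact hτ.trans (germ_eq_prod hbi)

theorem map_dil_neg_one_injective {l l' : Filter (Cot d X)}
    (h : map (dil (-1)) l = map (dil (-1)) l') : l = l' := by
  have h1 : ∀ q : Cot d X, dil (-1) (dil (-1) q) = q := fun q => by
    unfold dil
    have h2 : ∀ ξ : V d →L[ℝ] ℝ, (-1 : ℝ) • (-1 : ℝ) • ξ = ξ := fun ξ =>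
      ContinuousLinearMap.ext fun u => by
        change (-1 : ℝ) * ((-1 : ℝ) * ξ u) = ξ u
        ring
    exact Bundle.TotalSpace.ext rfl (heq_of_eq (h2 q.snd))
  have h2 := congrArg (map (dil (-1))) h
  rw [Filter.map_map, Filter.map_map] at h2
  have h3 : (dil (-1) ∘ dil (-1) : Cot d X → Cot d X) = id := funext h1
  rwa [h3, Filter.map_id, Filter.map_id] at h2

theorem CotM.eq_of_eq_prod {ζ ζ' ξ ξ' : ThetaCot θ}
    (h : ζ.1 ×ˢ map (dil (-1)) ζ'.1 = ξ.1 ×ˢ map (dil (-1)) ξ'.1) : ζ = ξ ∧ ζ' = ξ' := by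
  have n1 := ζ.neBot
  have n2 := ζ'.neBot
  have n3 := ξ.neBot
  have n4 := ξ'.neBot
  constructor
  · have := congrArg (map Prod.fst) h
    rw [map_fst_prod, map_fst_prod] at this
    exact Subtype.ext this
  · have := congrArg (map Prod.snd) h
    rw [map_snd_prod, map_snd_prod] at this
    exact Subtype.ext (map_dil_neg_one_injective this)

theorem exists_prod_germ {ζ ζ' : ThetaCot θ} {c c' : ThetaChart θ} {a a' : V d × V d}
    (ha : a ∈ (thetaAtlas θ c).dom) (ha' : a' ∈ (thetaAtlas θ c').dom)
    (h : ζ.1 = (thetaAtlas θ c).germ a) (h' : ζ'.1 = (thetaAtlas θ c').germ a')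
    (h0 : 0 < a.1 0) (h0' : 0 < a'.1 0) :
    (mAtlas θ (MChart.prod c c')).germ ((a.1, a'.1),
      (MChart.prod c c').pairing (a.1, a'.1) a.2 a'.2) = ζ.1 ×ˢ map (dil (-1)) ζ'.1 := by
  rw [germ_pairing (prod_mem_baseInner ha ha' h0 h0'), h, h']
  rfl

variable (θ) in
theorem exists_isIdentification : ∃ φ : ThetaCot θ × ThetaCot θ → CotM θ, IsIdentification φ := by
  have : ∀ q : ThetaCot θ × ThetaCot θ, ∃ τ : CotM θ, q.1.OverInterior → q.2.OverInterior →
      τ.1 = q.1.1 ×ˢ map (dil (-1)) q.2.1 := fun q => by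
    by_cases hq : q.1.OverInterior ∧ q.2.OverInterior
    · obtain ⟨c, a, ha, h⟩ := q.1.exists_germ
      obtain ⟨c', a', ha', h'⟩ := q.2.exists_germ
      have h0 := (ThetaCot.overInterior_iff ha h).1 hq.1
      have h0' := (ThetaCot.overInterior_iff ha' h').1 hq.2
      exact ⟨BSpace.mk (MChart.prod c c') ((a.1, a'.1),
        (MChart.prod c c').pairing (a.1, a'.1) a.2 a'.2)
        (prod_mem_baseInner ha ha' h0 h0').1, fun _ _ => exists_prod_germ ha ha' h h' h0 h0'⟩
    -- Outside the interior the identification is unconstrained, so any covector serves.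
    · obtain ⟨τ⟩ := nonempty_cotM q.1
      exact ⟨τ, fun h1 h2 => (hq ⟨h1, h2⟩).elim⟩
  choose φ hφ using this
  exact ⟨φ, fun ζ ζ' h h' => hφ (ζ, ζ') h h'⟩

theorem IsIdentification.germ_prod {φ : ThetaCot θ × ThetaCot θ → CotM θ}
    (hφ : IsIdentification φ) {ζ ζ' : ThetaCot θ} {c c' : ThetaChart θ} {a a' : V d × V d}
    (ha : a ∈ (thetaAtlas θ c).dom) (ha' : a' ∈ (thetaAtlas θ c').dom)
    (h : ζ.1 = (thetaAtlas θ c).germ a) (h' : ζ'.1 = (thetaAtlas θ c').germ a')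
    (h0 : 0 < a.1 0) (h0' : 0 < a'.1 0) :
    (φ (ζ, ζ')).1 = (mAtlas θ (MChart.prod c c')).germ ((a.1, a'.1),
      (MChart.prod c c').pairing (a.1, a'.1) a.2 a'.2) :=
  (hφ ζ ζ' ((ThetaCot.overInterior_iff ha h).2 h0) ((ThetaCot.overInterior_iff ha' h').2 h0')).trans
    (exists_prod_germ ha ha' h h' h0 h0').symm

theorem pairing_prod_apply (c c' : ThetaChart θ) (a u : V d × V d) (v v' : V d) :
    (MChart.prod c c').pairing a v v' u = c.coform a.1 v u.1 - c'.coform a.2 v' u.2 := by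
  have : (MChart.prod c c').blowdown = id := rfl
  unfold pairing
  rw [this, fderiv_id]
  simp [MChart.left, MChart.right]

theorem IsIdentification.isCanonicalDiffeoOverInterior {φ : ThetaCot θ × ThetaCot θ → CotM θ}
    (hφ : IsIdentification φ) : IsCanonicalDiffeoOverInterior φ := by
  refine ⟨⟨fun q hq => CotM.overInterior_of_eq_prod (hφ _ _ hq.1 hq.2) hq.1 hq.2, ?_, ?_⟩, ?_⟩
  · intro q hq q' hq' h
    have h1 := (hφ _ _ hq.1 hq.2).symm.trans ((congrArg Subtype.val h).trans (hφ _ _ hq'.1 hq'.2))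
    obtain ⟨h2, h3⟩ := CotM.eq_of_eq_prod h1
    exact Prod.ext h2 h3
  · intro τ hτ
    obtain ⟨ζ, ζ', h, h', e⟩ := CotM.exists_eq_prod hτ
    exact ⟨(ζ, ζ'), ⟨h, h'⟩, Subtype.ext ((hφ _ _ h h').trans e.symm)⟩
  · intro ζ ζ' hζ hζ'
    obtain ⟨c, a, ha, h⟩ := ζ.exists_germ
    obtain ⟨c', a', ha', h'⟩ := ζ'.exists_germ
    have h0 := (ThetaCot.overInterior_iff ha h).1 hζ
    have h0' := (ThetaCot.overInterior_iff ha' h').1 hζ'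
    have hbi := prod_mem_baseInner ha ha' h0 h0'
    set m := MChart.prod c c'
    set G : (V d × V d) × (V d × V d) → CV d := fun b =>
      ((b.1.1, b.2.1), m.pairing (b.1.1, b.2.1) b.1.2 b.2.2) with hG
    have hGs : ContDiffAt ℝ ∞ G (a, a') := by
      have e1 : ContDiffAt ℝ ∞ (fun b : (V d × V d) × (V d × V d) =>
        ((b.1.1, b.2.1), (b.1.2, b.2.2))) (a, a') := by fun_prop
      have e2 : ContDiffAt ℝ ∞ (fun b : (V d × V d) × (V d × V d) => (b.1.1, b.2.1)) (a, a') := by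
        fun_prop
      have e3 := ContDiffAt.comp (a, a') (contDiffAt_pairing hbi a.2 a'.2) e1
      exact e2.prodMk e3
    have hpos : ∀ᶠ b in 𝓝 (a, a'), (b.1.1, b.2.1) ∈ m.baseInner := by
      have : Continuous fun b : (V d × V d) × (V d × V d) => (b.1.1, b.2.1) := by fun_prop
      exact (this.tendsto (a, a')).eventually (baseInner_mem_nhds hbi)
    refine ⟨c, c', m, a, a', G, ha, ha', h, h', hGs, ?_, ?_, ?_⟩
    · filter_upwards [hpos] with b hb
      refine ⟨hb.1, fun q q' hq hq' => ?_⟩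
      exact hφ.germ_prod hb.1.1 hb.1.2.1 hq hq' hb.2.1 hb.2.2
    -- `split` is a left inverse of `G` near the point, and source and target have equal dimension.
    · have hinj : Function.Injective (fderiv ℝ G (a, a')) := by
        have hbi' : (G (a, a')).1 ∈ m.baseInner := hbi
        have e1 : (fun b => m.split (G b)) =ᶠ[𝓝 (a, a')] id := by
          filter_upwards [hpos] with b hb
          exact split_pairing hb b.1.2 b.2.2
        have e2 := ((contDiffAt_split hbi').differentiableAt (by simp)).hasFDerivAt.comp (a, a')
          (hGs.differentiableAt (by simp)).hasFDerivAt
        have e3 := (hasFDerivAt_id (𝕜 := ℝ) (a, a')).congr_of_eventuallyEq e1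
        have e4 := e2.unique e3
        intro u v huv
        have e5 := congrArg (fderiv ℝ m.split (G (a, a'))) huv
        have e6 : ∀ u, fderiv ℝ m.split (G (a, a')) (fderiv ℝ G (a, a') u) = u :=
          fun u => DFunLike.congr_fun e4 u
        rwa [e6, e6] at e5
      exact ⟨hinj, (LinearMap.injective_iff_surjective_of_finrank_eq_finrank
        (f := (fderiv ℝ G (a, a')).toLinearMap) finrank_CV).1 hinj⟩
    · intro u
      have e1 : HasFDerivAt (fun b : (V d × V d) × (V d × V d) => (b.1.1, b.2.1))
          (((ContinuousLinearMap.fst ℝ _ _).comp (ContinuousLinearMap.fst ℝ _ _)).prod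
            ((ContinuousLinearMap.fst ℝ _ _).comp (ContinuousLinearMap.snd ℝ _ _))) (a, a') :=
        (((ContinuousLinearMap.fst ℝ _ _).comp (ContinuousLinearMap.fst ℝ _ _)).prod
            ((ContinuousLinearMap.fst ℝ _ _).comp
              (ContinuousLinearMap.snd ℝ (V d × V d) (V d × V d)))).hasFDerivAt
      have e2 := (hGs.differentiableAt (by simp)).hasFDerivAt.fst
      have e3 := DFunLike.congr_fun (e2.unique e1) u
      have e4 : (fderiv ℝ G (a, a') u).1 = (u.1.1, u.2.1) := e3
      rw [e4]
      exact pairing_prod_apply c c' _ _ _ _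

end Ident

end ThetaCalc

end

noncomputable section
namespace ThetaCalc
set_option linter.unusedSectionVars false

/-! ### Changes of charts of the stretched product -/

variable {d : ℕ} {X : Type*} [TopologicalSpace X] [ChartedSpace (EuclideanHalfSpace (d + 2)) X]
  [IsManifold (𝓡∂ (d + 2)) ∞ X]
  {θ : ∀ p : X, TangentSpace (𝓡∂ (d + 2)) p →L[ℝ] ℝ}

open ThetaChart MChart

/-- Provides genuine derivatives at the points of `t` that extend continuously to the boundary point
`a`, so that differentials of transition maps have limits there. -/
theorem exists_eventually_hasFDerivAt {E F : Type*} [NormedAddCommGroup E]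
    [NormedSpace ℝ E] [NormedAddCommGroup F] [NormedSpace ℝ F] {f : E → F} {s t : Set E} {a : E}
    (hf : ContDiffWithinAt ℝ ∞ f s a) (ha : a ∈ s) (ht : t ⊆ s) (hn : ∀ b ∈ t, t ∈ 𝓝 b) :
    ∃ D : E → E →L[ℝ] F, ContinuousWithinAt D s a ∧
      ∀ᶠ b in 𝓝[t] a, HasFDerivAt f (D b) b := by
  have hf1 : ContDiffWithinAt ℝ (0 + 1) f s a := hf.of_le (by simp)
  obtain ⟨u, hu, -, D, hD, hDc⟩ := (contDiffWithinAt_succ_iff_hasFDerivWithinAt (by simp)).1 hf1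
  rw [insert_eq_of_mem ha] at hu
  refine ⟨D, hDc.continuousWithinAt.mono_of_mem_nhdsWithin hu, ?_⟩
  have h1 : ∀ᶠ b in 𝓝[s] a, u ∈ 𝓝[s] b := eventually_eventually_nhdsWithin.2 hu
  filter_upwards [nhdsWithin_mono a ht h1, nhdsWithin_mono a ht hu, self_mem_nhdsWithin]
    with b h2 h3 h4
  have h5 : 𝓝[s] b = 𝓝 b := nhdsWithin_eq_nhds.2 (mem_of_superset (hn b h4) ht)
  rw [h5] at h2
  exact (hD b h3).hasFDerivAt h2

/-- `T` is compatible with the blow-down maps at the point `b` over the interior. -/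
structure MChart.Compat (m m₂ : MChart θ) (T : V d × V d → V d × V d) (b : V d × V d) : Prop where
  mem : T b ∈ m₂.baseInner
  left : (m.blowdown b).1 ∈ m.left.overlap m₂.left
  right : (m.blowdown b).2 ∈ m.right.overlap m₂.right
  eq : m₂.blowdown (T b) =
    (m.left.change m₂.left (m.blowdown b).1, m.right.change m₂.right (m.blowdown b).2)

theorem ThetaChart.hasFDerivAt_change {c c' : ThetaChart θ} {x : V d} (h : x ∈ c.overlap c')
    (h0 : 0 < x 0) : HasFDerivAt (c.change c') (dchange c c' x) x :=
  (hasFDerivWithinAt_change h).hasFDerivAt (HS_mem_nhds h0)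

/-- Differentiating the identity between the two blow-down maps expresses `D` after the inverse
differential of one of them through the inverse differential of the other and the base changes. The
pulled back covector therefore has the same left and right parts. -/
theorem MChart.toFun_eq_of_compat {m m₂ : MChart θ} {T' : V d × V d → V d × V d} {b b₂ : V d × V d}
    (hb : b ∈ m.baseInner) (hb₂ : b₂ ∈ m₂.baseInner) (hT : T' b₂ = b)
    {D : V d × V d →L[ℝ] V d × V d} (hD : HasFDerivAt T' D b₂)
    (h : ∀ᶠ y in 𝓝 b₂, m₂.Compat m T' y) (η : V d × V d →L[ℝ] ℝ) :
    (mAtlas θ m₂).toFun (b₂, η.comp D) = (mAtlas θ m).toFun (b, η) := by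
  obtain ⟨-, hl, hr, he⟩ := h.self_of_nhds
  rw [hT] at he
  have e1 : HasFDerivAt (fun y => m.blowdown (T' y)) ((fderiv ℝ m.blowdown b).comp D) b₂ := by
    refine HasFDerivAt.comp (g := m.blowdown) b₂ ?_ hD
    rw [hT]
    exact ((contDiffAt_blowdown hb).differentiableAt (by simp)).hasFDerivAt
  have e2 := ((contDiffAt_blowdown hb₂).differentiableAt (by simp)).hasFDerivAt
  have e3 := ((hasFDerivAt_change hl hb₂.2.1).comp b₂ e2.fst).prodMk
    ((hasFDerivAt_change hr hb₂.2.2).comp b₂ e2.snd)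
  have e4 := e1.unique (e3.congr_of_eventuallyEq (h.mono fun y hy => hy.eq))
  have e5 : ∀ u, fderiv ℝ m.blowdown b (D ((fderiv ℝ m₂.blowdown b₂).inverse u)) =
      (dchange m₂.left m.left (m₂.blowdown b₂).1 u.1,
        dchange m₂.right m.right (m₂.blowdown b₂).2 u.2) := fun u => by
    have := DFunLike.congr_fun e4 ((fderiv ℝ m₂.blowdown b₂).inverse u)
    simp only [ContinuousLinearMap.comp_apply, ContinuousLinearMap.prod_apply,
      ContinuousLinearMap.coe_fst', ContinuousLinearMap.coe_snd', fderiv_inverse_apply hb₂] at this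
    exact this
  have e6 : ∀ u, D ((fderiv ℝ m₂.blowdown b₂).inverse u) = (fderiv ℝ m.blowdown b).inverse
      (dchange m₂.left m.left (m₂.blowdown b₂).1 u.1,
        dchange m₂.right m.right (m₂.blowdown b₂).2 u.2) := fun u => by
    rw [← e5, inverse_fderiv_apply hb]
  refine Prod.ext ?_ ?_
  · change m₂.left.cov _ _ = m.left.cov (m.blowdown b).1 _
    rw [he, cov_change hl]
    congr 1
    refine ContinuousLinearMap.ext fun u => ?_
    simp only [ContinuousLinearMap.comp_apply, ContinuousLinearMap.inl_apply, e6, map_zero]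
  · change m₂.right.cov _ _ = m.right.cov (m.blowdown b).2 _
    rw [he, cov_change hr]
    congr 1
    refine ContinuousLinearMap.ext fun u => ?_
    simp only [ContinuousLinearMap.comp_apply, ContinuousLinearMap.inr_apply, e6, map_zero]

theorem MChart.tendsto_transition {m m₂ : MChart θ} {T : V d × V d → V d × V d} {a : V d × V d}
    (hT : ContDiffWithinAt ℝ ∞ T m.dom a) (h : ∀ᶠ b in 𝓝[m.baseInner] a, m.Compat m₂ T b) :
    Tendsto T (𝓝[m.baseInner] a) (𝓝[m₂.baseInner] (T a)) :=
  tendsto_nhdsWithin_iff.2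
    ⟨hT.continuousWithinAt.mono (fun _ hb => hb.1), h.mono fun _ hb => hb.mem⟩

theorem MChart.germ_le_of_compat {m m₂ : MChart θ} {T T' : V d × V d → V d × V d}
    {D : V d × V d → V d × V d →L[ℝ] V d × V d} {a : V d × V d}
    (hT : ContDiffWithinAt ℝ ∞ T m.dom a)
    (h : ∀ᶠ b in 𝓝[m.baseInner] a, m.Compat m₂ T b)
    (hTT : ∀ᶠ b in 𝓝[m.baseInner] a, T' (T b) = b)
    (hD : ContinuousWithinAt D m₂.dom (T a))
    (hD' : ∀ᶠ y in 𝓝[m₂.baseInner] (T a), HasFDerivAt T' (D y) y)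
    (h' : ∀ᶠ y in 𝓝[m₂.baseInner] (T a), m₂.Compat m T' y)
    (η : V d × V d →L[ℝ] ℝ) :
    (mAtlas θ m).germ (a, η) ≤ (mAtlas θ m₂).germ (T a, η.comp (D (T a))) := by
  have hT1 := tendsto_transition hT h
  have hT2 : Tendsto (fun b => D (T b)) (𝓝[m.baseInner] a) (𝓝 (D (T a))) :=
    hD.tendsto.comp (hT1.mono_right (nhdsWithin_mono _ fun _ hb => hb.1))
  have hfst : Tendsto Prod.fst (𝓝[(mAtlas θ m).inner] (a, η)) (𝓝[m.baseInner] a) :=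
    tendsto_fst_inner
  have h1 : Tendsto (fun b : CV d => (T b.1, b.2.comp (D (T b.1))))
      (𝓝[(mAtlas θ m).inner] (a, η)) (𝓝[(mAtlas θ m₂).inner] (T a, η.comp (D (T a)))) := by
    refine tendsto_nhdsWithin_iff.2 ⟨Tendsto.prodMk_nhds
      ((hT1.mono_right nhdsWithin_le_nhds).comp hfst) ?_, ?_⟩
    · have e1 : Tendsto (fun b : CV d => b.2) (𝓝[(mAtlas θ m).inner] (a, η)) (𝓝 η) :=
        continuous_snd.continuousWithinAt
      have hc : Continuous fun p : (V d × V d →L[ℝ] ℝ) × (V d × V d →L[ℝ] V d × V d) =>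
        p.1.comp p.2 := by fun_prop
      exact (hc.tendsto (η, D (T a))).comp (e1.prodMk_nhds (hT2.comp hfst))
    · exact (hfst.eventually h).mono fun b hb => hb.mem
  unfold BChart.germ
  refine le_trans (le_of_eq ?_) (Filter.map_mono h1)
  rw [Filter.map_map]
  refine Filter.map_congr ?_
  have h2 : ∀ᶠ y in 𝓝[m₂.baseInner] (T a), ∀ᶠ y' in 𝓝 y, m₂.Compat m T' y' := by
    filter_upwards [eventually_eventually_nhdsWithin.2 h', self_mem_nhdsWithin] with y hy hy'
    rwa [nhdsWithin_eq_nhds.2 (baseInner_mem_nhds hy')] at hy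
  filter_upwards [self_mem_nhdsWithin, hfst.eventually h, hfst.eventually hTT,
    (hT1.comp hfst).eventually hD', (hT1.comp hfst).eventually h2] with b b1 b2 b3 b4 b5
  exact (toFun_eq_of_compat b1 b2.mem b3 b4 b5 b.2).symm

/-- Two transition maps, smooth up to the boundary and mutually inverse over the interior, give
inclusions of germs both ways. The composite of the two comparisons is the identity because, by
density of the interior, the limits of their differentials are inverse to each other. -/
theorem MChart.germ_eq_of_compat {m m₂ : MChart θ} {T T' : V d × V d → V d × V d} {a : V d × V d}
    (ha : a ∈ m.dom) (ha₂ : T a ∈ m₂.dom)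
    (hT : ContDiffWithinAt ℝ ∞ T m.dom a) (hT' : ContDiffWithinAt ℝ ∞ T' m₂.dom (T a))
    (h : ∀ᶠ b in 𝓝[m.baseInner] a, m.Compat m₂ T b)
    (h' : ∀ᶠ y in 𝓝[m₂.baseInner] (T a), m₂.Compat m T' y)
    (hTT : ∀ᶠ b in 𝓝[m.baseInner] a, T' (T b) = b)
    (hTT' : ∀ᶠ y in 𝓝[m₂.baseInner] (T a), T (T' y) = y) (η : V d × V d →L[ℝ] ℝ) :
    ∃ η', (mAtlas θ m).germ (a, η) = (mAtlas θ m₂).germ (T a, η') := by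
  obtain ⟨D, hD, hDe⟩ := exists_eventually_hasFDerivAt hT ha (t := m.baseInner)
    (fun _ hb => hb.1) fun b hb => baseInner_mem_nhds hb
  obtain ⟨D', hD', hDe'⟩ := exists_eventually_hasFDerivAt hT' ha₂ (t := m₂.baseInner)
    (fun _ hb => hb.1) fun b hb => baseInner_mem_nhds hb
  have hne : (𝓝[m.baseInner] a).NeBot :=
    mem_closure_iff_nhdsWithin_neBot.1 (dom_subset_closure_baseInner ha)
  have hT1 := tendsto_transition hT h
  have hT1' := tendsto_transition hT' h'
  have hTa : T' (T a) = a :=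
    tendsto_nhds_unique (((hT1'.comp hT1).mono_right nhdsWithin_le_nhds).congr'
      (hTT.mono fun b hb => hb)) nhdsWithin_le_nhds
  have hcomp : (D' (T a)).comp (D a) = ContinuousLinearMap.id ℝ _ := by
    have e1 : Tendsto (fun b => (D' (T b)).comp (D b)) (𝓝[m.baseInner] a)
        (𝓝 ((D' (T a)).comp (D a))) := by
      have hc : Continuous fun p : (V d × V d →L[ℝ] V d × V d) × (V d × V d →L[ℝ] V d × V d) =>
        p.1.comp p.2 := by fun_prop
      exact (hc.tendsto (D' (T a), D a)).comp (Tendsto.prodMk_nhds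
        (hD'.tendsto.comp (hT1.mono_right (nhdsWithin_mono _ fun _ hb => hb.1)))
        (hD.mono_left (nhdsWithin_mono _ fun _ hb => hb.1)))
    refine tendsto_nhds_unique e1 (tendsto_const_nhds.congr' ?_)
    have e2 : ∀ᶠ b in 𝓝[m.baseInner] a, ∀ᶠ b' in 𝓝 b, T' (T b') = b' := by
      filter_upwards [eventually_eventually_nhdsWithin.2 hTT, self_mem_nhdsWithin] with y hy hy'
      rwa [nhdsWithin_eq_nhds.2 (baseInner_mem_nhds hy')] at hy
    filter_upwards [e2, hDe, hT1.eventually hDe'] with b b1 b2 b3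
    exact ((hasFDerivAt_id b).congr_of_eventuallyEq b1).unique (b3.comp b b2)
  refine ⟨η.comp (D' (T a)), le_antisymm (germ_le_of_compat hT h hTT hD' hDe' h' η) ?_⟩
  have e := germ_le_of_compat (T := T') (T' := T) (D := D) (a := T a) hT' h' hTT'
    (by rwa [hTa]) (by rwa [hTa]) (by rwa [hTa]) (η.comp (D' (T a)))
  rwa [hTa, ContinuousLinearMap.comp_assoc, hcomp, ContinuousLinearMap.comp_id] at e

end ThetaCalc

end

noncomputable section
namespace ThetaCalc
set_option linter.unusedSectionVars false

/-! ### Passage to the projective chart where ρ' dominates -/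

variable {d : ℕ} {X : Type*} [TopologicalSpace X] [ChartedSpace (EuclideanHalfSpace (d + 2)) X]
  [IsManifold (𝓡∂ (d + 2)) ∞ X]
  {θ : ∀ p : X, TangentSpace (𝓡∂ (d + 2)) p →L[ℝ] ℝ}

open ThetaChart MChart

theorem frontLeft_unique {c : ThetaChart θ} {k : Option (Fin (d + 2))} {pos : Bool}
    {a : V d × V d} {x : V d} (hr : frontRight k pos a ∈ c.target)
    (h0 : x 0 = slot k a * omega k pos a 0)
    (hi : ∀ i, i ≠ 0 → i ≠ Fin.last (d + 1) →
      x i = (frontRight k pos a) i + slot k a * omega k pos a i)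
    (hl : c.form (frontRight k pos a) (x - frontRight k pos a) =
      slot k a ^ 2 * omega k pos a (Fin.last (d + 1))) :
    frontLeft c k pos a = x := by
  have h : frontLeft c k pos a - frontRight k pos a = x - frontRight k pos a := by
    refine eq_of_form_eq hr (fun i hi' => ?_) ((form_frontLeft_sub hr).trans hl.symm)
    simp only [PiLp.sub_apply]
    congr 1
    by_cases h : i = 0
    · rw [h, frontLeft_zero, h0]
    · rw [frontLeft_of_ne _ h hi', hi i h hi', frontRight_of_ne _ h]
  exact sub_left_injective h

/-! #### The dominating function `ρ'` -/

@[simp] theorem slot_none (a : V d × V d) : slot none a = a.2 0 := rfl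

@[simp] theorem omegaR_none (a : V d × V d) : omegaR none true a = 1 := by simp [omegaR, sgn]

@[simp] theorem omega_none (pos : Bool) (a : V d × V d) (i : Fin (d + 2)) :
    omega none pos a i = a.1 i := by simp [omega]

@[simp] theorem frontRight_none (a : V d × V d) : frontRight none true a = a.2 := by
  refine PiLp.ext fun i => ?_
  by_cases hi : i = 0
  · rw [hi, frontRight_zero]; simp
  · rw [frontRight_of_ne _ hi]

theorem mem_none_dom {c : ThetaChart θ} {a : V d × V d} : a ∈ (front c none true).dom ↔
    0 ≤ a.1 0 ∧ frontLeft c none true a ∈ c.target ∧ a.2 ∈ c.target := by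
  rw [mem_front_dom]
  simp only [slot_none, omega_none, omegaR_none, frontRight_none]
  exact ⟨fun h => ⟨h.2.1, h.2.2.2⟩, fun h => ⟨nonneg h.2.2, h.1, zero_le_one, h.2⟩⟩

theorem mem_none_baseInner {c : ThetaChart θ} {a : V d × V d} :
    a ∈ (front c none true).baseInner ↔
    0 < a.1 0 ∧ 0 < a.2 0 ∧ frontLeft c none true a ∈ c.target ∧ a.2 ∈ c.target := by
  constructor
  · intro h
    have h1 := front_pos h
    simp only [slot_none, omega_none, omegaR_none] at h1
    exact ⟨h1.2.1, h1.1, (mem_none_dom.1 h.1).2⟩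
  · intro h
    refine ⟨mem_none_dom.2 ⟨h.1.le, h.2.2⟩, ?_, ?_⟩
    · change 0 < (frontLeft c none true a) 0
      rw [frontLeft_zero]
      simpa using mul_pos h.2.1 h.1
    · change 0 < (frontRight none true a) 0
      simpa using h.2.1

theorem injOn_blowdown_none {c : ThetaChart θ} :
    InjOn (front c none true).blowdown (front c none true).baseInner := by
  intro a ha b hb h
  have h1 : a.2 = b.2 := by
    have := congrArg Prod.snd h
    change frontRight none true a = frontRight none true b at this
    simpa using this
  have h2 : frontLeft c none true a = frontLeft c none true b := congrArg Prod.fst h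
  obtain ⟨-, hs, -, hr⟩ := mem_none_baseInner.1 ha
  refine Prod.ext (PiLp.ext fun i => ?_) h1
  by_cases hl : i = Fin.last (d + 1)
  · have e1 := form_frontLeft_sub (c := c) (k := none) (pos := true) (a := a) (by simpa using hr)
    have e2 := form_frontLeft_sub (c := c) (k := none) (pos := true) (a := b)
      (by simpa [← h1] using hr)
    simp only [h2, frontRight_none, h1] at e1 e2
    have e3 := e1.symm.trans e2
    simp only [slot_none, omega_none, h1] at e3
    rw [h1] at hs
    rw [hl]
    exact mul_left_cancel₀ (pow_pos hs 2).ne' e3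
  · have e3 := congrArg (fun v : V d => v i) h2
    by_cases h0 : i = 0
    · subst h0
      simp only [frontLeft_zero, slot_none, omega_none, h1] at e3
      rw [h1] at hs
      exact mul_left_cancel₀ hs.ne' e3
    · simp only [frontLeft_of_ne _ h0 hl, slot_none, omega_none, h1] at e3
      rw [h1] at hs
      exact mul_left_cancel₀ hs.ne' (add_left_cancel e3)

theorem ThetaChart.mem_overlap_self {c : ThetaChart θ} {x : V d} (hx : x ∈ c.target) :
    x ∈ c.overlap c ∧ c.change c x = x := change_eq_of_pt_eq hx hx rfl

theorem compat_of_blowdown_eq {m m₂ : MChart θ} {T : V d × V d → V d × V d} {b : V d × V d}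
    {c : ThetaChart θ} (hl : m.left = c) (hr : m.right = c) (hl₂ : m₂.left = c) (hr₂ : m₂.right = c)
    (hb : b ∈ m.dom) (hT : T b ∈ m₂.baseInner) (h : m₂.blowdown (T b) = m.blowdown b) :
    m.Compat m₂ T b := by
  have h1 := blowdown_mem hb
  rw [hl, hr] at h1
  have e1 := mem_overlap_self h1.1
  have e2 := mem_overlap_self h1.2
  refine ⟨hT, ?_, ?_, ?_⟩
  · rw [hl, hl₂]; exact e1.1
  · rw [hr, hr₂]; exact e2.1
  · rw [h, hl, hl₂, hr, hr₂, e1.2, e2.2]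

/-- The weight of the rescaled function `ω_i`. -/
def wt (i : Fin (d + 2)) : ℕ := if i = Fin.last (d + 1) then 2 else 1

/-- The change from a projective chart to the one where `ρ'` dominates. -/
def toNone (k : Option (Fin (d + 2))) (pos : Bool) (b : V d × V d) : V d × V d :=
  (WithLp.toLp 2 fun i => omega k pos b i / omegaR k pos b ^ wt i, frontRight k pos b)

/-- The value of `1 / ω_R` in terms of the coordinates where `ρ'` dominates. -/
def scaleNone (j : Fin (d + 2)) (pos : Bool) (y : V d × V d) : ℝ :=
  -- In the new chart the j-th coordinate is ± ω_R to the power minus its weight, so recovering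
  -- 1/ω_R takes a square root when the weight is two.
  if j = Fin.last (d + 1) then √(sgn pos * y.1 j) else sgn pos * y.1 j

/-- The inverse of `toNone`. -/
def ofNone (j : Fin (d + 2)) (pos : Bool) (y : V d × V d) : V d × V d :=
  (WithLp.toLp 2 fun i => if i = j then y.2 0 * scaleNone j pos y
      else y.1 i / scaleNone j pos y ^ wt i,
    WithLp.toLp 2 fun i => if i = 0 then 1 / scaleNone j pos y else y.2 i)

theorem blowdown_toNone {c : ThetaChart θ} {k : Option (Fin (d + 2))} {pos : Bool}
    {b : V d × V d} (hr : frontRight k pos b ∈ c.target) (hR : omegaR k pos b ≠ 0) :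
    (front c none true).blowdown (toNone k pos b) = (front c k pos).blowdown b := by
  have e : frontRight none true (toNone k pos b) = frontRight k pos b := by
    rw [frontRight_none]; rfl
  have es : slot none (toNone k pos b) = slot k b * omegaR k pos b := by
    change (frontRight k pos b) 0 = _
    rw [frontRight_zero]
  have eo : ∀ i, omega none true (toNone k pos b) i = omega k pos b i / omegaR k pos b ^ wt i :=
    fun i => by rw [omega_none]; rfl
  refine Prod.ext ?_ e
  refine frontLeft_unique (by rwa [e]) ?_ ?_ ?_
  · change (frontLeft c k pos b) 0 = _
    rw [frontLeft_zero, es, eo, wt, if_neg zero_ne_last']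
    field_simp
  · intro i h0 hl
    change (frontLeft c k pos b) i = _
    rw [frontLeft_of_ne _ h0 hl, e, es, eo, frontRight_of_ne _ h0, wt, if_neg hl]
    field_simp
  · rw [e, es, eo, wt, if_pos rfl]
    refine (form_frontLeft_sub hr).trans ?_
    field_simp

theorem scaleNone_pow {j : Fin (d + 2)} {pos : Bool} {y : V d × V d} (h : 0 < scaleNone j pos y) :
    scaleNone j pos y ^ wt j = sgn pos * y.1 j := by
  unfold scaleNone wt at *
  split_ifs with hj
  · rw [if_pos hj] at h
    exact Real.sq_sqrt (Real.sqrt_pos.1 h).le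
  · simp

theorem toNone_ofNone {j : Fin (d + 2)} {pos : Bool} {y : V d × V d}
    (h : 0 < scaleNone j pos y) : toNone (some j) pos (ofNone j pos y) = y := by
  have hR : omegaR (some j) pos (ofNone j pos y) = 1 / scaleNone j pos y := by
    simp [omegaR, ofNone]
  have hs : slot (some j) (ofNone j pos y) = y.2 0 * scaleNone j pos y := by
    simp [slot, ofNone]
  refine Prod.ext (PiLp.ext fun i => ?_) (PiLp.ext fun i => ?_)
  · change omega (some j) pos (ofNone j pos y) i / _ ^ _ = _
    rw [hR]
    by_cases hi : j = i
    · subst hi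
      simp only [omega, if_true]
      rw [one_div, inv_pow, scaleNone_pow h, div_inv_eq_mul, ← mul_assoc, sgn_mul_self, one_mul]
    · have hi' : ¬ i = j := fun h => hi h.symm
      simp only [omega, Option.some.injEq, hi, if_false, ofNone, hi']
      rw [one_div, inv_pow, div_inv_eq_mul, div_mul_cancel₀ _ (pow_pos h _).ne']
  · change (frontRight (some j) pos (ofNone j pos y)) i = _
    by_cases hi : i = 0
    · rw [hi, frontRight_zero, hR, hs]
      field_simp
    · rw [frontRight_of_ne _ hi]
      simp [ofNone, hi]

theorem scaleNone_toNone {j : Fin (d + 2)} {pos : Bool} {b : V d × V d}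
    (h : 0 < omegaR (some j) pos b) :
    scaleNone j pos (toNone (some j) pos b) = 1 / omegaR (some j) pos b := by
  have e : sgn pos * (toNone (some j) pos b).1 j = 1 / omegaR (some j) pos b ^ wt j := by
    simp only [toNone, omega, if_true]
    rw [← mul_div_assoc, sgn_mul_self]
  unfold scaleNone
  rw [e, wt]
  split_ifs with hj
  · rw [← one_div_pow, Real.sqrt_sq (by positivity)]
  · rw [pow_one]

theorem ofNone_toNone {j : Fin (d + 2)} {pos : Bool} {b : V d × V d}
    (h : 0 < omegaR (some j) pos b) : ofNone j pos (toNone (some j) pos b) = b := by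
  refine Prod.ext (PiLp.ext fun i => ?_) (PiLp.ext fun i => ?_)
  · simp only [ofNone, scaleNone_toNone h]
    split_ifs with hi
    · change (frontRight (some j) pos b) 0 * _ = _
      rw [frontRight_zero, hi]
      simp only [slot]
      field_simp
    · have hi' : ¬ j = i := fun h => hi h.symm
      simp only [toNone, omega, Option.some.injEq, hi', if_false]
      rw [one_div, inv_pow, div_inv_eq_mul, div_mul_cancel₀ _ (pow_pos h _).ne']
  · simp only [ofNone, scaleNone_toNone h]
    split_ifs with hi
    · rw [one_div_one_div, hi]; rfl
    · change (frontRight (some j) pos b) i = _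
      rw [frontRight_of_ne _ hi]

theorem contDiffAt_toNone {k : Option (Fin (d + 2))} {pos : Bool} {b : V d × V d}
    (h : omegaR k pos b ≠ 0) : ContDiffAt ℝ ∞ (toNone k pos) b := by
  refine ContDiffAt.prodMk (contDiffAt_euclidean.2 fun i => ?_) (contDiff_frontRight k pos).contDiffAt
  exact (contDiff_omega k pos i).contDiffAt.div ((contDiff_omegaR k pos).contDiffAt.pow _)
    (pow_ne_zero _ h)

theorem contDiffAt_scaleNone {j : Fin (d + 2)} {pos : Bool} {y : V d × V d}
    (h : 0 < scaleNone j pos y) : ContDiffAt ℝ ∞ (scaleNone j pos) y := by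
  have e : ContDiffAt ℝ ∞ (fun y : V d × V d => sgn pos * y.1 j) y := by fun_prop
  by_cases hj : j = Fin.last (d + 1)
  · have e1 : scaleNone j pos = fun y : V d × V d => √(sgn pos * y.1 j) :=
      funext fun y => if_pos hj
    rw [e1] at h ⊢
    exact e.sqrt (Real.sqrt_pos.1 h).ne'
  · have e1 : scaleNone j pos = fun y : V d × V d => sgn pos * y.1 j :=
      funext fun y => if_neg hj
    rwa [e1]

theorem contDiffAt_ofNone {j : Fin (d + 2)} {pos : Bool} {y : V d × V d}
    (h : 0 < scaleNone j pos y) : ContDiffAt ℝ ∞ (ofNone j pos) y := by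
  have hs := contDiffAt_scaleNone h
  refine ContDiffAt.prodMk (contDiffAt_euclidean.2 fun i => ?_) (contDiffAt_euclidean.2 fun i => ?_)
  · by_cases hi : i = j
    · simp only [hi, if_true]
      exact (by fun_prop : ContDiffAt ℝ ∞ (fun y : V d × V d => y.2 0) y).mul hs
    · simp only [hi, if_false]
      exact (by fun_prop : ContDiffAt ℝ ∞ (fun y : V d × V d => y.1 i) y).div (hs.pow _)
        (pow_ne_zero _ h.ne')
  · by_cases hi : i = 0
    · simp only [hi, if_true]
      exact contDiffAt_const.div hs h.ne'
    · simp only [hi, if_false]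
      fun_prop

/-- Where ω_R > 0 the function ρ' = s ω_R is comparable with s and may replace it. Each rescaled
function is then divided by ω_R to the power of its weight, which is a smooth invertible change near
the point. -/
theorem exists_none_germ {c : ThetaChart θ} {k : Option (Fin (d + 2))} {pos : Bool}
    {a : V d × V d} (ha : a ∈ (front c k pos).dom) (hR : 0 < omegaR k pos a)
    (η : V d × V d →L[ℝ] ℝ) :
    ∃ a₂ ∈ (front c none true).dom, ∃ η₂, (mAtlas θ (front c k pos)).germ (a, η) =
      (mAtlas θ (front c none true)).germ (a₂, η₂) := by
  cases k with
  | none =>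
    cases pos with
    | true => exact ⟨a, ha, η, rfl⟩
    | false =>
      simp [omegaR, sgn] at hR
      linarith
  | some j =>
    have hbd := blowdown_toNone (k := some j) (pos := pos) ha.2.2.2.2 hR.ne'
    have hb1 : frontLeft c none true (toNone (some j) pos a) = frontLeft c (some j) pos a :=
      congrArg Prod.fst hbd
    have hda : toNone (some j) pos a ∈ (front c none true).dom := by
      refine mem_none_dom.2 ⟨?_, ?_, ha.2.2.2.2⟩
      · exact div_nonneg ha.2.1 (pow_pos hR _).le
      · rw [hb1]; exact ha.2.2.2.1
    have hs : 0 < scaleNone j pos (toNone (some j) pos a) := by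
      rw [scaleNone_toNone hR]; positivity
    have e1 : ∀ᶠ y in 𝓝 (toNone (some j) pos a), 0 < scaleNone j pos y :=
      (contDiffAt_scaleNone hs).continuousAt.eventually_const_lt hs
    refine ⟨toNone (some j) pos a, hda, germ_eq_of_compat ha hda
      (contDiffAt_toNone hR.ne').contDiffWithinAt (contDiffAt_ofNone hs).contDiffWithinAt
      ?_ ?_ ?_ ?_ η⟩
    · filter_upwards [self_mem_nhdsWithin] with b hb
      have hp := front_pos hb
      have hbd := blowdown_toNone (k := some j) (pos := pos) hb.1.2.2.2.2 hp.2.2.ne'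
      have hb1 : frontLeft c none true (toNone (some j) pos b) = frontLeft c (some j) pos b :=
        congrArg Prod.fst hbd
      refine compat_of_blowdown_eq (c := c) rfl rfl rfl rfl hb.1 (mem_none_baseInner.2
        ⟨div_pos hp.2.1 (pow_pos hp.2.2 _), hb.2.2, ?_, hb.1.2.2.2.2⟩) hbd
      rw [hb1]; exact hb.1.2.2.2.1
    · filter_upwards [self_mem_nhdsWithin, e1.filter_mono nhdsWithin_le_nhds] with y hy hys
      obtain ⟨y1, y2, y3, y4⟩ := mem_none_baseInner.1 hy
      have hty := toNone_ofNone hys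
      have hR' : omegaR (some j) pos (ofNone j pos y) = 1 / scaleNone j pos y := by
        simp [omegaR, ofNone]
      have hR0 : 0 < omegaR (some j) pos (ofNone j pos y) := by rw [hR']; positivity
      have hfr : frontRight (some j) pos (ofNone j pos y) = y.2 := congrArg Prod.snd hty
      have hbd := blowdown_toNone (c := c) (k := some j) (pos := pos) (b := ofNone j pos y)
        (by rwa [hfr]) hR0.ne'
      rw [hty] at hbd
      have hfl : frontLeft c (some j) pos (ofNone j pos y) = frontLeft c none true y :=
        (congrArg Prod.fst hbd).symm
      have hsl : 0 < slot (some j) (ofNone j pos y) := by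
        have : slot (some j) (ofNone j pos y) = y.2 0 * scaleNone j pos y := by
          simp [slot, ofNone]
        rw [this]; positivity
      have hl0 : (frontLeft c none true y) 0 = y.2 0 * y.1 0 := by
        rw [frontLeft_zero]; simp
      have hom : 0 < omega (some j) pos (ofNone j pos y) 0 := by
        have e := frontLeft_zero (c := c) (k := some j) (pos := pos) (ofNone j pos y)
        rw [hfl, hl0] at e
        exact (pos_iff_pos_of_mul_pos (by rw [← e]; positivity)).1 hsl
      refine compat_of_blowdown_eq (c := c) rfl rfl rfl rfl hy.1 ⟨⟨hsl.le, hom.le, hR0.le, ?_, ?_⟩,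
        ?_, ?_⟩ hbd.symm
      · rw [hfl]; exact y3
      · rw [hfr]; exact y4
      · rw [← hbd]; exact hy.2.1
      · rw [← hbd]; exact hy.2.2
    · filter_upwards [self_mem_nhdsWithin] with b hb
      exact ofNone_toNone (front_pos hb).2.2
    · filter_upwards [e1.filter_mono nhdsWithin_le_nhds] with y hys
      exact toNone_ofNone hys

end ThetaCalc

end

noncomputable section
namespace ThetaCalc
set_option linter.unusedSectionVars false

variable {d : ℕ} {X : Type*} [TopologicalSpace X] [ChartedSpace (EuclideanHalfSpace (d + 2)) X]
  [IsManifold (𝓡∂ (d + 2)) ∞ X]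
  {θ : ∀ p : X, TangentSpace (𝓡∂ (d + 2)) p →L[ℝ] ℝ}

open ThetaChart MChart

/-! #### Change of the chart of the base -/

/-- The boundary defining coordinates divide each other smoothly. If the quotient vanished at a
boundary point, the ρ component of the differential of the coordinate change would vanish there,
contradicting its invertibility. -/
theorem ThetaChart.exists_change_zero {c c' : ThetaChart θ} {y : V d} (hy : y ∈ c.overlap c')
    (h0 : y 0 = 0) : ∃ g : V d → ℝ, ContDiffWithinAt ℝ ∞ g (HS d) y ∧ 0 < g y ∧
      ∀ᶠ x in 𝓝[HS d] y, (c.change c' x) 0 = x 0 * g x := by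
  have hyt : y ∈ c.target := hy.1
  have hyHS : y ∈ HS d := target_subset hyt
  have hκ := contDiffWithinAt_change hy
  obtain ⟨g, hg, hge⟩ := exists_smooth_quotient (rho_ei (d := d)) (a := y)
    (f := fun x => rho d (c.change c' x)) hyHS ((rho d).contDiff.comp_contDiffWithinAt hκ) (by
      filter_upwards [overlap_mem_nhdsWithin hy] with x hx hx0
      exact (change_eq_zero_iff hx).2 hx0)
  refine ⟨g, hg, lt_of_le_of_ne ?_ ?_, hge⟩
  · have hcl : y ∈ closure {x | x ∈ c.target ∧ 0 < x 0} := target_subset_closure hyt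
    have hne := mem_closure_iff_nhdsWithin_neBot.1 hcl
    have hle : 𝓝[{x | x ∈ c.target ∧ 0 < x 0}] y ≤ 𝓝[HS d] y :=
      nhdsWithin_mono _ fun x hx => hx.2.le
    refine ge_of_tendsto (hg.continuousWithinAt.tendsto.mono_left hle) ?_
    filter_upwards [hle hge, hle (overlap_mem_nhdsWithin hy), self_mem_nhdsWithin] with x h1 h2 h3
    have h4 := change_pos h2 h3.2
    have h5 : (c.change c' x) 0 = x 0 * g x := h1
    rw [h5] at h4
    exact ((pos_iff_pos_of_mul_pos h4).1 h3.2).le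
  · intro hgy
    have e1 := (rho d).hasFDerivAt.comp_hasFDerivWithinAt y (hasFDerivWithinAt_change hy)
    have e2 := ((rho d).hasFDerivAt (x := y)).hasFDerivWithinAt.mul
      (hg.differentiableWithinAt (by simp)).hasFDerivWithinAt (s := HS d)
    have e3 := (uniqueDiffOn_HS y hyHS).eq e1 (e2.congr_of_eventuallyEq hge (by
      exact hge.self_of_nhdsWithin hyHS))
    have e4 := DFunLike.congr_fun e3 (dchange c' c (c.change c' y) (ei 0))
    simp only [ContinuousLinearMap.comp_apply, dchange_dchange_apply' hy, rho_ei] at e4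
    simp [h0, ← hgy] at e4

/-- The parabolic blow-up does not depend on the chart of X. With κ the change of coordinates, κ(x)
- κ(x') is s times the averaged derivative of κ on `frontStep`, which settles the weight one
functions. The new weight two function needs a second factor s, and that is where the forms have to
agree on ∂X. -/
theorem exists_none_transition {c c₂ : ThetaChart θ} {a : V d × V d}
    (ha : a ∈ (front c none true).dom) (h0 : a.2 0 = 0) (hω : 0 < a.1 0)
    (ho : a.2 ∈ c.overlap c₂) :
    ∃ T : V d × V d → V d × V d, ContDiffWithinAt ℝ ∞ T (front c none true).dom a ∧
      T a ∈ (front c₂ none true).dom ∧ (T a).2 = c.change c₂ a.2 ∧ 0 < (T a).1 0 ∧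
      ∀ᶠ b in 𝓝[(front c none true).baseInner] a,
        (front c none true).Compat (front c₂ none true) T b := by
  obtain ⟨g, hg, hgpos, hge⟩ := exists_change_zero ho h0
  obtain ⟨-, hlt, hyt⟩ := mem_none_dom.1 ha
  have hyHS : a.2 ∈ HS d := target_subset hyt
  have hfl : frontLeft c none true a = a.2 := by
    rw [frontLeft_eq, slot_none, h0, zero_smul, add_zero, frontRight_none]
  set κ := c.change c₂ with hκdef
  have hκ : ContDiffWithinAt ℝ ∞ κ (HS d) a.2 := contDiffWithinAt_change ho
  obtain ⟨hA, hAe⟩ := exists_avgDeriv convex_HS uniqueDiffOn_HS hyHS hκ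
  set D : Set (V d × V d) := {b | 0 ≤ slotL none b} with hD
  have hDn : ∀ b ∈ D, (0 : ℝ) ≤ slot none b * omegaR none true b := fun b hb => by
    rw [omegaR_none, mul_one]; exact hb
  have hdomD : (front c none true).dom ⊆ D := fun b hb => hb.1
  have hx : ContDiffWithinAt ℝ ∞ (frontLeft c none true) D a :=
    contDiffWithinAt_frontLeft hDn (by rwa [frontRight_none])
  have hst : ContDiffWithinAt ℝ ∞ (frontStep c none true) D a :=
    contDiffWithinAt_frontStep hDn (by rwa [frontRight_none])
  have hy : ContDiffWithinAt ℝ ∞ (Prod.snd : V d × V d → V d) D a := contDiffWithinAt_snd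
  have hyD : ∀ᶠ b in 𝓝[D] a, b.2 ∈ HS d := by
    filter_upwards [self_mem_nhdsWithin] with b hb using hb
  have hω' : ∀ᶠ b in 𝓝 a, 0 < b.1 0 := by
    have : Continuous fun b : V d × V d => b.1 0 := by fun_prop
    exact this.continuousAt.eventually_const_lt hω
  have hxD : ∀ᶠ b in 𝓝[D] a, frontLeft c none true b ∈ HS d := by
    filter_upwards [self_mem_nhdsWithin, hω'.filter_mono nhdsWithin_le_nhds] with b hb hb'
    change 0 ≤ (frontLeft c none true b) 0
    rw [frontLeft_zero, omega_none]
    exact mul_nonneg hb hb'.le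
  have hκy : ContDiffWithinAt ℝ ∞ (fun b => κ b.2) D a := ContDiffWithinAt.comp_of_eventually hκ hy hyD
  have hgy : ContDiffWithinAt ℝ ∞ (fun b => g b.2) D a := ContDiffWithinAt.comp_of_eventually hg hy hyD
  have hgx : ContDiffWithinAt ℝ ∞ (fun b => g (frontLeft c none true b)) D a :=
    ContDiffWithinAt.comp_of_eventually (by rwa [hfl]) hx hxD
  have hAst : ContDiffWithinAt ℝ ∞ (fun b => avgDeriv κ (HS d) (frontLeft c none true b, b.2)
      (frontStep c none true b)) D a := by
    refine ContDiffWithinAt.clm_apply ?_ hst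
    refine ContDiffWithinAt.comp_of_eventually (g := avgDeriv κ (HS d))
      (f := fun b => (frontLeft c none true b, b.2)) (t := HS d ×ˢ HS d) (by rwa [hfl])
      (hx.prodMk hy) ?_
    filter_upwards [hxD, hyD] with b h1 h2 using ⟨h1, h2⟩
  have hf2 : ContDiffWithinAt ℝ ∞ (fun b => c₂.form (κ b.2)) D a := by
    refine ContDiffWithinAt.comp_of_eventually (t := HS d)
      (contDiffWithinAt_form (change_mem_target ho)) hκy ?_
    filter_upwards [hyD] with b hb using mapsTo_change_HS hb
  set f : V d × V d → ℝ := fun b => c₂.form (κ b.2)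
    (avgDeriv κ (HS d) (frontLeft c none true b, b.2) (frontStep c none true b)) with hf
  have hfs : ContDiffWithinAt ℝ ∞ f D a := hf2.clm_apply hAst
  -- At s = 0 the averaged derivative is the differential of κ, and `form_change` reduces the value
  -- to the old form on `frontStep`, which is s times a coordinate and hence zero.
  have hf0 : ∀ᶠ b in 𝓝[D] a, slotL none b = 0 → f b = 0 := by
    have hyo : ∀ᶠ b in 𝓝[D] a, b.2 ∈ c.overlap c₂ :=
      (tendsto_nhdsWithin_iff.2 ⟨hy.continuousWithinAt.tendsto, hyD⟩).eventually
        (overlap_mem_nhdsWithin ho)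
    filter_upwards [hyo] with b hb hs
    have hs' : slot none b = 0 := hs
    have hfl : frontLeft c none true b = b.2 := by
      rw [frontLeft_eq, hs', zero_smul, add_zero, frontRight_none]
    have hfd : fderivWithin ℝ κ (HS d) b.2 = dchange c c₂ b.2 :=
      (hasFDerivWithinAt_change hb).fderivWithin (uniqueDiffOn_HS _ (target_subset hb.1))
    have h1 : c.pt b.2 ∈ (𝓡∂ (d + 2)).boundary X := (pt_mem_boundary_iff hb.1).2 hs'
    have h2 := form_frontStep (c := c) (k := none) (pos := true) (a := b)
      (by rw [frontRight_none]; exact hb.1)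
    rw [hs', zero_mul, frontRight_none] at h2
    rw [hf]
    simp only [hfl, avgDeriv_self, hfd]
    rw [form_change hb h1, h2]
  obtain ⟨Z, hZ, hZe⟩ := exists_smooth_quotient (ρ := slotL (d := d) none) (e := (0, ei 0))
    (by simp [slotL_apply, slot, ei_apply]) (a := a) (f := f) (hdomD ha) hfs hf0
  -- The new dominating function is ρ' g(x'). Weight one quotients are divided by g(x') once, the
  -- weight two quotient twice, and the coordinate ρ itself carries g(x).
  set T : V d × V d → V d × V d := fun b => (WithLp.toLp 2 fun i =>
    if i = 0 then b.1 0 * g (frontLeft c none true b) / g b.2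
    else if i = Fin.last (d + 1) then Z b / (g b.2) ^ 2
    else (avgDeriv κ (HS d) (frontLeft c none true b, b.2) (frontStep c none true b)) i / g b.2,
    κ b.2) with hT
  have hT0 : 0 < (T a).1 0 := by
    simp only [hT, if_true, hfl]
    positivity
  have hTl : frontLeft c₂ none true (T a) = κ a.2 := by
    rw [frontLeft_eq, slot_none, frontRight_none]
    have : (T a).2 0 = 0 := (change_eq_zero_iff ho).2 h0
    rw [this, zero_smul, add_zero]
  refine ⟨T, ContDiffWithinAt.mono ?_ hdomD, mem_none_dom.2 ⟨hT0.le, ?_, change_mem_target ho⟩,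
    rfl, hT0, ?_⟩
  · refine ContDiffWithinAt.prodMk (contDiffWithinAt_euclidean.2 fun i => ?_) hκy
    dsimp only
    split_ifs with h1 h2
    · exact ((by fun_prop : ContDiff ℝ ∞ fun b : V d × V d => b.1 0).contDiffWithinAt.mul hgx).div
        hgy hgpos.ne'
    · exact hZ.div (hgy.pow 2) (pow_ne_zero _ hgpos.ne')
    · exact ((EuclideanSpace.proj (𝕜 := ℝ) i).contDiff.comp_contDiffWithinAt hAst).div hgy hgpos.ne'
  · rw [hTl]; exact change_mem_target ho
  · have hle : 𝓝[(front c none true).baseInner] a ≤ 𝓝[D] a :=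
      nhdsWithin_mono _ fun b hb => hdomD hb.1
    have tx : Tendsto (frontLeft c none true) (𝓝[D] a) (𝓝[HS d] a.2) := by
      refine tendsto_nhdsWithin_iff.2 ⟨?_, hxD⟩
      have := hx.continuousWithinAt.tendsto
      rwa [hfl] at this
    have ty : Tendsto (Prod.snd : V d × V d → V d) (𝓝[D] a) (𝓝[HS d] a.2) :=
      tendsto_nhdsWithin_iff.2 ⟨hy.continuousWithinAt.tendsto, hyD⟩
    have hAe' : ∀ᶠ b in 𝓝[D] a, κ (frontLeft c none true b) - κ b.2 =
        avgDeriv κ (HS d) (frontLeft c none true b, b.2) (frontLeft c none true b - b.2) := by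
      have h1 : Tendsto (fun b => (frontLeft c none true b, b.2)) (𝓝[D] a)
          (𝓝[HS d ×ˢ HS d] (a.2, a.2)) := by
        rw [nhdsWithin_prod_eq]; exact tx.prodMk ty
      exact h1.eventually hAe
    filter_upwards [self_mem_nhdsWithin, hle hAe', hle hZe, hle (tx.eventually hge),
      hle (ty.eventually hge), hle (tx.eventually (overlap_mem_nhdsWithin ho)),
      hle (ty.eventually (overlap_mem_nhdsWithin ho))] with b b1 b2 b3 b4 b5 b6 b7
    obtain ⟨p1, p2, p3, p4⟩ := mem_none_baseInner.1 b1
    have q1 : 0 < g b.2 := by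
      have h1 := change_pos b7 p2
      rw [b5] at h1
      exact (pos_iff_pos_of_mul_pos h1).1 p2
    have q2 : 0 < g (frontLeft c none true b) := by
      have h1 := change_pos b6 b1.2.1
      rw [b4] at h1
      exact (pos_iff_pos_of_mul_pos h1).1 b1.2.1
    have hs : slot none (T b) = b.2 0 * g b.2 := b5
    have hdiff : κ (frontLeft c none true b) - κ b.2 = b.2 0 •
        avgDeriv κ (HS d) (frontLeft c none true b, b.2) (frontStep c none true b) := by
      rw [b2, ← map_smul]
      congr 1
      rw [frontLeft_eq, frontRight_none, add_sub_cancel_left]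
      rfl
    have hTbl : frontLeft c₂ none true (T b) = κ (frontLeft c none true b) := by
      refine frontLeft_unique (by rw [frontRight_none]; exact change_mem_target b7) ?_ ?_ ?_
      · rw [hs, b4, frontLeft_zero, omega_none]
        simp only [hT, if_true, slot_none, omega_none]
        field_simp
      · intro i hi hl
        rw [frontRight_none, hs, omega_none]
        simp only [hT, hi, hl, if_false]
        have := congrArg (fun v : V d => v i) hdiff
        simp only [PiLp.sub_apply, PiLp.smul_apply, smul_eq_mul] at this
        rw [sub_eq_iff_eq_add] at this
        rw [this]
        field_simp
        ring
      · rw [frontRight_none, hs, omega_none]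
        change c₂.form (κ b.2) (κ (frontLeft c none true b) - κ b.2) = _
        have h3 : f b = b.2 0 * Z b := b3
        rw [hdiff, map_smul, smul_eq_mul]
        change b.2 0 * f b = _
        rw [h3]
        simp only [hT, last_ne_zero', if_true, if_false]
        field_simp
    refine ⟨mem_none_baseInner.2 ⟨?_, ?_, ?_, change_mem_target b7⟩, b6, ?_, ?_⟩
    · simp only [hT, if_true]
      positivity
    · change 0 < (κ b.2) 0
      rw [b5]; positivity
    · rw [hTbl]; exact change_mem_target b6
    · change frontRight none true b ∈ _
      rw [frontRight_none]; exact b7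
    · refine Prod.ext hTbl ?_
      change frontRight none true (T b) = c.change c₂ (frontRight none true b)
      rw [frontRight_none, frontRight_none]

end ThetaCalc

end

noncomputable section
namespace ThetaCalc
set_option linter.unusedSectionVars false

/-! ### Separation of points of the cotangent bundle of the stretched product -/

variable {d : ℕ} {X : Type*} [TopologicalSpace X] [ChartedSpace (EuclideanHalfSpace (d + 2)) X]
  [IsManifold (𝓡∂ (d + 2)) ∞ X]
  {θ : ∀ p : X, TangentSpace (𝓡∂ (d + 2)) p →L[ℝ] ℝ}

open ThetaChart MChart

/-- Meeting germs from two charts provide a proper filter of pairs of coordinates that describe the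
same interior point. Limits along it relate the two sets of coordinates. -/
theorem neBot_prod_inf_principal {α β γ : Type*} {f : α → γ} {g : β → γ} {l : Filter α}
    {l' : Filter β} (h : (map f l ⊓ map g l').NeBot) :
    ((l ×ˢ l') ⊓ 𝓟 {p : α × β | f p.1 = g p.2}).NeBot := by
  rw [inf_principal_neBot_iff]
  intro U hU
  obtain ⟨A, hA, B, hB, hAB⟩ := mem_prod_iff.1 hU
  obtain ⟨_, ⟨x, hx, rfl⟩, y, hy, hxy⟩ := h.nonempty_of_mem
    (inter_mem_inf (image_mem_map hA) (image_mem_map hB))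
  exact ⟨(x, y), hAB ⟨hx, hy⟩, hxy.symm⟩

/-- The transitions in the two directions are mutually inverse over the interior, since the
blow-down map is injective there and both composites cover the identity. -/
theorem exists_none_germ_change {c c₂ : ThetaChart θ} {a : V d × V d}
    (ha : a ∈ (front c none true).dom) (h0 : a.2 0 = 0) (hω : 0 < a.1 0)
    (ho : a.2 ∈ c.overlap c₂) (η : V d × V d →L[ℝ] ℝ) :
    ∃ a₂ ∈ (front c₂ none true).dom, ∃ η₂, (mAtlas θ (front c none true)).germ (a, η) =
      (mAtlas θ (front c₂ none true)).germ (a₂, η₂) := by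
  obtain ⟨T, hT, hTa, hTy, hT0, hTc⟩ := exists_none_transition ha h0 hω ho
  have ho' : (T a).2 ∈ c₂.overlap c := by rw [hTy]; exact change_mem_overlap ho
  have h0' : (T a).2 0 = 0 := by rw [hTy]; exact (change_eq_zero_iff ho).2 h0
  obtain ⟨T', hT', hTa', hTy', hT0', hTc'⟩ := exists_none_transition hTa h0' hT0 ho'
  have key : ∀ {c c₂ : ThetaChart θ} {T T' : V d × V d → V d × V d} {b : V d × V d},
      b ∈ (front c none true).baseInner →
      (front c none true).Compat (front c₂ none true) T b →
      (front c₂ none true).Compat (front c none true) T' (T b) → T' (T b) = b := by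
    intro c c₂ T T' b hb h1 h2
    refine injOn_blowdown_none h2.mem hb ?_
    rw [h2.eq, h1.eq]
    exact Prod.ext (change_change h1.left) (change_change h1.right)
  have t1 := tendsto_transition hT hTc
  have t1' := tendsto_transition hT' hTc'
  have hTT : ∀ᶠ b in 𝓝[(front c none true).baseInner] a, T' (T b) = b := by
    filter_upwards [self_mem_nhdsWithin, hTc, t1.eventually hTc'] with b b1 b2 b3
    exact key b1 b2 b3
  have hne : (𝓝[(front c none true).baseInner] a).NeBot :=
    mem_closure_iff_nhdsWithin_neBot.1 (dom_subset_closure_baseInner ha)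
  have hTTa : T' (T a) = a :=
    tendsto_nhds_unique (((t1'.comp t1).mono_right nhdsWithin_le_nhds).congr'
      (hTT.mono fun b hb => hb)) nhdsWithin_le_nhds
  have hTT' : ∀ᶠ y in 𝓝[(front c₂ none true).baseInner] (T a), T (T' y) = y := by
    rw [hTTa] at t1'
    filter_upwards [self_mem_nhdsWithin, hTc', t1'.eventually hTc] with b b1 b2 b3
    exact key b1 b2 b3
  exact ⟨T a, hTa, germ_eq_of_compat ha hTa hT hT' hTc hTc' hTT hTT' η⟩

theorem toNone_mem_baseInner {c : ThetaChart θ} {k : Option (Fin (d + 2))} {pos : Bool}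
    {b : V d × V d} (hb : b ∈ (front c k pos).baseInner) :
    toNone k pos b ∈ (front c none true).baseInner := by
  have hp := front_pos hb
  have hbd := blowdown_toNone (k := k) (pos := pos) hb.1.2.2.2.2 hp.2.2.ne'
  have hb1 : frontLeft c none true (toNone k pos b) = frontLeft c k pos b := congrArg Prod.fst hbd
  refine mem_none_baseInner.2 ⟨div_pos hp.2.1 (pow_pos hp.2.2 _), hb.2.2, ?_, hb.1.2.2.2.2⟩
  rw [hb1]; exact hb.1.2.2.2.1

theorem blowdown_eq_of_toFun_eq {m m' : MChart θ} (hl : m.left = m'.left)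
    (hr : m.right = m'.right) {b b' : CV d} (hb : b.1 ∈ m.dom) (hb' : b'.1 ∈ m'.dom)
    (h : (mAtlas θ m).toFun b = (mAtlas θ m').toFun b') :
    m.blowdown b.1 = m'.blowdown b'.1 := by
  have h1 : m.left.cov _ _ = m'.left.cov _ _ := congrArg Prod.fst h
  have h2 : m.right.cov _ _ = m'.right.cov _ _ := congrArg Prod.snd h
  have e1 := blowdown_mem hb
  have e2 := blowdown_mem hb'
  rw [hl, hr] at e1
  rw [hl] at h1
  rw [hr] at h2
  exact Prod.ext (cov_injOn e1.1 e2.1 h1).1 (cov_injOn e1.2 e2.2 h2).1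

theorem cot_injOn_none {c : ThetaChart θ} : InjOn (mAtlas θ (front c none true)).toFun
    (mAtlas θ (front c none true)).inner := by
  intro b hb b' hb' h
  have hbi : b.1 ∈ (front c none true).baseInner := hb
  have hbi' : b'.1 ∈ (front c none true).baseInner := hb'
  have h1 : b.1 = b'.1 := injOn_blowdown_none hb hb' (blowdown_eq_of_toFun_eq rfl rfl hbi.1 hbi'.1 h)
  obtain ⟨p, ξ⟩ := b
  obtain ⟨p', ξ'⟩ := b'
  obtain rfl : p = p' := h1
  have e1 := (cov_injOn (blowdown_mem hbi.1).1 (blowdown_mem hbi.1).1 (congrArg Prod.fst h)).2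
  have e2 := (cov_injOn (blowdown_mem hbi.1).2 (blowdown_mem hbi.1).2 (congrArg Prod.snd h)).2
  refine Prod.ext rfl (ContinuousLinearMap.ext fun u => ?_)
  change ξ u = ξ' u
  rw [← inverse_fderiv_apply hbi u]
  have e3 : ∀ ζ : V d × V d →L[ℝ] ℝ, ∀ w : V d × V d,
      ζ ((fderiv ℝ (front c none true).blowdown p).inverse w) =
      ((ζ.comp (fderiv ℝ (front c none true).blowdown p).inverse).comp
        (ContinuousLinearMap.inl ℝ (V d) (V d))) w.1 +
      ((ζ.comp (fderiv ℝ (front c none true).blowdown p).inverse).comp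
        (ContinuousLinearMap.inr ℝ (V d) (V d))) w.2 := fun ζ w => by
    simp only [ContinuousLinearMap.comp_apply, ContinuousLinearMap.inl_apply,
      ContinuousLinearMap.inr_apply]
    rw [← map_add, ← map_add]
    simp
  rw [e3 ξ, e3 ξ']
  exact congrArg₂ (· + ·) (DFunLike.congr_fun e1 _) (DFunLike.congr_fun e2 _)

namespace CotM

variable [T2Space X]

/-- Both covectors lie over the same interior pair and split as products of filters, which reduces
the claim to the separation of ᶿT*X in each factor. -/
theorem eq_of_inf_neBot_of_overInterior {τ τ₁ : CotM θ} (h₁ : τ₁.OverInterior)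
    (h : (τ.1 ⊓ τ₁.1).NeBot) : τ = τ₁ := by
  have hτ : τ.OverInterior := by
    obtain ⟨p, hp, p', hp', hq⟩ := h₁
    obtain ⟨m, b, hb, hb'⟩ := τ.exists_germ
    have e := isOver_of_germ hb hb'
    exact ⟨p, hp, p', hp', isOver_eq_of_inf_neBot h e hq ▸ e⟩
  obtain ⟨ζ, ζ', -, -, e⟩ := exists_eq_prod hτ
  obtain ⟨ζ₁, ζ₁', -, -, e₁⟩ := exists_eq_prod h₁
  rw [e, e₁] at h
  have h1 : (ζ.1 ⊓ ζ₁.1).NeBot := by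
    rw [prod_inf_prod] at h
    exact (prod_neBot.1 h).1
  have h2 : (ζ'.1 ⊓ ζ₁'.1).NeBot := by
    rw [prod_inf_prod] at h
    refine neBot_inf_of_map_injOn (s := univ) univ_mem univ_mem (f := dil (-1)) ?_ (prod_neBot.1 h).2
    intro q _ q' _ hqq
    have := map_dil_neg_one_injective (l := pure q) (l' := pure q') (by simp [hqq])
    exact pure_injective this
  rw [ThetaCot.eq_of_inf_neBot h1, ThetaCot.eq_of_inf_neBot h2] at e
  exact Subtype.ext (e.trans e₁.symm)

/-- The other point also lies over the boundary diagonal, so it is in a projective chart; product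
charts omit that diagonal. After moving both to one chart of X, the case ω_R = 0 is excluded below.
Hence ω_R > 0, both points have coordinates in the chart where ρ' dominates, and that chart is
injective over the interior. -/
theorem eq_of_inf_neBot_of_front {τ τ₁ : CotM θ} {c : ThetaChart θ} {a₁ : CV d}
    (ha₁ : a₁.1 ∈ (front c none true).dom) (h0 : a₁.1.2 0 = 0) (hω : 0 < a₁.1.1 0)
    (h₁ : τ₁.1 = (mAtlas θ (front c none true)).germ a₁)
    (h : (τ.1 ⊓ τ₁.1).NeBot) : τ = τ₁ := by
  obtain ⟨m, ⟨a, η⟩, ha, hτ⟩ := τ.exists_germ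
  have hfr : τ.OverFront := by
    obtain ⟨p, hp, e⟩ := overFront_of_slot_eq_zero ha₁ h₁ h0
    have e' := isOver_of_germ ha hτ
    exact ⟨p, hp, isOver_eq_of_inf_neBot h e' e ▸ e'⟩
  cases m with
  | prod c' c'' => exact (ha.2.2 ((overFront_iff ha hτ).1 hfr)).elim
  | front c₂ k pos =>
    have hov := isOver_eq_of_inf_neBot h (isOver_of_germ ha hτ) (isOver_of_germ ha₁ h₁)
    have hov2 : c₂.pt (frontRight k pos a) = c.pt (frontRight none true a₁.1) :=
      congrArg Prod.snd hov
    rw [frontRight_none] at hov2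
    have ho := (change_eq_of_pt_eq (mem_none_dom.1 ha₁).2.2 ha.2.2.2.2 hov2.symm).1
    obtain ⟨a₂, ha₂, η₂, h₂⟩ := exists_none_germ_change ha₁ h0 hω ho a₁.2
    have h₂' : τ₁.1 = (mAtlas θ (front c₂ none true)).germ (a₂, η₂) := h₁.trans h₂
    have hne := h
    rw [hτ, h₂'] at hne
    have hne' := neBot_prod_inf_principal hne
    set L := ((𝓝[(mAtlas θ (front c₂ k pos)).inner] (a, η)) ×ˢ
      (𝓝[(mAtlas θ (front c₂ none true)).inner] (a₂, η₂))) ⊓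
      𝓟 {p | (mAtlas θ (front c₂ k pos)).toFun p.1 = (mAtlas θ (front c₂ none true)).toFun p.2}
    have t1 : Tendsto (fun p : CV d × CV d => p.1.1) L (𝓝[(front c₂ k pos).baseInner] a) :=
      (tendsto_fst_inner (b := (a, η))).comp (tendsto_fst.mono_left inf_le_left)
    have t2 : Tendsto (fun p : CV d × CV d => p.2.1) L
        (𝓝[(front c₂ none true).baseInner] a₂) :=
      (tendsto_fst_inner (b := (a₂, η₂))).comp (tendsto_snd.mono_left inf_le_left)
    have hL : ∀ᶠ p in L, toNone k pos p.1.1 = p.2.1 := by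
      filter_upwards [t1.eventually self_mem_nhdsWithin, t2.eventually self_mem_nhdsWithin,
        mem_inf_of_right (mem_principal_self _)] with p p1 p2 p3
      have e1 := blowdown_eq_of_toFun_eq (m := front c₂ k pos) (m' := front c₂ none true)
        (b := p.1) (b' := p.2) rfl rfl p1.1 p2.1 p3
      have e2 := blowdown_toNone (k := k) (pos := pos) p1.1.2.2.2.2 (front_pos p1).2.2.ne'
      exact injOn_blowdown_none (toNone_mem_baseInner p1) p2 (e2.trans e1)
    have hlim : ∀ i, omega k pos a i = a₂.1 i * omegaR k pos a ^ wt i := fun i => by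
      have e1 : Tendsto (fun p : CV d × CV d => omega k pos p.1.1 i) L (𝓝 (omega k pos a i)) :=
        ((contDiff_omega k pos i).continuous.tendsto a).comp (t1.mono_right nhdsWithin_le_nhds)
      have e2 : Tendsto (fun p : CV d × CV d => p.2.1.1 i * omegaR k pos p.1.1 ^ wt i) L
          (𝓝 (a₂.1 i * omegaR k pos a ^ wt i)) := by
        have f1 : Continuous fun b : V d × V d => b.1 i := by fun_prop
        exact ((f1.tendsto a₂).comp (t2.mono_right nhdsWithin_le_nhds)).mul
          ((((contDiff_omegaR k pos).continuous.tendsto a).comp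
            (t1.mono_right nhdsWithin_le_nhds)).pow _)
      refine tendsto_nhds_unique e1 (e2.congr' ?_)
      filter_upwards [hL, t1.eventually self_mem_nhdsWithin] with p p1 p2
      rw [← p1]
      exact div_mul_cancel₀ _ (pow_ne_zero _ (front_pos p2).2.2.ne')
    have hsgn : sgn pos ≠ 0 := fun hs => by
      have := sgn_mul_self pos
      simp [hs] at this
    -- If ω_R vanished, the limit relation `hlim` would make every ω_i vanish; but the dominating
    -- function, ω_k or ω_R itself, equals ±1.
    have hR : omegaR k pos a ≠ 0 := fun hR => by
      have hz : ∀ i, omega k pos a i = 0 := fun i => by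
        rw [hlim, hR, zero_pow (by unfold wt; split_ifs <;> simp), mul_zero]
      cases k with
      | none => exact hsgn hR
      | some j =>
        have := hz j
        rw [omega, if_pos rfl] at this
        exact hsgn this
    obtain ⟨a₃, ha₃, η₃, h₃⟩ := exists_none_germ ha (lt_of_le_of_ne ha.2.2.1 hR.symm) η
    have h₃' : τ.1 = (mAtlas θ (front c₂ none true)).germ (a₃, η₃) := hτ.trans h₃
    have h4 := h
    rw [h₃', h₂'] at h4
    have := BChart.eq_of_germ_inf_neBot cot_injOn_none h4
    exact Subtype.ext (by rw [h₃', h₂', this])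

/-- The covectors of the stretched product over the interior, or over the part of the front face
away from the left and right faces. -/
def IsRegular (τ : CotM θ) : Prop :=
  τ.OverInterior ∨ ∃ c : ThetaChart θ, ∃ a : CV d, a.1 ∈ (front c none true).dom ∧ a.1.2 0 = 0 ∧
    0 < a.1.1 0 ∧ τ.1 = (mAtlas θ (front c none true)).germ a

theorem IsRegular.eq_of_inf_neBot {τ τ₁ : CotM θ} (h₁ : τ₁.IsRegular)
    (h : (τ.1 ⊓ τ₁.1).NeBot) : τ = τ₁ := by
  obtain h₁ | ⟨c, a, ha, h0, hω, h₁⟩ := h₁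
  · exact eq_of_inf_neBot_of_overInterior h₁ h
  · exact eq_of_inf_neBot_of_front ha h0 hω h₁ h

/-- Regular points are separated from all other points. -/
theorem IsRegular.eq_of_tendsto {α : Type*} {l : Filter α} [l.NeBot] {f : α → CotM θ}
    {τ τ₁ : CotM θ} (h₁ : τ₁.IsRegular) (hf : Tendsto f l (𝓝 τ)) (hf₁ : Tendsto f l (𝓝 τ₁)) :
    τ = τ₁ := by
  refine h₁.eq_of_inf_neBot (neBot_iff.2 fun hbot => ?_)
  obtain ⟨s, hs, t, ht, hst⟩ := mem_inf_iff.1 (hbot ▸ mem_bot : (∅ : Set _) ∈ τ.1 ⊓ τ₁.1)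
  obtain ⟨y, h1, h2⟩ := ((BSpace.tendsto_nhds_iff.1 hf s hs).and
    (BSpace.tendsto_nhds_iff.1 hf₁ t ht)).exists
  have := (f y).neBot
  exact (this.nonempty_of_mem (inter_mem h1 h2)).ne_empty hst.symm

end CotM

end ThetaCalc

end

noncomputable section
namespace ThetaCalc
set_option linter.unusedSectionVars false

/-! ### Canonical transformations near the boundary -/

variable {d : ℕ} {X : Type*} [TopologicalSpace X] [ChartedSpace (EuclideanHalfSpace (d + 2)) X]
  {θ : ∀ p : X, TangentSpace (𝓡∂ (d + 2)) p →L[ℝ] ℝ}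

open ThetaChart MChart

/-- The boundary defining coordinate on coordinates of `ᶿT*X`. -/
def rhoF (d : ℕ) : V d × V d →L[ℝ] ℝ := (rho d).comp (ContinuousLinearMap.fst ℝ (V d) (V d))

@[simp] theorem rhoF_apply (b : V d × V d) : rhoF d b = b.1 0 := rfl

/-- Coordinates of `ᶿT*X` lie in this half space. -/
def HF (d : ℕ) : Set (V d × V d) := {b | 0 ≤ rhoF d b}

theorem rhoF_ei : rhoF d (ei 0, 0) = 1 := rho_ei (d := d)

theorem uniqueDiffOn_HF : UniqueDiffOn ℝ (HF d) := uniqueDiffOn_halfspace_ge rhoF_ei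

theorem isOpen_posF : IsOpen {b : V d × V d | 0 < b.1 0} :=
  isOpen_lt continuous_const (rhoF d).continuous

theorem mem_closure_posF {b : V d × V d} (hb : b ∈ HF d) : b ∈ closure {b : V d × V d | 0 < b.1 0} := by
  have h1 : Tendsto (fun t : ℝ => b + t • ((ei 0, 0) : V d × V d)) (𝓝[>] 0) (𝓝 b) := by
    have h2 : Continuous fun t : ℝ => b + t • ((ei 0, 0) : V d × V d) := by fun_prop
    have h3 := h2.tendsto 0
    simp only [zero_smul, add_zero] at h3
    exact h3.mono_left nhdsWithin_le_nhds
  refine mem_closure_of_tendsto h1 ?_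
  filter_upwards [self_mem_nhdsWithin] with t ht
  rw [← rhoF_apply, map_add, map_smul, rhoF_ei, smul_eq_mul, mul_one]
  exact add_pos_of_nonneg_of_pos hb ht

theorem posF_neBot {b : V d × V d} (hb : b ∈ HF d) :
    (𝓝[{b : V d × V d | 0 < b.1 0}] b).NeBot :=
  mem_closure_iff_nhdsWithin_neBot.1 (mem_closure_posF hb)

theorem nhdsWithin_posF_le {b : V d × V d} :
    𝓝[{b : V d × V d | 0 < b.1 0}] b ≤ 𝓝[HF d] b :=
  nhdsWithin_mono _ fun b hb => (show 0 < b.1 0 from hb).le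

theorem HF_mem_nhds {b : V d × V d} (hb : 0 < b.1 0) : HF d ∈ 𝓝 b :=
  mem_of_superset (isOpen_posF.mem_nhds hb) fun b hb => (show 0 < b.1 0 from hb).le

/-- A coordinate expression, near a boundary point, of a canonical transformation
covering the identity over the boundary. -/
structure BoundaryRep (c : ThetaChart θ) (a : V d × V d) (G : V d × V d → V d × V d) : Prop where
  mem : a.1 ∈ c.target
  zero : a.1 0 = 0
  smooth : ContDiffWithinAt ℝ ∞ G (HF d) a
  target : ∀ᶠ b in 𝓝[HF d] a, (G b).1 ∈ c.target
  fix : ∀ᶠ b in 𝓝[HF d] a, b.1 0 = 0 → (G b).1 = b.1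
  pos : ∀ᶠ b in 𝓝[HF d] a, 0 < b.1 0 → 0 < (G b).1 0
  canonical : ∀ᶠ b in 𝓝[HF d] a, 0 < b.1 0 → ∀ h : V d × V d,
    c.coform (G b).1 (G b).2 (fderiv ℝ G b h).1 = c.coform b.1 b.2 h.1
  -- What remains of the smooth inverse of the transformation: ρ is a multiple of ρ ∘ G by a factor
  -- that converges at the point.
  inv : ∃ (k : V d × V d → ℝ) (k₀ : ℝ), Tendsto k (𝓝[HF d] a) (𝓝 k₀) ∧
    ∀ᶠ b in 𝓝[HF d] a, b.1 0 = (G b).1 0 * k b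

namespace BoundaryRep

variable {c : ThetaChart θ} {a : V d × V d} {G : V d × V d → V d × V d}

theorem mem_HF (h : BoundaryRep c a G) : a ∈ HF d := by
  change 0 ≤ a.1 0
  rw [h.zero]

/-- Over the interior ρ' = ρ (1 + Y_0) > 0 and ρ = ρ' k, so (1 + Y_0) k = 1 with k convergent. Thus
the limit of 1 + Y_0 is nonnegative and cannot be zero. -/
theorem exists_quotient (h : BoundaryRep c a G) :
    ∃ Y : V d × V d → V d, ContDiffWithinAt ℝ ∞ Y (HF d) a ∧
      (∀ᶠ b in 𝓝[HF d] a, (G b).1 = b.1 + b.1 0 • Y b) ∧ 0 < 1 + (Y a) 0 := by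
  obtain ⟨Y, hY, hYe⟩ := exists_smooth_quotient (rhoF_ei (d := d)) (a := a)
    (f := fun b => (G b).1 - b.1) h.mem_HF (h.smooth.fst.sub contDiffWithinAt_fst) (by
      filter_upwards [h.fix] with b hb hb0
      rw [hb hb0, sub_self])
  have hYe' : ∀ᶠ b in 𝓝[HF d] a, (G b).1 = b.1 + b.1 0 • Y b := by
    filter_upwards [hYe] with b hb
    rw [← rhoF_apply, ← hb]; abel
  refine ⟨Y, hY, hYe', ?_⟩
  obtain ⟨k, k₀, hk, hke⟩ := h.inv
  have := posF_neBot h.mem_HF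
  have hle := nhdsWithin_posF_le (b := a)
  have hg : Tendsto (fun b => 1 + (Y b) 0) (𝓝[{b : V d × V d | 0 < b.1 0}] a)
      (𝓝 (1 + (Y a) 0)) := by
    have h1 : Continuous fun v : V d => 1 + v 0 := by fun_prop
    exact (h1.tendsto _).comp (hY.continuousWithinAt.tendsto.mono_left hle)
  have h0 : ∀ᶠ b in 𝓝[{b : V d × V d | 0 < b.1 0}] a, (G b).1 0 = b.1 0 * (1 + (Y b) 0) := by
    filter_upwards [hle hYe'] with b hb
    rw [hb]
    simp
    ring
  refine lt_of_le_of_ne (ge_of_tendsto hg ?_) fun h2 => ?_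
  · filter_upwards [hle h.pos, h0, self_mem_nhdsWithin] with b h1 h2 h3
    have h4 := h1 h3
    rw [h2] at h4
    exact ((pos_iff_pos_of_mul_pos h4).1 h3).le
  · have h3 : Tendsto (fun b => (1 + (Y b) 0) * k b) (𝓝[{b : V d × V d | 0 < b.1 0}] a) (𝓝 1) := by
      refine tendsto_const_nhds.congr' ?_
      filter_upwards [hle hke, h0, self_mem_nhdsWithin] with b h1 h2 h3
      have h3 : 0 < b.1 0 := h3
      rw [h2] at h1
      have h4 : b.1 0 * ((1 + (Y b) 0) * k b) = b.1 0 * 1 := by linarith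
      exact (mul_left_cancel₀ h3.ne' h4).symm
    have h4 := tendsto_nhds_unique h3 (hg.mul (hk.mono_left hle))
    rw [← h2, zero_mul] at h4
    exact one_ne_zero h4

theorem exists_eq_on_ball {P : V d × V d → Prop} {a : V d × V d} (h : ∀ᶠ b in 𝓝[HF d] a, P b) :
    ∃ r > 0, ∀ b ∈ HF d ∩ Metric.ball a r, P b := by
  obtain ⟨r, hr, h1⟩ := Metric.mem_nhdsWithin_iff.1 h
  exact ⟨r, hr, fun b hb => h1 ⟨hb.2, hb.1⟩⟩

/-- The decisive use of the canonical form. Multiplied by ρ'² = ρ² (1 + Y_0)², its invariance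
becomes an identity that is continuous up to ρ = 0. There ∂_z gives t' = (1 + Y_0)² t, and ∂_ρ,
which the differential of the base map sends to ∂_ρ + Y, then gives t form(Y) = 0. The case t = 0
follows by continuity. -/
theorem form_quotient_eq_zero (h : BoundaryRep c a G) {Y : V d × V d → V d}
    (hY : ContDiffWithinAt ℝ ∞ Y (HF d) a)
    (hYe : ∀ᶠ b in 𝓝[HF d] a, (G b).1 = b.1 + b.1 0 • Y b) (hYa : 0 < 1 + (Y a) 0) :
    ∀ᶠ b in 𝓝[HF d] a, b.1 0 = 0 → c.form b.1 (Y b) = 0 := by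
  obtain ⟨r₁, hr₁, hG1⟩ := eventually_contDiffOn_ball (n := 1) h.mem_HF (h.smooth.of_le (by simp))
  obtain ⟨r₂, hr₂, hY2⟩ := eventually_contDiffOn_ball (n := 1) h.mem_HF (hY.of_le (by simp))
  have hY0 : ∀ᶠ b in 𝓝[HF d] a, 0 < 1 + (Y b) 0 := by
    have h1 : Continuous fun v : V d => 1 + v 0 := by fun_prop
    exact ((h1.tendsto _).comp hY.continuousWithinAt.tendsto).eventually_const_lt hYa
  have htar : ∀ᶠ b in 𝓝[HF d] a, b.1 ∈ c.target := by
    have h1 : Tendsto Prod.fst (𝓝[HF d] a) (𝓝[HS d] a.1) :=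
      tendsto_nhdsWithin_iff.2 ⟨continuous_fst.continuousWithinAt,
        by filter_upwards [self_mem_nhdsWithin] with b hb using hb⟩
    exact h1.eventually (target_mem_nhdsWithin h.mem)
  obtain ⟨r₃, hr₃, hall⟩ := exists_eq_on_ball (h.target.and (h.canonical.and (hYe.and
    (hY0.and htar))))
  set r := min r₁ (min r₂ r₃) with hr
  have hrpos : 0 < r := lt_min hr₁ (lt_min hr₂ hr₃)
  set U := HF d ∩ Metric.ball a r with hU
  have hU1 : U ⊆ HF d ∩ Metric.ball a r₁ :=
    inter_subset_inter_right _ (Metric.ball_subset_ball (min_le_left _ _))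
  have hU2 : U ⊆ HF d ∩ Metric.ball a r₂ :=
    inter_subset_inter_right _ (Metric.ball_subset_ball ((min_le_right _ _).trans (min_le_left _ _)))
  have hU3 : U ⊆ HF d ∩ Metric.ball a r₃ :=
    inter_subset_inter_right _ (Metric.ball_subset_ball ((min_le_right _ _).trans (min_le_right _ _)))
  have hUu : UniqueDiffOn ℝ U := uniqueDiffOn_HF.inter Metric.isOpen_ball
  have hG : ContDiffOn ℝ 1 G U := hG1.mono hU1
  have hYU : ContDiffOn ℝ 1 Y U := hY2.mono hU2
  have hG' : ContinuousOn (fderivWithin ℝ G U) U :=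
    hG.continuousOn_fderivWithin hUu le_rfl
  have hfx : ContinuousOn (fun b : V d × V d => c.form b.1) U := fun b hb =>
    ContinuousWithinAt.comp (t := HS d) (contDiffWithinAt_form (hall b (hU3 hb)).2.2.2.2).continuousWithinAt
      continuous_fst.continuousWithinAt fun b hb => hb.1
  have hfx' : ContinuousOn (fun b : V d × V d => c.form (G b).1) U := fun b hb =>
    ContinuousWithinAt.comp (t := HS d)
      (contDiffWithinAt_form (hall b (hU3 hb)).1).continuousWithinAt
      (continuous_fst.comp_continuousOn hG.continuousOn b hb)
      fun b hb => target_subset (hall b (hU3 hb)).1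
  -- Invariance with denominators cleared. Both sides are continuous on the relatively open set `U`,
  -- so it is enough to check the identity where ρ > 0.
  have hid : ∀ u : V d × V d, ∀ b ∈ U,
      (G b).1 0 * lin (G b).2 (fderivWithin ℝ G U b u).1 +
        (G b).2 (Fin.last (d + 1)) * c.form (G b).1 (fderivWithin ℝ G U b u).1 =
      (1 + (Y b) 0) ^ 2 * (b.1 0 * lin b.2 u.1 + b.2 (Fin.last (d + 1)) * c.form b.1 u.1) := by
    intro u b hb
    have hw : ContinuousOn (fun b => (fderivWithin ℝ G U b u).1) U :=
      continuous_fst.comp_continuousOn (hG'.clm_apply continuousOn_const)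
    have hGc := hG.continuousOn
    have hv : ContinuousOn (fun b => (G b).2) U := continuous_snd.comp_continuousOn hGc
    have hx : ContinuousOn (fun b => (G b).1) U := continuous_fst.comp_continuousOn hGc
    have hcoord : ∀ i, Continuous fun v : V d => v i := fun i => by fun_prop
    have hL : ContinuousOn (fun b => (G b).1 0 * lin (G b).2 (fderivWithin ℝ G U b u).1 +
        (G b).2 (Fin.last (d + 1)) * c.form (G b).1 (fderivWithin ℝ G U b u).1) U :=
      (((hcoord _).comp_continuousOn hx).mul
        ((lin.continuous.comp_continuousOn hv).clm_apply hw)).add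
        (((hcoord _).comp_continuousOn hv).mul (hfx'.clm_apply hw))
    have hR : ContinuousOn (fun b : V d × V d => (1 + (Y b) 0) ^ 2 *
        (b.1 0 * lin b.2 u.1 + b.2 (Fin.last (d + 1)) * c.form b.1 u.1)) U := by
      refine ((continuousOn_const.add ((hcoord 0).comp_continuousOn hYU.continuousOn)).pow 2).mul
        (ContinuousOn.add ?_ ?_)
      · exact (Continuous.continuousOn (by fun_prop)).mul
          ((lin.continuous.comp continuous_snd).continuousOn.clm_apply continuousOn_const)
      · exact (Continuous.continuousOn (by fun_prop)).mul (hfx.clm_apply continuousOn_const)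
    have hne := posF_neBot hb.1
    have hle : 𝓝[{b : V d × V d | 0 < b.1 0}] b ≤ 𝓝[U] b := by
      refine nhdsWithin_le_iff.2 ?_
      filter_upwards [self_mem_nhdsWithin,
        nhdsWithin_le_nhds (Metric.isOpen_ball.mem_nhds hb.2)] with y h1 h2
      exact ⟨(show 0 < y.1 0 from h1).le, h2⟩
    refine tendsto_nhds_unique ((hL b hb).tendsto.mono_left hle)
      (((hR b hb).tendsto.mono_left hle).congr' ?_)
    filter_upwards [self_mem_nhdsWithin, hle self_mem_nhdsWithin] with y y1 y2
    have y1 : 0 < y.1 0 := y1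
    obtain ⟨e1, e2, e3, e4, e5⟩ := hall y (hU3 y2)
    have e6 : U ∈ 𝓝 y := inter_mem (HF_mem_nhds y1) (Metric.isOpen_ball.mem_nhds y2.2)
    have e7 := e2 y1 u
    rw [← fderivWithin_of_mem_nhds e6, coform_apply, coform_apply] at e7
    have e8 : (G y).1 0 = y.1 0 * (1 + (Y y) 0) := by rw [e3]; simp; ring
    rw [e8] at e7 ⊢
    field_simp at e7
    linear_combination -e7
  have hbd : ∀ b ∈ U, b.1 0 = 0 → b.2 (Fin.last (d + 1)) ≠ 0 → c.form b.1 (Y b) = 0 := by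
    intro b hb hb0 ht
    obtain ⟨e1, e2, e3, e4, e5⟩ := hall b (hU3 hb)
    have hGb : (G b).1 = b.1 := by rw [e3, hb0, zero_smul, add_zero]
    have hder : ∀ u : V d × V d, (fderivWithin ℝ G U b u).1 = u.1 + u.1 0 • Y b := by
      intro u
      have f1 := ((hG.differentiableOn (by simp)) b hb).hasFDerivWithinAt.fst
      have f2 := ((ContinuousLinearMap.fst ℝ (V d) (V d)).hasFDerivWithinAt (s := U) (x := b)).add
        (((rhoF d).hasFDerivWithinAt (s := U) (x := b)).smul
          ((hYU.differentiableOn (by simp)) b hb).hasFDerivWithinAt)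
      have f3 : HasFDerivWithinAt (fun b => (G b).1) _ U b :=
        HasFDerivWithinAt.congr f2 (fun y hy => (hall y (hU3 hy)).2.2.1) e3
      have f4 := DFunLike.congr_fun ((hUu b hb).eq f1 f3) u
      refine f4.trans ?_
      simp [hb0]
    -- ∂_z is fixed by the differential of the base map at a boundary point, whereas ∂_ρ acquires
    -- the extra term Y.
    have i1 := hid (ez d, 0) b hb
    have i2 := hid (ei 0, 0) b hb
    have hz0 : (ez d) 0 = 0 := ez_of_ne zero_ne_last'
    have h10 : (ei 0 : V d) 0 = 1 := rho_ei (d := d)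
    simp only [hder, hz0, hGb, hb0, zero_mul, zero_add, zero_smul, add_zero] at i1
    simp only [hder, h10, hGb, hb0, zero_mul, zero_add, one_smul, map_add] at i2
    have hz := c.form_ez b.1 e5
    have i3 : (G b).2 (Fin.last (d + 1)) = (1 + (Y b) 0) ^ 2 * b.2 (Fin.last (d + 1)) :=
      mul_right_cancel₀ hz (by linarith)
    rw [i3] at i2
    have i4 : (1 + (Y b) 0) ^ 2 * b.2 (Fin.last (d + 1)) * c.form b.1 (Y b) = 0 := by linarith
    exact (mul_eq_zero.1 i4).resolve_left (mul_ne_zero (pow_pos e4 2).ne' ht)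
  have hUa : U ∈ 𝓝[HF d] a := inter_mem self_mem_nhdsWithin
    (nhdsWithin_le_nhds (Metric.ball_mem_nhds a hrpos))
  filter_upwards [hUa] with b hb hb0
  -- Moving along the last fibre coordinate makes t nonzero without changing the base point, so a
  -- boundary point with t = 0 is a limit of points already treated.
  set u : V d × V d := (0, ez d) with hu
  have ht : Tendsto (fun t : ℝ => b + t • u) (𝓝 0) (𝓝 b) := by
    have h2 : Continuous fun t : ℝ => b + t • u := by fun_prop
    have h3 := h2.tendsto 0
    simpa only [zero_smul, add_zero] using h3
  have hbt : ∀ t : ℝ, (b + t • u).1 = b.1 := fun t => by simp [hu]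
  have htU : Tendsto (fun t : ℝ => b + t • u) (𝓝[≠] 0) (𝓝[U] b) := by
    refine tendsto_nhdsWithin_iff.2 ⟨ht.mono_left nhdsWithin_le_nhds, ?_⟩
    filter_upwards [(ht.mono_left nhdsWithin_le_nhds).eventually (Metric.isOpen_ball.mem_nhds hb.2)]
      with t h1
    refine ⟨?_, h1⟩
    change 0 ≤ (b + t • u).1 0
    rw [hbt, hb0]
  have hcont : ContinuousWithinAt (fun b : V d × V d => c.form b.1 (Y b)) U b :=
    (hfx b hb).clm_apply (hYU.continuousOn b hb)
  refine tendsto_nhds_unique (hcont.tendsto.comp htU) (tendsto_const_nhds.congr' ?_)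
  have h1 : ∀ᶠ t : ℝ in 𝓝[≠] 0, b.2 (Fin.last (d + 1)) + t ≠ 0 := by
    by_cases h2 : b.2 (Fin.last (d + 1)) = 0
    · filter_upwards [self_mem_nhdsWithin] with t ht
      rw [h2, zero_add]; exact ht
    · have h3 : Continuous fun t : ℝ => b.2 (Fin.last (d + 1)) + t := by fun_prop
      have h4 := h3.tendsto 0
      rw [add_zero] at h4
      exact (h4.mono_left nhdsWithin_le_nhds).eventually_ne h2
  filter_upwards [h1, htU.eventually self_mem_nhdsWithin] with t t1 t2
  refine (hbd _ t2 (by rw [hbt]; exact hb0) ?_).symm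
  have : (b + t • u).2 (Fin.last (d + 1)) = b.2 (Fin.last (d + 1)) + t := by
    simp [hu]
  rw [this]; exact t1

end BoundaryRep

end ThetaCalc

end

noncomputable section
namespace ThetaCalc
set_option linter.unusedSectionVars false

/-! ### The lifted covector near the front face -/

variable {d : ℕ} {X : Type*} [TopologicalSpace X] [ChartedSpace (EuclideanHalfSpace (d + 2)) X]
  [IsManifold (𝓡∂ (d + 2)) ∞ X]
  {θ : ∀ p : X, TangentSpace (𝓡∂ (d + 2)) p →L[ℝ] ℝ}

open ThetaChart MChart

theorem lin_ez' (v : V d) : lin v (ez d) = 0 := by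
  rw [lin_apply]
  refine Finset.sum_eq_zero fun j _ => ?_
  rw [ez_of_ne (Fin.castSucc_lt_last j).ne, mul_zero]

/-- The derivative of the left point divided by `s`, in the chart where `ρ'` dominates, along the
directions that keep the right point fixed. -/
def leftDir (c : ThetaChart θ) (x' : V d) : V d →L[ℝ] V d :=
  ContinuousLinearMap.id ℝ (V d) + ((c.form x' (ez d))⁻¹ •
    (x' 0 • EuclideanSpace.proj (𝕜 := ℝ) (Fin.last (d + 1)) - c.form x')).smulRight (ez d)

theorem leftDir_apply (c : ThetaChart θ) (x' u : V d) : leftDir c x' u = u +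
    ((c.form x' (ez d))⁻¹ * (x' 0 * u (Fin.last (d + 1)) - c.form x' u)) • ez d := rfl

theorem form_leftDir {c : ThetaChart θ} {x' : V d} (hx : x' ∈ c.target) (u : V d) :
    c.form x' (leftDir c x' u) = x' 0 * u (Fin.last (d + 1)) := by
  have hz := c.form_ez x' hx
  rw [leftDir_apply, map_add, map_smul, smul_eq_mul]
  field_simp
  ring

theorem leftDir_of_ne {c : ThetaChart θ} {x' : V d} (u : V d) {i : Fin (d + 2)}
    (hi : i ≠ Fin.last (d + 1)) : (leftDir c x' u) i = u i := by
  rw [leftDir_apply, PiLp.add_apply, PiLp.smul_apply, ez_of_ne hi, smul_zero, add_zero]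

theorem lin_leftDir (c : ThetaChart θ) (x' u v : V d) : lin v (leftDir c x' u) = lin v u := by
  rw [leftDir_apply, map_add, map_smul, lin_ez', smul_zero, add_zero]

theorem fderiv_blowdown_none {c : ThetaChart θ} {p : V d × V d}
    (hp : p ∈ (front c none true).baseInner) (u : V d) :
    fderiv ℝ (front c none true).blowdown p (u, 0) = (p.2 0 • leftDir c p.2 u, 0) := by
  obtain ⟨p1, p2, p3, p4⟩ := mem_none_baseInner.1 hp
  have e : liftVec none true p (fun i => u i) = (u, 0) := by
    refine Prod.ext (PiLp.ext fun i => ?_) (PiLp.ext fun i => ?_)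
    · simp [liftVec]
    · simp [liftVec]
  rw [← e]
  refine fderiv_blowdown_liftVec _ (by rwa [frontRight_none]) (by rwa [frontRight_none])
    ((contDiffAt_blowdown hp).differentiableAt (by simp)) (fun i hi => ?_) ?_
  · rw [PiLp.smul_apply, leftDir_of_ne u hi]; rfl
  · rw [frontRight_none, map_smul, form_leftDir p4, smul_eq_mul, slot_none]
    ring

/-- In directions that fix the right point the left displacement is ρ' `leftDir`. With ρ = ρ' ω_0
and with `form` at the left point equal to `form` at the right point plus ρ' Q, all powers of ρ'
cancel. The right-hand side makes sense, and is smooth, up to the front face where ω_0 > 0. -/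
theorem pairing_none_left {c : ThetaChart θ} {p : V d × V d}
    (hp : p ∈ (front c none true).baseInner) {Q : V d →L[ℝ] ℝ}
    (hQ : c.form (frontLeft c none true p) - c.form p.2 = p.2 0 • Q) (v v' u : V d) :
    (front c none true).pairing p v v' (u, 0) =
      (p.1 0)⁻¹ * lin v u + v (Fin.last (d + 1)) * ((p.1 0)⁻¹) ^ 2 *
        (u (Fin.last (d + 1)) + Q (leftDir c p.2 u)) := by
  obtain ⟨p1, p2, p3, p4⟩ := mem_none_baseInner.1 hp
  have e1 : (front c none true).pairing p v v' (u, 0) =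
      c.coform (frontLeft c none true p) v (p.2 0 • leftDir c p.2 u) := by
    unfold pairing
    rw [ContinuousLinearMap.comp_apply, fderiv_blowdown_none hp]
    change c.coform (frontLeft c none true p) v _ - c.coform _ v' 0 = _
    rw [map_zero, sub_zero]
    rfl
  have e2 : c.form (frontLeft c none true p) = c.form p.2 + p.2 0 • Q := by rw [← hQ]; abel
  have e3 : (frontLeft c none true p) 0 = p.2 0 * p.1 0 := by
    rw [frontLeft_zero, slot_none, omega_none]
  rw [e1, coform_apply, e3, e2, map_smul, map_smul, lin_leftDir, add_apply, form_leftDir p4,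
    smul_apply, smul_eq_mul, smul_eq_mul, smul_eq_mul]
  field_simp

theorem contDiffWithinAt_leftDir {c : ThetaChart θ} {E : Type*} [NormedAddCommGroup E]
    [NormedSpace ℝ E] {f : E → V d} {s : Set E} {q : E} (hq : f q ∈ c.target)
    (hf : ContDiffWithinAt ℝ ∞ f s q) (h : ∀ᶠ b in 𝓝[s] q, f b ∈ HS d) :
    ContDiffWithinAt ℝ ∞ (fun b => leftDir c (f b)) s q := by
  have h1 : ContDiffWithinAt ℝ ∞ (fun b => c.form (f b)) s q :=
    ContDiffWithinAt.comp_of_eventually (contDiffWithinAt_form hq) hf h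
  have h2 : ContDiffWithinAt ℝ ∞ (fun b => (f b) 0) s q :=
    (rho d).contDiff.comp_contDiffWithinAt hf
  have h3 : ContDiffWithinAt ℝ ∞ (fun b => (c.form (f b) (ez d))⁻¹ •
    ((f b) 0 • EuclideanSpace.proj (𝕜 := ℝ) (Fin.last (d + 1)) - c.form (f b))) s q :=
    (ContDiffWithinAt.inv (h1.clm_apply contDiffWithinAt_const) (c.form_ez _ hq)).smul
      ((h2.smul contDiffWithinAt_const).sub h1)
  exact contDiffWithinAt_const.add (h3.smulRight contDiffWithinAt_const)

namespace BoundaryRep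

variable {c : ThetaChart θ} {a : V d × V d} {G : V d × V d → V d × V d}

/-- The rescaled left coordinates determined by the quotients `Y` and `Z`. -/
def omegaOf (Y : V d × V d → V d) (Z : V d × V d → ℝ) (b : V d × V d) : V d :=
  -- Here ρ' = ρ (1 + Y_0), x - x' = -ρ Y and form(x - x') = -ρ² Z, to be divided by ρ' or by ρ'²
  -- according to weight.
  WithLp.toLp 2 fun i => if i = 0 then (1 + (Y b) 0)⁻¹
    else if i = Fin.last (d + 1) then -Z b / (1 + (Y b) 0) ^ 2
    else -(Y b) i / (1 + (Y b) 0)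

theorem frontLeft_omegaOf {Y : V d × V d → V d} {Z : V d × V d → ℝ} {b : V d × V d}
    (h1 : (G b).1 ∈ c.target) (h2 : (G b).1 = b.1 + b.1 0 • Y b) (h3 : 0 < 1 + (Y b) 0)
    (h4 : c.form (G b).1 (Y b) = b.1 0 * Z b) :
    frontLeft c none true (omegaOf Y Z b, (G b).1) = b.1 := by
  have hs : slot none (omegaOf Y Z b, (G b).1) = b.1 0 * (1 + (Y b) 0) := by
    rw [slot_none, h2]; simp; ring
  refine frontLeft_unique (by rwa [frontRight_none]) ?_ ?_ ?_
  · rw [hs, omega_none]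
    simp only [omegaOf, if_true]
    field_simp
  · intro i hi hl
    rw [hs, omega_none, frontRight_none]
    simp only [omegaOf, hi, hl, if_false]
    rw [h2]
    simp only [PiLp.add_apply, PiLp.smul_apply, smul_eq_mul]
    field_simp
    ring
  · rw [hs, omega_none, frontRight_none]
    simp only [omegaOf, last_ne_zero', if_true, if_false]
    have : b.1 - (G b).1 = -(b.1 0 • Y b) := by rw [h2]; abel
    rw [this, map_neg, map_smul, h4, smul_eq_mul]
    field_simp

theorem contDiffWithinAt_omegaOf {Y : V d × V d → V d} {Z : V d × V d → ℝ} {s : Set (V d × V d)}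
    (hY : ContDiffWithinAt ℝ ∞ Y s a) (hZ : ContDiffWithinAt ℝ ∞ Z s a) (h : 0 < 1 + (Y a) 0) :
    ContDiffWithinAt ℝ ∞ (omegaOf Y Z) s a := by
  have hYi : ∀ i, ContDiffWithinAt ℝ ∞ (fun b => (Y b) i) s a := fun i =>
    (EuclideanSpace.proj (𝕜 := ℝ) i).contDiff.comp_contDiffWithinAt hY
  have hg : ContDiffWithinAt ℝ ∞ (fun b => 1 + (Y b) 0) s a := contDiffWithinAt_const.add (hYi 0)
  refine contDiffWithinAt_euclidean.2 fun i => ?_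
  simp only [omegaOf]
  split_ifs
  · exact hg.inv h.ne'
  · exact hZ.neg.div (hg.pow 2) (pow_ne_zero _ h.ne')
  · exact (hYi i).neg.div hg h.ne'

/-- At the boundary point the base map has derivative y + y_0 Y in the base directions. It is
injective because its ρ component multiplies y_0 by 1 + Y_0 > 0, and invertibility persists nearby.
So the right point of the graph moves in every direction as the left base point varies. -/
theorem exists_inverse_partial (h : BoundaryRep c a G) {Y : V d × V d → V d}
    (hY : ContDiffWithinAt ℝ ∞ Y (HF d) a)
    (hYe : ∀ᶠ b in 𝓝[HF d] a, (G b).1 = b.1 + b.1 0 • Y b) (hYa : 0 < 1 + (Y a) 0) :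
    ∃ B : V d × V d → V d →L[ℝ] V d, ContDiffWithinAt ℝ ∞ B (HF d) a ∧
      ∀ᶠ b in 𝓝[HF d] a, ∀ y,
        fderivWithin ℝ (fun b => (G b).1) (HF d) b (B b y, 0) = y := by
  set A : V d × V d → V d →L[ℝ] V d := fun b =>
    (fderivWithin ℝ (fun b => (G b).1) (HF d) b).comp (ContinuousLinearMap.inl ℝ (V d) (V d))
  have hA : ContDiffWithinAt ℝ ∞ A (HF d) a :=
    (h.smooth.fst.fderivWithin_right uniqueDiffOn_HF (by simp) h.mem_HF).clm_comp
      contDiffWithinAt_const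
  have hAa : ∀ y, A a y = y + y 0 • Y a := by
    intro y
    have f2 := ((ContinuousLinearMap.fst ℝ (V d) (V d)).hasFDerivWithinAt (s := HF d) (x := a)).add
        (((rhoF d).hasFDerivWithinAt (s := HF d) (x := a)).smul
          (hY.differentiableWithinAt (by simp)).hasFDerivWithinAt)
    have f3 : HasFDerivWithinAt (fun b => (G b).1) _ (HF d) a :=
      HasFDerivWithinAt.congr_of_eventuallyEq f2 hYe (hYe.self_of_nhdsWithin h.mem_HF)
    have f4 := DFunLike.congr_fun (f3.fderivWithin (uniqueDiffOn_HF a h.mem_HF)) (y, 0)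
    refine f4.trans ?_
    simp [h.zero]
  have hinj : Function.Injective (A a) := by
    refine (injective_iff_map_eq_zero _).2 fun y hy => ?_
    rw [hAa] at hy
    have h1 := congrArg (fun v : V d => v 0) hy
    simp only [PiLp.add_apply, PiLp.smul_apply, PiLp.zero_apply, smul_eq_mul] at h1
    have h2 : y 0 * (1 + (Y a) 0) = 0 := by linarith
    have h3 : y 0 = 0 := (mul_eq_zero.1 h2).resolve_right hYa.ne'
    rwa [h3, zero_smul, add_zero] at hy
  let E : V d ≃L[ℝ] V d := (LinearEquiv.ofInjectiveEndo (A a).toLinearMap hinj).toContinuousLinearEquiv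
  have hE : (E : V d →L[ℝ] V d) = A a := ContinuousLinearMap.ext fun y => rfl
  refine ⟨fun b => (A b).inverse, ?_, ?_⟩
  · have e1 := contDiffAt_map_inverse (𝕜 := ℝ) (n := ∞) E
    rw [hE] at e1
    exact e1.comp_contDiffWithinAt a hA
  · have e2 := E.nhds
    rw [hE] at e2
    filter_upwards [hA.continuousWithinAt.tendsto.eventually e2] with b hb y
    obtain ⟨E', hE'⟩ := hb
    change A b ((A b).inverse y) = y
    rw [← hE', ContinuousLinearMap.inverse_equiv]
    simp

/-- The formula `pairing` for the covector is singular at the boundary, so the smooth extension is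
assembled from two values that determine it: the explicit expression on directions fixing the right
point, and zero on directions tangent to the lifted graph. The last conclusion, with `g₀` = 1 + Y_0
at `a`, is what transversality needs. -/
theorem exists_lift (h : BoundaryRep c a G) :
    ∃ F : V d × V d → CV d, ContDiffWithinAt ℝ ∞ F (HF d) a ∧ (F a).1.2 0 = 0 ∧
      0 < (F a).1.1 0 ∧
      (∀ᶠ b in 𝓝[HF d] a, (F b).1 ∈ (front c none true).dom ∧
        frontLeft c none true (F b).1 = b.1 ∧ (F b).1.2 = (G b).1 ∧
        (0 < b.1 0 → (F b).2 = (front c none true).pairing (F b).1 b.2 (G b).2)) ∧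
      ∃ g₀ > 0, ∀ u, (fderivWithin ℝ F (HF d) a u).1.2 0 = g₀ * u.1 0 := by
  obtain ⟨Y, hY, hYe, hYa⟩ := h.exists_quotient
  have hG1 := h.smooth.fst
  have hGa : (G a).1 = a.1 := h.fix.self_of_nhdsWithin h.mem_HF h.zero
  have hGHS : ∀ᶠ b in 𝓝[HF d] a, (G b).1 ∈ HS d := h.target.mono fun b hb => target_subset hb
  have hf : ContDiffWithinAt ℝ ∞ (fun b => c.form (G b).1 (Y b)) (HF d) a := by
    refine ContDiffWithinAt.clm_apply ?_ hY
    exact ContDiffWithinAt.comp_of_eventually (contDiffWithinAt_form (by rw [hGa]; exact h.mem))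
      hG1 hGHS
  obtain ⟨Z, hZ, hZe⟩ := exists_smooth_quotient (rhoF_ei (d := d)) h.mem_HF hf (by
    filter_upwards [h.form_quotient_eq_zero hY hYe hYa, h.fix] with b h1 h2 h3
    rw [h2 h3, h1 h3])
  obtain ⟨B, hB, hBe⟩ := h.exists_inverse_partial hY hYe hYa
  have hY0 : ∀ᶠ b in 𝓝[HF d] a, 0 < 1 + (Y b) 0 := by
    have h1 : Continuous fun v : V d => 1 + v 0 := by fun_prop
    exact ((h1.tendsto _).comp hY.continuousWithinAt.tendsto).eventually_const_lt hYa
  have htar : ∀ᶠ b in 𝓝[HF d] a, b.1 ∈ c.target := by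
    have h1 : Tendsto Prod.fst (𝓝[HF d] a) (𝓝[HS d] a.1) :=
      tendsto_nhdsWithin_iff.2 ⟨continuous_fst.continuousWithinAt,
        by filter_upwards [self_mem_nhdsWithin] with b hb using hb⟩
    exact h1.eventually (target_mem_nhdsWithin h.mem)
  set m : V d × V d → V d × V d := fun b => (omegaOf Y Z b, (G b).1) with hm
  have hω := contDiffWithinAt_omegaOf hY hZ hYa
  have hms : ContDiffWithinAt ℝ ∞ m (HF d) a := hω.prodMk hG1
  have hω0 : ∀ b, (m b).1 0 = (1 + (Y b) 0)⁻¹ := fun b => by simp [hm, omegaOf]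
  have hme : ∀ᶠ b in 𝓝[HF d] a, m b ∈ (front c none true).dom ∧
      frontLeft c none true (m b) = b.1 := by
    filter_upwards [h.target, hYe, hY0, hZe, htar] with b h1 h2 h3 h4 h5
    have h6 := frontLeft_omegaOf h1 h2 h3 h4
    refine ⟨mem_none_dom.2 ⟨?_, ?_, h1⟩, h6⟩
    · rw [hω0]; positivity
    · rw [h6]; exact h5
  have hma := (hme.self_of_nhdsWithin h.mem_HF).1
  obtain ⟨Q, hQ, hQe⟩ := exists_form_quotient hma
  have tm : Tendsto m (𝓝[HF d] a) (𝓝[(front c none true).dom] (m a)) :=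
    tendsto_nhdsWithin_iff.2 ⟨hms.continuousWithinAt.tendsto, hme.mono fun b hb => hb.1⟩
  have hQm : ContDiffWithinAt ℝ ∞ (fun b => Q (m b)) (HF d) a :=
    ContDiffWithinAt.comp_of_eventually hQ hms (hme.mono fun b hb => hb.1)
  set η₁ : V d × V d → V d →L[ℝ] ℝ := fun b => ((m b).1 0)⁻¹ • lin b.2 +
    (b.2 (Fin.last (d + 1)) * (((m b).1 0)⁻¹) ^ 2) •
      (EuclideanSpace.proj (𝕜 := ℝ) (Fin.last (d + 1)) +
        (Q (m b)).comp (leftDir c (G b).1)) with hη₁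
  have hη₁s : ContDiffWithinAt ℝ ∞ η₁ (HF d) a := by
    have e0 : ContDiffWithinAt ℝ ∞ (fun b => ((m b).1 0)⁻¹) (HF d) a := by
      refine ContDiffWithinAt.inv ((rho d).contDiff.comp_contDiffWithinAt hms.fst) ?_
      change (m a).1 0 ≠ 0
      rw [hω0]
      positivity
    have e1 : ContDiffWithinAt ℝ ∞ (fun b : V d × V d => lin b.2) (HF d) a :=
      (lin.contDiff.comp contDiff_snd).contDiffWithinAt
    have e2 : ContDiffWithinAt ℝ ∞ (fun b : V d × V d => b.2 (Fin.last (d + 1))) (HF d) a :=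
      (by fun_prop : ContDiff ℝ ∞ fun b : V d × V d => b.2 (Fin.last (d + 1))).contDiffWithinAt
    have e3 := contDiffWithinAt_leftDir (c := c) (by rw [hGa]; exact h.mem) hG1 hGHS
    exact (e0.smul e1).add ((e2.mul (e0.pow 2)).smul
      (contDiffWithinAt_const.add (hQm.clm_comp e3)))
  set Dω : V d × V d → V d × V d →L[ℝ] V d := fderivWithin ℝ (omegaOf Y Z) (HF d) with hDω
  have hDωs : ContDiffWithinAt ℝ ∞ Dω (HF d) a :=
    hω.fderivWithin_right uniqueDiffOn_HF (by simp) h.mem_HF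
  -- Every w is the sum of the derivative of the lifted graph along (B w.2, 0), whose right part is
  -- w.2, and of a vector that fixes the right point. The first summand is to be annihilated, so
  -- only `η₁` on the second remains.
  set η : V d × V d → V d × V d →L[ℝ] ℝ := fun b =>
    (η₁ b).comp (ContinuousLinearMap.fst ℝ (V d) (V d)) -
      (((η₁ b).comp (Dω b)).comp (ContinuousLinearMap.inl ℝ (V d) (V d))).comp
        ((B b).comp (ContinuousLinearMap.snd ℝ (V d) (V d))) with hη
  have hηs : ContDiffWithinAt ℝ ∞ η (HF d) a :=
    (hη₁s.clm_comp contDiffWithinAt_const).sub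
      (((hη₁s.clm_comp hDωs).clm_comp contDiffWithinAt_const).clm_comp
        (hB.clm_comp contDiffWithinAt_const))
  have hF := hms.prodMk hηs
  have hmdiff : ∀ᶠ b in 𝓝[HF d] a, 0 < b.1 0 → DifferentiableAt ℝ m b := by
    obtain ⟨r, hr, hU⟩ := eventually_contDiffOn_ball (n := 1) h.mem_HF (hms.of_le (by simp))
    filter_upwards [self_mem_nhdsWithin, nhdsWithin_le_nhds (Metric.ball_mem_nhds a hr)]
      with b b1 b2 b3
    exact ((hU b ⟨b1, b2⟩).contDiffAt (inter_mem (HF_mem_nhds b3)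
      (Metric.isOpen_ball.mem_nhds b2))).differentiableAt (by simp)
  have hGdiff : ∀ᶠ b in 𝓝[HF d] a, 0 < b.1 0 → DifferentiableAt ℝ G b := by
    obtain ⟨r, hr, hU⟩ := eventually_contDiffOn_ball (n := 1) h.mem_HF (h.smooth.of_le (by simp))
    filter_upwards [self_mem_nhdsWithin, nhdsWithin_le_nhds (Metric.ball_mem_nhds a hr)]
      with b b1 b2 b3
    exact ((hU b ⟨b1, b2⟩).contDiffAt (inter_mem (HF_mem_nhds b3)
      (Metric.isOpen_ball.mem_nhds b2))).differentiableAt (by simp)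
  refine ⟨fun b => (m b, η b), hF, ?_, ?_, ?_, 1 + (Y a) 0, hYa, ?_⟩
  · change (G a).1 0 = 0
    rw [hGa, h.zero]
  · change 0 < (m a).1 0
    rw [hω0]; positivity
  · have hme2 := eventually_eventually_nhdsWithin.2 hme
    filter_upwards [hme, hme2, tm.eventually hQe, hBe, hmdiff, hGdiff, h.canonical, h.pos, hY0]
      with b b1 b2 b3 b4 b5 b6 b7 b8 b9
    refine ⟨b1.1, b1.2, rfl, fun hb0 => ?_⟩
    have hnb : 𝓝[HF d] b = 𝓝 b := nhdsWithin_eq_nhds.2 (HF_mem_nhds hb0)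
    rw [hnb] at b2
    have hbi : m b ∈ (front c none true).baseInner :=
      mem_none_baseInner.2 ⟨by rw [hω0]; positivity, b8 hb0, (mem_none_dom.1 b1.1).2⟩
    have key1 : ∀ u, (front c none true).pairing (m b) b.2 (G b).2 (u, 0) = η₁ b u := by
      intro u
      rw [frontRight_none] at b3
      rw [pairing_none_left hbi b3]
      simp only [hη₁, add_apply, smul_apply, smul_eq_mul, ContinuousLinearMap.comp_apply]
      rfl
    have hmd := (b5 hb0).hasFDerivAt
    -- The blow-down of the lifted graph is the graph itself, so this value is α(k) minus the
    -- canonical form on the image of k, which is zero.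
    have key2 : ∀ k, (front c none true).pairing (m b) b.2 (G b).2 (fderiv ℝ m b k) = 0 := by
      intro k
      have e1 := ((contDiffAt_blowdown hbi).differentiableAt (by simp)).hasFDerivAt.comp b hmd
      have e2 := (hasFDerivAt_fst (𝕜 := ℝ) (E := V d) (F := V d) (p := b)).prodMk
        (b6 hb0).hasFDerivAt.fst
      have e3 : (front c none true).blowdown ∘ m =ᶠ[𝓝 b] fun b => (b.1, (G b).1) := by
        filter_upwards [b2] with y hy
        refine Prod.ext hy.2 ?_
        change frontRight none true (m y) = _
        rw [frontRight_none]
      have e4 := DFunLike.congr_fun (e1.unique (e2.congr_of_eventuallyEq e3)) k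
      have e5 : fderiv ℝ (front c none true).blowdown (m b) (fderiv ℝ m b k) =
        (k.1, (fderiv ℝ G b k).1) := e4
      have e6 : (front c none true).blowdown (m b) = (b.1, (G b).1) := e3.self_of_nhds
      unfold pairing
      rw [ContinuousLinearMap.comp_apply, e5, e6]
      change c.coform b.1 b.2 k.1 - c.coform (G b).1 (G b).2 (fderiv ℝ G b k).1 = 0
      rw [b7 hb0 k, sub_self]
    have e7 : ∀ k, fderiv ℝ m b k = (Dω b k, fderivWithin ℝ (fun b => (G b).1) (HF d) b k) := by
      intro k
      have f1 := hmd.fst.fderiv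
      have f2 := hmd.snd.fderiv
      rw [hDω, fderivWithin_of_mem_nhds (HF_mem_nhds hb0), fderivWithin_of_mem_nhds (HF_mem_nhds hb0)]
      exact Prod.ext (DFunLike.congr_fun f1 k).symm (DFunLike.congr_fun f2 k).symm
    refine ContinuousLinearMap.ext fun w => ?_
    have e8 := key2 (B b w.2, 0)
    rw [e7, b4] at e8
    have e9 : w = (w.1 - Dω b (B b w.2, 0), 0) + (Dω b (B b w.2, 0), w.2) := by
      refine Prod.ext ?_ ?_ <;> simp
    have e10 : (front c none true).pairing (m b) b.2 (G b).2 w =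
        η₁ b (w.1 - Dω b (B b w.2, 0)) := by
      conv_lhs => rw [e9, map_add, e8, key1, add_zero]
    rw [e10, map_sub]
    rfl
  · intro u
    have f1 := ((hF.differentiableWithinAt (by simp)).hasFDerivWithinAt.fst).snd
    have f2 := ((rho d).hasFDerivAt (x := (G a).1)).comp_hasFDerivWithinAt a f1
    have f3 : HasFDerivWithinAt (fun b : V d × V d => rhoF d b * (1 + rho d (Y b))) _ (HF d) a :=
      ((rhoF d).hasFDerivWithinAt (s := HF d) (x := a)).mul
      ((hasFDerivWithinAt_const (1 : ℝ) a (HF d)).add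
        ((rho d).hasFDerivAt.comp_hasFDerivWithinAt a
          (hY.differentiableWithinAt (by simp)).hasFDerivWithinAt))
    have f4 : (fun b => rho d (G b).1) =ᶠ[𝓝[HF d] a] fun b => rhoF d b * (1 + rho d (Y b)) := by
      filter_upwards [hYe] with b hb
      rw [hb]
      simp
      ring
    have f5 := (uniqueDiffOn_HF a h.mem_HF).eq f2
      (f3.congr_of_eventuallyEq f4 (f4.self_of_nhdsWithin h.mem_HF))
    refine (DFunLike.congr_fun f5 u).trans ?_
    simp [h.zero]

end BoundaryRep

end ThetaCalc

end

noncomputable section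
namespace ThetaCalc
set_option linter.unusedSectionVars false

/-! ### Smooth families of covectors over the graph of a canonical transformation -/

variable {d : ℕ} {X : Type*} [TopologicalSpace X] [ChartedSpace (EuclideanHalfSpace (d + 2)) X]
  [IsManifold (𝓡∂ (d + 2)) ∞ X]
  {θ : ∀ p : X, TangentSpace (𝓡∂ (d + 2)) p →L[ℝ] ℝ}

open ThetaChart MChart

theorem eventually_contDiffAt {E : Type} [NormedAddCommGroup E] [NormedSpace ℝ E]
    {F : V d × V d → E} {a : V d × V d} (ha : a ∈ HF d) (hF : ContDiffWithinAt ℝ ∞ F (HF d) a)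
    (n : ℕ) : ∀ᶠ b in 𝓝[HF d] a, 0 < b.1 0 → ContDiffAt ℝ n F b := by
  obtain ⟨r, hr, hU⟩ := eventually_contDiffOn_ball (n := n) ha (hF.of_le (by exact_mod_cast le_top))
  filter_upwards [self_mem_nhdsWithin, nhdsWithin_le_nhds (Metric.ball_mem_nhds a hr)]
    with b b1 b2 b3
  exact (hU b ⟨b1, b2⟩).contDiffAt (inter_mem (HF_mem_nhds b3) (Metric.isOpen_ball.mem_nhds b2))

theorem continuous_symp {E : Type*} [NormedAddCommGroup E] [NormedSpace ℝ E] :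
    Continuous fun p : (E × (E →L[ℝ] ℝ)) × (E × (E →L[ℝ] ℝ)) => symp p.1 p.2 := by
  unfold symp
  fun_prop

/-- The hypothesis says that the canonical 1-form pulls back to zero over the interior. One more
derivative, antisymmetrized, gives the symplectic form because second derivatives are symmetric;
continuity of the first derivative of `F` carries the result to boundary points. -/
theorem symp_fderivWithin_eq_zero {F : V d × V d → CV d} {a : V d × V d} (ha : a ∈ HF d)
    (hF : ContDiffWithinAt ℝ ∞ F (HF d) a)
    (h0 : ∀ᶠ b in 𝓝[HF d] a, 0 < b.1 0 → ∀ k, (F b).2 (fderiv ℝ F b k).1 = 0)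
    (u k : V d × V d) :
    symp (fderivWithin ℝ F (HF d) a u) (fderivWithin ℝ F (HF d) a k) = 0 := by
  have hne := posF_neBot ha
  have hle := nhdsWithin_posF_le (b := a)
  have hc := (hF.fderivWithin_right uniqueDiffOn_HF (m := ∞) (by simp) ha).continuousWithinAt
  have hlim : Tendsto (fun b => symp (fderivWithin ℝ F (HF d) b u) (fderivWithin ℝ F (HF d) b k))
      (𝓝[{b : V d × V d | 0 < b.1 0}] a)
      (𝓝 (symp (fderivWithin ℝ F (HF d) a u) (fderivWithin ℝ F (HF d) a k))) := by
    have e1 : Continuous fun L : V d × V d →L[ℝ] CV d => (L u, L k) := by fun_prop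
    exact ((continuous_symp.comp e1).tendsto _).comp (hc.tendsto.mono_left hle)
  refine tendsto_nhds_unique hlim (tendsto_const_nhds.congr' ?_)
  filter_upwards [hle (eventually_contDiffAt ha hF 2), hle (eventually_eventually_nhdsWithin.2 h0),
    self_mem_nhdsWithin] with b b1 b2 b3
  have b3 : 0 < b.1 0 := b3
  have b1 := b1 b3
  rw [nhdsWithin_eq_nhds.2 (HF_mem_nhds b3)] at b2
  rw [fderivWithin_of_mem_nhds (HF_mem_nhds b3)]
  have hd : HasFDerivAt F (fderiv ℝ F b) b := (b1.differentiableAt (by simp)).hasFDerivAt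
  have hd2 : HasFDerivAt (fderiv ℝ F) (fderiv ℝ (fderiv ℝ F) b) b :=
    ((b1.fderiv_right (m := 1) (by norm_num)).differentiableAt (by simp)).hasFDerivAt
  have hz : ∀ w k : V d × V d, (fderiv ℝ F b w).2 (fderiv ℝ F b k).1 +
      (F b).2 (fderiv ℝ (fderiv ℝ F) b w k).1 = 0 := by
    intro w k
    have e1 : HasFDerivAt (fun b => (fderiv ℝ F b k).1) _ b :=
      (hd2.clm_apply (hasFDerivAt_const k b)).fst
    have e2 := hd.snd.clm_apply e1
    have e3 : (fun b => (F b).2 (fderiv ℝ F b k).1) =ᶠ[𝓝 b] fun _ => 0 := by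
      filter_upwards [b2, isOpen_posF.mem_nhds b3] with y y1 y2
      exact y1 y2 k
    have e4 := DFunLike.congr_fun
      (e2.unique ((hasFDerivAt_const (0 : ℝ) b).congr_of_eventuallyEq e3)) w
    simp at e4
    linarith
  have hsymm : fderiv ℝ (fderiv ℝ F) b u k = fderiv ℝ (fderiv ℝ F) b k u :=
    (b1.isSymmSndFDerivAt (by simp)) u k
  have e1 := hz u k
  have e2 := hz k u
  rw [hsymm] at e1
  unfold symp
  linarith

/-- `F` is a smooth family of covectors of the stretched product over the graph of the coordinate
expression `G` of a map preserving the canonical 1-form. -/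
structure LiftRep (m : MChart θ) (a : V d × V d) (G : V d × V d → V d × V d)
    (F : V d × V d → CV d) : Prop where
  mem : a ∈ HF d
  smooth : ContDiffWithinAt ℝ ∞ F (HF d) a
  smooth_rep : ContDiffWithinAt ℝ ∞ G (HF d) a
  dom : ∀ᶠ b in 𝓝[HF d] a, (F b).1 ∈ m.dom
  blow : ∀ᶠ b in 𝓝[HF d] a, m.blowdown (F b).1 = (b.1, (G b).1)
  pair : ∀ᶠ b in 𝓝[HF d] a, 0 < b.1 0 → 0 < (G b).1 0 ∧
    (F b).2 = m.pairing (F b).1 b.2 (G b).2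
  canonical : ∀ᶠ b in 𝓝[HF d] a, 0 < b.1 0 → ∀ h : V d × V d,
    m.right.coform (G b).1 (G b).2 (fderiv ℝ G b h).1 = m.left.coform b.1 b.2 h.1
  regular : ∀ᶠ b in 𝓝[HF d] a, b.1 0 = 0 → ∃ c, m = front c none true ∧ (F b).1.2 0 = 0 ∧
    0 < (F b).1.1 0

namespace LiftRep

variable {m : MChart θ} {a : V d × V d} {G : V d × V d → V d × V d} {F : V d × V d → CV d}

theorem eventually_baseInner (h : LiftRep m a G F) :
    ∀ᶠ b in 𝓝[HF d] a, 0 < b.1 0 → (F b).1 ∈ m.baseInner := by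
  filter_upwards [h.dom, h.blow, h.pair] with b b1 b2 b3 b4
  exact ⟨b1, by rw [b2]; exact b4, by rw [b2]; exact (b3 b4).1⟩

theorem apply_fderiv (h : LiftRep m a G F) :
    ∀ᶠ b in 𝓝[HF d] a, 0 < b.1 0 → ∀ k, (F b).2 (fderiv ℝ F b k).1 = 0 := by
  filter_upwards [h.eventually_baseInner, eventually_eventually_nhdsWithin.2 h.blow, h.pair,
    h.canonical, eventually_contDiffAt h.mem h.smooth 1,
    eventually_contDiffAt h.mem h.smooth_rep 1] with b b1 b2 b3 b4 b5 b6 hb0 k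
  rw [nhdsWithin_eq_nhds.2 (HF_mem_nhds hb0)] at b2
  have hbi := b1 hb0
  have hF := ((b5 hb0).differentiableAt (by simp)).hasFDerivAt.fst
  have e1 := ((contDiffAt_blowdown hbi).differentiableAt (by simp)).hasFDerivAt.comp b hF
  have e2 := (hasFDerivAt_fst (𝕜 := ℝ) (E := V d) (F := V d) (p := b)).prodMk
    ((b6 hb0).differentiableAt (by simp)).hasFDerivAt.fst
  have e4 := DFunLike.congr_fun (e1.unique (e2.congr_of_eventuallyEq b2)) k
  have e5 : fderiv ℝ m.blowdown (F b).1 (fderiv ℝ F b k).1 = (k.1, (fderiv ℝ G b k).1) := e4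
  have e6 := b2.self_of_nhds
  rw [(b3 hb0).2]
  unfold pairing
  rw [ContinuousLinearMap.comp_apply, e5, e6]
  change m.left.coform b.1 b.2 k.1 - m.right.coform (G b).1 (G b).2 (fderiv ℝ G b k).1 = 0
  rw [b4 hb0 k, sub_self]

theorem symp_eq_zero (h : LiftRep m a G F) (u k : V d × V d) :
    symp (fderivWithin ℝ F (HF d) a u) (fderivWithin ℝ F (HF d) a k) = 0 :=
  symp_fderivWithin_eq_zero h.mem h.smooth h.apply_fderiv u k

/-- The parameter is recovered from `F`: the blow-down gives the left base point, and pairing with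
the lifted left frame gives the fibre components. Differentiating both recoveries yields the claim.
Only the values of the covector derivative on the lifted fields are assumed to vanish, so that at
the front face its restriction to TF is enough. -/
theorem eq_zero_of_fderivWithin (h : LiftRep m a G F) {T : Fin (d + 2) → V d × V d → V d × V d}
    (hT : ∀ j, ContDiffWithinAt ℝ ∞ (T j) m.dom (F a).1)
    (hT' : ∀ᶠ b in 𝓝[m.dom] (F a).1, b ∈ m.baseInner →
        ∀ j, fderiv ℝ m.blowdown b (T j b) = (m.left.frame (m.blowdown b).1 j, 0))
    {u : V d × V d} (h1 : (fderivWithin ℝ F (HF d) a u).1 = 0)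
    (h2 : ∀ j, (fderivWithin ℝ F (HF d) a u).2 (T j (F a).1) = 0) : u = 0 := by
  have hne := posF_neBot h.mem
  have hle := nhdsWithin_posF_le (b := a)
  have hdomF := h.dom.self_of_nhdsWithin h.mem
  have hF := (h.smooth.differentiableWithinAt (by simp)).hasFDerivWithinAt
  have tF : Tendsto (fun b => (F b).1) (𝓝[HF d] a) (𝓝[m.dom] (F a).1) :=
    tendsto_nhdsWithin_iff.2 ⟨h.smooth.fst.continuousWithinAt.tendsto, h.dom⟩
  have hHF : HF d ∈ 𝓝[HF d] a := self_mem_nhdsWithin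
  have hTF : ∀ j, ContDiffWithinAt ℝ ∞ (fun b => T j (F b).1) (HF d) a := fun j =>
    ContDiffWithinAt.comp_of_eventually (hT j) h.smooth.fst h.dom
  have hv : ∀ j, HasFDerivWithinAt (fun b => (F b).2 (T j (F b).1)) _ (HF d) a := fun j =>
    hF.snd.clm_apply ((hTF j).differentiableWithinAt (by simp)).hasFDerivWithinAt
  have hbv : ∀ᶠ b in 𝓝[{b : V d × V d | 0 < b.1 0}] a, ∀ j, (F b).2 (T j (F b).1) = b.2 j := by
    filter_upwards [hle h.eventually_baseInner, hle h.blow, hle h.pair, hle (tF.eventually hT'),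
      self_mem_nhdsWithin] with b b1 b2 b3 b4 b5 j
    have hbi := b1 b5
    rw [(b3 b5).2]
    unfold pairing
    rw [ContinuousLinearMap.comp_apply, b4 hbi j, b2]
    change m.left.coform b.1 b.2 (m.left.frame b.1 j) - m.right.coform _ _ 0 = _
    have hb1 := (blowdown_mem hbi.1).1
    rw [b2] at hb1
    rw [map_zero, sub_zero, coform_frame hb1 b5]
  have hUn : UniqueDiffWithinAt ℝ {b : V d × V d | 0 < b.1 0} a := by
    refine uniqueDiffWithinAt_convex ?_ ?_ (mem_closure_posF h.mem)
    · exact convex_halfSpace_gt (rhoF d).toLinearMap.isLinear 0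
    · rw [isOpen_posF.interior_eq]
      exact ⟨(ei 0, 0), by change (0 : ℝ) < rhoF d (ei 0, 0); rw [rhoF_ei]; exact one_pos⟩
  have hsub : {b : V d × V d | 0 < b.1 0} ⊆ HF d := fun b hb => (show 0 < b.1 0 from hb).le
  have hu2 : ∀ j, u.2 j = 0 := fun j => by
    have e1 := (hv j).mono hsub
    have e2 : HasFDerivWithinAt (fun b : V d × V d => b.2 j)
        ((EuclideanSpace.proj (𝕜 := ℝ) j).comp (ContinuousLinearMap.snd ℝ (V d) (V d)))
        {b : V d × V d | 0 < b.1 0} a :=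
      ((EuclideanSpace.proj (𝕜 := ℝ) j).comp
        (ContinuousLinearMap.snd ℝ (V d) (V d))).hasFDerivWithinAt
    have e3 : (F a).2 (T j (F a).1) = a.2 j :=
      tendsto_nhds_unique ((e1.continuousWithinAt.tendsto).congr' (hbv.mono fun b hb => hb j))
        e2.continuousWithinAt.tendsto
    have e4 := DFunLike.congr_fun
      (hUn.eq e1 (e2.congr_of_eventuallyEq (hbv.mono fun b hb => hb j) e3)) u
    have e5 : u.2 j = _ := e4.symm
    rw [e5]
    -- The lifted field depends on the parameter only through the base point of `F`, whose
    -- derivative along `u` is zero.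
    have e6 : fderivWithin ℝ (fun b => T j (F b).1) (HF d) a u = 0 := by
      obtain ⟨D, hD⟩ := (hT j).differentiableWithinAt (by simp)
      have f1 : HasFDerivWithinAt (fun b => T j (F b).1) _ (HF d) a :=
        HasFDerivWithinAt.comp_of_tendsto (x := a) (f := fun b => (F b).1) hD hF.fst tF
      rw [f1.fderivWithin (uniqueDiffOn_HF a h.mem)]
      change D (fderivWithin ℝ F (HF d) a u).1 = 0
      rw [h1, map_zero]
    simp [e6, h2 j]
  have hu1 : u.1 = 0 := by
    obtain ⟨D, hD⟩ := (contDiffWithinAt_blowdown hdomF).fst.differentiableWithinAt (by simp)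
    have f1 := HasFDerivWithinAt.comp_of_tendsto (x := a) (f := fun b => (F b).1) hD hF.fst tF
    have f2 : HasFDerivWithinAt (fun b : V d × V d => b.1) _ (HF d) a :=
      f1.congr_of_eventuallyEq (h.blow.mono fun b hb => (congrArg Prod.fst hb).symm)
        (congrArg Prod.fst (h.blow.self_of_nhdsWithin h.mem)).symm
    have f3 := DFunLike.congr_fun ((uniqueDiffOn_HF a h.mem).eq f2
      ((ContinuousLinearMap.fst ℝ (V d) (V d)).hasFDerivWithinAt)) u
    have f4 : u.1 = D (fderivWithin ℝ F (HF d) a u).1 := f3.symm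
    rw [f4, h1, map_zero]
  exact Prod.ext hu1 (PiLp.ext hu2)

end LiftRep

end ThetaCalc

end

noncomputable section
namespace ThetaCalc
set_option linter.unusedSectionVars false

/-! ### Lifts of canonical transformations -/

variable {d : ℕ} {X : Type*} [TopologicalSpace X] [T2Space X]
  [ChartedSpace (EuclideanHalfSpace (d + 2)) X] [IsManifold (𝓡∂ (d + 2)) ∞ X]
  {θ : ∀ p : X, TangentSpace (𝓡∂ (d + 2)) p →L[ℝ] ℝ}

open ThetaChart MChart ThetaCot

theorem nhdsWithin_dom_HF {c : ThetaChart θ} {a : V d × V d} (ha : a ∈ (thetaAtlas θ c).dom) :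
    𝓝[(thetaAtlas θ c).dom] a = 𝓝[HF d] a := nhdsWithin_dom ha

theorem contDiffWithinAt_dom_iff {E : Type*} [NormedAddCommGroup E] [NormedSpace ℝ E]
    {c : ThetaChart θ} {a : V d × V d} (ha : a ∈ (thetaAtlas θ c).dom) {F : V d × V d → E} :
    ContDiffWithinAt ℝ ∞ F (thetaAtlas θ c).dom a ↔ ContDiffWithinAt ℝ ∞ F (HF d) a :=
  contDiffWithinAt_congr_set (nhdsWithin_eq_iff_eventuallyEq.1 (nhdsWithin_dom_HF ha))

theorem fderivWithin_dom {E : Type*} [NormedAddCommGroup E] [NormedSpace ℝ E]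
    {c : ThetaChart θ} {a : V d × V d} (ha : a ∈ (thetaAtlas θ c).dom) (F : V d × V d → E) :
    fderivWithin ℝ F (thetaAtlas θ c).dom a = fderivWithin ℝ F (HF d) a :=
  fderivWithin_congr_set (nhdsWithin_eq_iff_eventuallyEq.1 (nhdsWithin_dom_HF ha))

theorem mem_HF_of_dom {c : ThetaChart θ} {a : V d × V d} (ha : a ∈ (thetaAtlas θ c).dom) :
    a ∈ HF d := target_subset (c := c) ha

variable {z : Bool} {χ : ThetaCot θ → ThetaCot θ}

theorem IsLocalRep.eventually_domain {c c' : ThetaChart θ} {a : V d × V d}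
    {G : V d × V d → V d × V d} (h : IsLocalRep (thetaAtlas θ) (thetaAtlas θ) χ c c' a G)
    {ζ : ThetaCot θ} (hζ : ζ ∈ domain θ z) (hζa : ζ.1 = (thetaAtlas θ c).germ a) :
    ∀ᶠ b in 𝓝[HF d] a, b ∈ (thetaAtlas θ c).dom ∧ G b ∈ (thetaAtlas θ c').dom ∧
      ∀ ζ' : ThetaCot θ, ζ'.1 = (thetaAtlas θ c).germ b →
        ζ' ∈ domain θ z ∧ (χ ζ').1 = (thetaAtlas θ c').germ (G b) := by
  rw [← nhdsWithin_dom_HF h.mem]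
  filter_upwards [h.rep, eventually_mem_domain h.mem hζa hζ] with b b1 b2
  exact ⟨b2.1, b1.1, fun ζ' h' => ⟨b2.2 ζ' h', b1.2 ζ' h'⟩⟩

namespace IsLiftable

theorem overInterior_iff (hχ : IsLiftable z χ) {ζ : ThetaCot θ} (hζ : ζ ∈ domain θ z) :
    (χ ζ).OverInterior ↔ ζ.OverInterior := by
  refine ⟨fun h => ?_, fun h => (hχ.canonical ζ hζ h).1⟩
  rcases overInterior_or_overBoundary ζ with h1 | ⟨p, hp, h1⟩
  · exact h1
  · exact absurd ⟨p, hp, hχ.boundary ζ hζ p hp h1⟩ (not_overBoundary_of_overInterior h)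

theorem eventually_pos (hχ : IsLiftable z χ) {ζ : ThetaCot θ} (hζ : ζ ∈ domain θ z)
    {c c' : ThetaChart θ} {a : V d × V d} {G : V d × V d → V d × V d}
    (h : IsLocalRep (thetaAtlas θ) (thetaAtlas θ) χ c c' a G)
    (hζa : ζ.1 = (thetaAtlas θ c).germ a) :
    ∀ᶠ b in 𝓝[HF d] a, 0 < b.1 0 → 0 < (G b).1 0 := by
  filter_upwards [h.eventually_domain hζ hζa] with b b1 b2
  obtain ⟨b3, b4⟩ := b1.2.2 (BSpace.mk c b b1.1) rfl
  exact (ThetaCot.overInterior_iff b1.2.1 b4).1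
    ((hχ.overInterior_iff b3).2 ((ThetaCot.overInterior_iff b1.1 rfl).2 b2))

theorem eventually_canonical (hχ : IsLiftable z χ) {ζ : ThetaCot θ} (hζ : ζ ∈ domain θ z)
    {c c' : ThetaChart θ} {a : V d × V d} {G : V d × V d → V d × V d}
    (h : IsLocalRep (thetaAtlas θ) (thetaAtlas θ) χ c c' a G)
    (hζa : ζ.1 = (thetaAtlas θ c).germ a) :
    ∀ᶠ b in 𝓝[HF d] a, 0 < b.1 0 → ∀ h : V d × V d,
      c'.coform (G b).1 (G b).2 (fderiv ℝ G b h).1 = c.coform b.1 b.2 h.1 := by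
  filter_upwards [eventually_eventually_nhdsWithin.2 (h.eventually_domain hζ hζa),
    h.eventually_domain hζ hζa] with b b1 b2 b3
  rw [nhdsWithin_eq_nhds.2 (HF_mem_nhds b3)] at b1
  exact hχ.canonical_of_rep (b2.2.2 (BSpace.mk c b b2.1) rfl).1 b2.1 b3 rfl
    (b1.mono fun y hy => ⟨hy.2.1, fun p hp => (hy.2.2 p hp).2⟩)

theorem boundaryRep (hχ : IsLiftable z χ) {ζ : ThetaCot θ} (hζ : ζ ∈ domain θ z)
    {c : ThetaChart θ} {a : V d × V d} {G : V d × V d → V d × V d}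
    (h : IsLocalRep (thetaAtlas θ) (thetaAtlas θ) χ c c a G)
    (hζa : ζ.1 = (thetaAtlas θ c).germ a) (h0 : a.1 0 = 0) : BoundaryRep c a G where
  mem := h.mem
  zero := h0
  smooth := (contDiffWithinAt_dom_iff h.mem).1 h.smooth
  target := (h.eventually_domain hζ hζa).mono fun b hb => hb.2.1
  pos := hχ.eventually_pos hζ h hζa
  canonical := hχ.eventually_canonical hζ h hζa
  fix := by
    filter_upwards [h.eventually_domain hζ hζa] with b b1 b2
    obtain ⟨b3, b4⟩ := b1.2.2 (BSpace.mk c b b1.1) rfl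
    have e1 := isOver_of_germ (ζ := BSpace.mk c b b1.1) b1.1 rfl
    obtain ⟨p, hp, e2⟩ := (overBoundary_iff (ζ := BSpace.mk c b b1.1) b1.1 rfl).2 b2
    have e3 := hχ.boundary _ b3 _ hp e2
    exact pt_injOn b1.2.1 b1.1
      ((isOver_unique (isOver_of_germ b1.2.1 b4) e3).trans (isOver_unique e2 e1))
  inv := by
    obtain ⟨ψ, hψm, hψi, hψs⟩ := hχ.inverse
    have hev := h.eventually_domain hζ hζa
    obtain ⟨a1, a2, a3⟩ := hev.self_of_nhdsWithin (mem_HF_of_dom h.mem)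
    obtain ⟨-, a4⟩ := a3 ζ hζa
    have hχζ := hχ.mapsTo hζ
    obtain ⟨H, hHa, hH⟩ := (hψs _ hχζ).exists_isLocalRep a2 a4 a1
      (by rw [hψi.1 hζ]; exact hζa)
    have hHs := (contDiffWithinAt_dom_iff a2).1 hH.smooth
    have hHd : ∀ᶠ y in 𝓝[HF d] (G a), y ∈ (thetaAtlas θ c).dom ∧ H y ∈ (thetaAtlas θ c).dom ∧
        ∀ ζ' : ThetaCot θ, ζ'.1 = (thetaAtlas θ c).germ y →
          ζ' ∈ domain θ z ∧ (ψ ζ').1 = (thetaAtlas θ c).germ (H y) := by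
      rw [← nhdsWithin_dom_HF a2]
      filter_upwards [hH.rep, eventually_mem_domain a2 a4 hχζ] with y y1 y2
      exact ⟨y2.1, y1.1, fun ζ' h' => ⟨y2.2 ζ' h', y1.2 ζ' h'⟩⟩
    -- The inverse `ψ` also maps the boundary to the boundary, so ρ ∘ H is divisible by ρ; composed
    -- with `G` this is the factor required.
    obtain ⟨k, hk, hke⟩ := exists_smooth_quotient (rhoF_ei (d := d)) (mem_HF_of_dom a2)
      (f := fun y => rhoF d (H y)) ((rhoF d).contDiff.comp_contDiffWithinAt hHs) (by
        filter_upwards [hHd] with y y1 y2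
        obtain ⟨y3, y4⟩ := y1.2.2 (BSpace.mk c y y1.1) rfl
        have e1 := overInterior_or_overBoundary (ψ (BSpace.mk c y y1.1))
        rcases e1 with e1 | e1
        · rw [← hχ.overInterior_iff (hψm y3), hψi.2 y3] at e1
          exact absurd ((overBoundary_iff y1.1 rfl).2 y2) (not_overBoundary_of_overInterior e1)
        · exact (overBoundary_iff y1.2.1 y4).1 e1)
    have hGt : Tendsto G (𝓝[HF d] a) (𝓝[HF d] (G a)) :=
      tendsto_nhdsWithin_iff.2 ⟨((contDiffWithinAt_dom_iff a1).1 h.smooth).continuousWithinAt,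
        hev.mono fun b hb => mem_HF_of_dom hb.2.1⟩
    refine ⟨fun b => k (G b), k (G a), hk.continuousWithinAt.tendsto.comp hGt, ?_⟩
    filter_upwards [hev, hGt.eventually hHd, hGt.eventually hke] with b b1 b2 b3
    obtain ⟨b4, b5⟩ := b1.2.2 (BSpace.mk c b b1.1) rfl
    have e1 := (b2.2.2 _ b5).2
    rw [hψi.1 b4] at e1
    have e2 : b = H (G b) := eq_of_germ_eq b1.1 e1
    have e3 : rhoF d (H (G b)) = _ := b3
    rw [← e2] at e3
    exact e3

end IsLiftable

/-- `F` is a smooth family of covectors of the stretched product lying over the graph of `χ`. -/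
def GraphRep (χ : ThetaCot θ → ThetaCot θ) (m : MChart θ) (a : V d × V d)
    (F : V d × V d → CV d) : Prop :=
  ∃ G, IsLocalRep (thetaAtlas θ) (thetaAtlas θ) χ m.left m.right a G ∧ LiftRep m a G F

theorem IsLiftable.exists_graphRep_of_boundary (hχ : IsLiftable z χ) {ζ : ThetaCot θ}
    (hζ : ζ ∈ domain θ z) {c : ThetaChart θ} {a : V d × V d} (ha : a ∈ (thetaAtlas θ c).dom)
    (hζa : ζ.1 = (thetaAtlas θ c).germ a) (h0 : a.1 0 = 0) :
    ∃ F, GraphRep χ (front c none true) a F ∧ (F a).1.2 0 = 0 ∧ 0 < (F a).1.1 0 ∧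
      ∃ g₀ > 0, ∀ u, (fderivWithin ℝ F (HF d) a u).1.2 0 = g₀ * u.1 0 := by
  obtain ⟨p, hp, e2⟩ := (overBoundary_iff ha hζa).2 h0
  have e1 := isOver_of_germ ha hζa
  have e3 := hχ.boundary _ hζ _ hp e2
  rw [isOver_unique e2 e1] at e3
  -- The image lies over the same boundary point, so one chart of X serves source and target, as the
  -- projective charts require.
  obtain ⟨v', hv'⟩ := exists_germ_of_isOver ha e3
  obtain ⟨G, hGa, hG⟩ := (hχ.smooth ζ hζ).exists_isLocalRep ha hζa
    (a' := (a.1, v')) (c' := c) ha hv'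
  have hB := hχ.boundaryRep hζ hG hζa h0
  obtain ⟨F, hF, hF0, hF1, hFe, hg⟩ := hB.exists_lift
  refine ⟨F, ⟨G, hG, hB.mem_HF, hF, hB.smooth, hFe.mono fun b hb => hb.1, ?_, ?_, hB.canonical,
    ?_⟩, hF0, hF1, hg⟩
  · filter_upwards [hFe] with b b1
    change (frontLeft c none true (F b).1, frontRight none true (F b).1) = _
    rw [frontRight_none, b1.2.1, b1.2.2.1]
  · filter_upwards [hFe, hB.pos] with b b1 b2 b3
    exact ⟨b2 b3, b1.2.2.2 b3⟩
  · have t1 : ∀ᶠ b in 𝓝[HF d] a, 0 < (F b).1.1 0 :=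
      (((EuclideanSpace.proj (𝕜 := ℝ) (0 : Fin (d + 2))).continuous.tendsto _).comp
        hF.fst.fst.continuousWithinAt.tendsto).eventually (lt_mem_nhds hF1)
    filter_upwards [t1, hFe, hB.fix] with b b1 b2 b3 b4
    exact ⟨c, rfl, by rw [b2.2.2.1, b3 b4, b4], b1⟩

theorem IsLiftable.exists_graphRep_of_interior (hχ : IsLiftable z χ) {ζ : ThetaCot θ}
    (hζ : ζ ∈ domain θ z) {c : ThetaChart θ} {a : V d × V d} (ha : a ∈ (thetaAtlas θ c).dom)
    (hζa : ζ.1 = (thetaAtlas θ c).germ a) (h0 : 0 < a.1 0) :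
    ∃ c' F, GraphRep χ (MChart.prod c c') a F := by
  obtain ⟨c', a', ha', hζ'⟩ := ThetaCot.exists_germ (χ ζ)
  obtain ⟨G, hGa, hG⟩ := (hχ.smooth ζ hζ).exists_isLocalRep ha hζa ha' hζ'
  have hev := hG.eventually_domain hζ hζa
  have hpos := hχ.eventually_pos hζ hG hζa
  have hGs := (contDiffWithinAt_dom_iff ha).1 hG.smooth
  have haH := mem_HF_of_dom ha
  have hin : ∀ᶠ b in 𝓝[HF d] a, 0 < b.1 0 :=
    nhdsWithin_le_nhds (isOpen_posF.mem_nhds h0)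
  have hbi : ∀ᶠ b in 𝓝[HF d] a, (b.1, (G b).1) ∈ (MChart.prod c c').baseInner := by
    filter_upwards [hin, hev, hpos] with b b1 b2 b3
    exact prod_mem_baseInner b2.1 b2.2.1 b1 (b3 b1)
  refine ⟨c', fun b => ((b.1, (G b).1), (MChart.prod c c').pairing (b.1, (G b).1) b.2 (G b).2), G,
    hG, haH, ?_, hGs, hbi.mono fun b hb => hb.1, Eventually.of_forall fun b => rfl, ?_,
    hχ.eventually_canonical hζ hG hζa, hin.mono fun b h1 h2 => absurd h2 h1.ne'⟩
  · have e1 : ContDiffWithinAt ℝ ∞ (fun b : V d × V d => (b.1, (G b).1)) (HF d) a :=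
      contDiffWithinAt_fst.prodMk hGs.fst
    refine e1.prodMk ?_
    exact (contDiffAt_pairing (hbi.self_of_nhdsWithin haH) a.2 (G a).2).comp_contDiffWithinAt a
      (f := fun b => ((b.1, (G b).1), (b.2, (G b).2))) (e1.prodMk (contDiffWithinAt_snd.prodMk hGs.snd))
  · filter_upwards [hpos] with b b1 b2
    exact ⟨b1 b2, rfl⟩

theorem IsLiftable.exists_graphRep_of_germ (hχ : IsLiftable z χ) {ζ : ThetaCot θ}
    (hζ : ζ ∈ domain θ z) {c : ThetaChart θ} {a : V d × V d} (ha : a ∈ (thetaAtlas θ c).dom)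
    (hζa : ζ.1 = (thetaAtlas θ c).germ a) : ∃ m F, m.left = c ∧ GraphRep χ m a F := by
  rcases (show (0 : ℝ) ≤ a.1 0 from mem_HF_of_dom ha).eq_or_lt with h0 | h0
  · obtain ⟨F, hF, -⟩ := hχ.exists_graphRep_of_boundary hζ ha hζa h0.symm
    exact ⟨front c none true, F, rfl, hF⟩
  · obtain ⟨c', F, hF⟩ := hχ.exists_graphRep_of_interior hζ ha hζa h0
    exact ⟨MChart.prod c c', F, rfl, hF⟩

theorem IsLiftable.exists_graphRep (hχ : IsLiftable z χ) {ζ : ThetaCot θ}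
    (hζ : ζ ∈ domain θ z) : ∃ m a F, ζ.1 = (thetaAtlas θ m.left).germ a ∧ GraphRep χ m a F := by
  obtain ⟨c, a, ha, hζa⟩ := ThetaCot.exists_germ ζ
  obtain ⟨m, F, rfl, hF⟩ := hχ.exists_graphRep_of_germ hζ ha hζa
  exact ⟨m, a, F, hζa, hF⟩

end ThetaCalc

end

noncomputable section
namespace ThetaCalc
set_option linter.unusedSectionVars false

/-! ### The lifted graph -/

variable {d : ℕ} {X : Type*} [TopologicalSpace X] [T2Space X]
  [ChartedSpace (EuclideanHalfSpace (d + 2)) X] [IsManifold (𝓡∂ (d + 2)) ∞ X]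
  {θ : ∀ p : X, TangentSpace (𝓡∂ (d + 2)) p →L[ℝ] ℝ}

open ThetaChart MChart ThetaCot

variable {z : Bool} {χ : ThetaCot θ → ThetaCot θ} {φ : ThetaCot θ × ThetaCot θ → CotM θ}

theorem ThetaCot.nhdsWithin_overInterior_neBot (ζ : ThetaCot θ) :
    (𝓝[{ζ' : ThetaCot θ | ζ'.OverInterior}] ζ).NeBot := by
  obtain ⟨c, a, ha, h⟩ := ThetaCot.exists_germ ζ
  have hne := posF_neBot (mem_HF_of_dom ha)
  classical
  have hd : ∀ᶠ b in 𝓝[{b : V d × V d | 0 < b.1 0}] a, b ∈ (thetaAtlas θ c).dom := by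
    refine nhdsWithin_posF_le ?_
    rw [← nhdsWithin_dom_HF ha]
    exact self_mem_nhdsWithin
  let f : V d × V d → ThetaCot θ := fun b =>
    if hb : b ∈ (thetaAtlas θ c).dom then BSpace.mk c b hb else ζ
  have hf : ∀ b (hb : b ∈ (thetaAtlas θ c).dom), (f b).1 = (thetaAtlas θ c).germ b := fun b hb => by
    simp only [f, dif_pos hb]; rfl
  have ht : Tendsto f (𝓝[{b : V d × V d | 0 < b.1 0}] a) (𝓝 ζ) :=
    BSpace.tendsto_of_germ h (g := id) (tendsto_id'.2 nhdsWithin_le_nhds)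
      (hd.mono fun b hb => hf b hb)
  refine (tendsto_nhdsWithin_iff.2 ⟨ht, ?_⟩).neBot
  filter_upwards [hd, self_mem_nhdsWithin] with b b1 b2
  exact (overInterior_iff b1 (hf b b1)).2 b2

/-- `τ` is the limit at `ζ`, from the interior, of the graph of `χ`. -/
def IsGraphLimit (φ : ThetaCot θ × ThetaCot θ → CotM θ) (χ : ThetaCot θ → ThetaCot θ)
    (ζ : ThetaCot θ) (τ : CotM θ) : Prop :=
  τ.IsRegular ∧
    Tendsto (fun ζ' => φ (ζ', χ ζ')) (𝓝[{ζ' : ThetaCot θ | ζ'.OverInterior}] ζ) (𝓝 τ)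

/-- The interior accumulates at every point of ᶿT*X, and one regular limit excludes any other. -/
theorem IsGraphLimit.unique {ζ : ThetaCot θ} {τ τ' : CotM θ} (h : IsGraphLimit φ χ ζ τ)
    (h' : IsGraphLimit φ χ ζ τ') : τ = τ' :=
  have := nhdsWithin_overInterior_neBot ζ
  h'.1.eq_of_tendsto h.2 h'.2

open Classical in
/-- The continuous extension of the graph of `χ`. -/
def graphLift (φ : ThetaCot θ × ThetaCot θ → CotM θ) (χ : ThetaCot θ → ThetaCot θ)
    (ζ : ThetaCot θ) : CotM θ :=
  -- On the domain of a liftable `χ` the limit exists, so the default value plays no role there.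
  if h : ∃ τ, IsGraphLimit φ χ ζ τ then h.choose else φ (ζ, χ ζ)

theorem IsGraphLimit.graphLift_eq {ζ : ThetaCot θ} {τ : CotM θ} (h : IsGraphLimit φ χ ζ τ) :
    graphLift φ χ ζ = τ := by
  have h1 : ∃ τ, IsGraphLimit φ χ ζ τ := ⟨τ, h⟩
  rw [graphLift, dif_pos h1]
  exact h1.choose_spec.unique h

namespace GraphRep

variable {m : MChart θ} {a : V d × V d} {F : V d × V d → CV d}

theorem mem_dom (h : GraphRep χ m a F) : a ∈ (thetaAtlas θ m.left).dom := by
  obtain ⟨G, hG, hF⟩ := h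
  exact hG.mem

theorem smooth (h : GraphRep χ m a F) : ContDiffWithinAt ℝ ∞ F (HF d) a := by
  obtain ⟨G, hG, hF⟩ := h
  exact hF.smooth

theorem eventually_dom (h : GraphRep χ m a F) : ∀ᶠ b in 𝓝[HF d] a, (F b).1 ∈ m.dom := by
  obtain ⟨G, hG, hF⟩ := h
  exact hF.dom

theorem eventually_baseInner (h : GraphRep χ m a F) :
    ∀ᶠ b in 𝓝[HF d] a, 0 < b.1 0 → (F b).1 ∈ m.baseInner := by
  obtain ⟨G, hG, hF⟩ := h
  exact hF.eventually_baseInner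

theorem eventually_eq (h : GraphRep χ m a F) (hφ : IsIdentification φ) :
    ∀ᶠ b in 𝓝[HF d] a, b ∈ (thetaAtlas θ m.left).dom ∧ (0 < b.1 0 → ∀ ζ : ThetaCot θ,
      ζ.1 = (thetaAtlas θ m.left).germ b → (φ (ζ, χ ζ)).1 = (mAtlas θ m).germ (F b)) := by
  obtain ⟨G, hG, hF⟩ := h
  have hr := hG.rep
  have hd : ∀ᶠ b in 𝓝[(thetaAtlas θ m.left).dom] a, b ∈ (thetaAtlas θ m.left).dom :=
    self_mem_nhdsWithin
  rw [nhdsWithin_dom_HF hG.mem] at hr hd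
  filter_upwards [hr, hd, hF.eventually_baseInner, hF.blow, hF.pair] with b b1 b2 b3 b4 b5
  refine ⟨b2, fun b0 ζ hζ => ?_⟩
  obtain ⟨b6, b7⟩ := b5 b0
  have e1 := b1.2 ζ hζ
  rw [hφ ζ (χ ζ) ((overInterior_iff b2 hζ).2 b0) ((overInterior_iff b1.1 e1).2 b6), hζ, e1]
  have e2 := MChart.germ_pairing (b3 b0) b.2 (G b).2
  rw [← b7, b4] at e2
  exact e2.symm

theorem eventually_isRegular (h : GraphRep χ m a F) :
    ∀ᶠ b in 𝓝[HF d] a, ∀ η, ∀ τ : CotM θ,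
      τ.1 = (mAtlas θ m).germ ((F b).1, η) → τ.IsRegular := by
  have hin := h.eventually_baseInner
  obtain ⟨G, hG, hF⟩ := h
  filter_upwards [hin, hF.regular, hF.dom, self_mem_nhdsWithin] with b b1 b2 b3 b4 η τ hτ
  rcases (show (0 : ℝ) ≤ b.1 0 from b4).eq_or_lt with b5 | b5
  · obtain ⟨c, rfl, b6, b7⟩ := b2 b5.symm
    exact Or.inr ⟨c, ((F b).1, η), b3, b6, b7, hτ⟩
  · exact Or.inl ((CotM.overInterior_iff (b := ((F b).1, η)) b3 hτ).2 (b1 b5))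

/-- `F` is continuous at all nearby points, those over the boundary included, and at interior points
it describes the graph. So its value is the limit of the graph from the interior. That this holds at
every nearby `b` makes `F` a coordinate expression of the extension. -/
theorem eventually_isGraphLimit (h : GraphRep χ m a F) (hφ : IsIdentification φ) :
    ∀ᶠ b in 𝓝[HF d] a, ∀ (ζ : ThetaCot θ) (τ : CotM θ), ζ.1 = (thetaAtlas θ m.left).germ b →
      τ.1 = (mAtlas θ m).germ (F b) → IsGraphLimit φ χ ζ τ := by
  have haH := mem_HF_of_dom h.mem_dom
  have hc : ∀ᶠ b in 𝓝[HF d] a, ContinuousWithinAt F (HF d) b := by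
    have h1 := (h.smooth.of_le (m := 0) (by simp)).eventually (by simp)
    rw [insert_eq_of_mem haH] at h1
    exact h1.mono fun b hb => hb.continuousWithinAt
  filter_upwards [hc, eventually_eventually_nhdsWithin.2 h.eventually_dom,
    eventually_eventually_nhdsWithin.2 (h.eventually_eq hφ), h.eventually_eq hφ,
    h.eventually_isRegular] with b b1 b2 b3 b4 b5 ζ τ hζ hτ
  refine ⟨b5 _ τ hτ, BSpace.tendsto_nhds_iff.2 fun s hs => ?_⟩
  rw [hτ] at hs
  have e1 : ∀ᶠ y in 𝓝[HF d] b, s ∈ (mAtlas θ m).germ (F y) :=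
    b1.tendsto.eventually (BChart.eventually_mem_germ hs)
  have e2 := b3.and e1
  rw [← nhdsWithin_dom_HF b4.1] at e2
  filter_upwards [nhdsWithin_le_nhds (ThetaCot.eventually_exists_germ b4.1 hζ e2),
    self_mem_nhdsWithin] with ζ' h1 h2
  obtain ⟨y, ⟨⟨y1, y2⟩, y3⟩, y4⟩ := h1
  rw [y1.2 ((overInterior_iff y3 y4).1 h2) ζ' y4]
  exact y2

theorem isLocalRep (h : GraphRep χ m a F) (hφ : IsIdentification φ) :
    IsLocalRep (thetaAtlas θ) (mAtlas θ) (graphLift φ χ) m.left m a F := by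
  refine ⟨h.mem_dom, (contDiffWithinAt_dom_iff h.mem_dom).2 h.smooth, ?_⟩
  rw [nhdsWithin_dom_HF h.mem_dom]
  filter_upwards [h.eventually_dom, h.eventually_isGraphLimit hφ] with b b1 b2
  refine ⟨b1, fun ζ hζ => ?_⟩
  rw [(b2 ζ (BSpace.mk m (F b) b1) hζ rfl).graphLift_eq]
  rfl

end GraphRep

theorem IsLiftable.graphLift_isRegular (hχ : IsLiftable z χ) (hφ : IsIdentification φ)
    {ζ : ThetaCot θ} (hζ : ζ ∈ domain θ z) : (graphLift φ χ ζ).IsRegular := by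
  obtain ⟨m, a, F, hζa, hF⟩ := hχ.exists_graphRep hζ
  have haH := mem_HF_of_dom hF.mem_dom
  exact hF.eventually_isRegular.self_of_nhdsWithin haH _ _
    (((hF.isLocalRep hφ).rep.self_of_nhdsWithin hF.mem_dom).2 ζ hζa)

theorem IsLiftable.graphLift_eq (hχ : IsLiftable z χ) (hφ : IsIdentification φ)
    {ζ : ThetaCot θ} (hζ : ζ ∈ domain θ z) (h0 : ζ.OverInterior) :
    graphLift φ χ ζ = φ (ζ, χ ζ) := by
  obtain ⟨m, a, F, hζa, hF⟩ := hχ.exists_graphRep hζ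
  have haH := mem_HF_of_dom hF.mem_dom
  refine Subtype.ext ((((hF.isLocalRep hφ).rep.self_of_nhdsWithin hF.mem_dom).2 ζ hζa).trans ?_)
  exact (((hF.eventually_eq hφ).self_of_nhdsWithin haH).2
    ((ThetaCot.overInterior_iff hF.mem_dom hζa).1 h0) ζ hζa).symm

theorem IsLiftable.continuousAt_graphLift (hχ : IsLiftable z χ) (hφ : IsIdentification φ)
    {ζ : ThetaCot θ} (hζ : ζ ∈ domain θ z) : ContinuousAt (graphLift φ χ) ζ := by
  obtain ⟨m, a, F, hζa, hF⟩ := hχ.exists_graphRep hζ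
  exact (hF.isLocalRep hφ).continuousAt hζa

instance : T2Space (ThetaCot θ) := by
  refine ⟨fun ζ ζ' h => ?_⟩
  have h1 : Disjoint ζ.1 ζ'.1 := by
    by_contra h2
    exact h (ThetaCot.eq_of_inf_neBot ((neBot_iff).2 fun h3 => h2 (disjoint_iff.2 h3)))
  obtain ⟨s, hs, t, ht, hst⟩ := Filter.disjoint_iff.1 h1
  refine ⟨{ζ | s ∈ ζ.1}, {ζ | t ∈ ζ.1}, ?_, ?_, hs, ht, ?_⟩
  · exact isOpen_iff_mem_nhds.2 fun ζ hζ => BSpace.eventually_mem hζ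
  · exact isOpen_iff_mem_nhds.2 fun ζ hζ => BSpace.eventually_mem hζ
  · refine Set.disjoint_left.2 fun ζ h1 h2 => ?_
    have := ThetaCot.neBot ζ
    exact this.ne (Filter.empty_mem_iff_bot.1 (hst.inter_eq ▸ inter_mem h1 h2))

theorem ThetaCot.domain_mem_nhds {ζ : ThetaCot θ} (hζ : ζ ∈ domain θ z) : domain θ z ∈ 𝓝 ζ := by
  obtain ⟨c, a, ha, h⟩ := ThetaCot.exists_germ ζ
  filter_upwards [ThetaCot.eventually_exists_germ ha h (eventually_mem_domain ha h hζ)] with ζ' h'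
  obtain ⟨b, hb, hb'⟩ := h'
  exact hb.1.2 ζ' hb'

theorem CotM.left_eq_of_eq_prod {τ : CotM θ} {ζ ζ' : ThetaCot θ}
    (h : τ.1 = ζ.1 ×ˢ map (dil (-1)) ζ'.1) : CotM.left τ = ζ :=
  CotM.left_eq (by rw [h]; exact tendsto_fst)

theorem IsLiftable.phi_eq_prod (hχ : IsLiftable z χ) (hφ : IsIdentification φ)
    {ζ : ThetaCot θ} (hζ : ζ ∈ domain θ z) (h0 : ζ.OverInterior) :
    (φ (ζ, χ ζ)).1 = ζ.1 ×ˢ map (dil (-1)) (χ ζ).1 :=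
  hφ ζ (χ ζ) h0 ((hχ.overInterior_iff hζ).2 h0)

/-- Over the interior the lift is a product of filters with first factor ζ; elsewhere continuity and
density of the interior apply. A continuous left inverse turns the lift into an embedding. -/
theorem IsLiftable.left_graphLift (hχ : IsLiftable z χ) (hφ : IsIdentification φ)
    {ζ : ThetaCot θ} (hζ : ζ ∈ domain θ z) : CotM.left (graphLift φ χ ζ) = ζ := by
  have := nhdsWithin_overInterior_neBot ζ
  have h1 : Tendsto (fun ζ => CotM.left (graphLift φ χ ζ)) (𝓝[{ζ' : ThetaCot θ | ζ'.OverInterior}] ζ)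
      (𝓝 (CotM.left (graphLift φ χ ζ))) :=
    (CotM.continuous_left.continuousAt.comp (hχ.continuousAt_graphLift hφ hζ)).tendsto.mono_left
      nhdsWithin_le_nhds
  refine tendsto_nhds_unique h1 (Tendsto.congr' ?_ (tendsto_id'.2 nhdsWithin_le_nhds))
  filter_upwards [nhdsWithin_le_nhds (domain_mem_nhds hζ), self_mem_nhdsWithin] with ζ' h2 h3
  rw [hχ.graphLift_eq hφ h2 h3]
  exact (CotM.left_eq_of_eq_prod (hχ.phi_eq_prod hφ h2 h3)).symm

theorem IsLiftable.isEmbedding_graphLift (hχ : IsLiftable z χ) (hφ : IsIdentification φ) :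
    IsEmbedding ((domain θ z).domRestrict (graphLift φ χ)) := by
  have hc : ContinuousOn (graphLift φ χ) (domain θ z) := fun ζ hζ =>
    (hχ.continuousAt_graphLift hφ hζ).continuousWithinAt
  refine IsEmbedding.of_comp (g := CotM.left) (continuousOn_iff_continuous_domRestrict.1 hc)
    CotM.continuous_left ?_
  convert IsEmbedding.subtypeVal (p := fun ζ => ζ ∈ domain θ z) using 1
  exact funext fun ζ => hχ.left_graphLift hφ ζ.2

/-- The left projection descends to T*F, where it is still a continuous left inverse. -/
theorem IsLiftable.isEmbedding_restrictToF (hχ : IsLiftable z χ) (hφ : IsIdentification φ) :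
    IsEmbedding (fun ζ : {ζ : ThetaCot θ // ζ ∈ domain θ z ∧ (graphLift φ χ ζ).OverFront} =>
      restrictToF ⟨graphLift φ χ ζ.1, ζ.2.2⟩) := by
  refine IsEmbedding.of_comp (g := CotF.left) ?_ CotF.continuous_left ?_
  · refine continuous_quot_mk.comp (Continuous.subtype_mk ?_ _)
    exact continuous_iff_continuousAt.2 fun ζ =>
      (hχ.continuousAt_graphLift hφ ζ.2.1).comp continuous_subtype_val.continuousAt
  · convert IsEmbedding.subtypeVal
      (p := fun ζ => ζ ∈ domain θ z ∧ (graphLift φ χ ζ).OverFront) using 1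
    exact funext fun ζ => hχ.left_graphLift hφ ζ.2.1

theorem GraphRep.injective {m : MChart θ} {a : V d × V d} {F : V d × V d → CV d}
    (h : GraphRep χ m a F) : Function.Injective (fderivWithin ℝ F (HF d) a) := by
  have haH := mem_HF_of_dom h.mem_dom
  obtain ⟨T, hT, hT', -⟩ := m.exists_lift (h.eventually_dom.self_of_nhdsWithin haH)
  obtain ⟨G, hG, hF⟩ := h
  refine (injective_iff_map_eq_zero _).2 fun u hu => hF.eq_zero_of_fderivWithin hT hT' ?_ ?_
  · rw [hu]; rfl
  · intro j; rw [hu]; rfl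

theorem IsLiftable.isLagrangianEmbedding (hχ : IsLiftable z χ) (hφ : IsIdentification φ) :
    IsLagrangianEmbedding (domain θ z) (graphLift φ χ) := by
  refine ⟨hχ.isEmbedding_graphLift hφ, fun ζ hζ => ?_⟩
  obtain ⟨m, a, F, hζa, hF⟩ := hχ.exists_graphRep hζ
  refine ⟨m.left, m, a, F, hζa, hF.isLocalRep hφ, ?_⟩
  rw [fderivWithin_dom hF.mem_dom]
  refine ⟨hF.injective, ?_⟩
  obtain ⟨G, hG, hF⟩ := hF
  exact hF.symp_eq_zero

theorem IsLiftable.image_subset_domain (hχ : IsLiftable z χ) (hφ : IsIdentification φ) :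
    graphLift φ χ '' domain θ z ⊆ CotM.domain θ z := by
  rintro _ ⟨ζ, hζ, rfl⟩
  refine hζ.imp id fun h1 h2 => h1 ?_
  have h3 := CotM.left_isZero h2
  rwa [hχ.left_graphLift hφ hζ] at h3

theorem IsLiftable.overFront_iff (hχ : IsLiftable z χ) (hφ : IsIdentification φ)
    {ζ : ThetaCot θ} (hζ : ζ ∈ domain θ z) : (graphLift φ χ ζ).OverFront ↔ ζ.OverBoundary := by
  constructor
  · rintro ⟨p, hp, h⟩
    have h1 := CotM.left_isOver h
    rw [hχ.left_graphLift hφ hζ] at h1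
    exact ⟨p, hp, h1⟩
  · intro h
    obtain ⟨c, a, ha, hζa⟩ := ThetaCot.exists_germ ζ
    have h0 := (overBoundary_iff ha hζa).1 h
    obtain ⟨F, hF, hF0, -⟩ := hχ.exists_graphRep_of_boundary hζ ha hζa h0
    obtain ⟨h1, h2⟩ := (hF.isLocalRep hφ).rep.self_of_nhdsWithin ha
    exact CotM.overFront_of_slot_eq_zero h1 (h2 ζ hζa) hF0

theorem IsLiftable.overInterior_or_overFront (hχ : IsLiftable z χ) (hφ : IsIdentification φ) :
    ∀ τ ∈ graphLift φ χ '' domain θ z, τ.OverInterior ∨ τ.OverFront := by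
  rintro _ ⟨ζ, hζ, rfl⟩
  rcases hχ.graphLift_isRegular hφ hζ with h | ⟨c, a, h1, h2, h3, h4⟩
  · exact Or.inl h
  · exact Or.inr (CotM.overFront_of_slot_eq_zero h1 h4 h2)

theorem IsLiftable.isTransverseToFront (hχ : IsLiftable z χ) (hφ : IsIdentification φ) :
    IsTransverseToFront (domain θ z) (graphLift φ χ) := by
  intro ζ hζ hfr
  obtain ⟨c, a, ha, hζa⟩ := ThetaCot.exists_germ ζ
  have h0 := (overBoundary_iff ha hζa).1 ((hχ.overFront_iff hφ hζ).1 hfr)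
  obtain ⟨F, hF, hF0, -, g₀, hg, hg'⟩ := hχ.exists_graphRep_of_boundary hζ ha hζa h0
  refine ⟨c, c, none, true, a, F, hζa, hF.isLocalRep hφ, hF0, fun u => ?_⟩
  rw [fderivWithin_dom ha]
  -- The front face is ρ' = 0, and ρ' has derivative `g₀` in the direction ∂_ρ; this multiple of ∂_ρ
  -- matches the normal component of `u`, and the rest is tangent to the boundary.
  refine ⟨((u.1.2 0 / g₀) • ei 0, 0), u - fderivWithin ℝ F (HF d) a ((u.1.2 0 / g₀) • ei 0, 0), ?_,
    add_sub_cancel _ _⟩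
  change u.1.2 0 - (fderivWithin ℝ F (HF d) a ((u.1.2 0 / g₀) • ei 0, 0)).1.2 0 = 0
  rw [hg']
  change u.1.2 0 - g₀ * ((u.1.2 0 / g₀) * (ei 0 : V d) 0) = 0
  have e1 : (ei 0 : V d) 0 = 1 := rho_ei (d := d)
  rw [e1]
  field_simp
  ring

theorem IsLiftable.isFrontLagrangianEmbedding (hχ : IsLiftable z χ) (hφ : IsIdentification φ) :
    IsFrontLagrangianEmbedding (domain θ z) (graphLift φ χ) := by
  refine ⟨fun ζ hζ => hχ.overFront_iff hφ hζ, hχ.isEmbedding_restrictToF hφ, fun ζ hζ hfr => ?_⟩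
  obtain ⟨c, a, ha, hζa⟩ := ThetaCot.exists_germ ζ
  have h0 := (overBoundary_iff ha hζa).1 ((hχ.overFront_iff hφ hζ).1 hfr)
  obtain ⟨F, hF, hF0, -, g₀, hg, hg'⟩ := hχ.exists_graphRep_of_boundary hζ ha hζa h0
  have haH := mem_HF_of_dom ha
  obtain ⟨T, hT, hT', hT0⟩ := MChart.exists_lift _ (hF.eventually_dom.self_of_nhdsWithin haH)
  refine ⟨c, c, none, true, a, F, hζa, hF.isLocalRep hφ, h0, hF0, ?_⟩
  rw [fderivWithin_dom ha]
  obtain ⟨G, hG, hL⟩ := hF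
  refine ⟨fun h hh => ?_, fun h hh h1 h2 => ?_, fun h l _ _ => hL.symp_eq_zero h l⟩
  · exact (hg' h).trans (by rw [hh, mul_zero])
  · exact hL.eq_zero_of_fderivWithin hT hT' h1 fun j => h2 _ (hT0 c none true rfl hF0 j)

end ThetaCalc

end

noncomputable section
namespace ThetaCalc
set_option linter.unusedSectionVars false

/-! ### Dilations, and closedness of the lifted graph -/

variable {d : ℕ} {X : Type*} [TopologicalSpace X]
  [ChartedSpace (EuclideanHalfSpace (d + 2)) X] [IsManifold (𝓡∂ (d + 2)) ∞ X]
  {θ : ∀ p : X, TangentSpace (𝓡∂ (d + 2)) p →L[ℝ] ℝ}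

open ThetaChart MChart ThetaCot

theorem map_smul_nhdsWithin {A B : Type*} [TopologicalSpace A] [NormedAddCommGroup B]
    [NormedSpace ℝ B] {r : ℝ} (hr : r ≠ 0) {s : Set A} (a : A × B) :
    map (fun b : A × B => (b.1, r • b.2)) (𝓝[{b | b.1 ∈ s}] a) =
      𝓝[{b : A × B | b.1 ∈ s}] (a.1, r • a.2) := by
  have hc : ∀ r : ℝ, Continuous fun b : A × B => (b.1, r • b.2) := fun r => by fun_prop
  have ht : ∀ (r : ℝ) (a : A × B), Tendsto (fun b : A × B => (b.1, r • b.2))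
      (𝓝[{b | b.1 ∈ s}] a) (𝓝[{b : A × B | b.1 ∈ s}] (a.1, r • a.2)) := fun r a =>
    tendsto_nhdsWithin_iff.2 ⟨((hc r).tendsto a).mono_left nhdsWithin_le_nhds,
      eventually_nhdsWithin_of_forall fun b hb => hb⟩
  refine Filter.map_eq_of_rightInverse (g := fun b => (b.1, r⁻¹ • b.2)) (ht r a) ?_
    (Eventually.of_forall fun b => by simp [smul_smul, hr])
  have h := ht r⁻¹ (a.1, r • a.2)
  simpa [smul_smul, hr] using h

theorem ThetaChart.map_dil_germ {c : ThetaChart θ} {r : ℝ} (hr : r ≠ 0) (a : V d × V d) :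
    map (dil r) ((thetaAtlas θ c).germ a) = (thetaAtlas θ c).germ (a.1, r • a.2) := by
  have h := map_smul_nhdsWithin hr (s := {x | x ∈ c.target ∧ 0 < x 0}) a
  change map _ (map _ _) = map _ _
  change _ = map _ (𝓝[{b : V d × V d | b.1 ∈ {x | x ∈ c.target ∧ 0 < x 0}}] (a.1, r • a.2))
  rw [← h, map_map, map_map]
  refine congrArg (fun f => map f _) (funext fun b => ?_)
  change dil r (c.cov b.1 (c.coform b.1 b.2)) = c.cov b.1 (c.coform b.1 (r • b.2))
  rw [dil_cov, coform_smul]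

theorem MChart.map_dil_germ {m : MChart θ} {r : ℝ} (hr : r ≠ 0) (a : CV d) :
    map (Prod.map (dil r) (dil r)) ((mAtlas θ m).germ a) =
      (mAtlas θ m).germ (a.1, r • a.2) := by
  have h := map_smul_nhdsWithin hr (s := m.baseInner) a
  change map _ (map _ _) = map _ _
  change _ = map _ (𝓝[{b : CV d | b.1 ∈ m.baseInner}] (a.1, r • a.2))
  rw [← h, map_map, map_map]
  refine congrArg (fun f => map f _) (funext fun b => ?_)
  change Prod.map (dil r) (dil r) (m.cotChart.toFun b) = m.cotChart.toFun (b.1, r • b.2)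
  simp only [MChart.cotChart, Prod.map_apply, dil_cov, ContinuousLinearMap.smul_comp]

/-- Dilations of `ᶿT*X`. -/
def ThetaCot.scale {r : ℝ} (hr : r ≠ 0) (ζ : ThetaCot θ) : ThetaCot θ :=
  ⟨map (dil r) ζ.1, by
    obtain ⟨c, a, ha, h⟩ := ζ.2
    exact ⟨c, (a.1, r • a.2), ha, by rw [h, ThetaChart.map_dil_germ hr]⟩⟩

/-- Dilations of `T*M`. -/
def CotM.scale {r : ℝ} (hr : r ≠ 0) (τ : CotM θ) : CotM θ :=
  ⟨map (Prod.map (dil r) (dil r)) τ.1, by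
    obtain ⟨c, a, ha, h⟩ := τ.2
    exact ⟨c, (a.1, r • a.2), ha, by rw [h, MChart.map_dil_germ hr]⟩⟩

theorem ThetaCot.continuous_scale {r : ℝ} (hr : r ≠ 0) :
    Continuous (scale hr : ThetaCot θ → ThetaCot θ) :=
  continuous_iff_continuousAt.2 fun _ => BSpace.tendsto_nhds_iff.2 fun s hs =>
    BSpace.eventually_mem (s := dil r ⁻¹' s) hs

theorem CotM.continuous_scale {r : ℝ} (hr : r ≠ 0) :
    Continuous (scale hr : CotM θ → CotM θ) :=
  continuous_iff_continuousAt.2 fun _ => BSpace.tendsto_nhds_iff.2 fun s hs =>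
    BSpace.eventually_mem (s := Prod.map (dil r) (dil r) ⁻¹' s) hs

theorem ThetaCot.scale_overInterior {r : ℝ} (hr : r ≠ 0) {ζ : ThetaCot θ} (h : ζ.OverInterior) :
    (scale hr ζ).OverInterior := by
  obtain ⟨p, hp, h⟩ := h
  exact ⟨p, hp, tendsto_map'_iff.2 h⟩

theorem CotM.IsRegular.scale {r : ℝ} (hr : r ≠ 0) {τ : CotM θ} (h : τ.IsRegular) :
    (scale hr τ).IsRegular := by
  rcases h with ⟨p, hp, p', hp', h⟩ | ⟨c, a, h1, h2, h3, h4⟩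
  · exact Or.inl ⟨p, hp, p', hp', tendsto_map'_iff.2 h⟩
  · exact Or.inr ⟨c, (a.1, r • a.2), h1, h2, h3,
      (congrArg (map _) h4).trans (MChart.map_dil_germ hr a)⟩

variable [T2Space X] {z : Bool} {χ : ThetaCot θ → ThetaCot θ}
  {φ : ThetaCot θ × ThetaCot θ → CotM θ}

theorem ThetaCot.scale_mem_domain {r : ℝ} (hr : r ≠ 0) {ζ : ThetaCot θ} (h : ζ ∈ domain θ z) :
    scale hr ζ ∈ domain θ z := by
  obtain ⟨c, a, ha, h'⟩ := ThetaCot.exists_germ ζ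
  have h2 : (scale hr ζ).1 = (thetaAtlas θ c).germ (a.1, r • a.2) :=
    (congrArg (map _) h').trans (ThetaChart.map_dil_germ hr a)
  rw [mem_domain_iff (a := (a.1, r • a.2)) ha h2]
  exact ((mem_domain_iff ha h' z).1 h).imp id fun h => smul_ne_zero hr h

theorem dil_comm (r s : ℝ) (q : Cot d X) : dil r (dil s q) = dil s (dil r q) := by
  simp only [dil]
  exact congrArg _ (smul_comm r s q.snd)

theorem IsLiftable.phi_scale (hχ : IsLiftable z χ) (hφ : IsIdentification φ)
    {ζ : ThetaCot θ} (hζ : ζ ∈ domain θ z) (h0 : ζ.OverInterior) {r : ℝ} (hr : 0 < r) :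
    φ (scale hr.ne' ζ, χ (scale hr.ne' ζ)) = CotM.scale hr.ne' (φ (ζ, χ ζ)) := by
  refine Subtype.ext ?_
  rw [hχ.phi_eq_prod hφ (scale_mem_domain hr.ne' hζ) (scale_overInterior hr.ne' h0)]
  change _ = map _ (φ (ζ, χ ζ)).1
  rw [hχ.phi_eq_prod hφ hζ h0, hχ.homogeneous r hr ζ hζ _ rfl, ← prod_map_map_eq']
  change map (dil r) ζ.1 ×ˢ _ = _
  rw [map_map, map_map]
  exact congrArg (fun f => _ ×ˢ map f _) (funext fun q => dil_comm _ _ _)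

/-- Over the interior this is homogeneity of `χ`. Both sides are continuous, and dilation preserves
regularity, so the limits agree. -/
theorem IsLiftable.graphLift_scale (hχ : IsLiftable z χ) (hφ : IsIdentification φ)
    {ζ : ThetaCot θ} (hζ : ζ ∈ domain θ z) {r : ℝ} (hr : 0 < r) :
    graphLift φ χ (scale hr.ne' ζ) = CotM.scale hr.ne' (graphLift φ χ ζ) := by
  have := nhdsWithin_overInterior_neBot ζ
  have h1 := ((hχ.continuousAt_graphLift hφ (scale_mem_domain hr.ne' hζ)).comp
    (ThetaCot.continuous_scale hr.ne').continuousAt).tendsto.mono_left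
    (nhdsWithin_le_nhds (s := {ζ' : ThetaCot θ | ζ'.OverInterior}))
  have h2 := ((CotM.continuous_scale hr.ne').continuousAt.comp
    (hχ.continuousAt_graphLift hφ hζ)).tendsto.mono_left
    (nhdsWithin_le_nhds (s := {ζ' : ThetaCot θ | ζ'.OverInterior}))
  refine ((hχ.graphLift_isRegular hφ hζ).scale hr.ne').eq_of_tendsto (h1.congr' ?_) h2
  filter_upwards [nhdsWithin_le_nhds (domain_mem_nhds hζ), self_mem_nhdsWithin] with ζ' h3 h4
  change graphLift φ χ (ThetaCot.scale hr.ne' ζ') = CotM.scale hr.ne' (graphLift φ χ ζ')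
  rw [hχ.graphLift_eq hφ h3 h4, hχ.graphLift_eq hφ (scale_mem_domain hr.ne' h3)
    (scale_overInterior hr.ne' h4), hχ.phi_scale hφ h3 h4 hr]

theorem IsLiftable.isConic (hχ : IsLiftable z χ) (hφ : IsIdentification φ) :
    CotM.IsConic (graphLift φ χ '' domain θ z) := by
  rintro r hr _ ⟨ζ, hζ, rfl⟩ τ' hτ'
  exact ⟨scale hr.ne' ζ, scale_mem_domain hr.ne' hζ,
    (hχ.graphLift_scale hφ hζ hr).trans (Subtype.ext hτ'.symm)⟩

/-- An ultrafilter on the lifted graph converging to `τ` projects to one on Γ converging to the left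
component of `τ`. If that component lies in the domain, continuity and separation identify `τ`.
Otherwise the zero section is excluded and the component is a zero vector. The fibre directions then
converge on the compact unit sphere, and by homogeneity the lift is the fibre norm, tending to zero,
times a convergent covector. So `τ` would be a zero covector. -/
theorem IsLiftable.closure_inter_subset (hχ : IsLiftable z χ) (hφ : IsIdentification φ) :
    closure (graphLift φ χ '' domain θ z) ∩ CotM.domain θ z ⊆ graphLift φ χ '' domain θ z := by
  rintro τ ⟨hτ, hτz⟩
  obtain ⟨u₀, hu₀, hu₀τ⟩ := mem_closure_iff_ultrafilter.1 hτ
  set u : Ultrafilter (ThetaCot θ) := u₀.map CotM.left with hu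
  have hD : domain θ z ∈ u := by
    change CotM.left ⁻¹' domain θ z ∈ u₀
    refine mem_of_superset hu₀ ?_
    rintro _ ⟨ζ, hζ, rfl⟩
    change CotM.left (graphLift φ χ ζ) ∈ domain θ z
    rwa [hχ.left_graphLift hφ hζ]
  have hlim : Tendsto (graphLift φ χ) u (𝓝 τ) := by
    have h1 : Tendsto (fun τ' => graphLift φ χ (CotM.left τ')) u₀ (𝓝 τ) := by
      refine Tendsto.congr' ?_ (tendsto_id'.2 hu₀τ)
      filter_upwards [hu₀]
      rintro _ ⟨ζ, hζ, rfl⟩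
      rw [hχ.left_graphLift hφ hζ]; rfl
    exact tendsto_map'_iff.2 h1
  have hleft : (u : Filter (ThetaCot θ)) ≤ 𝓝 (CotM.left τ) :=
    (CotM.continuous_left.tendsto τ).mono_left hu₀τ
  by_cases h0 : CotM.left τ ∈ domain θ z
  · exact ⟨_, h0, ((hχ.graphLift_isRegular hφ h0).eq_of_tendsto hlim
      ((hχ.continuousAt_graphLift hφ h0).tendsto.mono_left hleft)).symm⟩
  exfalso
  obtain ⟨c, a, ha, hτa⟩ := ThetaCot.exists_germ (CotM.left τ)
  rw [mem_domain_iff ha hτa, not_or, not_not] at h0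
  have hτz : ¬ τ.IsZero := hτz.resolve_left h0.1
  classical
  -- Coordinates in the chart `c`; the default `a` is irrelevant, since the points of the
  -- ultrafilter eventually lie in that chart.
  let κ : ThetaCot θ → V d × V d := fun ζ =>
    if h : ∃ b ∈ (thetaAtlas θ c).dom, ζ.1 = (thetaAtlas θ c).germ b then h.choose else a
  have hκ : ∀ᶠ ζ in (u : Filter (ThetaCot θ)), κ ζ ∈ (thetaAtlas θ c).dom ∧
      ζ.1 = (thetaAtlas θ c).germ (κ ζ) := by
    filter_upwards [hleft (ThetaCot.eventually_exists_germ ha hτa self_mem_nhdsWithin)] with ζ h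
    have h' : ∃ b ∈ (thetaAtlas θ c).dom, ζ.1 = (thetaAtlas θ c).germ b :=
      h.imp fun b hb => ⟨hb.1.1, hb.2⟩
    have h2 := h'.choose_spec
    simp only [κ, dif_pos h']
    exact h2
  have hκt : Tendsto κ u (𝓝[(thetaAtlas θ c).dom] a) := fun W hW => by
    change ∀ᶠ ζ in (u : Filter (ThetaCot θ)), κ ζ ∈ W
    filter_upwards [hleft (ThetaCot.eventually_exists_germ ha hτa hW), hκ] with ζ h h'
    obtain ⟨b, hb, hb'⟩ := h
    have e : κ ζ = b := eq_of_germ_eq h'.1 (h'.2.symm.trans hb')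
    rw [e]
    exact hb.1
  have hκ0 : ∀ᶠ ζ in (u : Filter (ThetaCot θ)), (κ ζ).2 ≠ 0 := by
    filter_upwards [hκ, hD] with ζ h1 h2
    exact ((mem_domain_iff h1.1 h1.2 z).1 h2).resolve_left h0.1
  have hsph : ∀ᶠ ζ in (u : Filter (ThetaCot θ)),
      ‖(κ ζ).2‖⁻¹ • (κ ζ).2 ∈ Metric.sphere (0 : V d) 1 :=
    hκ0.mono fun ζ h => by simp [norm_smul, h]
  obtain ⟨v, hv, hvt⟩ := (isCompact_sphere (0 : V d) 1).ultrafilter_le_nhds'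
    (u.map fun ζ => ‖(κ ζ).2‖⁻¹ • (κ ζ).2) hsph
  have hv0 : v ≠ 0 := fun h => by simp [h] at hv
  have hâ : (a.1, v) ∈ (thetaAtlas θ c).dom := ha
  have hκ' : Tendsto (fun ζ => ((κ ζ).1, ‖(κ ζ).2‖⁻¹ • (κ ζ).2)) u (𝓝[HF d] (a.1, v)) := by
    refine tendsto_nhdsWithin_iff.2 ⟨?_, hκ.mono fun ζ h => mem_HF_of_dom (c := c) h.1⟩
    exact ((continuous_fst.tendsto a).comp (hκt.mono_right nhdsWithin_le_nhds)).prodMk_nhds hvt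
  have hmem : BSpace.mk c (a.1, v) hâ ∈ domain θ z :=
    (mem_domain_iff hâ rfl z).2 (Or.inr hv0)
  obtain ⟨m, F, rfl, hF⟩ := hχ.exists_graphRep_of_germ hmem hâ rfl
  have haH := mem_HF_of_dom hâ
  have hdom := hF.eventually_dom.self_of_nhdsWithin haH
  have hrep := (hF.isLocalRep hφ).rep
  rw [nhdsWithin_dom_HF hâ] at hrep
  -- The candidate limit: the zero covector at the base point of the lift in the limiting direction
  -- `v`.
  let τ₁ : CotM θ := BSpace.mk m ((F (a.1, v)).1, 0) hdom
  have hτ₁ : Tendsto (graphLift φ χ) u (𝓝 τ₁) := by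
    have hFt := hF.smooth.continuousWithinAt.tendsto.comp hκ'
    have hn : Tendsto (fun ζ => ‖(κ ζ).2‖) u (𝓝 0) := by
      have h1 := ((continuous_snd.norm).tendsto a).comp (hκt.mono_right nhdsWithin_le_nhds)
      rwa [h0.2, norm_zero] at h1
    have hg := ((continuous_fst.tendsto _).comp hFt).prodMk_nhds
      (hn.smul ((continuous_snd.tendsto _).comp hFt))
    rw [zero_smul] at hg
    refine BSpace.tendsto_of_germ (i := m) rfl hg ?_
    filter_upwards [hκ, hκ0, hκ'.eventually hrep] with ζ h1 h2 h3
    have hr : 0 < ‖(κ ζ).2‖ := norm_pos_iff.2 h2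
    set ζ' : ThetaCot θ := BSpace.mk m.left ((κ ζ).1, ‖(κ ζ).2‖⁻¹ • (κ ζ).2) h1.1
    have hζ' : ζ' ∈ domain θ z := (mem_domain_iff (ζ := ζ')
      (a := ((κ ζ).1, ‖(κ ζ).2‖⁻¹ • (κ ζ).2)) h1.1 rfl z).2
        (Or.inr (smul_ne_zero (inv_ne_zero hr.ne') h2))
    have e1 : ζ = scale hr.ne' ζ' := by
      refine Subtype.ext (h1.2.trans ?_)
      refine Eq.trans ?_ (ThetaChart.map_dil_germ hr.ne' _).symm
      rw [smul_smul, mul_inv_cancel₀ hr.ne', one_smul]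
    have e2 := hχ.graphLift_scale hφ hζ' hr
    rw [← e1] at e2
    rw [e2]
    exact (congrArg (map _) (h3.2 ζ' rfl)).trans (MChart.map_dil_germ hr.ne' _)
  have hreg : τ₁.IsRegular := hF.eventually_isRegular.self_of_nhdsWithin haH 0 τ₁ rfl
  rw [hreg.eq_of_tendsto hlim hτ₁] at hτz
  exact hτz ⟨m, _, hdom, rfl⟩

end ThetaCalc

end

noncomputable section
namespace ThetaCalc
set_option linter.unusedSectionVars false

/-! ### The lifted graph does not meet the side faces -/

variable {d : ℕ} {X : Type*} [TopologicalSpace X] [T2Space X]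
  [ChartedSpace (EuclideanHalfSpace (d + 2)) X] [IsManifold (𝓡∂ (d + 2)) ∞ X]
  {θ : ∀ p : X, TangentSpace (𝓡∂ (d + 2)) p →L[ℝ] ℝ}

open ThetaChart MChart ThetaCot

/-- A closed set that confines the base points of all covectors near `τ` and meets the boundary of X
× X only in the diagonal keeps them away from the points whose closure is the union of the side
faces. -/
theorem CotM.notMem_sideFaces {τ : CotM θ} {C : Set (X × X)} (hC : IsClosed C)
    (hτ : {r : Cot d X × Cot d X | (r.1.proj, r.2.proj) ∈ C} ∈ τ.1)
    (h : ∀ p p', (p, p') ∈ C → p ∈ (𝓡∂ (d + 2)).boundary X ∨ p' ∈ (𝓡∂ (d + 2)).boundary X →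
      p = p') : τ ∉ sideFaces θ := by
  intro hs
  obtain ⟨τ', ⟨p, p', h1, h2, h3⟩, h4⟩ :=
    ((mem_closure_iff_frequently.1 hs).and_eventually (BSpace.eventually_mem hτ)).exists
  have := CotM.neBot τ'
  exact h2 (h p p' (hC.mem_of_tendsto h3 h4) h1)

theorem ThetaChart.exists_isCompact_subset {c : ThetaChart θ} {x : V d} (hx : x ∈ c.target) :
    ∃ K ⊆ c.target, IsCompact K ∧ K ∈ 𝓝[HS d] x := by
  obtain ⟨u, hu, h⟩ := mem_nhdsWithin_iff_exists_mem_nhds_inter.1 (target_mem_nhdsWithin hx)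
  obtain ⟨r, hr, hru⟩ := Metric.nhds_basis_closedBall.mem_iff.1 hu
  refine ⟨Metric.closedBall x r ∩ HS d, (inter_subset_inter_left _ hru).trans h,
    (isCompact_closedBall x r).inter_right isClosed_HS, ?_⟩
  exact inter_mem (mem_nhdsWithin_of_mem_nhds (Metric.closedBall_mem_nhds x hr))
    self_mem_nhdsWithin

theorem CotM.IsRegular.notMem_sideFaces {τ : CotM θ} (h : τ.IsRegular) : τ ∉ sideFaces θ := by
  rcases h with ⟨p, hp, p', hp', h⟩ | ⟨c, ⟨a, η⟩, ha, h0, hω, h⟩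
  · have : LocallyCompactSpace (EuclideanHalfSpace (d + 2)) :=
      Manifold.locallyCompact_of_finiteDimensional (𝓡∂ (d + 2))
    have : LocallyCompactSpace X := ChartedSpace.locallyCompactSpace (EuclideanHalfSpace (d + 2)) X
    have ho : IsOpen ((𝓡∂ (d + 2)).interior X) :=
      ModelWithCorners.isOpen_interior (n := ∞) (by simp)
    obtain ⟨C, hC, hCc, hCi⟩ := exists_mem_nhds_isClosed_subset (ho.mem_nhds hp)
    obtain ⟨C', hC', hCc', hCi'⟩ := exists_mem_nhds_isClosed_subset (ho.mem_nhds hp')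
    refine CotM.notMem_sideFaces (hCc.prod hCc') (h (prod_mem_nhds hC hC')) ?_
    rintro q q' ⟨h1, h2⟩ h3
    rw [← ModelWithCorners.compl_interior, mem_compl_iff, mem_compl_iff] at h3
    exact absurd h3 (not_or.2 ⟨not_not.2 (hCi h1), not_not.2 (hCi' h2)⟩)
  · have ha : a ∈ (front c none true).dom := ha
    have h0 : a.2 0 = 0 := h0
    have hω : 0 < a.1 0 := hω
    obtain ⟨h2, h3, h4⟩ := mem_none_dom.1 ha
    have hla : frontLeft c none true a = a.2 := by
      rw [frontLeft_eq, frontRight_none, slot_none, h0, zero_smul, add_zero]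
    obtain ⟨K, hK, hKc, hKn⟩ := c.exists_isCompact_subset h4
    set B : ℝ := ‖frontStep c none true a‖ + 1 with hB
    -- Near such a front point ρ = ρ' ω_0 with ω_0 bounded below, and x - x' is ρ' times a bounded
    -- vector. These closed conditions force ρ' = 0, hence x = x', as soon as either point is on the
    -- boundary. Compactness makes the image in X × X closed.
    let R : Set (V d × V d) := (K ×ˢ K) ∩ {q | a.1 0 / 2 * q.2 0 ≤ q.1 0 ∧ ‖q.1 - q.2‖ ≤ B * q.2 0}
    have hR : IsCompact R := by
      have c1 : Continuous fun q : V d × V d => a.1 0 / 2 * q.2 0 := by fun_prop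
      have c2 : Continuous fun q : V d × V d => q.1 0 := by fun_prop
      have c3 : Continuous fun q : V d × V d => ‖q.1 - q.2‖ := by fun_prop
      have c4 : Continuous fun q : V d × V d => B * q.2 0 := by fun_prop
      exact (hKc.prod hKc).inter_right ((isClosed_le c1 c2).inter (isClosed_le c3 c4))
    have hcont : ContinuousOn (Prod.map c.pt c.pt) R :=
      (continuousOn_pt.prodMap continuousOn_pt).mono
        (inter_subset_left.trans (prod_mono hK hK))
    refine CotM.notMem_sideFaces (hR.image_of_continuousOn hcont).isClosed ?_ ?_
    · have tl := (contDiffWithinAt_blowdown ha).continuousWithinAt.tendsto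
      have ts := (contDiffWithinAt_frontStep (slot_mul_omegaR_nonneg (c := c) (k := none)
        (pos := true)) (a := a) (by rw [frontRight_none]; exact h4)).continuousWithinAt.tendsto
      have hdom : ∀ᶠ b in 𝓝[(front c none true).dom] a, b ∈ (front c none true).dom :=
        self_mem_nhdsWithin
      have e1 : ∀ᶠ b in 𝓝[(front c none true).dom] a, frontLeft c none true b ∈ K := by
        have t1 : Tendsto (frontLeft c none true) (𝓝[(front c none true).dom] a) (𝓝[HS d] a.2) := by
          refine tendsto_nhdsWithin_iff.2 ⟨?_, hdom.mono fun b hb =>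
            target_subset (mem_none_dom.1 hb).2.1⟩
          have := (continuous_fst.tendsto _).comp tl
          rwa [show ((front c none true).blowdown a).1 = a.2 from hla] at this
        exact t1 hKn
      have e2 : ∀ᶠ b in 𝓝[(front c none true).dom] a, b.2 ∈ K := by
        have t1 : Tendsto (fun b : V d × V d => b.2) (𝓝[(front c none true).dom] a)
            (𝓝[HS d] a.2) :=
          tendsto_nhdsWithin_iff.2 ⟨(continuous_snd.tendsto a).mono_left nhdsWithin_le_nhds,
            hdom.mono fun b hb => target_subset (mem_none_dom.1 hb).2.2⟩
        exact t1 hKn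
      have e3 : ∀ᶠ b in 𝓝[(front c none true).dom] a, a.1 0 / 2 < b.1 0 := by
        have t1 : Continuous fun b : V d × V d => b.1 0 := by fun_prop
        exact ((t1.tendsto a).mono_left nhdsWithin_le_nhds).eventually
          (lt_mem_nhds (half_lt_self hω))
      have e4 : ∀ᶠ b in 𝓝[(front c none true).dom] a, ‖frontStep c none true b‖ < B :=
        ts.norm.eventually (gt_mem_nhds (lt_add_one _))
      rw [h]
      change ∀ᶠ b in 𝓝[(mAtlas θ (front c none true)).inner] (a, η), _
      filter_upwards [tendsto_fst_inner_dom.eventually ((e1.and e2).and (e3.and (e4.and hdom)))]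
        with b hb
      obtain ⟨⟨b1, b2⟩, b3, b4, b5⟩ := hb
      refine ⟨(frontLeft c none true b.1, frontRight none true b.1), ⟨⟨b1, ?_⟩, ?_, ?_⟩, rfl⟩
      · rw [frontRight_none]; exact b2
      · have b6 : 0 ≤ b.1.2 0 := nonneg (mem_none_dom.1 b5).2.2
        change a.1 0 / 2 * (frontRight none true b.1) 0 ≤ (frontLeft c none true b.1) 0
        rw [frontLeft_zero, frontRight_none]
        simp only [slot_none, omega_none]
        nlinarith
      · have b6 : 0 ≤ b.1.2 0 := nonneg (mem_none_dom.1 b5).2.2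
        change ‖frontLeft c none true b.1 - frontRight none true b.1‖ ≤
          B * (frontRight none true b.1) 0
        rw [frontLeft_eq, add_sub_cancel_left, frontRight_none, norm_smul, slot_none,
          Real.norm_of_nonneg b6, mul_comm]
        exact mul_le_mul_of_nonneg_right b4.le b6
    · rintro _ _ ⟨⟨x, x'⟩, ⟨⟨hx, hx'⟩, h5, h6⟩, h7⟩ h8
      obtain ⟨rfl, rfl⟩ := Prod.mk.inj h7
      have h5 : a.1 0 / 2 * x' 0 ≤ x 0 := h5
      have h6 : ‖x - x'‖ ≤ B * x' 0 := h6
      have hx0 : 0 ≤ x' 0 := nonneg (hK hx')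
      have h9 : x' 0 = 0 := by
        rcases h8 with h8 | h8
        · have h10 : x 0 = 0 := (pt_mem_boundary_iff (hK hx)).1 h8
          rw [h10] at h5
          nlinarith
        · exact (pt_mem_boundary_iff (hK hx')).1 h8
      rw [h9, mul_zero] at h6
      rw [sub_eq_zero.1 (norm_le_zero_iff.1 h6)]

end ThetaCalc

end

/-! ### The lifted graph as an extendible conic Lagrangian submanifold -/

theorem mainTheorem6 (d : ℕ) (X : Type*) [TopologicalSpace X] [T2Space X]
    [ChartedSpace (EuclideanHalfSpace (d + 2)) X] [IsManifold (𝓡∂ (d + 2)) ∞ X]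
    (θ : ∀ p : X, TangentSpace (𝓡∂ (d + 2)) p →L[ℝ] ℝ)
    (hθ : IsSmoothForm d X θ) (hθ' : NonvanishingOnBoundary θ)
    (z : Bool) (χ : ThetaCot θ → ThetaCot θ) (hχ : IsLiftable z χ) :
    ∃ (φ : ThetaCot θ × ThetaCot θ → CotM θ) (Φ : ThetaCot θ → CotM θ),
      IsIdentification φ ∧ IsCanonicalDiffeoOverInterior φ ∧
      (∀ ζ ∈ ThetaCot.domain θ z, ζ.OverInterior → Φ ζ = φ (ζ, χ ζ)) ∧
      ContinuousOn Φ (ThetaCot.domain θ z) ∧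
      IsLagrangianEmbedding (ThetaCot.domain θ z) Φ ∧
      CotM.IsConic (Φ '' ThetaCot.domain θ z) ∧
      (Φ '' ThetaCot.domain θ z ⊆ CotM.domain θ z ∧
        closure (Φ '' ThetaCot.domain θ z) ∩ CotM.domain θ z ⊆ Φ '' ThetaCot.domain θ z) ∧
      (∀ τ ∈ Φ '' ThetaCot.domain θ z, τ.OverInterior ∨ τ.OverFront) ∧
      Disjoint (Φ '' ThetaCot.domain θ z) (CotM.sideFaces θ) ∧
      IsTransverseToFront (ThetaCot.domain θ z) Φ ∧
      IsFrontLagrangianEmbedding (ThetaCot.domain θ z) Φ := by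
  obtain ⟨φ, hφ⟩ := exists_isIdentification (X := X) θ
  refine ⟨φ, graphLift φ χ, hφ, hφ.isCanonicalDiffeoOverInterior,
    fun ζ hζ h0 => hχ.graphLift_eq hφ hζ h0,
    fun ζ hζ => (hχ.continuousAt_graphLift hφ hζ).continuousWithinAt,
    hχ.isLagrangianEmbedding hφ, hχ.isConic hφ,
    ⟨hχ.image_subset_domain hφ, hχ.closure_inter_subset hφ⟩,
    hχ.overInterior_or_overFront hφ, ?_, hχ.isTransverseToFront hφ,
    hχ.isFrontLagrangianEmbedding hφ⟩
  refine Set.disjoint_left.2 ?_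
  rintro _ ⟨ζ, hζ, rfl⟩
  exact (hχ.graphLift_isRegular hφ hζ).notMem_sideFaces
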